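/- **Conventions.** All vector spaces are over $\mathbb{C}$. Objects are bigraded by $\mathbb{Z}\times\mathbb{Z}/2$ (cohomological degree and super parity); all signs follow the Koszul rule for the totalized parity $|x|=(\text{cohomological degree})+(\text{super parity})\in\mathbb{Z}/2$, and brackets of operators are graded commutators. For $x=u,z,w,\dots$ let $\mathcal{K}=\mathcal{K}^x$ be the graded commutative algebra of raviolo Laurent series: $\mathcal{K}^0=\mathbb{C}[[x]]$, $\mathcal{K}^1=\bigoplus_{m\ge0}\mathbb{C}\,\Omega^m_x$, with $x^i\Omega_x^m=\Omega_x^{m-i}$ for $i\le m$, $x^i\Omega_x^m=0$ for $i>m$, and $\mathcal{K}^1\cdot\mathcal{K}^1=0$. It has the derivation $\partial_x x^n=nx^{n-1}$, $\partial_x\Omega_x^m=-(m+1)\Omega_x^{m+1}$, and the residue $\mathrm{Res}_x\,dx\,\Omega_x^m=\delta_{m,0}$, $\mathrm{Res}_x\,dx\,x^n=0$. For a vector space $M$, $M\langle\!\langle x\rangle\!\rangle$ denotes the expressions $\sum_{n<0}x^{-n-1}m_n+\sum_{n\ge0}\Omega_x^nm_n$ with $m_n\in M$ and $m_n=0$ for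 $n\gg0$. **Raviolo vertex algebras.** A raviolo field on $N$ is $A(z)=\sum_{n<0}z^{-n-1}A_{(n)}+\sum_{n\ge0}\Omega_z^nA_{(n)}$ with $A_{(n)}\in\mathrm{End}(N)$ such that for every $v\in N$ one has $A_{(n)}v=0$ for $n\gg0$. Two fields are mutually local if for some $n\ge 0$: $(z-w)^{n+1}[A(z),B(w)]=0$ and $\bigl(\Omega_z^m-\sum_{j=0}^n(w-z)^j\binom{m+j}{j}\Omega_w^{m+j}\bigr)[A(z),B(w)]=0$ for all $m\ge0$. A raviolo vertex algebra is a bigraded space $\mathcal{V}$ with a vacuum $|0\rangle$ of bidegree $0$, an operator $\partial$ of bidegree $0$, and a linear assignment $a\mapsto Y(a,z)$ of fields on $\mathcal{V}$, pairwise mutually local, homogeneous of the bidegree of $a$ (so that $a_{(n)}$ has the bidegree of $a$ for $n<0$ and one cohomological degree less for $n\ge0$), with $\partial|0\rangle=0$, $[\partial,Y(a,z)]=\partial_zY(a,z)$, $Y(|0\rangle,z)=\mathrm{id}$, and $Y(a,z)|0\rangle\in a+z\mathcal{V}[[z]]$. The normal-ordered product of fields of parities $a,b$ is $:\!A(z)B(z)\!:\;=A(z)_+B(z)+(-1)^{ab}B(z)A(z)_-$,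 where $A(z)_+$ is the part of $A(z)$ with powers of $z$ and $A(z)_-$ the part with the $\Omega_z^n$. **Modules.** Let $\mathcal{K}_{z,w,z-w}$ be the graded commutative $\mathbb{C}[[z,w]]$-algebra generated by degree-one elements $\Omega_x^m$, $m\ge0$, $x\in\{z,w,z-w\}$, with relations $x\Omega_x^m=\Omega_x^{m-1}$, $x\Omega_x^0=0$, $\Omega_x^m\Omega_x^n=0$, together with $\Omega_{z-w}^0\Omega_z^0+\Omega_w^0\Omega_{z-w}^0+\Omega_z^0\Omega_w^0=0$ and all its $\partial_z,\partial_w$-derivatives; in $M\otimes\mathcal{K}_{z,w,z-w}$ power series in $z,w$ are allowed coefficients in $M$. A $\mathcal{V}$-module is a graded space $M$ with a linear assignment $a\mapsto Y_M(a,z)=\sum_{n<0}z^{-n-1}a^M_{(n)}+\sum_{n\ge0}\Omega_z^na^M_{(n)}$ of fields on $M$, compatible with the gradings, such that $Y_M(|0\rangle,z)=\mathrm{id}_M$ and for all homogeneous $a,b\in\mathcal{V}$ and $m\in M$ the expressions $Y_M(a,z)Y_M(b,w)m\in M\langle\!\langle z\rangle\!\rangle\langle\!\langle w\rangle\!\rangle$,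 $(-1)^{|a||b|}Y_M(b,w)Y_M(a,z)m\in M\langle\!\langle w\rangle\!\rangle\langle\!\langle z\rangle\!\rangle$ and $Y_M(Y(a,z-w)b,w)m\in M\langle\!\langle w\rangle\!\rangle\langle\!\langle z-w\rangle\!\rangle$ are expansions of one and the same element of $M\otimes\mathcal{K}_{z,w,z-w}$ in their respective domains ($\Omega_{z-w}^m\mapsto\sum_n\binom{m+n}{n}w^n\Omega_z^{m+n}$ in the first, $\Omega_{z-w}^m\mapsto(-1)^m\sum_n\binom{m+n}{n}z^n\Omega_w^{m+n}$ in the second, $z\mapsto w+(z-w)$ and $\Omega_z^m\mapsto\sum_n(-1)^n\binom{m+n}{n}(z-w)^n\Omega_w^{m+n}$ in the third). Morphisms are the linear maps $f$ with $f(Y_M(a,z)m)=Y_N(a,z)f(m)$. **Current algebras.** Let $\mathfrak{g}$ be a complex Lie superalgebra with an even, (super)symmetric, invariant bilinear form $h$, and let $\mathfrak{g}\langle\!\langle u\rangle\!\rangle=\mathfrak{g}\otimes\mathcal{K}^u$, with bracket $[A\otimes\alpha,B\otimes\beta]=(-1)^{|\alpha||B|}[A,B]\otimes\alpha\beta$.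 The shifted central extension $\hat{\mathfrak{g}}_h=\mathfrak{g}\langle\!\langle u\rangle\!\rangle\oplus\mathbb{C}\kappa$, with $\kappa$ central of cohomological degree $1$ and super even, has the bracket $$[A\otimes\alpha,B\otimes\beta]=(-1)^{|\alpha||B|}\bigl([A,B]\otimes\alpha\beta-\kappa\,h(A,B)\,\mathrm{Res}_u\,du\,\alpha\,\partial_u\beta\bigr).$$ Put $J_{A,n}=A\otimes u^n$, $\mu_{A,n}=A\otimes\Omega_u^n$, $\mathbb{C}[\kappa]=\mathbb{C}\oplus\mathbb{C}\kappa$ and $\hat{\mathfrak{g}}_{\ge0}=\mathfrak{g}[[u]]\oplus\mathbb{C}\kappa$, where $\mathfrak g[[u]]=\mathfrak g\otimes\mathbb C[[u]]$. Define $$\mathcal{V}[\mathfrak{g},h]_{univ}=U\hat{\mathfrak{g}}_h\otimes_{U\hat{\mathfrak{g}}_{\ge0}}\mathbb{C}[\kappa],\qquad \mathcal{V}[\mathfrak{g}]=U\hat{\mathfrak{g}}_h\otimes_{U\hat{\mathfrak{g}}_{\ge0}}\mathbb{C},$$ where $\mathfrak{g}[[u]]$ acts by $0$ on both, and $\kappa$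 acts by multiplication on $\mathbb{C}[\kappa]$ and by $0$ on $\mathbb{C}$. Each of the two carries exactly one structure of raviolo vertex algebra with the following properties: the vacuum is $1\otimes1$; $\hat{\mathfrak{g}}_h$ acts homogeneously; $\partial$ is induced by the derivation $-\partial_u$ of $\hat{\mathfrak{g}}_h$; the modes are graded $\mathbb{C}[\kappa]$-linear and $Y(\kappa b,z)=\kappa Y(b,z)$; and, for homogeneous $A\in\mathfrak{g}$ and homogeneous $b$, $$Y(\mu_{A,0}|0\rangle,z)=\mu_A(z):=\sum_{n\ge0}z^n\mu_{A,n}+(-1)^{|A|}\Omega_z^nJ_{A,n},\qquad Y(\mu_{A,n}b,z)=\tfrac1{n!}:\!\partial_z^n\mu_A(z)\,Y(b,z)\!:\,.$$ A module $M$ over $\hat{\mathfrak{g}}_h$ or over $\mathfrak{g}\langle\!\langle u\rangle\!\rangle$ is smooth if for all $m\in M$ and $A\in\mathfrak{g}$ there is $N\ge0$ with $(A\otimes u^Nf)\,m=0$ for all $f\in\mathbb{C}[[u]]$. Morphisms of smooth modules are the linear maps that commute with the action. **Proposition.** The category of $\mathcal{V}[\mathfrak{g},h]_{univ}$-modules is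 equivalent to the category of smooth $\hat{\mathfrak{g}}_h$-modules. The equivalence leaves underlying graded vector spaces and linear maps unchanged (up to natural linear isomorphism), and under it, for homogeneous $A\in\mathfrak{g}$, $Y_M(\mu_{A,0}|0\rangle,z)=\sum_{n\ge0}z^n\mu_{A,n}+(-1)^{|A|}\Omega_z^nJ_{A,n}$, while $\kappa$ acts as the mode $(\kappa|0\rangle)^M_{(-1)}$. **Corollary.** In the same way, the category of $\mathcal{V}[\mathfrak{g}]$-modules is equivalent to the category of smooth $\mathfrak{g}\langle\!\langle u\rangle\!\rangle$-modules. In both statements the modules may be graded by cohomological degree only, or by cohomological degree and super parity, or more generally by any abelian group $\Gamma$ through a homomorphism $\pi:\mathbb{Z}\times\mathbb{Z}/2\to\Gamma$, an element of bidegree $d$ then acting with degree $\pi(d)$ (the same $\Gamma$ and $\pi$ on both sides). -/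

import Mathlib

open scoped TensorProduct

universe u v w

namespace Raviolo

noncomputable section

/-! ### Gradings and Koszul signs -/

/-- A bidegree: the cohomological degree and the super parity. -/
abbrev Bideg : Type := ℤ × ZMod 2

/-- The totalized parity of a bidegree, which governs all signs. -/
def tot (d : Bideg) : ZMod 2 := (d.1 : ZMod 2) + d.2

/-- The Koszul sign `(-1)^{xy}`. -/
def koszul (x y : ZMod 2) : ℂ := if x = 1 ∧ y = 1 then -1 else 1

/-- The family of subspaces `𝓜` is a grading: `M` is the direct sum of its members. -/
def IsGrading {I : Type*} {M : Type*} [AddCommGroup M] [Module ℂ M]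
    (𝓜 : I → Submodule ℂ M) : Prop :=
  iSupIndep 𝓜 ∧ ⨆ i, 𝓜 i = ⊤

theorem koszul_comm (x y : ZMod 2) : koszul x y = koszul y x := by
  simp [koszul, and_comm]

theorem koszul_add_left (x y z : ZMod 2) : koszul (x + y) z = koszul x z * koszul y z := by
  have h : ∀ t : ZMod 2, t = 0 ∨ t = 1 := by decide
  have h11 : (1 : ZMod 2) + 1 = 0 := by decide
  rcases h x with rfl | rfl <;> rcases h y with rfl | rfl <;> rcases h z with rfl | rfl <;>
    simp [koszul, h11]

theorem koszul_add_right (x y z : ZMod 2) : koszul x (y + z) = koszul x y * koszul x z := by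
  rw [koszul_comm, koszul_add_left, koszul_comm y, koszul_comm z]

theorem koszul_mul_self (x y : ZMod 2) : koszul x y * koszul x y = 1 := by
  unfold koszul; split_ifs <;> norm_num

theorem koszul_zero_left (x : ZMod 2) : koszul 0 x = 1 := by
  simp [koszul]

/-- A graded family is independent as soon as there are projections onto its members. -/
theorem iSupIndep_of_proj {I : Type*} {M : Type*} [AddCommGroup M] [Module ℂ M]
    (𝓜 : I → Submodule ℂ M) (π : I → M →ₗ[ℂ] M)
    (h1 : ∀ i, ∀ x ∈ 𝓜 i, π i x = x) (h2 : ∀ i j, i ≠ j → ∀ x ∈ 𝓜 j, π i x = 0) :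
    iSupIndep 𝓜 := by
  intro i
  rw [Submodule.disjoint_def]
  intro x hx hx'
  have : (⨆ j, ⨆ (_ : j ≠ i), 𝓜 j) ≤ LinearMap.ker (π i) :=
    iSup₂_le fun j hj y hy => h2 i j hj.symm y hy
  rw [← h1 i x hx]
  exact this hx'

/-! ### Lie superalgebras -/

/-- A complex Lie superalgebra structure on the vector space `g`. -/
structure LieSuperalgebra (g : Type u) [AddCommGroup g] [Module ℂ g] where
  /-- even part `par 0` and odd part `par 1` -/
  par : ZMod 2 → Submodule ℂ g
  isCompl : IsCompl (par 0) (par 1)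
  br : g →ₗ[ℂ] g →ₗ[ℂ] g
  br_mem : ∀ {p q : ZMod 2} {A B : g}, A ∈ par p → B ∈ par q → br A B ∈ par (p + q)
  skew : ∀ {p q : ZMod 2} {A B : g}, A ∈ par p → B ∈ par q →
    br A B = -(koszul p q • br B A)
  jacobi : ∀ {p q r : ZMod 2} {A B C : g}, A ∈ par p → B ∈ par q → C ∈ par r →
    br A (br B C) = br (br A B) C + koszul p q • br B (br A C)

/-- A Lie superalgebra with an additional compatible cohomological `ℤ`-grading; signs are governed
by the totalized parity. -/
structure GradedLieSuperalgebra (L : Type u) [AddCommGroup L] [Module ℂ L] where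
  deg : Bideg → Submodule ℂ L
  isGrading : IsGrading deg
  br : L →ₗ[ℂ] L →ₗ[ℂ] L
  br_mem : ∀ {d e : Bideg} {x y : L}, x ∈ deg d → y ∈ deg e → br x y ∈ deg (d + e)
  skew : ∀ {d e : Bideg} {x y : L}, x ∈ deg d → y ∈ deg e →
    br x y = -(koszul (tot d) (tot e) • br y x)
  jacobi : ∀ {d e f : Bideg} {x y z : L}, x ∈ deg d → y ∈ deg e → z ∈ deg f →
    br x (br y z) = br (br x y) z + koszul (tot d) (tot e) • br y (br x z)

/-- An even, (super)symmetric, invariant bilinear form on a Lie superalgebra. -/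
structure InvariantForm {g : Type u} [AddCommGroup g] [Module ℂ g] (𝔤 : LieSuperalgebra g) where
  form : g →ₗ[ℂ] g →ₗ[ℂ] ℂ
  even : ∀ {p q : ZMod 2} {A B : g}, A ∈ 𝔤.par p → B ∈ 𝔤.par q → p ≠ q → form A B = 0
  symm : ∀ {p q : ZMod 2} {A B : g}, A ∈ 𝔤.par p → B ∈ 𝔤.par q →
    form A B = koszul p q • form B A
  invariant : ∀ A B C : g, form (𝔤.br A B) C = form A (𝔤.br B C)

/-! ### Raviolo Laurent series -/

/-- The underlying vector space of the algebra `𝒦` of raviolo Laurent series: the pair `(f, q)`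
stands for `f(u) + ∑ₘ qₘ Ωᵐ`, with `f` a power series in cohomological degree `0` and a finite
sum `∑ₘ qₘ Ωᵐ` in cohomological degree `1`. -/
abbrev RavK : Type := PowerSeries ℂ × (ℕ →₀ ℂ)

namespace RavK

/-- The product of `q ∈ 𝒦¹` and `f ∈ 𝒦⁰`, determined by `uⁱ Ωᵐ = Ωᵐ⁻ⁱ` for `i ≤ m` and
`uⁱ Ωᵐ = 0` for `i > m`. -/
def act : (ℕ →₀ ℂ) →ₗ[ℂ] PowerSeries ℂ →ₗ[ℂ] (ℕ →₀ ℂ) :=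
  Finsupp.linearCombination ℂ fun m =>
    ∑ i ∈ Finset.range (m + 1), (PowerSeries.coeff i).smulRight (Finsupp.single (m - i) 1)

/-- The product of `𝒦`; it is commutative and the product of two elements of degree `1` is `0`. -/
def mul : RavK →ₗ[ℂ] RavK →ₗ[ℂ] RavK :=
  LinearMap.mk₂ ℂ (fun α β => (α.1 * β.1, act β.2 α.1 + act α.2 β.1))
    (fun α α' β => by
      ext1
      · simp [add_mul]
      · simp only [Prod.fst_add, Prod.snd_add, map_add, LinearMap.add_apply]; abel)
    (fun c α β => by ext1 <;> simp)
    (fun α β β' => by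
      ext1
      · simp [mul_add]
      · simp only [Prod.fst_add, Prod.snd_add, map_add, LinearMap.add_apply]; abel)
    (fun c α β => by ext1 <;> simp)

/-- The derivation `∂_u` of `𝒦`, with `∂ uⁿ = n uⁿ⁻¹` and `∂ Ωᵐ = -(m+1) Ωᵐ⁺¹`. -/
def deriv : RavK →ₗ[ℂ] RavK :=
  LinearMap.prodMap (PowerSeries.derivative (R := ℂ)).toLinearMap
    (Finsupp.linearCombination ℂ fun m => Finsupp.single (m + 1) (-((m : ℂ) + 1)))

/-- The residue `Res_u du`, with `Res uⁿ = 0` and `Res Ωᵐ = δ_{m,0}`. -/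
def res : RavK →ₗ[ℂ] ℂ := Finsupp.lapply 0 ∘ₗ LinearMap.snd ℂ _ _

/-- The component of cohomological degree `0`. -/
def proj0 : RavK →ₗ[ℂ] RavK := LinearMap.inl ℂ _ _ ∘ₗ LinearMap.fst ℂ _ _

/-- The component of cohomological degree `1`. -/
def proj1 : RavK →ₗ[ℂ] RavK := LinearMap.inr ℂ _ _ ∘ₗ LinearMap.snd ℂ _ _

/-- The cohomological grading of `𝒦`, concentrated in degrees `0` and `1`. -/
def deg (r : ℤ) : Submodule ℂ RavK :=
  if r = 0 then LinearMap.range (LinearMap.inl ℂ _ _)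
  else if r = 1 then LinearMap.range (LinearMap.inr ℂ _ _) else ⊥

/-- The element `Ωᵐ` of `𝒦`. -/
def omega (m : ℕ) : RavK := (0, Finsupp.single m 1)

/-- A power series in `u`, as an element of `𝒦`. -/
def ofSeries : PowerSeries ℂ →ₗ[ℂ] RavK := LinearMap.inl ℂ _ _

theorem act_single_apply (m : ℕ) (c : ℂ) (f : PowerSeries ℂ) (n : ℕ) :
    act (Finsupp.single m c) f n = if n ≤ m then c * PowerSeries.coeff (m - n) f else 0 := by
  simp only [act, Finsupp.linearCombination_single, LinearMap.smul_apply, LinearMap.sum_apply,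
    LinearMap.smulRight_apply, Finsupp.smul_apply, Finsupp.finsetSum_apply, smul_eq_mul,
    Finsupp.single_apply]
  split_ifs with h
  · congr 1
    rw [Finset.sum_eq_single (m - n)]
    · simp [show m - (m - n) = n by omega]
    · intro b hb hbn
      have : m - b ≠ n := by
        simp at hb; omega
      simp [this]
    · intro h'; simp at h'
  · rw [Finset.sum_eq_zero, mul_zero]
    intro b hb
    have : m - b ≠ n := by omega
    simp [this]

theorem act_act (q : ℕ →₀ ℂ) (f k : PowerSeries ℂ) : act (act q f) k = act q (f * k) := by
  induction q using Finsupp.induction_linear with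
  | zero => simp
  | add a b ha hb => simp [ha, hb]
  | single m c =>
    ext n
    rw [act_single_apply]
    have h : act (Finsupp.single m c) f
        = ∑ i ∈ Finset.range (m + 1), Finsupp.single (m - i) (c * PowerSeries.coeff i f) := by
      simp [act, Finset.smul_sum]
    rw [h, map_sum, LinearMap.sum_apply, Finsupp.finsetSum_apply]
    simp only [act_single_apply]
    split_ifs with hn
    · rw [PowerSeries.coeff_mul, Finset.Nat.sum_antidiagonal_eq_sum_range_succ_mk, Finset.mul_sum]
      have hsub : Finset.range (m - n).succ ⊆ Finset.range (m + 1) := by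
        intro x; simp; omega
      rw [← Finset.sum_subset hsub]
      · refine Finset.sum_congr rfl fun i hi => ?_
        simp at hi
        rw [if_pos (by omega), show m - i - n = m - n - i by omega]
        ring
      · intro x hx hx'
        simp at hx hx'
        rw [if_neg (by omega)]
    · refine Finset.sum_eq_zero fun i hi => ?_
      rw [if_neg (by omega)]

theorem mul_comm' (α β : RavK) : mul α β = mul β α := by
  simp only [mul, LinearMap.mk₂_apply, mul_comm α.1, add_comm (act β.2 α.1)]

theorem mul_assoc' (α β γ : RavK) : mul (mul α β) γ = mul α (mul β γ) := by
  simp only [mul, LinearMap.mk₂_apply]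
  ext1
  · simp [mul_assoc]
  · simp only [map_add, LinearMap.add_apply, act_act, mul_comm, add_assoc]

theorem deriv_mul (α β : RavK) : deriv (mul α β) = mul (deriv α) β + mul α (deriv β) := by
  have key : ∀ (q : ℕ →₀ ℂ) (f : PowerSeries ℂ),
      (deriv (0, act q f)).2 = act q (deriv (f, 0)).1 + act (deriv (0, q)).2 f := by
    intro q f
    induction q using Finsupp.induction_linear with
    | zero => simp [deriv]
    | add a b ha hb =>
      simp only [deriv, LinearMap.prodMap_apply, map_add, LinearMap.add_apply] at ha hb ⊢
      rw [ha, hb]; abel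
    | single m c =>
      have h : act (Finsupp.single m c) f
          = ∑ i ∈ Finset.range (m + 1), Finsupp.single (m - i) (c * PowerSeries.coeff i f) := by
        simp [act, Finset.smul_sum]
      have hd : ∀ (p : ℕ →₀ ℂ) (n : ℕ), (Finsupp.linearCombination ℂ fun m : ℕ =>
          Finsupp.single (m + 1) (-((m : ℂ) + 1))) p n = -(n : ℂ) * p (n - 1) := by
        intro p n
        induction p using Finsupp.induction_linear with
        | zero => simp
        | add a b ha hb => rw [map_add, Finsupp.add_apply, ha, hb, Finsupp.add_apply, mul_add]
        | single k d =>
          simp only [Finsupp.linearCombination_single, Finsupp.smul_apply, Finsupp.single_apply]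
          rcases n with _ | n
          · simp
          · by_cases hk : k = n
            · subst hk; simp; ring
            · simp [hk]
      ext n
      simp only [deriv, LinearMap.prodMap_apply, Finsupp.add_apply, hd, act_single_apply]
      rw [show (Finsupp.linearCombination ℂ fun m : ℕ => Finsupp.single (m + 1) (-((m : ℂ) + 1)))
        (Finsupp.single m c) = Finsupp.single (m + 1) (-(c * ((m : ℂ) + 1))) by
          rw [Finsupp.linearCombination_single, Finsupp.smul_single, smul_eq_mul, mul_neg],
        act_single_apply]
      have hder : ∀ k, PowerSeries.coeff k
          ((PowerSeries.derivative (R := ℂ)).toLinearMap f)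
            = PowerSeries.coeff (k + 1) f * (k + 1) := fun k => by
        simpa using PowerSeries.coeff_derivative (R := ℂ) f k
      rw [hder]
      rcases n with _ | n
      · simp; ring
      · rcases lt_trichotomy n m with h1 | h1 | h1
        · rw [if_pos (by omega), if_pos (by omega), if_pos (by omega),
            show m + 1 - (n + 1) = m - n by omega,
            show n + 1 - 1 = n by omega, show m - (n + 1) + 1 = m - n by omega,
            Nat.cast_sub (by omega)]
          push_cast; ring
        · subst h1
          simp; ring
        · rw [if_neg (by omega), if_neg (by omega), if_neg (by omega)]; simp
  have e : ∀ (q q' : ℕ →₀ ℂ), (deriv (0, q + q')).2 = (deriv (0, q)).2 + (deriv (0, q')).2 := by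
    intro q q'; simp [deriv]
  ext1
  · simp [mul, deriv]; ring
  · have h1 : (deriv (mul α β)).2 = (deriv (0, act β.2 α.1 + act α.2 β.1)).2 := rfl
    rw [h1, e, key, key]
    simp only [mul, LinearMap.mk₂_apply, Prod.snd_add, deriv, LinearMap.prodMap_apply]
    abel

theorem res_deriv (α : RavK) : res (deriv α) = 0 := by
  obtain ⟨f, q⟩ := α
  simp only [res, deriv, LinearMap.comp_apply, LinearMap.prodMap_apply, LinearMap.snd_apply]
  induction q using Finsupp.induction_linear with
  | zero => simp
  | add a b ha hb => simp [map_add] at ha hb ⊢; simp [ha, hb]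
  | single k d => simp

theorem fst_eq_zero_of_mem {r : ℤ} (hr : r ≠ 0) {α : RavK} (h : α ∈ deg r) : α.1 = 0 := by
  unfold deg at h
  rw [if_neg hr] at h
  split_ifs at h
  · obtain ⟨q, rfl⟩ := h; rfl
  · rw [Submodule.mem_bot] at h; rw [h]; rfl

theorem snd_eq_zero_of_mem {r : ℤ} (hr : r ≠ 1) {α : RavK} (h : α ∈ deg r) : α.2 = 0 := by
  unfold deg at h
  split_ifs at h
  · obtain ⟨q, rfl⟩ := h; rfl
  · rw [Submodule.mem_bot] at h; rw [h]; rfl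

theorem mem_deg_zero {α : RavK} (h : α.2 = 0) : α ∈ deg 0 := by
  simp only [deg, if_true]; exact ⟨α.1, by ext1 <;> simp [h]⟩

theorem mem_deg_one {α : RavK} (h : α.1 = 0) : α ∈ deg 1 := by
  simp only [deg, if_true, one_ne_zero, if_false]; exact ⟨α.2, by ext1 <;> simp [h]⟩

theorem mul_eq_zero {α β : RavK} (ha : α.1 = 0) (hb : β.1 = 0) : mul α β = 0 := by
  simp [mul, ha, hb]

theorem mul_mem {r s : ℤ} {α β : RavK} (ha : α ∈ deg r) (hb : β ∈ deg s) :
    mul α β ∈ deg (r + s) := by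
  by_cases hr : r = 0
  · by_cases hs : s = 0
    · subst hr hs
      refine mem_deg_zero ?_
      simp [mul, snd_eq_zero_of_mem (by decide) ha, snd_eq_zero_of_mem (by decide) hb]
    · by_cases hs1 : s = 1
      · subst hr hs1
        refine mem_deg_one ?_
        simp [mul, fst_eq_zero_of_mem (by decide) hb]
      · rw [show β = 0 from Prod.ext (fst_eq_zero_of_mem hs hb) (snd_eq_zero_of_mem hs1 hb)]
        simp
  · by_cases hs : s = 0
    · by_cases hr1 : r = 1
      · subst hs hr1
        refine mem_deg_one ?_
        simp [mul, fst_eq_zero_of_mem (by decide) ha]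
      · rw [show α = 0 from Prod.ext (fst_eq_zero_of_mem hr ha) (snd_eq_zero_of_mem hr1 ha)]
        simp
    · rw [mul_eq_zero (fst_eq_zero_of_mem hr ha) (fst_eq_zero_of_mem hs hb)]
      exact zero_mem _

theorem fst_mul (α β : RavK) : (mul α β).1 = α.1 * β.1 := rfl

theorem fst_deriv {α : RavK} (h : α.1 = 0) : (deriv α).1 = 0 := by
  simp [deriv, h]

/-- Either the sign for exchanging `α` and `β` is trivial or both are multiples of the `Ωᵐ`. -/
theorem koszul_eq_one_or {r s : ℤ} {α β : RavK} (ha : α ∈ deg r) (hb : β ∈ deg s) :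
    koszul (r : ZMod 2) (s : ZMod 2) = 1 ∨ (α.1 = 0 ∧ β.1 = 0) := by
  by_cases hr : r = 0
  · left; simp [hr, koszul]
  · by_cases hs : s = 0
    · left; simp [hs, koszul]
    · exact Or.inr ⟨fst_eq_zero_of_mem hr ha, fst_eq_zero_of_mem hs hb⟩

theorem res_mul_deriv_skew (α β : RavK) :
    res (mul α (deriv β)) = -res (mul β (deriv α)) := by
  have h := res_deriv (mul α β)
  rw [deriv_mul, map_add, mul_comm' (deriv α)] at h
  linear_combination h

theorem res_cocycle (α β γ : RavK) :
    res (mul α (deriv (mul β γ))) + res (mul β (deriv (mul α γ)))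
      = res (mul (mul α β) (deriv γ)) := by
  have h := res_deriv (mul (mul α β) γ)
  have e1 : mul α (mul (deriv β) γ) = mul (mul α (deriv β)) γ := (mul_assoc' _ _ _).symm
  have e2 : mul α (mul β (deriv γ)) = mul (mul α β) (deriv γ) := (mul_assoc' _ _ _).symm
  have e3 : mul β (mul (deriv α) γ) = mul (mul (deriv α) β) γ := by
    rw [← mul_assoc', mul_comm' β]
  have e4 : mul β (mul α (deriv γ)) = mul (mul α β) (deriv γ) := by
    rw [← mul_assoc', mul_comm' β]
  rw [deriv_mul, deriv_mul] at h
  rw [deriv_mul β, deriv_mul α γ]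
  simp only [map_add, LinearMap.add_apply, e1, e2, e3, e4] at h ⊢
  linear_combination h

end RavK

/-! ### The current algebra and its central extension -/

section Current

open RavK

variable {g : Type u} [AddCommGroup g] [Module ℂ g]

namespace LieSuperalgebra

variable (𝔤 : LieSuperalgebra g)

/-- The projection of `g` onto its part of parity `p`. -/
def parProj (p : ZMod 2) : g →ₗ[ℂ] g :=
  if p = 0 then Submodule.projection (𝔤.par 0) (𝔤.par 1) 𝔤.isCompl
  else Submodule.projection (𝔤.par 1) (𝔤.par 0) 𝔤.isCompl.symm

/-- The parity involution `A ↦ (-1)^{|A|} A`. -/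
def parInv : g →ₗ[ℂ] g := 𝔤.parProj 0 - 𝔤.parProj 1

/-- The bracket of the current algebra `g⟨⟨u⟩⟩ = g ⊗ 𝒦`: it is given on pure tensors by
`[A ⊗ α, B ⊗ β] = (-1)^{|α||B|} [A, B] ⊗ αβ`. -/
def currentBr : (g ⊗[ℂ] RavK) →ₗ[ℂ] (g ⊗[ℂ] RavK) →ₗ[ℂ] (g ⊗[ℂ] RavK) :=
  TensorProduct.map₂ 𝔤.br (mul ∘ₗ proj0)
    + TensorProduct.map₂ (𝔤.br.compl₂ 𝔤.parInv) (mul ∘ₗ proj1)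

/-- The bilinear map `(A ⊗ α, B ⊗ β) ↦ (-1)^{|α||B|} h(A, B) Res_u du α ∂_u β`. -/
def currentCocycle (h : InvariantForm 𝔤) :
    (g ⊗[ℂ] RavK) →ₗ[ℂ] (g ⊗[ℂ] RavK) →ₗ[ℂ] ℂ :=
  (TensorProduct.map₂ h.form (((mul ∘ₗ proj0).compl₂ deriv).compr₂ res)
    + TensorProduct.map₂ (h.form.compl₂ 𝔤.parInv)
        (((mul ∘ₗ proj1).compl₂ deriv).compr₂ res)).compr₂ (TensorProduct.lid ℂ ℂ).toLinearMap

/-- The bigrading of the current algebra. -/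
def currentDeg (d : Bideg) : Submodule ℂ (g ⊗[ℂ] RavK) :=
  Submodule.span ℂ {x | ∃ A ∈ 𝔤.par d.2, ∃ α ∈ RavK.deg d.1, x = A ⊗ₜ[ℂ] α}

theorem par_cases (p : ZMod 2) : p = 0 ∨ p = 1 := by
  revert p; decide

theorem parProj_of_mem {p : ZMod 2} {A : g} (hA : A ∈ 𝔤.par p) : 𝔤.parProj p A = A := by
  rcases par_cases p with rfl | rfl
  · simp only [parProj, if_true]
    exact Submodule.projection_apply_left 𝔤.isCompl ⟨A, hA⟩
  · simp only [parProj, one_ne_zero, if_false]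
    exact Submodule.projection_apply_left 𝔤.isCompl.symm ⟨A, hA⟩

theorem parProj_of_ne {p q : ZMod 2} (h : p ≠ q) {A : g} (hA : A ∈ 𝔤.par q) :
    𝔤.parProj p A = 0 := by
  rcases par_cases p with rfl | rfl <;> rcases par_cases q with rfl | rfl
  · exact absurd rfl h
  · simp only [parProj, if_true]
    exact (Submodule.projection_apply_eq_zero_iff 𝔤.isCompl).2 hA
  · simp only [parProj, one_ne_zero, if_false]
    exact (Submodule.projection_apply_eq_zero_iff 𝔤.isCompl.symm).2 hA
  · exact absurd rfl h

theorem parInv_of_mem {p : ZMod 2} {A : g} (hA : A ∈ 𝔤.par p) :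
    𝔤.parInv A = koszul 1 p • A := by
  have h01 : (0 : ZMod 2) ≠ 1 := by decide
  rcases par_cases p with rfl | rfl
  · rw [parInv, LinearMap.sub_apply, 𝔤.parProj_of_mem hA, 𝔤.parProj_of_ne h01.symm hA]
    simp [koszul]
  · rw [parInv, LinearMap.sub_apply, 𝔤.parProj_of_mem hA, 𝔤.parProj_of_ne h01 hA]
    simp [koszul]

theorem exists_par_add (A : g) : ∃ B ∈ 𝔤.par 0, ∃ C ∈ 𝔤.par 1, B + C = A := by
  have h : A ∈ 𝔤.par 0 ⊔ 𝔤.par 1 := by rw [𝔤.isCompl.sup_eq_top]; trivial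
  obtain ⟨B, hB, C, hC, e⟩ := Submodule.mem_sup.1 h
  exact ⟨B, hB, C, hC, e⟩

theorem currentBr_tmul {r : ℤ} {q : ZMod 2} (A : g) {α : RavK} (hα : α ∈ RavK.deg r) {B : g}
    (hB : B ∈ 𝔤.par q) (β : RavK) :
    𝔤.currentBr (A ⊗ₜ α) (B ⊗ₜ β) = koszul r q • (𝔤.br A B ⊗ₜ[ℂ] mul α β) := by
  have e : 𝔤.currentBr (A ⊗ₜ α) (B ⊗ₜ β) = 𝔤.br A B ⊗ₜ[ℂ] mul (proj0 α) β
      + 𝔤.br A (𝔤.parInv B) ⊗ₜ[ℂ] mul (proj1 α) β := by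
    simp [currentBr]
  rw [e, 𝔤.parInv_of_mem hB]
  by_cases hr : r = 0
  · subst hr
    have h2 := snd_eq_zero_of_mem (by decide) hα
    rw [show proj0 α = α by ext1 <;> simp [proj0, h2], show proj1 α = 0 by ext1 <;> simp [proj1, h2]]
    simp [koszul]
  · have h1 := fst_eq_zero_of_mem hr hα
    by_cases hr1 : r = 1
    · subst hr1
      rw [show proj1 α = α by ext1 <;> simp [proj1, h1],
        show proj0 α = 0 by ext1 <;> simp [proj0, h1]]
      simp [TensorProduct.smul_tmul']
    · rw [show α = 0 from Prod.ext h1 (snd_eq_zero_of_mem hr1 hα)]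
      simp

theorem currentCocycle_tmul (h : InvariantForm 𝔤) {r : ℤ} {q : ZMod 2} (A : g) {α : RavK}
    (hα : α ∈ RavK.deg r) {B : g} (hB : B ∈ 𝔤.par q) (β : RavK) :
    𝔤.currentCocycle h (A ⊗ₜ α) (B ⊗ₜ β)
      = koszul r q * (h.form A B * res (mul α (deriv β))) := by
  have e : 𝔤.currentCocycle h (A ⊗ₜ α) (B ⊗ₜ β) = h.form A B * res (mul (proj0 α) (deriv β))
      + h.form A (𝔤.parInv B) * res (mul (proj1 α) (deriv β)) := by
    simp [currentCocycle]
  rw [e, 𝔤.parInv_of_mem hB]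
  by_cases hr : r = 0
  · subst hr
    have h2 := snd_eq_zero_of_mem (by decide) hα
    rw [show proj0 α = α by ext1 <;> simp [proj0, h2], show proj1 α = 0 by ext1 <;> simp [proj1, h2]]
    simp [koszul]
  · have h1 := fst_eq_zero_of_mem hr hα
    by_cases hr1 : r = 1
    · subst hr1
      rw [show proj1 α = α by ext1 <;> simp [proj1, h1],
        show proj0 α = 0 by ext1 <;> simp [proj0, h1]]
      simp [mul_assoc]
    · rw [show α = 0 from Prod.ext h1 (snd_eq_zero_of_mem hr1 hα)]
      simp

theorem current_isGrading : IsGrading 𝔤.currentDeg := by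
  constructor
  · refine iSupIndep_of_proj _ (fun d => TensorProduct.map (𝔤.parProj d.2)
      (if d.1 = 0 then proj0 else if d.1 = 1 then proj1 else 0)) ?_ ?_
    · intro d x hx
      induction hx using Submodule.span_induction with
      | zero => simp
      | add x y _ _ hx hy => rw [map_add, hx, hy]
      | smul c x _ hx => rw [map_smul, hx]
      | mem x hx =>
        obtain ⟨A, hA, α, hα, rfl⟩ := hx
        rw [TensorProduct.map_tmul, 𝔤.parProj_of_mem hA]
        congr 1
        split_ifs with h0 h1
        · rw [h0] at hα
          have h2 := snd_eq_zero_of_mem (by decide) hα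
          ext1 <;> simp [proj0, h2]
        · rw [h1] at hα
          have h2 := fst_eq_zero_of_mem (by decide) hα
          ext1 <;> simp [proj1, h2]
        · rw [show α = 0 from Prod.ext (fst_eq_zero_of_mem h0 hα) (snd_eq_zero_of_mem h1 hα)]
          simp
    · intro d e hde x hx
      induction hx using Submodule.span_induction with
      | zero => simp
      | add x y _ _ hx hy => rw [map_add, hx, hy, add_zero]
      | smul c x _ hx => rw [map_smul, hx, smul_zero]
      | mem x hx =>
        obtain ⟨A, hA, α, hα, rfl⟩ := hx
        rw [TensorProduct.map_tmul]
        by_cases h2 : d.2 = e.2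
        · have h1 : d.1 ≠ e.1 := fun h1 => hde (Prod.ext h1 h2)
          suffices h0 : (if d.1 = 0 then proj0 else if d.1 = 1 then proj1 else 0 :
              RavK →ₗ[ℂ] RavK) α = 0 by rw [h0, TensorProduct.tmul_zero]
          split_ifs with h0 h1'
          · have := fst_eq_zero_of_mem (by omega) hα
            ext1 <;> simp [proj0, this]
          · have := snd_eq_zero_of_mem (by omega) hα
            ext1 <;> simp [proj1, this]
          · rfl
        · rw [𝔤.parProj_of_ne h2 hA, TensorProduct.zero_tmul]
  · rw [eq_top_iff]
    intro x _
    have key : ∀ (p : ZMod 2) (A : g), A ∈ 𝔤.par p → ∀ α : RavK,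
        A ⊗ₜ[ℂ] α ∈ ⨆ d, 𝔤.currentDeg d := by
      intro p A hA α
      have e : α = (α.1, 0) + (0, α.2) := by ext1 <;> simp
      rw [e, TensorProduct.tmul_add]
      refine add_mem ?_ ?_
      · exact Submodule.mem_iSup_of_mem (0, p)
          (Submodule.subset_span ⟨A, hA, _, mem_deg_zero rfl, rfl⟩)
      · exact Submodule.mem_iSup_of_mem (1, p)
          (Submodule.subset_span ⟨A, hA, _, mem_deg_one rfl, rfl⟩)
    induction x using TensorProduct.induction_on with
    | zero => exact zero_mem _
    | add x y hx hy => exact add_mem (hx trivial) (hy trivial)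
    | tmul A α =>
      obtain ⟨B, hB, C, hC, rfl⟩ := 𝔤.exists_par_add A
      rw [TensorProduct.add_tmul]
      exact add_mem (key 0 B hB α) (key 1 C hC α)

/-- Reduction of a bilinear identity to homogeneous pure tensors. -/
theorem current_ext₂ {N : Type*} [AddCommGroup N] [Module ℂ N] {d e : Bideg}
    (F G : (g ⊗[ℂ] RavK) →ₗ[ℂ] (g ⊗[ℂ] RavK) →ₗ[ℂ] N)
    (H : ∀ A ∈ 𝔤.par d.2, ∀ α ∈ RavK.deg d.1, ∀ B ∈ 𝔤.par e.2, ∀ β ∈ RavK.deg e.1,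
      F (A ⊗ₜ α) (B ⊗ₜ β) = G (A ⊗ₜ α) (B ⊗ₜ β))
    {x y : g ⊗[ℂ] RavK} (hx : x ∈ 𝔤.currentDeg d) (hy : y ∈ 𝔤.currentDeg e) :
    F x y = G x y := by
  induction hx using Submodule.span_induction with
  | zero => simp
  | add x x' _ _ hx hx' => simp [hx, hx']
  | smul c x _ hx => simp [hx]
  | mem x hx =>
    obtain ⟨A, hA, α, hα, rfl⟩ := hx
    induction hy using Submodule.span_induction with
    | zero => simp
    | add x x' _ _ hx hx' => simp [hx, hx']
    | smul c x _ hx => simp [hx]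
    | mem y hy =>
      obtain ⟨B, hB, β, hβ, rfl⟩ := hy
      exact H A hA α hα B hB β hβ

theorem currentBr_mem {d e : Bideg} {x y : g ⊗[ℂ] RavK} (hx : x ∈ 𝔤.currentDeg d)
    (hy : y ∈ 𝔤.currentDeg e) : 𝔤.currentBr x y ∈ 𝔤.currentDeg (d + e) := by
  rw [← Submodule.Quotient.mk_eq_zero]
  have := 𝔤.current_ext₂ (𝔤.currentBr.compr₂ (𝔤.currentDeg (d + e)).mkQ) 0
    (fun A hA α hα B hB β hβ => ?_) hx hy
  · simpa using this
  · simp only [LinearMap.compr₂_apply, LinearMap.zero_apply, Submodule.mkQ_apply,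
      Submodule.Quotient.mk_eq_zero]
    rw [𝔤.currentBr_tmul A hα hB]
    exact Submodule.smul_mem _ _
      (Submodule.subset_span ⟨_, 𝔤.br_mem hA hB, _, RavK.mul_mem hα hβ, rfl⟩)

theorem currentBr_skew {d e : Bideg} {x y : g ⊗[ℂ] RavK} (hx : x ∈ 𝔤.currentDeg d)
    (hy : y ∈ 𝔤.currentDeg e) :
    𝔤.currentBr x y = -(koszul (tot d) (tot e) • 𝔤.currentBr y x) := by
  have := 𝔤.current_ext₂ 𝔤.currentBr (-(koszul (tot d) (tot e) • 𝔤.currentBr.flip))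
    (fun A hA α hα B hB β hβ => ?_) hx hy
  · simpa using this
  · simp only [LinearMap.neg_apply, LinearMap.smul_apply, LinearMap.flip_apply]
    rw [𝔤.currentBr_tmul A hα hB, 𝔤.currentBr_tmul B hβ hA, 𝔤.skew hA hB, RavK.mul_comm' β α]
    rcases koszul_eq_one_or hα hβ with h1 | ⟨h1, h2⟩
    · simp only [tot, koszul_add_left, koszul_add_right, h1, TensorProduct.neg_tmul, smul_neg,
        TensorProduct.smul_tmul', smul_smul, neg_inj]
      congr 2
      rw [koszul_comm d.2 (e.1 : ZMod 2)]
      linear_combination (-(koszul (d.1 : ZMod 2) e.2 * koszul d.2 e.2))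
        * koszul_mul_self (e.1 : ZMod 2) d.2
    · rw [RavK.mul_eq_zero h1 h2]; simp

theorem currentCocycle_skew (h : InvariantForm 𝔤) {d e : Bideg} {x y : g ⊗[ℂ] RavK}
    (hx : x ∈ 𝔤.currentDeg d) (hy : y ∈ 𝔤.currentDeg e) :
    𝔤.currentCocycle h x y = -(koszul (tot d) (tot e) • 𝔤.currentCocycle h y x) := by
  have := 𝔤.current_ext₂ (𝔤.currentCocycle h)
    (-(koszul (tot d) (tot e) • (𝔤.currentCocycle h).flip))
    (fun A hA α hα B hB β hβ => ?_) hx hy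
  · simpa using this
  · simp only [LinearMap.neg_apply, LinearMap.smul_apply, LinearMap.flip_apply, smul_eq_mul]
    rw [𝔤.currentCocycle_tmul h A hα hB, 𝔤.currentCocycle_tmul h B hβ hA, h.symm hA hB,
      res_mul_deriv_skew α β]
    rcases koszul_eq_one_or hα hβ with h1 | ⟨h1, h2⟩
    · simp only [tot, koszul_add_left, koszul_add_right, h1, smul_eq_mul]
      rw [koszul_comm d.2 (e.1 : ZMod 2)]
      linear_combination (koszul (d.1 : ZMod 2) e.2 * koszul d.2 e.2 * h.form B A
        * res (mul β (deriv α))) * koszul_mul_self (e.1 : ZMod 2) d.2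
    · rw [RavK.mul_eq_zero h2 (fst_deriv h1)]; simp

theorem currentBr_jacobi {d e f : Bideg} {x y z : g ⊗[ℂ] RavK} (hx : x ∈ 𝔤.currentDeg d)
    (hy : y ∈ 𝔤.currentDeg e) (hz : z ∈ 𝔤.currentDeg f) :
    𝔤.currentBr x (𝔤.currentBr y z) = 𝔤.currentBr (𝔤.currentBr x y) z
      + koszul (tot d) (tot e) • 𝔤.currentBr y (𝔤.currentBr x z) := by
  induction hz using Submodule.span_induction with
  | zero => simp
  | add z z' _ _ hz hz' => simp only [map_add, hz, hz', smul_add]; abel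
  | smul c z _ hz => simp only [map_smul, hz, smul_add, smul_comm c]
  | mem z hz =>
    obtain ⟨C, hC, γ, hγ, rfl⟩ := hz
    have := 𝔤.current_ext₂ (𝔤.currentBr.compl₂ (𝔤.currentBr.flip (C ⊗ₜ γ)))
      (𝔤.currentBr.compr₂ (𝔤.currentBr.flip (C ⊗ₜ γ))
        + koszul (tot d) (tot e) • (𝔤.currentBr.compl₂ (𝔤.currentBr.flip (C ⊗ₜ γ))).flip)
      (fun A hA α hα B hB β hβ => ?_) hx hy
    · simpa using this
    · simp only [LinearMap.compl₂_apply, LinearMap.compr₂_apply, LinearMap.add_apply,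
        LinearMap.smul_apply, LinearMap.flip_apply]
      rw [𝔤.currentBr_tmul B hβ hC, 𝔤.currentBr_tmul A hα hB, 𝔤.currentBr_tmul A hα hC]
      simp only [map_smul, LinearMap.smul_apply]
      rw [𝔤.currentBr_tmul A hα (𝔤.br_mem hB hC), 𝔤.currentBr_tmul B hβ (𝔤.br_mem hA hC),
        𝔤.currentBr_tmul (𝔤.br A B) (RavK.mul_mem hα hβ) hC, 𝔤.jacobi hA hB hC,
        ← mul_assoc' β α, RavK.mul_comm' β α, ← mul_assoc' α β]
      rcases koszul_eq_one_or hα hβ with h1 | ⟨h1, h2⟩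
      · simp only [tot, koszul_add_left, koszul_add_right, h1, TensorProduct.add_tmul, smul_add,
          TensorProduct.smul_tmul', smul_smul, Int.cast_add]
        congr 3
        · ring
        · rw [koszul_comm d.2 (e.1 : ZMod 2)]
          linear_combination (-(koszul (e.1 : ZMod 2) f.2 * koszul (d.1 : ZMod 2) e.2
            * koszul (d.1 : ZMod 2) f.2 * koszul d.2 e.2)) * koszul_mul_self (e.1 : ZMod 2) d.2
      · rw [RavK.mul_eq_zero h1 h2]; simp

theorem currentCocycle_jacobi (h : InvariantForm 𝔤) {d e f : Bideg} {x y z : g ⊗[ℂ] RavK}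
    (hx : x ∈ 𝔤.currentDeg d) (hy : y ∈ 𝔤.currentDeg e) (hz : z ∈ 𝔤.currentDeg f) :
    𝔤.currentCocycle h x (𝔤.currentBr y z) = 𝔤.currentCocycle h (𝔤.currentBr x y) z
      + koszul (tot d) (tot e) * 𝔤.currentCocycle h y (𝔤.currentBr x z) := by
  induction hz using Submodule.span_induction with
  | zero => simp
  | add z z' _ _ hz hz' => simp only [map_add, hz, hz', mul_add]; abel
  | smul c z _ hz => simp only [map_smul, hz, smul_eq_mul]; ring
  | mem z hz =>
    obtain ⟨C, hC, γ, hγ, rfl⟩ := hz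
    have := 𝔤.current_ext₂ ((𝔤.currentCocycle h).compl₂ (𝔤.currentBr.flip (C ⊗ₜ γ)))
      (𝔤.currentBr.compr₂ ((𝔤.currentCocycle h).flip (C ⊗ₜ γ)) + koszul (tot d) (tot e) •
        ((𝔤.currentCocycle h).compl₂ (𝔤.currentBr.flip (C ⊗ₜ γ))).flip)
      (fun A hA α hα B hB β hβ => ?_) hx hy
    · simpa using this
    · simp only [LinearMap.compl₂_apply, LinearMap.compr₂_apply, LinearMap.add_apply,
        LinearMap.smul_apply, LinearMap.flip_apply]
      rw [𝔤.currentBr_tmul B hβ hC, 𝔤.currentBr_tmul A hα hB, 𝔤.currentBr_tmul A hα hC]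
      simp only [map_smul, LinearMap.smul_apply, smul_eq_mul]
      rw [𝔤.currentCocycle_tmul h A hα (𝔤.br_mem hB hC),
        𝔤.currentCocycle_tmul h B hβ (𝔤.br_mem hA hC),
        𝔤.currentCocycle_tmul h (𝔤.br A B) (RavK.mul_mem hα hβ) hC,
        ← h.invariant A B C, ← h.invariant B A C, 𝔤.skew hB hA]
      rcases koszul_eq_one_or hα hβ with h1 | ⟨h1, h2⟩
      · simp only [tot, koszul_add_left, koszul_add_right, h1, Int.cast_add, map_neg, map_smul,
          LinearMap.neg_apply, LinearMap.smul_apply, smul_eq_mul]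
        rw [koszul_comm d.2 (e.1 : ZMod 2), koszul_comm d.2 e.2]
        have k1 := koszul_mul_self (e.1 : ZMod 2) d.2
        have k2 := koszul_mul_self e.2 d.2
        have hc := res_cocycle α β γ
        generalize koszul (e.1 : ZMod 2) d.2 = a at *
        generalize koszul e.2 d.2 = b at *
        linear_combination (koszul (e.1 : ZMod 2) f.2 * koszul (d.1 : ZMod 2) e.2
          * koszul (d.1 : ZMod 2) f.2 * h.form (𝔤.br A B) C) * hc
          + (koszul (e.1 : ZMod 2) f.2 * koszul (d.1 : ZMod 2) e.2
          * koszul (d.1 : ZMod 2) f.2 * h.form (𝔤.br A B) C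
          * res (mul β (deriv (mul α γ)))) * (k1 * b * b + k2)
      · rw [RavK.mul_eq_zero h1 (fst_deriv (α := mul β γ) (by rw [fst_mul, h2, zero_mul])),
          RavK.mul_eq_zero h2 (fst_deriv (α := mul α γ) (by rw [fst_mul, h1, zero_mul])),
          RavK.mul_eq_zero h1 h2]
        simp

/-- The current algebra `g⟨⟨u⟩⟩ = g ⊗ 𝒦`. -/
def current : GradedLieSuperalgebra (g ⊗[ℂ] RavK) where
  deg := 𝔤.currentDeg
  isGrading := 𝔤.current_isGrading
  br := 𝔤.currentBr
  br_mem := 𝔤.currentBr_mem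
  skew := 𝔤.currentBr_skew
  jacobi := 𝔤.currentBr_jacobi

/-- The bracket of the central extension: with central generator `κ`, the element `(x, c)` standing
for `x + c κ`,
`[A ⊗ α, B ⊗ β] = (-1)^{|α||B|} ([A, B] ⊗ αβ - κ h(A, B) Res_u du α ∂_u β)`. -/
def affineBr (h : InvariantForm 𝔤) :
    ((g ⊗[ℂ] RavK) × ℂ) →ₗ[ℂ] ((g ⊗[ℂ] RavK) × ℂ) →ₗ[ℂ] ((g ⊗[ℂ] RavK) × ℂ) :=
  (𝔤.currentBr.compr₂ (LinearMap.inl ℂ _ ℂ)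
    - (𝔤.currentCocycle h).compr₂ (LinearMap.inr ℂ _ ℂ)).compl₁₂
      (LinearMap.fst ℂ _ ℂ) (LinearMap.fst ℂ _ ℂ)

/-- The bigrading of the central extension; `κ` has cohomological degree `1` and is super even. -/
def affineDeg (d : Bideg) : Submodule ℂ ((g ⊗[ℂ] RavK) × ℂ) :=
  (𝔤.currentDeg d).prod (if d = (1, 0) then ⊤ else ⊥)

theorem affineBr_apply (h : InvariantForm 𝔤) (x y : (g ⊗[ℂ] RavK) × ℂ) :
    𝔤.affineBr h x y = (𝔤.currentBr x.1 y.1, -𝔤.currentCocycle h x.1 y.1) := by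
  simp [affineBr]

theorem currentCocycle_eq_zero (h : InvariantForm 𝔤) {d e : Bideg} (hde : d + e ≠ (1, 0))
    {x y : g ⊗[ℂ] RavK} (hx : x ∈ 𝔤.currentDeg d) (hy : y ∈ 𝔤.currentDeg e) :
    𝔤.currentCocycle h x y = 0 := by
  have := 𝔤.current_ext₂ (𝔤.currentCocycle h) 0 (fun A hA α hα B hB β hβ => ?_) hx hy
  · simpa using this
  · rw [𝔤.currentCocycle_tmul h A hα hB]
    by_cases h2 : d.2 = e.2
    · have h1 : d.1 + e.1 ≠ 1 := fun h1 => hde (Prod.ext h1 (by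
        rw [Prod.snd_add, h2]; exact CharTwo.add_self_eq_zero _))
      have hm : res (mul α (RavK.deriv β)) = 0 := by
        by_cases hd : d.1 = 0
        · have hb2 : β.2 = 0 := RavK.snd_eq_zero_of_mem (by omega) hβ
          rw [hd] at hα
          have ha2 := RavK.snd_eq_zero_of_mem (by decide) hα
          simp [res, mul, RavK.deriv, ha2, hb2]
        · by_cases he : e.1 = 0
          · have ha2 : α.2 = 0 := RavK.snd_eq_zero_of_mem (by omega) hα
            rw [he] at hβ
            have hb2 := RavK.snd_eq_zero_of_mem (by decide) hβ
            simp [res, mul, RavK.deriv, ha2, hb2]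
          · rw [RavK.mul_eq_zero (RavK.fst_eq_zero_of_mem hd hα)
              (RavK.fst_deriv (RavK.fst_eq_zero_of_mem he hβ)), map_zero]
      simp [hm]
    · simp [h.even hA hB h2]

theorem affine_isGrading : IsGrading 𝔤.affineDeg := by
  obtain ⟨hi, ht⟩ := 𝔤.current_isGrading
  constructor
  · intro d
    rw [Submodule.disjoint_def]
    rintro ⟨x, c⟩ hx hx'
    have h1 : (⨆ j, ⨆ (_ : j ≠ d), 𝔤.affineDeg j)
        ≤ (⨆ j, ⨆ (_ : j ≠ d), 𝔤.currentDeg j).prod (if d = (1, 0) then ⊥ else ⊤) := by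
      refine iSup₂_le fun j hj y hy => ?_
      refine ⟨Submodule.mem_iSup_of_mem j (Submodule.mem_iSup_of_mem hj hy.1), ?_⟩
      split_ifs with hd
      · have := hy.2
        rwa [if_neg (fun h => hj (h.trans hd.symm))] at this
      · trivial
    have h2 := h1 hx'
    have hx0 : x = 0 := (Submodule.disjoint_def.1 (hi d)) x hx.1 h2.1
    have hc0 : c = 0 := by
      have a := hx.2
      have b := h2.2
      split_ifs at a b
      · exact b
      · exact a
    rw [hx0, hc0]; rfl
  · rw [eq_top_iff]
    rintro ⟨x, c⟩ _
    have e : ((x, c) : (g ⊗[ℂ] RavK) × ℂ) = (x, 0) + (0, c) := by simp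
    rw [e]
    refine add_mem ?_ ?_
    · have hx : x ∈ ⨆ d, 𝔤.currentDeg d := by rw [ht]; trivial
      have : (⨆ d, 𝔤.currentDeg d) ≤ (⨆ d, 𝔤.affineDeg d).comap (LinearMap.inl ℂ _ ℂ) :=
        iSup_le fun d y hy => Submodule.mem_iSup_of_mem d ⟨hy, zero_mem _⟩
      exact this hx
    · refine Submodule.mem_iSup_of_mem ((1, 0) : Bideg) ⟨zero_mem _, ?_⟩
      rw [if_pos rfl]; trivial

/-- The raviolo Kac-Moody algebra `ĝ_h`, the central extension of `g⟨⟨u⟩⟩` by `κ`. -/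
def affine (h : InvariantForm 𝔤) : GradedLieSuperalgebra ((g ⊗[ℂ] RavK) × ℂ) where
  deg := 𝔤.affineDeg
  isGrading := 𝔤.affine_isGrading
  br := 𝔤.affineBr h
  br_mem := by
    intro d e x y hx hy
    rw [affineBr_apply]
    refine ⟨𝔤.currentBr_mem hx.1 hy.1, ?_⟩
    split_ifs with hde
    · trivial
    · simp [𝔤.currentCocycle_eq_zero h hde hx.1 hy.1]
  skew := by
    intro d e x y hx hy
    rw [affineBr_apply, affineBr_apply, 𝔤.currentBr_skew hx.1 hy.1,
      𝔤.currentCocycle_skew h hx.1 hy.1]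
    ext1 <;> simp
  jacobi := by
    intro d e f x y z hx hy hz
    simp only [affineBr_apply]
    rw [𝔤.currentBr_jacobi hx.1 hy.1 hz.1, 𝔤.currentCocycle_jacobi h hx.1 hy.1 hz.1]
    ext1
    · simp
    · simp; ring

/-- The inclusion of the current algebra, as a vector space, into its central extension. -/
def toAffine : (g ⊗[ℂ] RavK) →ₗ[ℂ] ((g ⊗[ℂ] RavK) × ℂ) := LinearMap.inl ℂ _ ℂ

/-- The central element `κ`. -/
def kappa (g : Type u) [AddCommGroup g] [Module ℂ g] : (g ⊗[ℂ] RavK) × ℂ := (0, 1)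

end LieSuperalgebra

end Current

/-! ### Enveloping algebras and vacuum modules -/

namespace GradedLieSuperalgebra

variable {L : Type u} [AddCommGroup L] [Module ℂ L] (𝔏 : GradedLieSuperalgebra L)

/-- The defining relations `xy - (-1)^{|x||y|} yx = [x, y]` of the enveloping algebra. -/
inductive EnvRel : TensorAlgebra ℂ L → TensorAlgebra ℂ L → Prop
  | comm {d e : Bideg} {x y : L} (hx : x ∈ 𝔏.deg d) (hy : y ∈ 𝔏.deg e) :
      EnvRel (TensorAlgebra.ι ℂ x * TensorAlgebra.ι ℂ y
          - koszul (tot d) (tot e) • (TensorAlgebra.ι ℂ y * TensorAlgebra.ι ℂ x))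
        (TensorAlgebra.ι ℂ (𝔏.br x y))

/-- The universal enveloping algebra of a graded Lie superalgebra. -/
def Env : Type u := RingQuot 𝔏.EnvRel

instance : Ring 𝔏.Env := inferInstanceAs (Ring (RingQuot 𝔏.EnvRel))

instance : Algebra ℂ 𝔏.Env := inferInstanceAs (Algebra ℂ (RingQuot 𝔏.EnvRel))

/-- The canonical map to the enveloping algebra. -/
def ι : L →ₗ[ℂ] 𝔏.Env :=
  (RingQuot.mkAlgHom ℂ 𝔏.EnvRel).toLinearMap ∘ₗ TensorAlgebra.ι ℂ

end GradedLieSuperalgebra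

section Vacuum

variable {g : Type u} [AddCommGroup g] [Module ℂ g] (𝔤 : LieSuperalgebra g)
  (h : InvariantForm 𝔤)

/-- The inclusion of the positive subalgebra `g[[u]] ⊕ ℂ κ` into `ĝ_h`. -/
def posIncl (g : Type u) [AddCommGroup g] [Module ℂ g] :
    ((g ⊗[ℂ] PowerSeries ℂ) × ℂ) →ₗ[ℂ] ((g ⊗[ℂ] RavK) × ℂ) :=
  LinearMap.prodMap (TensorProduct.map LinearMap.id RavK.ofSeries) LinearMap.id

/-- The relations `x b ⊗ e = x ⊗ b e`, `b = y + c κ` in `g[[u]] ⊕ ℂ κ`, where `g[[u]]` acts on `E`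
by zero and `κ` acts by `k`. -/
def inducedRel (E : Type) [AddCommGroup E] [Module ℂ E] (k : Module.End ℂ E) :
    Submodule (𝔤.affine h).Env ((𝔤.affine h).Env ⊗[ℂ] E) :=
  Submodule.span _ {t | ∃ (x : (𝔤.affine h).Env) (b : (g ⊗[ℂ] PowerSeries ℂ) × ℂ) (e : E),
    t = (x * (𝔤.affine h).ι (posIncl g b)) ⊗ₜ[ℂ] e - x ⊗ₜ[ℂ] (b.2 • k e)}

/-- The induced module `U(ĝ_h) ⊗_{U(g[[u]] ⊕ ℂ κ)} E`. -/
abbrev Induced (E : Type) [AddCommGroup E] [Module ℂ E] (k : Module.End ℂ E) : Type u :=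
  ((𝔤.affine h).Env ⊗[ℂ] E) ⧸ inducedRel 𝔤 h E k

/-- The underlying space of `𝒱[g, h]_univ`: the module induced from `ℂ[κ] = ℂ ⊕ ℂ κ`, realized as
the dual numbers, on which `κ` acts by multiplication. -/
abbrev VUniv : Type u :=
  Induced 𝔤 h (DualNumber ℂ) (LinearMap.mulLeft ℂ (DualNumber.eps : DualNumber ℂ))

/-- The underlying space of `𝒱[g]`: the module induced from the trivial module `ℂ`. -/
abbrev VZero : Type u := Induced 𝔤 h ℂ 0

/-- The class of `1 ⊗ e`. -/
def inducedMk (E : Type) [AddCommGroup E] [Module ℂ E] (k : Module.End ℂ E) (e : E) :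
    Induced 𝔤 h E k :=
  Submodule.Quotient.mk ((1 : (𝔤.affine h).Env) ⊗ₜ[ℂ] e)

end Vacuum

/-! ### Raviolo distributions, fields and locality -/

/-- The cohomological degree, mod 2, of the basis element of `𝒦_dist` with index `n`, where the
index `n < 0` belongs to `z^{-n-1}` and the index `n ≥ 0` belongs to `Ωⁿ`. -/
def ix (n : ℤ) : ZMod 2 := if 0 ≤ n then 1 else 0

/-- The bidegree of the basis element of `𝒦_dist` with index `n`. -/
def ixDeg (n : ℤ) : Bideg := if 0 ≤ n then (1, 0) else (0, 0)

section Locality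

variable {N : Type w} [AddCommGroup N] [Module ℂ N]

/-- `N`-valued distributions in `𝒦_dist^{z,w}` are given by their coefficients, the basis element
of index `p` in `z` being written to the left of the one of index `q` in `w`, and both to the left
of the coefficient. This is multiplication by `z`. -/
def mulZ : Module.End ℂ (ℤ → ℤ → N) where
  toFun f p q := if p = -1 then 0 else f (p + 1) q
  map_add' f f' := by ext p q; simp only [Pi.add_apply]; split_ifs <;> simp
  map_smul' c f := by ext p q; simp only [Pi.smul_apply, RingHom.id_apply]; split_ifs <;> simp

/-- Multiplication by `w`. -/
def mulW : Module.End ℂ (ℤ → ℤ → N) where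
  toFun f p q := if q = -1 then 0 else f p (q + 1)
  map_add' f f' := by ext p q; simp only [Pi.add_apply]; split_ifs <;> simp
  map_smul' c f := by ext p q; simp only [Pi.smul_apply, RingHom.id_apply]; split_ifs <;> simp

/-- Multiplication from the left by `Ω_z^m`. -/
def mulOmegaZ (m : ℕ) (f : ℤ → ℤ → N) : ℤ → ℤ → N := fun p q =>
  if 0 ≤ p ∧ p ≤ m then f (p - m - 1) q else 0

/-- Multiplication from the left by `Ω_w^m`. -/
def mulOmegaW (m : ℕ) (f : ℤ → ℤ → N) : ℤ → ℤ → N := fun p q =>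
  if 0 ≤ q ∧ q ≤ m then koszul 1 (ix p) • f p (q - m - 1) else 0

/-- The coefficients of `A(z) B(w)` for a family `A` of total parity `a`. -/
def prodZW (a : ZMod 2) (A B : ℤ → Module.End ℂ N) : ℤ → ℤ → Module.End ℂ N := fun p q =>
  koszul (a + ix p) (ix q) • (A p * B q)

/-- The coefficients of `(-1)^{ab} B(w) A(z)` for families `A` and `B` of total parities `a` and
`b`. -/
def prodWZ (a b : ZMod 2) (A B : ℤ → Module.End ℂ N) : ℤ → ℤ → Module.End ℂ N := fun p q =>
  (koszul a b * koszul (b + ix q) (ix p) * koszul (ix p) (ix q)) • (B q * A p)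

/-- `A` is the sequence of modes of a raviolo field on `N`. -/
def IsField (A : ℤ → Module.End ℂ N) : Prop := ∀ v : N, ∃ n₀ : ℤ, ∀ n ≥ n₀, A n v = 0

/-- Mutual locality of the fields `A(z)` and `B(w)` of total parities `a` and `b`: for some `n`,
`(z - w)^{n+1} [A(z), B(w)] = 0` and
`(Ω_z^m - ∑_{j ≤ n} (w - z)^j binom(m+j, j) Ω_w^{m+j}) [A(z), B(w)] = 0` for all `m`. -/
def MutuallyLocal (a b : ZMod 2) (A B : ℤ → Module.End ℂ N) : Prop :=
  ∃ n : ℕ,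
    ((mulZ - mulW : Module.End ℂ (ℤ → ℤ → Module.End ℂ N)) ^ (n + 1))
      (prodZW a A B - prodWZ a b A B) = 0 ∧
    ∀ m : ℕ, mulOmegaZ m (prodZW a A B - prodWZ a b A B)
      - ∑ j ∈ Finset.range (n + 1), ((m + j).choose j : ℂ) •
          ((mulW - mulZ : Module.End ℂ (ℤ → ℤ → Module.End ℂ N)) ^ j)
            (mulOmegaW (m + j) (prodZW a A B - prodWZ a b A B)) = 0

/-- The mode of index `k`, applied to `v`, of the normal-ordered product
`(1/l!) :∂^l A(z) B(z): = (1/l!) (∂^l A(z)_+ B(z) + (-1)^{ab} B(z) ∂^l A(z)_-)` of fields of total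
parities `a` and `b`. -/
def normalOrderedMode (a b : ZMod 2) (l : ℕ) (A B : ℤ → Module.End ℂ N) : ℤ → N → N
  | .negSucc k, v => ∑ i ∈ Finset.Icc l (k + l),
      (i.choose l : ℂ) • A (.negSucc i) (B (.negSucc (k + l - i)) v)
  | .ofNat k, v =>
      koszul a 1 • ∑ᶠ i : ℕ, (i.choose l : ℂ) • A (.negSucc i) (B (k + i - l) v)
      + ((-1) ^ l * koszul (a + 1) b) • ∑ᶠ j : ℕ,
          ((k + j).choose l : ℂ) • B (.negSucc j) (A (k + j - l) v)

end Locality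

/-! ### Raviolo vertex algebras -/

/-- A raviolo vertex (super)algebra structure on the vector space `V`. The element `Y a n` is the
mode `a_(n)` of `Y(a, z) = ∑_{n < 0} z^{-n-1} a_(n) + ∑_{n ≥ 0} Ω_z^n a_(n)`. -/
structure RavioloVertexAlgebra (V : Type u) [AddCommGroup V] [Module ℂ V] where
  deg : Bideg → Submodule ℂ V
  isGrading : IsGrading deg
  vac : V
  vac_mem : vac ∈ deg 0
  T : Module.End ℂ V
  T_mem : ∀ {d : Bideg} {v : V}, v ∈ deg d → T v ∈ deg d
  Y : V →ₗ[ℂ] (ℤ → Module.End ℂ V)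
  Y_field : ∀ a, IsField (Y a)
  Y_mem : ∀ {d e : Bideg} {a v : V}, a ∈ deg d → v ∈ deg e →
    ∀ n, Y a n v ∈ deg (d - ixDeg n + e)
  translation : ∀ (a v : V) (n : ℤ), T (Y a n v) - Y a n (T v) = -(n : ℂ) • Y a (n - 1) v
  T_vac : T vac = 0
  Y_vac : ∀ n, Y vac n = if n = -1 then 1 else 0
  Y_apply_vac : ∀ a, ∀ n ≥ 0, Y a n vac = 0
  Y_creation : ∀ a, Y a (-1) vac = a
  locality : ∀ {d e : Bideg} {a b : V}, a ∈ deg d → b ∈ deg e →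
    MutuallyLocal (tot d) (tot e) (Y a) (Y b)

section CurrentRVA

variable {g : Type u} [AddCommGroup g] [Module ℂ g] {𝔤 : LieSuperalgebra g}
  {h : InvariantForm 𝔤} {E : Type} [AddCommGroup E] [Module ℂ E] {k : Module.End ℂ E}

/-- `X` is the raviolo vertex algebra structure over `ℂ[κ]` on the vacuum module induced from `E`,
with vacuum vector `1 ⊗ e₀`, strongly generated over `ℂ[κ]` by the currents. Here `J_{A,n}` and
`μ_{A,n}` are `A ⊗ uⁿ` and `A ⊗ Ωⁿ`, and the current of `A` is
`μ_A(z) = ∑ μ_{A,n} zⁿ + J_{A,n} Ω_z^n = ∑ zⁿ μ_{A,n} + (-1)^{|A|} Ω_z^n J_{A,n}`. -/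
structure IsCurrentAlgebra (X : RavioloVertexAlgebra (Induced 𝔤 h E k)) (e₀ : E) : Prop where
  vac_eq : X.vac = inducedMk 𝔤 h E k e₀
  /-- `ĝ_h` acts homogeneously -/
  act_mem : ∀ {d e : Bideg} {x : (g ⊗[ℂ] RavK) × ℂ} {v : Induced 𝔤 h E k},
    x ∈ (𝔤.affine h).deg d → v ∈ X.deg e → (𝔤.affine h).ι x • v ∈ X.deg (d + e)
  /-- the translation operator is induced by the derivation `-∂_u` of `ĝ_h` -/
  T_act : ∀ (x : (g ⊗[ℂ] RavK) × ℂ) (v : Induced 𝔤 h E k),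
    X.T ((𝔤.affine h).ι x • v) = (𝔤.affine h).ι x • X.T v
      - (𝔤.affine h).ι (TensorProduct.map LinearMap.id RavK.deriv x.1, 0) • v
  /-- the modes of the currents -/
  current_pos : ∀ {p : ZMod 2} {A : g}, A ∈ 𝔤.par p → ∀ (n : ℕ) (v : Induced 𝔤 h E k),
    X.Y ((𝔤.affine h).ι (LieSuperalgebra.toAffine (A ⊗ₜ RavK.omega 0)) • X.vac) n v
      = koszul p 1 • (𝔤.affine h).ι (LieSuperalgebra.toAffine (A ⊗ₜ RavK.ofSeries (PowerSeries.X ^ n))) • v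
  current_neg : ∀ {p : ZMod 2} {A : g}, A ∈ 𝔤.par p → ∀ (n : ℕ) (v : Induced 𝔤 h E k),
    X.Y ((𝔤.affine h).ι (LieSuperalgebra.toAffine (A ⊗ₜ RavK.omega 0)) • X.vac) (.negSucc n) v
      = (𝔤.affine h).ι (LieSuperalgebra.toAffine (A ⊗ₜ RavK.omega n)) • v
  /-- the fields of composite states are normal-ordered products,
  `Y(μ_{A,n} b, z) = (1/n!) :∂ⁿμ_A(z) Y(b, z):` -/
  composite : ∀ {p : ZMod 2} {A : g}, A ∈ 𝔤.par p → ∀ {e : Bideg} {b : Induced 𝔤 h E k},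
    b ∈ X.deg e → ∀ (n : ℕ) (m : ℤ) (v : Induced 𝔤 h E k),
    X.Y ((𝔤.affine h).ι (LieSuperalgebra.toAffine (A ⊗ₜ RavK.omega n)) • b) m v
      = normalOrderedMode (1 + p) (tot e) n
          (X.Y ((𝔤.affine h).ι (LieSuperalgebra.toAffine (A ⊗ₜ RavK.omega 0)) • X.vac)) (X.Y b) m v
  /-- the state-field correspondence is `ℂ[κ]`-linear, `Y(κ b, z) = κ Y(b, z)` -/
  Y_kappa : ∀ (b v : Induced 𝔤 h E k) (m : ℤ),
    X.Y ((𝔤.affine h).ι (LieSuperalgebra.kappa g) • b) m v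
      = koszul 1 (ix m) • (𝔤.affine h).ι (LieSuperalgebra.kappa g) • X.Y b m v
  /-- the modes of all fields are (graded) `ℂ[κ]`-linear -/
  mode_kappa : ∀ {e : Bideg} {b : Induced 𝔤 h E k}, b ∈ X.deg e →
    ∀ (m : ℤ) (v : Induced 𝔤 h E k),
    X.Y b m ((𝔤.affine h).ι (LieSuperalgebra.kappa g) • v)
      = koszul 1 (tot e + ix m) • (𝔤.affine h).ι (LieSuperalgebra.kappa g) • X.Y b m v

end CurrentRVA

/-! ### Elements of `M ⊗ 𝒦_{z,w,z-w}` and their expansions -/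

/-- The elements of `M ⊗ 𝒦_{z,w,z-w}` (with power series completed), where `𝒦_{z,w,z-w}` is the
graded commutative algebra over `ℂ[[z,w]]` generated by `Ω_z^m`, `Ω_w^m`, `Ω_{z-w}^m` in degree one,
with the relations `x Ω_x^m = Ω_x^{m-1}`, `x Ω_x^0 = 0`, `Ω_x^m Ω_x^n = 0` for `x = z, w, z-w`, and
`Ω_{z-w}^0 Ω_z^0 + Ω_w^0 Ω_{z-w}^0 + Ω_z^0 Ω_w^0 = 0` together with all its `∂_z, ∂_w`-derivatives.
By these relations every element is uniquely of the form
`∑ zⁱwʲ r i j + ∑ Ω_z^m wʲ s m j + ∑ Ω_w^m zⁱ t m i + ∑ Ω_{z-w}^m wʲ d m j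
  + ∑ Ω_z^m Ω_w^n x m n + ∑ Ω_{z-w}^m Ω_w^n y m n`,
the sums over `m` (and over `n`) being finite. -/
structure ThreePoint (M : Type w) [AddCommGroup M] [Module ℂ M] where
  r : ℕ → ℕ → M
  s : ℕ →₀ (ℕ → M)
  t : ℕ →₀ (ℕ → M)
  d : ℕ →₀ (ℕ → M)
  x : ℕ →₀ (ℕ →₀ M)
  y : ℕ →₀ (ℕ →₀ M)

namespace ThreePoint

variable {M : Type w} [AddCommGroup M] [Module ℂ M]

/-- The expansion in `M⟨⟨z⟩⟩⟨⟨w⟩⟩`, with `Ω_{z-w}^m ↦ ∑_n binom(m+n, n) wⁿ Ω_z^{m+n}`. -/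
def expandZW (F : ThreePoint M) : ℤ → ℤ → M
  | .negSucc i, .negSucc j => F.r i j
  | .ofNat m, .negSucc j => F.s m j
      + ∑ n ∈ Finset.range (min m j + 1), (m.choose n : ℂ) • F.d (m - n) (j - n)
  | .negSucc i, .ofNat m => F.t m i
  | .ofNat m, .ofNat k => F.x m k
      + ∑ n ∈ Finset.range (m + 1), (m.choose n : ℂ) • F.y (m - n) (k + n)

/-- The expansion in `M⟨⟨w⟩⟩⟨⟨z⟩⟩`, with
`Ω_{z-w}^m ↦ (-1)^m ∑_n binom(m+n, n) zⁿ Ω_w^{m+n}`. -/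
def expandWZ (F : ThreePoint M) : ℤ → ℤ → M
  | .negSucc i, .negSucc j => F.r i j
  | .ofNat m, .negSucc j => F.s m j
  | .negSucc i, .ofNat k => F.t k i + F.d.sum fun m c =>
      if k ≤ m + i then ((-1) ^ m * ((m + i).choose i : ℂ)) • c (m + i - k) else 0
  | .ofNat m, .ofNat k => F.x m k

/-- The expansion in `M⟨⟨w⟩⟩⟨⟨z-w⟩⟩`, with `z ↦ w + (z-w)` and
`Ω_z^m ↦ ∑_n (-1)^n binom(m+n, n) (z-w)^n Ω_w^{m+n}`. The first index belongs to `z-w`, the second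
one to `w`. -/
def expandDiag (F : ThreePoint M) : ℤ → ℤ → M
  | .negSucc l, .negSucc j => ∑ i ∈ Finset.Icc l (j + l), (i.choose l : ℂ) • F.r i (j + l - i)
  | .negSucc l, .ofNat k =>
      (F.s.sum fun m c =>
        if k ≤ m + l then ((-1) ^ l * ((m + l).choose l : ℂ)) • c (m + l - k) else 0)
      + F.t.sum fun m c =>
        if k ≤ m then ((m - k + l).choose l : ℂ) • c (m - k + l) else 0
  | .ofNat m, .negSucc j => F.d m j
  | .ofNat m, .ofNat k => F.y m k

end ThreePoint

/-! ### Modules -/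

/-- A module over the raviolo vertex algebra `X`, graded by the abelian group `Γ` through the
homomorphism `π` from bidegrees to `Γ`. For `π` the first projection to `ℤ` these are the
cohomologically graded modules, for `π` the identity these are the cohomologically graded super
vector spaces with a compatible action. -/
structure RavioloModule {V : Type u} [AddCommGroup V] [Module ℂ V] (X : RavioloVertexAlgebra V)
    {Γ : Type v} [AddCommGroup Γ] (π : Bideg →+ Γ) where
  carrier : Type w
  [addCommGroup : AddCommGroup carrier]
  [module : Module ℂ carrier]
  deg : Γ → Submodule ℂ carrier
  isGrading : IsGrading deg
  Y : V →ₗ[ℂ] (ℤ → Module.End ℂ carrier)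
  Y_field : ∀ a, IsField (Y a)
  Y_mem : ∀ {d : Bideg} {γ : Γ} {a : V} {v : carrier}, a ∈ X.deg d → v ∈ deg γ →
    ∀ n, Y a n v ∈ deg (π (d - ixDeg n) + γ)
  Y_vac : ∀ n, Y X.vac n = if n = -1 then 1 else 0
  /-- `Y(a,z) Y(b,w) v`, `(-1)^{|a||b|} Y(b,w) Y(a,z) v` and `Y(Y(a,z-w) b, w) v` are the expansions
  of one and the same element -/
  associativity : ∀ {d e : Bideg} {a b : V}, a ∈ X.deg d → b ∈ X.deg e → ∀ v : carrier,
    ∃ F : ThreePoint carrier,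
      (∀ p q, F.expandZW p q = prodZW (tot d) (Y a) (Y b) p q v) ∧
      (∀ p q, F.expandWZ p q = prodWZ (tot d) (tot e) (Y a) (Y b) p q v) ∧
      (∀ p q, F.expandDiag p q = Y (X.Y a p b) q v)

attribute [instance] RavioloModule.addCommGroup RavioloModule.module

namespace RavioloModule

variable {V : Type u} [AddCommGroup V] [Module ℂ V] {X : RavioloVertexAlgebra V}
    {Γ : Type v} [AddCommGroup Γ] {π : Bideg →+ Γ}

/-- Morphisms are linear maps that intertwine the structure maps. -/
@[ext]
structure Hom (M N : RavioloModule.{u, v, w} X π) where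
  toLin : M.carrier →ₗ[ℂ] N.carrier
  map_Y : ∀ a n m, toLin (M.Y a n m) = N.Y a n (toLin m)

instance : CategoryTheory.Category (RavioloModule.{u, v, w} X π) where
  Hom := Hom
  id M := ⟨LinearMap.id, fun _ _ _ => rfl⟩
  comp f f' := ⟨f'.toLin ∘ₗ f.toLin, fun a n m => by simp [f.map_Y, f'.map_Y]⟩

end RavioloModule

/-- A smooth module over a graded Lie superalgebra `𝔏` that contains the space `g ⊗ 𝒦` via `j`,
graded by `Γ` through `π`: every vector is annihilated, for every `A ∈ g`, by `A ⊗ u^n ℂ[[u]]`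
for some `n`. -/
structure SmoothModule {g : Type u} [AddCommGroup g] [Module ℂ g]
    {L : Type u} [AddCommGroup L] [Module ℂ L] (𝔏 : GradedLieSuperalgebra L)
    (j : (g ⊗[ℂ] RavK) →ₗ[ℂ] L) {Γ : Type v} [AddCommGroup Γ] (π : Bideg →+ Γ) where
  carrier : Type w
  [addCommGroup : AddCommGroup carrier]
  [module : Module ℂ carrier]
  deg : Γ → Submodule ℂ carrier
  isGrading : IsGrading deg
  act : L →ₗ[ℂ] Module.End ℂ carrier
  act_mem : ∀ {d : Bideg} {γ : Γ} {x : L} {v : carrier}, x ∈ 𝔏.deg d → v ∈ deg γ →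
    act x v ∈ deg (π d + γ)
  act_br : ∀ {d e : Bideg} {x y : L}, x ∈ 𝔏.deg d → y ∈ 𝔏.deg e →
    act (𝔏.br x y) = act x * act y - koszul (tot d) (tot e) • (act y * act x)
  smooth : ∀ (v : carrier) (A : g), ∃ n : ℕ, ∀ f : PowerSeries ℂ,
    act (j (A ⊗ₜ RavK.ofSeries (PowerSeries.X ^ n * f))) v = 0

attribute [instance] SmoothModule.addCommGroup SmoothModule.module

namespace SmoothModule

variable {g : Type u} [AddCommGroup g] [Module ℂ g]
    {L : Type u} [AddCommGroup L] [Module ℂ L] {𝔏 : GradedLieSuperalgebra L}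
    {j : (g ⊗[ℂ] RavK) →ₗ[ℂ] L} {Γ : Type v} [AddCommGroup Γ] {π : Bideg →+ Γ}

/-- Morphisms are linear maps that commute with the action. -/
@[ext]
structure Hom (M N : SmoothModule.{u, v, w} 𝔏 j π) where
  toLin : M.carrier →ₗ[ℂ] N.carrier
  map_act : ∀ x m, toLin (M.act x m) = N.act x (toLin m)

instance : CategoryTheory.Category (SmoothModule.{u, v, w} 𝔏 j π) where
  Hom := Hom
  id M := ⟨LinearMap.id, fun _ _ => rfl⟩
  comp f f' := ⟨f'.toLin ∘ₗ f.toLin, fun x m => by simp [f.map_act, f'.map_act]⟩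

end SmoothModule

section Equivalence

variable {V : Type u} [AddCommGroup V] [Module ℂ V] {X : RavioloVertexAlgebra V}
    {g : Type u} [AddCommGroup g] [Module ℂ g]
    {L : Type u} [AddCommGroup L] [Module ℂ L] {𝔏 : GradedLieSuperalgebra L}
    {j : (g ⊗[ℂ] RavK) →ₗ[ℂ] L} {Γ : Type v} [AddCommGroup Γ] {π : Bideg →+ Γ}

/-- The functor `Φ` leaves the underlying graded vector space of a module and the underlying
linear map of a morphism unchanged, up to the isomorphisms `φ`. -/
structure PreservesUnderlying
    (Φ : CategoryTheory.Functor (RavioloModule.{u, v, w} X π) (SmoothModule.{u, v, w} 𝔏 j π))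
    (φ : ∀ M, M.carrier ≃ₗ[ℂ] (Φ.obj M).carrier) : Prop where
  deg_iff : ∀ M γ v, φ M v ∈ (Φ.obj M).deg γ ↔ v ∈ M.deg γ
  natural : ∀ {M N : RavioloModule.{u, v, w} X π} (f : M ⟶ N) (v : M.carrier),
    φ N (RavioloModule.Hom.toLin f v) = SmoothModule.Hom.toLin (Φ.map f) (φ M v)

/-- The action of `A ⊗ uⁿ` and `A ⊗ Ωⁿ` on `Φ M` is given by the modes of the field on `M` that
is attached to the state `c A`, namely `∑ zⁿ (A ⊗ Ωⁿ) + (-1)^{|A|} Ω_z^n (A ⊗ uⁿ)`. -/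
structure ActsByModes (par : ZMod 2 → Submodule ℂ g) (c : g → V)
    (Φ : CategoryTheory.Functor (RavioloModule.{u, v, w} X π) (SmoothModule.{u, v, w} 𝔏 j π))
    (φ : ∀ M, M.carrier ≃ₗ[ℂ] (Φ.obj M).carrier) : Prop where
  pos : ∀ M {p : ZMod 2} {A : g}, A ∈ par p → ∀ (n : ℕ) (v : M.carrier),
    φ M (M.Y (c A) n v)
      = koszul p 1 • (Φ.obj M).act (j (A ⊗ₜ RavK.ofSeries (PowerSeries.X ^ n))) (φ M v)
  neg : ∀ M {p : ZMod 2} {A : g}, A ∈ par p → ∀ (n : ℕ) (v : M.carrier),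
    φ M (M.Y (c A) (.negSucc n) v) = (Φ.obj M).act (j (A ⊗ₜ RavK.omega n)) (φ M v)

/-- The category of modules over `X` is equivalent to the category of smooth modules over `𝔏`, by an
equivalence that leaves the underlying graded vector spaces and linear maps unchanged; the action
of `A ⊗ uⁿ` and `A ⊗ Ωⁿ` is given by the modes of the field attached to `c A`, and, for every pair
`(s, x)` in `K`, the action of `x` is the mode of index `-1` of the field attached to `s`. -/
def ModulesAreSmoothModules (X : RavioloVertexAlgebra V) (𝔏 : GradedLieSuperalgebra L)
    (j : (g ⊗[ℂ] RavK) →ₗ[ℂ] L) (π : Bideg →+ Γ)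
    (par : ZMod 2 → Submodule ℂ g) (c : g → V) (K : Set (V × L)) : Prop :=
  ∃ (E : CategoryTheory.Equivalence (RavioloModule.{u, v, w} X π) (SmoothModule.{u, v, w} 𝔏 j π))
    (φ : ∀ M : RavioloModule.{u, v, w} X π, M.carrier ≃ₗ[ℂ] (E.functor.obj M).carrier),
    PreservesUnderlying E.functor φ ∧ ActsByModes par c E.functor φ ∧
    ∀ sx ∈ K, ∀ (M : RavioloModule.{u, v, w} X π) (v : M.carrier),
      φ M (M.Y sx.1 (-1) v) = (E.functor.obj M).act sx.2 (φ M v)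

end Equivalence

end

end Raviolo

/-! A field `C(w)` on `M` is encoded by its residues `α ↦ Res C(w) α(w)`, a linear map `Op M` from
`𝒦` to `End M`. A state of parity `|b|` gives a map of parity `|b| + 1`, because the residue has
degree `-1`. The modes are the values at `uⁿ` and `Ωⁿ`, up to sign.

The heart of the proof is that the fields on a smooth `ĝ_h`-module `M` themselves carry a
`ĝ_h`-action (`SmRep.op_op`). The element `A ⊗ ξ` sends `C(w)` to the residue in `u` of `A(u) ξ(u-w)
C(w) ∓ C(w) A(u) ξ(u-w)`, where `ξ(u-w)` is expanded for small `w` in the left term and for small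
`u` in the right one; `κ` acts by composition. Left multiplications represent the algebra, right
multiplications represent it in the reversed order, and the two kinds commute. The identity field is
annihilated by `g[[u]]`, since a power series in `u-w` has the same expansion in both regions
(`SmRep.op_idField_series`). The universal property of the induced module therefore gives an
equivariant map from the vacuum module to the fields on `M` (`SmRep.exists_lift`, `FieldMap`). For
`M` the vacuum module itself this is the state-field correspondence, called `Y` below; for general
`M` it is the module structure, called `X`. Statements about `X` cover both.

Creation, translation and homogeneity follow by induction over monomials in the generators.
Evaluation of fields at the vacuum provides projections onto the bigraded pieces, so no PBW theorem
is needed. As `𝒦¹ · 𝒦¹ = 0`, the creation modes supercommute (`FieldMap.creationComm`); this makes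
the normal-ordered product associative (`nop_nop`) and identifies the field of `a_(-1) b` with a
normal-ordered product (`FieldMap.fld_nop`). The commutator formula `[a(α), b(β)] = ± ∑ᵢ (a_(i)
b)(∂⁽ⁱ⁾α · β)` holds for the generators by the relations of `ĝ_h` and spreads to all states by
translation, skew-symmetry and a Wick formula (`comm`, `Comm.skew`, `OpComm.nop`). Locality is a
formal consequence (`mutuallyLocal_of_eq_cof`). The commutator formula and the normal-ordering
formula together give every coefficient of the required element of `M ⊗ 𝒦_{z,w,z-w}`
(`exists_threePoint`). The vertex algebra is unique because all its data are determined recursively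
from the vacuum (`VacMod.IsCurrent.eq`).

In the opposite direction, a comparison of the three expansions on a given module yields the
normal-ordering formula (`ModData.normalOrdered`) and the commutation relations of the currents on
monomials (`ModData.cur_elt_cur_elt`). The field condition extends these to all of `𝒦`, which gives
the smooth representation `ModData.rep`. It recovers the representation from which a module was
built (`ModData.rep_ofFieldMap`), whence essential surjectivity. A linear map that commutes with the
currents and `κ` commutes with all modes, these being iterated normal-ordered products
(`ModData.map_B`), whence fullness. Both halves of the theorem are instances of one argument:
`CoeffSys` covers `ℂ[κ]` and `ℂ`, and `CentralQuotient` covers `ĝ_h` and `g⟨⟨u⟩⟩`. -/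

set_option linter.unusedSectionVars false

namespace Raviolo

noncomputable section

open Finset.HasAntidiagonal (antidiagonal mem_antidiagonal)

/-! ### Sums of eventually zero sequences -/

section EventualSums

variable {M : Type*} [AddCommGroup M] [Module ℂ M] {M' : Type*} [AddCommGroup M'] [Module ℂ M']

/-- The sequence `X` vanishes from some index on. -/
def EvZero (X : ℕ → M) : Prop := ∃ N, ∀ k ≥ N, X k = 0

/-- The finitely supported sequences form a direct summand of all sequences over a field, so their
sum extends linearly along a chosen retraction. The extension lets operators given by such sums be
linear without any finiteness hypothesis; its values matter only on eventually zero sequences. -/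
theorem exists_evsum (M : Type*) [AddCommGroup M] [Module ℂ M] :
    ∃ f : (ℕ → M) →ₗ[ℂ] M, ∀ s : ℕ →₀ M, f s = s.sum fun _ m => m := by
  have hinj : LinearMap.ker (Finsupp.lcoeFun : (ℕ →₀ M) →ₗ[ℂ] (ℕ → M)) = ⊥ := by
    rw [LinearMap.ker_eq_bot]; exact DFunLike.coe_injective
  obtain ⟨l, hl⟩ := LinearMap.exists_leftInverse_of_injective _ hinj
  refine ⟨(Finsupp.lsum ℕ fun _ => (LinearMap.id : M →ₗ[ℂ] M)) ∘ₗ l, fun s => ?_⟩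
  have := LinearMap.congr_fun hl s
  simp only [LinearMap.comp_apply, Finsupp.lcoeFun_apply, LinearMap.id_apply] at this
  simp [this, Finsupp.sum]

/-- A linear extension to all sequences of the sum of the eventually zero sequences. -/
def evsum : (ℕ → M) →ₗ[ℂ] M := (exists_evsum M).choose

theorem evsum_eq {X : ℕ → M} {N : ℕ} (h : ∀ k ≥ N, X k = 0) :
    evsum X = ∑ k ∈ Finset.range N, X k := by
  have e : X = (Finsupp.onFinset (Finset.range N) X (fun k hk => by
      by_contra h'; exact hk (h k (by simpa using h'))) : ℕ →₀ M) := rfl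
  rw [evsum, e, (exists_evsum M).choose_spec, Finsupp.onFinset_sum _ (fun _ => rfl)]
  rfl

theorem evsum_eq_finsum {X : ℕ → M} (h : EvZero X) : evsum X = ∑ᶠ k, X k := by
  obtain ⟨N, hN⟩ := h
  rw [evsum_eq hN, finsum_eq_sum_of_support_subset]
  intro k hk
  by_contra h'
  exact hk (hN k (by simpa using h'))

theorem map_evsum (f : M →ₗ[ℂ] M') {X : ℕ → M} (h : EvZero X) :
    f (evsum X) = evsum fun k => f (X k) := by
  obtain ⟨N, hN⟩ := h
  rw [evsum_eq hN, evsum_eq (N := N) (fun k hk => by rw [hN k hk, map_zero]), map_sum]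

theorem EvZero.map {X : ℕ → M} (h : EvZero X) (f : ℕ → M →ₗ[ℂ] M') :
    EvZero fun k => f k (X k) := by
  obtain ⟨N, hN⟩ := h
  exact ⟨N, fun k hk => by simp only [hN k hk, map_zero]⟩

theorem EvZero.smul {X : ℕ → M} (h : EvZero X) (c : ℕ → ℂ) : EvZero fun k => c k • X k := by
  obtain ⟨N, hN⟩ := h
  exact ⟨N, fun k hk => by simp only [hN k hk, smul_zero]⟩

theorem evsum_add (X X' : ℕ → M) : (evsum fun k => X k + X' k) = evsum X + evsum X' :=
  map_add evsum X X'

theorem evsum_sub (X X' : ℕ → M) : (evsum fun k => X k - X' k) = evsum X - evsum X' :=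
  map_sub evsum X X'

theorem evsum_neg (X : ℕ → M) : (evsum fun k => - X k) = -evsum X :=
  map_neg evsum X

theorem evsum_smul (c : ℂ) (X : ℕ → M) : (evsum fun k => c • X k) = c • evsum X :=
  map_smul evsum c X

@[simp] theorem evsum_zero : (evsum fun _ => (0 : M)) = 0 := map_zero evsum

theorem evsum_eq_single {X : ℕ → M} (n : ℕ) (h : ∀ k ≠ n, X k = 0) : evsum X = X n := by
  rw [evsum_eq (N := n + 1) (fun k hk => h k (by omega)), Finset.sum_eq_single n]
  · intro b _ hb; exact h b hb
  · intro h'; simp at h'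

theorem evsum_succ {X : ℕ → M} (h : EvZero X) : evsum X = X 0 + evsum fun k => X (k + 1) := by
  obtain ⟨N, hN⟩ := h
  rw [evsum_eq (N := N + 1) (fun k hk => hN k (by omega)), Finset.sum_range_succ', add_comm,
    evsum_eq (N := N) (fun k hk => hN _ (by omega))]

/-- Leading zeros may be dropped. -/
theorem evsum_shift {X : ℕ → M} (n : ℕ) (h : ∀ k < n, X k = 0) (hX : EvZero X) :
    evsum X = evsum fun k => X (n + k) := by
  induction n with
  | zero => simp
  | succ n ih =>
    rw [ih fun k hk => h k (by omega), evsum_succ (by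
      obtain ⟨N, hN⟩ := hX; exact ⟨N, fun k hk => hN _ (by omega)⟩), h _ (by omega), zero_add]
    congr 1; ext k; congr 1; omega

/-- A double sequence with finitely many nonzero terms. -/
def EvZero₂ (X : ℕ → ℕ → M) : Prop := ∃ N, ∀ k l, N ≤ k + l → X k l = 0

theorem EvZero₂.of_iter {X : ℕ → ℕ → M} (h : ∃ N, ∀ k ≥ N, ∀ l, X k l = 0)
    (h' : ∀ k, EvZero (X k)) : EvZero₂ X := by
  obtain ⟨N, hN⟩ := h
  choose B hB using h'
  refine ⟨N + ∑ k ∈ Finset.range N, B k, fun k l hkl => ?_⟩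
  by_cases hk : N ≤ k
  · exact hN k hk l
  · refine hB k l ?_
    have := Finset.single_le_sum (f := B) (fun _ _ => Nat.zero_le _)
      (Finset.mem_range.2 (not_le.1 hk))
    omega

theorem EvZero₂.swap {X : ℕ → ℕ → M} (h : EvZero₂ X) : EvZero₂ fun k l => X l k := by
  obtain ⟨N, hN⟩ := h
  exact ⟨N, fun k l hkl => hN l k (by omega)⟩

theorem EvZero₂.outer {X : ℕ → ℕ → M} (h : EvZero₂ X) : EvZero fun k => evsum (X k) := by
  obtain ⟨N, hN⟩ := h
  refine ⟨N, fun k hk => ?_⟩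
  have : X k = fun _ => 0 := funext fun l => hN k l (by omega)
  simp only [this, evsum_zero]

theorem evsum_evsum {X : ℕ → ℕ → M} (h : EvZero₂ X) :
    (evsum fun k => evsum fun l => X k l)
      = evsum fun n => ∑ ij ∈ antidiagonal n, X ij.1 ij.2 := by
  have ho := h.outer
  obtain ⟨N, hN⟩ := h
  rw [evsum_eq (X := fun k => evsum fun l => X k l) (N := N) (fun k hk => by
      rw [show (fun l => X k l) = fun _ => 0 from funext fun l => hN k l (by omega), evsum_zero]),
    evsum_eq (N := N) (fun n hn => Finset.sum_eq_zero fun ij hij => by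
      rw [mem_antidiagonal] at hij; exact hN _ _ (by omega)),
    Finset.sum_congr rfl fun k (_ : k ∈ Finset.range N) =>
      evsum_eq (X := fun l => X k l) (N := N) (fun l hl => hN k l (by omega)),
    ← Finset.sum_product', Finset.sum_sigma']
  symm
  -- The triangle `k + l < N` is embedded in the square of side `N`; the points of the square
  -- outside the triangle contribute zero.
  refine Finset.sum_of_injOn (fun s => s.2) ?_ ?_ ?_ ?_
  · rintro ⟨n, i, j⟩ h1 ⟨n', i', j'⟩ h2 h12
    simp only [Finset.coe_sigma, Set.mem_sigma_iff, Finset.mem_coe, mem_antidiagonal] at h1 h2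
    obtain ⟨rfl, rfl⟩ := Prod.mk.inj h12
    obtain ⟨-, rfl⟩ := h1
    obtain ⟨-, rfl⟩ := h2
    rfl
  · rintro ⟨n, i, j⟩ h1
    simp only [Finset.coe_sigma, Set.mem_sigma_iff, Finset.mem_coe, mem_antidiagonal,
      Finset.mem_range, Finset.coe_product, Set.mem_prod] at h1 ⊢
    omega
  · rintro ⟨i, j⟩ _ h2
    refine hN i j ?_
    by_contra h3
    exact h2 ⟨⟨i + j, i, j⟩, Finset.mem_coe.2 (Finset.mem_sigma.2
      ⟨Finset.mem_range.2 (not_le.1 h3), mem_antidiagonal.2 rfl⟩), rfl⟩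
  · intros; rfl

theorem evsum_comm {X : ℕ → ℕ → M} (h : EvZero₂ X) :
    (evsum fun k => evsum fun l => X k l) = evsum fun l => evsum fun k => X k l := by
  rw [evsum_evsum h, evsum_evsum h.swap]
  congr 1; ext n
  rw [← Finset.Nat.sum_antidiagonal_swap]
  rfl

theorem evsum_mem (S : Submodule ℂ M) {X : ℕ → M} (h : EvZero X) (hS : ∀ k, X k ∈ S) :
    evsum X ∈ S := by
  obtain ⟨N, hN⟩ := h
  rw [evsum_eq hN]
  exact Submodule.sum_mem _ fun k _ => hS k

end EventualSums

/-! ### Divided powers of an endomorphism -/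

section DividedPowers

variable {M : Type*} [AddCommGroup M] [Module ℂ M]

/-- The divided power `Dᵏ / k!`. -/
def dp (D : Module.End ℂ M) (k : ℕ) : Module.End ℂ M := ((k.factorial : ℂ)⁻¹) • D ^ k

@[simp] theorem dp_zero (D : Module.End ℂ M) : dp D 0 = 1 := by simp [dp]

@[simp] theorem dp_one (D : Module.End ℂ M) : dp D 1 = D := by simp [dp]

theorem dp_mul_self (D : Module.End ℂ M) (k : ℕ) : dp D k * D = ((k : ℂ) + 1) • dp D (k + 1) := by
  have h1 : ((k : ℂ) + 1) ≠ 0 := by exact_mod_cast Nat.succ_ne_zero k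
  have h2 : ((k.factorial : ℂ)) ≠ 0 := by exact_mod_cast Nat.factorial_ne_zero k
  rw [dp, dp, smul_mul_assoc, ← pow_succ, smul_smul, Nat.factorial_succ]
  congr 1
  push_cast
  field_simp

theorem self_mul_dp (D : Module.End ℂ M) (k : ℕ) : D * dp D k = ((k : ℂ) + 1) • dp D (k + 1) := by
  rw [← dp_mul_self, dp, mul_smul_comm, smul_mul_assoc, ← pow_succ, ← pow_succ']

theorem dp_self_apply (D : Module.End ℂ M) (k : ℕ) (x : M) :
    dp D k (D x) = ((k : ℂ) + 1) • dp D (k + 1) x :=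
  LinearMap.congr_fun (dp_mul_self D k) x

theorem self_dp_apply (D : Module.End ℂ M) (k : ℕ) (x : M) :
    D (dp D k x) = ((k : ℂ) + 1) • dp D (k + 1) x :=
  LinearMap.congr_fun (self_mul_dp D k) x

theorem dp_succ_apply (D : Module.End ℂ M) (k : ℕ) (x : M) :
    dp D (k + 1) x = ((k : ℂ) + 1)⁻¹ • D (dp D k x) := by
  have h1 : ((k : ℂ) + 1) ≠ 0 := by exact_mod_cast Nat.succ_ne_zero k
  rw [self_dp_apply, smul_smul, inv_mul_cancel₀ h1, one_smul]

/-- The Leibniz rule for divided powers. -/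
theorem dp_leibniz {M₁ M₂ : Type*} [AddCommGroup M₁] [Module ℂ M₁] [AddCommGroup M₂] [Module ℂ M₂]
    (B : M₁ →ₗ[ℂ] M₂ →ₗ[ℂ] M) (D₁ : Module.End ℂ M₁) (D₂ : Module.End ℂ M₂) (D : Module.End ℂ M)
    (h : ∀ x y, D (B x y) = B (D₁ x) y + B x (D₂ y)) (n : ℕ) (x : M₁) (y : M₂) :
    dp D n (B x y) = ∑ ij ∈ antidiagonal n, B (dp D₁ ij.1 x) (dp D₂ ij.2 y) := by
  induction n with
  | zero => simp
  | succ n ih =>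
    have h1 : ((n : ℂ) + 1) ≠ 0 := by exact_mod_cast Nat.succ_ne_zero n
    rw [dp_succ_apply, ih, map_sum]
    simp only [h, self_dp_apply, map_smul, LinearMap.smul_apply]
    rw [Finset.sum_add_distrib]
    -- Both sums are moved to the antidiagonal of `n + 1`, with weights `i` and `j`. These add up to
    -- `n + 1`, which cancels the factor from `dp_succ_apply`.
    have e1 : ∑ ij ∈ antidiagonal n, ((ij.1 : ℂ) + 1) • B (dp D₁ (ij.1 + 1) x) (dp D₂ ij.2 y)
        = ∑ ij ∈ antidiagonal (n + 1), (ij.1 : ℂ) • B (dp D₁ ij.1 x) (dp D₂ ij.2 y) := by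
      rw [Finset.Nat.sum_antidiagonal_succ]
      simp
    have e2 : ∑ ij ∈ antidiagonal n, ((ij.2 : ℂ) + 1) • B (dp D₁ ij.1 x) (dp D₂ (ij.2 + 1) y)
        = ∑ ij ∈ antidiagonal (n + 1), (ij.2 : ℂ) • B (dp D₁ ij.1 x) (dp D₂ ij.2 y) := by
      rw [Finset.Nat.sum_antidiagonal_succ']
      simp
    rw [e1, e2, ← Finset.sum_add_distrib, Finset.smul_sum]
    refine Finset.sum_congr rfl fun ij hij => ?_
    rw [mem_antidiagonal] at hij
    rw [← add_smul, smul_smul]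
    have : ((ij.1 : ℂ) + ij.2) = n + 1 := by exact_mod_cast hij
    rw [this, inv_mul_cancel₀ h1, one_smul]

end DividedPowers

/-! ### More on raviolo Laurent series -/

namespace RavK

theorem mul_left_comm' (α β γ : RavK) : mul α (mul β γ) = mul β (mul α γ) := by
  rw [← mul_assoc', mul_comm' α β, mul_assoc']

/-- The monomial `uⁿ`. -/
def xp (n : ℕ) : RavK := ofSeries (PowerSeries.X ^ n)

theorem mul_ofSeries (f k : PowerSeries ℂ) : mul (ofSeries f) (ofSeries k) = ofSeries (f * k) := by
  ext1 <;> simp [mul, ofSeries]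

theorem xp_zero_mul (α : RavK) : mul (xp 0) α = α := by
  obtain ⟨f, q⟩ := α
  have : act q 1 = q := by
    induction q using Finsupp.induction_linear with
    | zero => simp
    | add a b ha hb => simp [ha, hb]
    | single m c =>
      ext n
      rw [act_single_apply, Finsupp.single_apply, PowerSeries.coeff_one]
      split_ifs <;> first | omega | simp
  ext1 <;> simp [mul, xp, ofSeries, this]

theorem xp_mul_xp (m n : ℕ) : mul (xp m) (xp n) = xp (m + n) := by
  rw [xp, xp, mul_ofSeries, ← pow_add, xp]

theorem xp_mul_mul (m n : ℕ) (α : RavK) : mul (xp m) (mul (xp n) α) = mul (xp (m + n)) α := by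
  rw [← mul_assoc', xp_mul_xp]

theorem ofSeries_mul_omega (f : PowerSeries ℂ) (m : ℕ) :
    mul (ofSeries f) (omega m)
      = ∑ i ∈ Finset.range (m + 1), PowerSeries.coeff i f • omega (m - i) := by
  have h : act (Finsupp.single m 1) f
      = ∑ i ∈ Finset.range (m + 1), PowerSeries.coeff i f • Finsupp.single (m - i) 1 := by
    simp [act]
  ext1
  · simp [mul, ofSeries, omega, Prod.fst_sum]
  · simp only [mul, ofSeries, omega, LinearMap.mk₂_apply, LinearMap.inl_apply, map_zero, add_zero,
      Prod.snd_sum, Prod.smul_snd, h]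

theorem xp_mul_omega (i m : ℕ) : mul (xp i) (omega m) = if i ≤ m then omega (m - i) else 0 := by
  rw [xp, ofSeries_mul_omega]
  simp only [PowerSeries.coeff_X_pow]
  split_ifs with h
  · rw [Finset.sum_eq_single i]
    · simp
    · intro b _ hb; simp [hb]
    · intro h'; simp at h'; omega
  · refine Finset.sum_eq_zero fun j hj => ?_
    simp at hj
    rw [if_neg (by omega), zero_smul]

theorem mul_omega_omega (m n : ℕ) : mul (omega m) (omega n) = 0 := mul_eq_zero rfl rfl

theorem deriv_omega (m : ℕ) : deriv (omega m) = -((m : ℂ) + 1) • omega (m + 1) := by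
  ext1
  · simp [deriv, omega]
  · simp only [deriv, omega, LinearMap.prodMap_apply, Finsupp.linearCombination_single, one_smul,
      Prod.smul_snd, Finsupp.smul_single, smul_eq_mul, mul_one]

theorem deriv_xp (n : ℕ) : deriv (xp n) = (n : ℂ) • xp (n - 1) := by
  ext1
  · simp only [deriv, xp, ofSeries, LinearMap.inl_apply, LinearMap.prodMap_apply, Prod.smul_fst]
    ext k
    have := PowerSeries.coeff_derivative (R := ℂ) (PowerSeries.X ^ n) k
    refine this.trans ?_
    rw [ PowerSeries.coeff_X_pow, map_smul, PowerSeries.coeff_X_pow]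
    rcases n with _ | n
    · simp
    · by_cases hk : k = n
      · subst hk; simp
      · simp [hk]
  · simp [deriv, xp, ofSeries]

theorem dp_deriv_omega (k m : ℕ) :
    dp deriv k (omega m) = ((-1) ^ k * ((m + k).choose k : ℂ)) • omega (m + k) := by
  induction k with
  | zero => simp
  | succ k ih =>
    have h1 : ((k : ℂ) + 1) ≠ 0 := by exact_mod_cast Nat.succ_ne_zero k
    rw [dp_succ_apply, ih, map_smul, deriv_omega, smul_smul, smul_smul, ← add_assoc]
    congr 1
    have := Nat.add_one_mul_choose_eq (m + k) k
    have h2 : ((m : ℂ) + k + 1) * ((m + k).choose k : ℂ)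
        = ((m + k + 1).choose (k + 1) : ℂ) * (k + 1) := by exact_mod_cast this
    field_simp
    push_cast
    linear_combination ((-1) ^ (k + 1)) * h2

theorem dp_deriv_xp (k n : ℕ) : dp deriv k (xp n) = (n.choose k : ℂ) • xp (n - k) := by
  induction k with
  | zero => simp
  | succ k ih =>
    have h1 : ((k : ℂ) + 1) ≠ 0 := by exact_mod_cast Nat.succ_ne_zero k
    rw [dp_succ_apply, ih, map_smul, deriv_xp, smul_smul, smul_smul, Nat.sub_sub]
    by_cases hk : k ≤ n
    · congr 1
      have := Nat.choose_succ_right_eq n k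
      have h2 : (n.choose (k + 1) : ℂ) * (k + 1) = (n.choose k : ℂ) * ((n - k : ℕ) : ℂ) := by
        exact_mod_cast this
      field_simp
      linear_combination -h2
    · rw [Nat.choose_eq_zero_of_lt (by omega), Nat.choose_eq_zero_of_lt (by omega)]
      simp

theorem dp_deriv_mul (n : ℕ) (α β : RavK) : dp deriv n (mul α β)
    = ∑ ij ∈ antidiagonal n, mul (dp deriv ij.1 α) (dp deriv ij.2 β) :=
  dp_leibniz mul deriv deriv deriv deriv_mul n α β

/-- The element `α` is homogeneous of degree `r` modulo `2`. -/
def IsPar (r : ZMod 2) (α : RavK) : Prop := (r = 0 → α.2 = 0) ∧ (r = 1 → α.1 = 0)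

theorem IsPar.mul {r s : ZMod 2} {α β : RavK} (hα : IsPar r α) (hβ : IsPar s β) :
    IsPar (r + s) (mul α β) := by
  have h11 : (1 : ZMod 2) + 1 = 0 := by decide
  have h : ∀ t : ZMod 2, t = 0 ∨ t = 1 := by decide
  rcases h r with rfl | rfl <;> rcases h s with rfl | rfl <;>
    simp_all [IsPar, RavK.mul]

theorem IsPar.deriv {r : ZMod 2} {α : RavK} (hα : IsPar r α) : IsPar r (deriv α) :=
  ⟨fun h => by simp [RavK.deriv, hα.1 h], fun h => by simp [RavK.deriv, hα.2 h]⟩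

theorem IsPar.smul {r : ZMod 2} {α : RavK} (hα : IsPar r α) (c : ℂ) : IsPar r (c • α) :=
  ⟨fun h => by simp [hα.1 h], fun h => by simp [hα.2 h]⟩

theorem IsPar.dp {r : ZMod 2} {α : RavK} (hα : IsPar r α) (k : ℕ) : IsPar r (dp RavK.deriv k α) := by
  induction k with
  | zero => simpa
  | succ k ih => rw [dp_succ_apply]; exact ih.deriv.smul _

theorem isPar_xp (n : ℕ) : IsPar 0 (xp n) := ⟨fun _ => rfl, fun h => by simp at h⟩

theorem isPar_ofSeries (f : PowerSeries ℂ) : IsPar 0 (ofSeries f) :=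
  ⟨fun _ => rfl, fun h => by simp at h⟩

theorem isPar_omega (n : ℕ) : IsPar 1 (omega n) := ⟨fun h => by simp at h, fun _ => rfl⟩

theorem IsPar.of_mem {r : ℤ} {α : RavK} (hα : α ∈ deg r) : IsPar (r : ZMod 2) α := by
  by_cases h0 : r = 0
  · subst h0
    exact ⟨fun _ => snd_eq_zero_of_mem (by decide) hα, fun h => by simp at h⟩
  · by_cases h1 : r = 1
    · subst h1
      exact ⟨fun h => by simp at h, fun _ => fst_eq_zero_of_mem (by decide) hα⟩
    · exact ⟨fun _ => snd_eq_zero_of_mem h1 hα, fun _ => fst_eq_zero_of_mem h0 hα⟩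

theorem IsPar.eq_ofSeries {α : RavK} (h : IsPar 0 α) : α = ofSeries α.1 := by
  ext1
  · rfl
  · simp [h.1 rfl, ofSeries]

theorem IsPar.mul_eq_zero {α β : RavK} (h : IsPar 1 α) (h' : IsPar 1 β) : RavK.mul α β = 0 :=
  RavK.mul_eq_zero (h.2 rfl) (h'.2 rfl)

/-- The automorphism `u ↦ -u`, `Ωᵐ ↦ (-1)ᵐ Ωᵐ`. -/
def twist : RavK →ₗ[ℂ] RavK :=
  LinearMap.prodMap
    { toFun := PowerSeries.rescale (-1 : ℂ)
      map_add' := map_add _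
      map_smul' := fun c f => by ext n; simp [PowerSeries.coeff_rescale]; ring }
    (Finsupp.linearCombination ℂ fun m => Finsupp.single m ((-1 : ℂ) ^ m))

theorem twist_mul (α β : RavK) : twist (mul α β) = mul (twist α) (twist β) := by
  have key : ∀ (q : ℕ →₀ ℂ) (f : PowerSeries ℂ),
      (twist (0, act q f)).2 = act (twist (0, q)).2 (twist (f, 0)).1 := by
    intro q f
    induction q using Finsupp.induction_linear with
    | zero => simp [twist]
    | add a b ha hb =>
      simp only [twist, LinearMap.prodMap_apply, map_add, LinearMap.add_apply] at ha hb ⊢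
      rw [ha, hb]
    | single m c =>
      have h : ∀ (c : ℂ) (f : PowerSeries ℂ), act (Finsupp.single m c) f
          = ∑ i ∈ Finset.range (m + 1), Finsupp.single (m - i) (c * PowerSeries.coeff i f) := by
        intro c f
        simp [act, Finset.smul_sum]
      simp only [twist, LinearMap.prodMap_apply, Finsupp.linearCombination_single,
        LinearMap.coe_mk, AddHom.coe_mk, Finsupp.smul_single, smul_eq_mul]
      rw [h, h, map_sum]
      refine Finset.sum_congr rfl fun i hi => ?_
      rw [Finset.mem_range] at hi
      rw [Finsupp.linearCombination_single, Finsupp.smul_single, smul_eq_mul,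
        PowerSeries.coeff_rescale]
      congr 1
      obtain ⟨j, rfl⟩ := Nat.exists_eq_add_of_le (Nat.lt_succ_iff.1 hi)
      rw [Nat.add_sub_cancel_left, pow_add]
      have : ((-1 : ℂ) ^ i) * (-1) ^ i = 1 := by rw [← mul_pow]; simp
      linear_combination (-(c * PowerSeries.coeff i f * (-1) ^ j)) * this
  have e : ∀ (q q' : ℕ →₀ ℂ), (twist (0, q + q')).2 = (twist (0, q)).2 + (twist (0, q')).2 := by
    intro q q'; simp [twist]
  ext1
  · simp [mul, twist]
  · have h1 : (twist (mul α β)).2 = (twist (0, act β.2 α.1 + act α.2 β.1)).2 := rfl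
    rw [h1, e, key, key]
    rfl

theorem twist_omega (m : ℕ) : twist (omega m) = ((-1 : ℂ) ^ m) • omega m := by
  ext1
  · simp [twist, omega]
  · simp [twist, omega, Finsupp.linearCombination_single]

theorem IsPar.twist {r : ZMod 2} {α : RavK} (hα : IsPar r α) : IsPar r (twist α) :=
  ⟨fun h => by simp [RavK.twist, hα.1 h], fun h => by simp [RavK.twist, hα.2 h]⟩

theorem omega_ext {M : Type*} [AddCommGroup M] [Module ℂ M] {F G : RavK →ₗ[ℂ] M}
    (h : ∀ n, F (omega n) = G (omega n)) {α : RavK} (hα : IsPar 1 α) : F α = G α := by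
  obtain ⟨f, q⟩ := α
  obtain rfl : f = 0 := hα.2 rfl
  have : F ∘ₗ LinearMap.inr ℂ _ _ = G ∘ₗ LinearMap.inr ℂ _ _ := by
    refine Finsupp.lhom_ext' fun n => LinearMap.ext_ring ?_
    exact h n
  exact LinearMap.congr_fun this q

/-- Linear maps on `𝒦` that annihilate high powers of `u` are determined by the values on the
monomials. -/
theorem monomial_ext {M : Type*} [AddCommGroup M] [Module ℂ M] {F G : RavK →ₗ[ℂ] M}
    (h : ∀ n, F (omega n) = G (omega n)) (h' : ∀ n, F (xp n) = G (xp n))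
    (hF : ∃ N, ∀ f, F (ofSeries (PowerSeries.X ^ N * f)) = 0)
    (hG : ∃ N, ∀ f, G (ofSeries (PowerSeries.X ^ N * f)) = 0) : F = G := by
  have key : ∀ f, F (ofSeries f) = G (ofSeries f) := by
    intro f
    obtain ⟨N, hN⟩ := hF
    obtain ⟨N', hN'⟩ := hG
    -- The tail after degree `N + N'` is annihilated by both maps, and the polynomial part is
    -- covered by the monomials.
    have e : f = (∑ i ∈ Finset.range (N + N'), PowerSeries.coeff i f • PowerSeries.X ^ i)
        + PowerSeries.X ^ (N + N') * PowerSeries.mk fun i => PowerSeries.coeff (i + (N + N')) f := by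
      ext n
      rw [map_add, map_sum, PowerSeries.coeff_X_pow_mul']
      simp only [map_smul, PowerSeries.coeff_X_pow, smul_eq_mul, mul_ite, mul_one, mul_zero,
        Finset.sum_ite_eq, Finset.mem_range, PowerSeries.coeff_mk]
      split_ifs with h1 h2 h2
      · omega
      · simp
      · simp [Nat.sub_add_cancel h2]
      · omega
    rw [e]
    simp only [map_add, map_sum, map_smul]
    have h1 := hN (PowerSeries.X ^ N' * PowerSeries.mk fun i => PowerSeries.coeff (i + (N + N')) f)
    have h2 := hN' (PowerSeries.X ^ N * PowerSeries.mk fun i => PowerSeries.coeff (i + (N + N')) f)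
    rw [← mul_assoc, ← pow_add] at h1 h2
    rw [add_comm N' N] at h2
    rw [h1, h2]
    congr 1
    exact Finset.sum_congr rfl fun i _ => by
      have := h' i
      rw [xp] at this
      rw [this]
  ext1
  · exact LinearMap.ext key
  · exact LinearMap.ext fun q => omega_ext h ⟨fun h => by simp at h, fun _ => rfl⟩

end RavK

open RavK

/-! ### Fields as maps on the algebra of raviolo Laurent series -/

/-- A family of endomorphisms of `M`, given by the residues `α ↦ Res C(w) α(w)`. -/
abbrev Op (M : Type*) [AddCommGroup M] [Module ℂ M] : Type _ := RavK →ₗ[ℂ] Module.End ℂ M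

section Op

variable {M : Type*} [AddCommGroup M] [Module ℂ M]

/-- The field condition. -/
def IsSm (C : Op M) : Prop :=
  ∀ v, ∃ N : ℕ, ∀ f : PowerSeries ℂ, C (ofSeries (PowerSeries.X ^ N * f)) v = 0

theorem xp_mul_ofSeries (n : ℕ) (f : PowerSeries ℂ) :
    mul (xp n) (ofSeries f) = ofSeries (PowerSeries.X ^ n * f) := mul_ofSeries _ _

theorem exists_xp_mul_eq_zero {α : RavK} (h : α.1 = 0) : ∃ N, ∀ k ≥ N, mul (xp k) α = 0 := by
  obtain ⟨f, q⟩ := α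
  obtain rfl : f = 0 := h
  induction q using Finsupp.induction_linear with
  | zero => exact ⟨0, fun k _ => map_zero (mul (xp k))⟩
  | add a b ha hb =>
    obtain ⟨N, hN⟩ := ha
    obtain ⟨N', hN'⟩ := hb
    refine ⟨max N N', fun k hk => ?_⟩
    have e : ((0, a + b) : RavK) = (0, a) + (0, b) := by simp
    rw [e, map_add, hN k (le_trans (le_max_left _ _) hk), hN' k (le_trans (le_max_right _ _) hk),
      add_zero]
  | single m c =>
    refine ⟨m + 1, fun k hk => ?_⟩
    have e : ((0, Finsupp.single m c) : RavK) = c • omega m := by simp [omega]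
    rw [e, map_smul, xp_mul_omega, if_neg (by omega), smul_zero]

/-- The power series part of `η` is absorbed into `f`, and its `Ω`-part is killed by a high power of
`u`. The bound is therefore uniform in `f`. -/
theorem IsSm.exists_bound {C : Op M} (hC : IsSm C) (η : RavK) (v : M) :
    ∃ N, ∀ k ≥ N, ∀ f, C (mul (xp k) (mul (ofSeries f) η)) v = 0 := by
  obtain ⟨N, hN⟩ := hC v
  obtain ⟨N', hN'⟩ := exists_xp_mul_eq_zero (α := (0, η.2)) rfl
  refine ⟨max N N', fun k hk f => ?_⟩
  have e : η = ofSeries η.1 + (0, η.2) := by ext1 <;> simp [ofSeries]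
  rw [mul_left_comm', e, map_add, map_add, hN' k (le_trans (le_max_right _ _) hk), map_zero,
    add_zero, mul_left_comm', mul_ofSeries, xp_mul_ofSeries]
  obtain ⟨j, rfl⟩ := Nat.exists_eq_add_of_le (le_trans (le_max_left _ _) hk)
  rw [pow_add, mul_assoc, hN]

theorem IsSm.evZero {C : Op M} (hC : IsSm C) (η : RavK) (v : M) :
    EvZero fun k => C (mul (xp k) η) v := by
  obtain ⟨N, hN⟩ := hC.exists_bound η v
  refine ⟨N, fun k hk => ?_⟩
  have := hN k hk 1
  rwa [show ofSeries 1 = xp 0 by simp [xp], xp_zero_mul] at this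

theorem IsSm.evZero_xp {C : Op M} (hC : IsSm C) (v : M) : EvZero fun k => C (xp k) v := by
  have := hC.evZero (xp 0) v
  simpa only [xp_mul_xp, add_zero] using this

theorem isSm_zero : IsSm (0 : Op M) := fun _ => ⟨0, fun _ => rfl⟩

theorem IsSm.add {C C' : Op M} (h : IsSm C) (h' : IsSm C') : IsSm (C + C') := by
  intro v
  obtain ⟨N, hN⟩ := h.exists_bound (xp 0) v
  obtain ⟨N', hN'⟩ := h'.exists_bound (xp 0) v
  refine ⟨max N N', fun f => ?_⟩
  have h1 := hN (max N N') (le_max_left _ _) f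
  have h2 := hN' (max N N') (le_max_right _ _) f
  rw [RavK.mul_comm' (ofSeries f), xp_zero_mul, xp_mul_ofSeries] at h1 h2
  simp [h1, h2]

theorem IsSm.smul {C : Op M} (h : IsSm C) (c : ℂ) : IsSm (c • C) := by
  intro v
  obtain ⟨N, hN⟩ := h v
  exact ⟨N, fun f => by simp [hN f]⟩

/-- The space of fields. -/
def Fld (M : Type*) [AddCommGroup M] [Module ℂ M] : Submodule ℂ (Op M) where
  carrier := {C | IsSm C}
  add_mem' := fun h h' => h.add h'
  zero_mem' := isSm_zero
  smul_mem' := fun c _ h => h.smul c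

/-- The values of a field on power series are determined by those on monomials. -/
theorem IsSm.apply_series {C : Op M} (hC : IsSm C) (f : PowerSeries ℂ) (β : RavK) (v : M) :
    C (mul (ofSeries f) β) v
      = evsum fun i => PowerSeries.coeff i f • C (mul (xp i) β) v := by
  obtain ⟨N, hN⟩ := hC.exists_bound β v
  have e : f = (∑ i ∈ Finset.range N, PowerSeries.coeff i f • PowerSeries.X ^ i)
      + PowerSeries.X ^ N * PowerSeries.mk fun i => PowerSeries.coeff (i + N) f := by
    ext n
    rw [map_add, map_sum, PowerSeries.coeff_X_pow_mul']
    simp only [map_smul, PowerSeries.coeff_X_pow, smul_eq_mul, mul_ite, mul_one, mul_zero,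
      Finset.sum_ite_eq, Finset.mem_range, PowerSeries.coeff_mk]
    split_ifs with h1 h2 h2
    · omega
    · simp
    · simp [Nat.sub_add_cancel h2]
    · omega
  rw [evsum_eq (N := N) (fun k hk => by
    have := hN k hk 1
    rw [show ofSeries 1 = xp 0 by simp [xp], xp_zero_mul] at this
    rw [this, smul_zero])]
  conv_lhs => rw [e]
  have h0 := hN N le_rfl (PowerSeries.mk fun i => PowerSeries.coeff (i + N) f)
  rw [← mul_assoc', xp_mul_ofSeries] at h0
  simp only [map_add, map_sum, map_smul, LinearMap.add_apply, LinearMap.sum_apply,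
    LinearMap.smul_apply, h0, add_zero]
  rfl

end Op

/-! ### Smooth representations -/

section Rep

variable {g : Type u} [AddCommGroup g] [Module ℂ g] {𝔤 : LieSuperalgebra g} {h : InvariantForm 𝔤}

/-- The derivation `∂_u` of the central extension. -/
def affineD (g : Type u) [AddCommGroup g] [Module ℂ g] : Module.End ℂ ((g ⊗[ℂ] RavK) × ℂ) :=
  LinearMap.prodMap (TensorProduct.map LinearMap.id RavK.deriv) 0

theorem map_deriv_mem {d : Bideg} {x : g ⊗[ℂ] RavK} (hx : x ∈ 𝔤.currentDeg d) :
    TensorProduct.map LinearMap.id RavK.deriv x ∈ 𝔤.currentDeg d := by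
  induction hx using Submodule.span_induction with
  | zero => simp
  | add x y _ _ hx hy => rw [map_add]; exact add_mem hx hy
  | smul c x _ hx => rw [map_smul]; exact Submodule.smul_mem _ _ hx
  | mem x hx =>
    obtain ⟨A, hA, α, hα, rfl⟩ := hx
    refine Submodule.subset_span ⟨A, hA, RavK.deriv α, ?_, by simp⟩
    by_cases h0 : d.1 = 0
    · rw [h0] at hα ⊢
      exact mem_deg_zero ((IsPar.of_mem hα).deriv.1 (by simp))
    · by_cases h1 : d.1 = 1
      · rw [h1] at hα ⊢
        exact mem_deg_one ((IsPar.of_mem hα).deriv.2 (by simp))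
      · rw [show α = 0 from Prod.ext (fst_eq_zero_of_mem h0 hα) (snd_eq_zero_of_mem h1 hα)]
        simp

theorem affineD_mem {d : Bideg} {x : (g ⊗[ℂ] RavK) × ℂ} (hx : x ∈ (𝔤.affine h).deg d) :
    affineD g x ∈ (𝔤.affine h).deg d :=
  ⟨map_deriv_mem hx.1, zero_mem _⟩

theorem dp_affineD_mem {d : Bideg} {x : (g ⊗[ℂ] RavK) × ℂ} (hx : x ∈ (𝔤.affine h).deg d) (k : ℕ) :
    dp (affineD g) k x ∈ (𝔤.affine h).deg d := by
  induction k with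
  | zero => simpa
  | succ k ih => rw [dp_succ_apply]; exact Submodule.smul_mem _ _ (affineD_mem ih)

/-- Bilinear identities on the current algebra may be checked on homogeneous pure tensors. -/
theorem current_ext_pure {N : Type*} [AddCommGroup N] [Module ℂ N]
    {F G : (g ⊗[ℂ] RavK) →ₗ[ℂ] N}
    (H : ∀ (p : ZMod 2) (r : ℤ), ∀ A ∈ 𝔤.par p, ∀ α ∈ RavK.deg r, F (A ⊗ₜ α) = G (A ⊗ₜ α)) :
    F = G := by
  refine LinearMap.ext fun x => ?_
  have hx : x ∈ ⨆ d, 𝔤.currentDeg d := by rw [𝔤.current_isGrading.2]; trivial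
  refine Submodule.iSup_induction _ (motive := fun x => F x = G x) hx ?_ (by simp) ?_
  · intro d x hx
    induction hx using Submodule.span_induction with
    | zero => simp
    | add x y _ _ hx hy => simp [hx, hy]
    | smul c x _ hx => simp [hx]
    | mem x hx =>
      obtain ⟨A, hA, α, hα, rfl⟩ := hx
      exact H _ _ A hA α hα
  · intro x y hx hy; simp [hx, hy]

theorem currentBr_deriv (x y : g ⊗[ℂ] RavK) :
    TensorProduct.map LinearMap.id RavK.deriv (𝔤.currentBr x y)
      = 𝔤.currentBr (TensorProduct.map LinearMap.id RavK.deriv x) y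
        + 𝔤.currentBr x (TensorProduct.map LinearMap.id RavK.deriv y) := by
  set D : (g ⊗[ℂ] RavK) →ₗ[ℂ] (g ⊗[ℂ] RavK) := TensorProduct.map LinearMap.id RavK.deriv
  have key : 𝔤.currentBr.compr₂ D = 𝔤.currentBr ∘ₗ D + 𝔤.currentBr.compl₂ D := by
    refine current_ext_pure (𝔤 := 𝔤) fun p r A hA α hα => ?_
    refine current_ext_pure (𝔤 := 𝔤) fun q s B hB β hβ => ?_
    have hα' : RavK.deriv α ∈ RavK.deg r := by
      have := IsPar.of_mem hα
      by_cases h0 : r = 0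
      · subst h0; exact mem_deg_zero ((IsPar.of_mem hα).deriv.1 (by simp))
      · by_cases h1 : r = 1
        · subst h1; exact mem_deg_one ((IsPar.of_mem hα).deriv.2 (by simp))
        · rw [show α = 0 from Prod.ext (fst_eq_zero_of_mem h0 hα) (snd_eq_zero_of_mem h1 hα)]
          simp
    simp only [LinearMap.compr₂_apply, LinearMap.add_apply, LinearMap.comp_apply,
      LinearMap.compl₂_apply, D, TensorProduct.map_tmul, LinearMap.id_apply]
    rw [𝔤.currentBr_tmul A hα hB, 𝔤.currentBr_tmul A hα' hB, 𝔤.currentBr_tmul A hα hB, map_smul,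
      TensorProduct.map_tmul, deriv_mul, TensorProduct.tmul_add, smul_add]
    rfl
  exact LinearMap.congr_fun (LinearMap.congr_fun key x) y

/-- Integration by parts: the residue of a derivative vanishes. This is why `∂_u`, extended by `∂κ =
0`, is a derivation of the central extension (`affineD_br`). -/
theorem currentCocycle_deriv (x y : g ⊗[ℂ] RavK) :
    𝔤.currentCocycle h (TensorProduct.map LinearMap.id RavK.deriv x) y
        + 𝔤.currentCocycle h x (TensorProduct.map LinearMap.id RavK.deriv y) = 0 := by
  set D : (g ⊗[ℂ] RavK) →ₗ[ℂ] (g ⊗[ℂ] RavK) := TensorProduct.map LinearMap.id RavK.deriv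
  have key : 𝔤.currentCocycle h ∘ₗ D + (𝔤.currentCocycle h).compl₂ D = 0 := by
    refine current_ext_pure (𝔤 := 𝔤) fun p r A hA α hα => ?_
    refine current_ext_pure (𝔤 := 𝔤) fun q s B hB β hβ => ?_
    have hα' : RavK.deriv α ∈ RavK.deg r := by
      by_cases h0 : r = 0
      · subst h0; exact mem_deg_zero ((IsPar.of_mem hα).deriv.1 (by simp))
      · by_cases h1 : r = 1
        · subst h1; exact mem_deg_one ((IsPar.of_mem hα).deriv.2 (by simp))
        · rw [show α = 0 from Prod.ext (fst_eq_zero_of_mem h0 hα) (snd_eq_zero_of_mem h1 hα)]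
          simp
    simp only [LinearMap.add_apply, LinearMap.comp_apply, LinearMap.zero_apply,
      LinearMap.compl₂_apply, D, TensorProduct.map_tmul, LinearMap.id_apply]
    rw [𝔤.currentCocycle_tmul h A hα' hB, 𝔤.currentCocycle_tmul h A hα hB]
    have := res_deriv (mul α (RavK.deriv β))
    rw [deriv_mul, map_add] at this
    linear_combination (koszul r q * h.form A B) * this
  exact LinearMap.congr_fun (LinearMap.congr_fun key x) y

theorem affineD_br (x y : (g ⊗[ℂ] RavK) × ℂ) :
    affineD g ((𝔤.affine h).br x y)
      = (𝔤.affine h).br (affineD g x) y + (𝔤.affine h).br x (affineD g y) := by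
  show affineD g (𝔤.affineBr h x y) = 𝔤.affineBr h _ y + 𝔤.affineBr h x _
  simp only [LieSuperalgebra.affineBr_apply, affineD, LinearMap.prodMap_apply, currentBr_deriv]
  ext1
  · rfl
  · simp only [LinearMap.zero_apply, Prod.snd_add]
    linear_combination currentCocycle_deriv (h := h) x.1 y.1

theorem dp_affineD_br (n : ℕ) (x y : (g ⊗[ℂ] RavK) × ℂ) :
    dp (affineD g) n ((𝔤.affine h).br x y) = ∑ ij ∈ antidiagonal n,
      (𝔤.affine h).br (dp (affineD g) ij.1 x) (dp (affineD g) ij.2 y) :=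
  dp_leibniz (𝔤.affine h).br _ _ _ affineD_br n x y

theorem dp_affineD_tmul (n : ℕ) (A : g) (α : RavK) :
    dp (affineD g) n (LieSuperalgebra.toAffine (A ⊗ₜ α))
      = LieSuperalgebra.toAffine (A ⊗ₜ dp RavK.deriv n α) := by
  induction n with
  | zero => simp
  | succ n ih =>
    rw [dp_succ_apply, ih, dp_succ_apply]
    simp [affineD, LieSuperalgebra.toAffine]

theorem dp_affineD_kappa (n : ℕ) :
    dp (affineD g) n (LieSuperalgebra.kappa g) = if n = 0 then LieSuperalgebra.kappa g else 0 := by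
  rcases n with _ | n
  · simp
  · rw [if_neg (by omega)]
    induction n with
    | zero => simp [affineD, LieSuperalgebra.kappa]
    | succ n ih => rw [dp_succ_apply, ih]; simp

variable (𝔤 h) in
/-- A smooth representation of `ĝ_h`, without grading. -/
structure SmRep (M : Type w) [AddCommGroup M] [Module ℂ M] where
  ρ : ((g ⊗[ℂ] RavK) × ℂ) →ₗ[ℂ] Module.End ℂ M
  br : ∀ {d e : Bideg} {x y : (g ⊗[ℂ] RavK) × ℂ}, x ∈ (𝔤.affine h).deg d →
    y ∈ (𝔤.affine h).deg e →
    ρ ((𝔤.affine h).br x y) = ρ x * ρ y - koszul (tot d) (tot e) • (ρ y * ρ x)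
  smooth : ∀ (v : M) (A : g), ∃ n : ℕ, ∀ f : PowerSeries ℂ,
    ρ (LieSuperalgebra.toAffine (A ⊗ₜ RavK.ofSeries (PowerSeries.X ^ n * f))) v = 0

variable {M : Type w} [AddCommGroup M] [Module ℂ M] (R : SmRep 𝔤 h M)

namespace SmRep

/-- The field of a current. -/
def cur : g →ₗ[ℂ] Op M := (TensorProduct.mk ℂ g RavK).compr₂ (R.ρ ∘ₗ LieSuperalgebra.toAffine)

theorem cur_apply (A : g) (α : RavK) :
    R.cur A α = R.ρ (LieSuperalgebra.toAffine (A ⊗ₜ α)) := rfl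

theorem cur_isSm (A : g) : IsSm (R.cur A) := fun v => R.smooth v A

/-- The action of `x` on the left of a field, `x(u)` being expanded as `x(u - w)` for small `w`. -/
def opL : ((g ⊗[ℂ] RavK) × ℂ) →ₗ[ℂ] Op M →ₗ[ℂ] Op M :=
  LinearMap.mk₂ ℂ (fun x C => LinearMap.mk₂ ℂ
      (fun β v => evsum fun k => ((-1 : ℂ) ^ k) • R.ρ (dp (affineD g) k x) (C (mul (xp k) β) v))
      (fun _ _ _ => by simp [smul_add, evsum_add])
      (fun c _ _ => by simp [smul_comm _ c, evsum_smul])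
      (fun _ _ _ => by simp [smul_add, evsum_add])
      (fun c _ _ => by simp [smul_comm _ c, evsum_smul]))
    (fun _ _ _ => by ext <;> simp [smul_add, evsum_add])
    (fun c _ _ => by ext <;> simp [smul_comm _ c, evsum_smul])
    (fun _ _ _ => by ext <;> simp [smul_add, evsum_add])
    (fun c _ _ => by ext <;> simp [smul_comm _ c, evsum_smul])

theorem opL_apply (x : (g ⊗[ℂ] RavK) × ℂ) (C : Op M) (β : RavK) (v : M) :
    R.opL x C β v
      = evsum fun k => ((-1 : ℂ) ^ k) • R.ρ (dp (affineD g) k x) (C (mul (xp k) β) v) := rfl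

/-- The action of `A ⊗ ξ` on the right of a field, `ξ(u)` being expanded as `ξ(u - w)` for small
`u`. -/
def opRPure (A : g) (ξ : RavK) : Op M →ₗ[ℂ] Op M where
  toFun C := LinearMap.mk₂ ℂ
      (fun β v => evsum fun k => C (mul (twist (dp RavK.deriv k ξ)) β) (R.cur A (xp k) v))
      (fun _ _ _ => by simp [evsum_add])
      (fun c _ _ => by simp [evsum_smul])
      (fun _ _ _ => by simp [evsum_add])
      (fun c _ _ => by simp [evsum_smul])
  map_add' _ _ := by ext <;> simp [evsum_add]
  map_smul' c _ := by ext <;> simp [evsum_smul]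

theorem opRPure_apply (A : g) (ξ : RavK) (C : Op M) (β : RavK) (v : M) :
    R.opRPure A ξ C β v
      = evsum fun k => C (mul (twist (dp RavK.deriv k ξ)) β) (R.cur A (xp k) v) := rfl

/-- The bilinear extension of the action on the right. -/
def opR : (g ⊗[ℂ] RavK) →ₗ[ℂ] Op M →ₗ[ℂ] Op M :=
  TensorProduct.lift (LinearMap.mk₂ ℂ R.opRPure
    (fun _ _ _ => by ext <;> simp [opRPure_apply, evsum_add])
    (fun c _ _ => by ext <;> simp [opRPure_apply, evsum_smul])
    (fun _ _ _ => by ext <;> simp [opRPure_apply, evsum_add])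
    (fun c _ _ => by ext <;> simp [opRPure_apply, evsum_smul]))

theorem opR_tmul (A : g) (ξ : RavK) : R.opR (A ⊗ₜ ξ) = R.opRPure A ξ := by
  simp [opR]

variable {R}

theorem opL_evZero (x : (g ⊗[ℂ] RavK) × ℂ) {C : Op M} (hC : IsSm C) (β : RavK) (v : M) :
    EvZero fun k => ((-1 : ℂ) ^ k) • R.ρ (dp (affineD g) k x) (C (mul (xp k) β) v) :=
  ((hC.evZero β v).map fun k => R.ρ (dp (affineD g) k x)).smul _

theorem opR_evZero (A : g) (ξ : RavK) (C : Op M) (β : RavK) (v : M) :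
    EvZero fun k => C (mul (twist (dp RavK.deriv k ξ)) β) (R.cur A (xp k) v) :=
  ((R.cur_isSm A).evZero_xp v).map fun k => C (mul (twist (dp RavK.deriv k ξ)) β)

theorem isSm_opL (x : (g ⊗[ℂ] RavK) × ℂ) {C : Op M} (hC : IsSm C) : IsSm (R.opL x C) := by
  intro v
  obtain ⟨N, hN⟩ := hC v
  refine ⟨N, fun f => ?_⟩
  rw [opL_apply]
  have : ∀ k, C (mul (xp k) (ofSeries (PowerSeries.X ^ N * f))) v = 0 := fun k => by
    rw [xp_mul_ofSeries, mul_left_comm, hN]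
  simp [this]

/-- Smoothness of `A` at `v` leaves finitely many terms, each a value of `C` at a fixed vector; the
sum of their bounds works for all of them. -/
theorem isSm_opRPure (A : g) (ξ : RavK) {C : Op M} (hC : IsSm C) : IsSm (R.opRPure A ξ C) := by
  intro v
  obtain ⟨K, hK⟩ := (R.cur_isSm A).evZero_xp v
  have : ∀ k, ∃ N, ∀ n ≥ N, ∀ f,
      C (mul (xp n) (mul (ofSeries f) (twist (dp RavK.deriv k ξ)))) (R.cur A (xp k) v) = 0 :=
    fun k => hC.exists_bound _ _
  choose N hN using this
  refine ⟨∑ k ∈ Finset.range K, N k, fun f => ?_⟩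
  rw [opRPure_apply, evsum_eq (N := K) (fun k hk => by
    rw [show R.cur A (xp k) v = 0 from hK k hk, map_zero])]
  refine Finset.sum_eq_zero fun k hk => ?_
  rw [RavK.mul_comm', ← xp_mul_ofSeries, mul_assoc', hN]
  exact Finset.single_le_sum (f := N) (fun _ _ => Nat.zero_le _) hk

theorem isSm_opR (x : g ⊗[ℂ] RavK) {C : Op M} (hC : IsSm C) : IsSm (R.opR x C) := by
  induction x using TensorProduct.induction_on with
  | zero => rw [map_zero]; exact isSm_zero
  | add x y hx hy => rw [map_add]; exact hx.add hy
  | tmul A ξ => rw [opR_tmul]; exact isSm_opRPure A ξ hC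

/-- Grouped by the total power of `u`, the product of two left multiplications has the terms `∂⁽ⁱ⁾x
∂⁽ʲ⁾y C(uⁿβ)` with `i + j = n`. The Leibniz rule for divided powers of `∂_u` then collects their
supercommutator into `∂⁽ⁿ⁾[x, y]`. -/
theorem opL_opL {d e : Bideg} {x y : (g ⊗[ℂ] RavK) × ℂ} (hx : x ∈ (𝔤.affine h).deg d)
    (hy : y ∈ (𝔤.affine h).deg e) {C : Op M} (hC : IsSm C) :
    R.opL x (R.opL y C) - koszul (tot d) (tot e) • R.opL y (R.opL x C)
      = R.opL ((𝔤.affine h).br x y) C := by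
  have key : ∀ (x y : (g ⊗[ℂ] RavK) × ℂ) (β : RavK) (v : M), R.opL x (R.opL y C) β v
      = evsum fun n => ∑ ij ∈ antidiagonal n, ((-1 : ℂ) ^ n) •
        R.ρ (dp (affineD g) ij.1 x) (R.ρ (dp (affineD g) ij.2 y) (C (mul (xp n) β) v)) := by
    intro x y β v
    have hz : EvZero₂ fun k l => ((-1 : ℂ) ^ (k + l)) • R.ρ (dp (affineD g) k x)
        (R.ρ (dp (affineD g) l y) (C (mul (xp (k + l)) β) v)) := by
      obtain ⟨N, hN⟩ := hC.evZero β v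
      exact ⟨N, fun k l hkl => by
        simp only [show C (mul (xp (k + l)) β) v = 0 from hN _ hkl, map_zero, smul_zero]⟩
    refine Eq.trans ?_ ((evsum_evsum hz).trans ?_)
    · rw [opL_apply]
      congr 1; ext k
      rw [opL_apply, map_evsum _ (opL_evZero y hC _ v), ← evsum_smul]
      congr 1; ext l
      rw [map_smul, smul_smul, ← pow_add, xp_mul_mul, add_comm l k]
    · congr 1; ext n
      refine Finset.sum_congr rfl fun ij hij => ?_
      rw [mem_antidiagonal] at hij
      rw [hij]
  refine LinearMap.ext fun β => LinearMap.ext fun v => ?_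
  simp only [LinearMap.sub_apply, LinearMap.smul_apply]
  rw [key, key, ← evsum_smul, ← evsum_sub, opL_apply]
  congr 1; ext n
  rw [dp_affineD_br, ← Finset.Nat.sum_antidiagonal_swap (f := fun ij => ((-1 : ℂ) ^ n) •
        R.ρ (dp (affineD g) ij.1 y) (R.ρ (dp (affineD g) ij.2 x) (C (mul (xp n) β) v))),
    Finset.smul_sum, ← Finset.sum_sub_distrib, map_sum, LinearMap.sum_apply, Finset.smul_sum]
  refine Finset.sum_congr rfl fun ij _ => ?_
  rw [R.br (dp_affineD_mem hx ij.1) (dp_affineD_mem hy ij.2)]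
  simp only [Prod.fst_swap, Prod.snd_swap, LinearMap.sub_apply, LinearMap.smul_apply,
    Module.End.mul_apply, smul_sub]
  rw [smul_comm]

/-- Left and right multiplication touch different sides of `C`; the only content is the interchange
of two finite sums. -/
theorem opL_opR (x : (g ⊗[ℂ] RavK) × ℂ) (y : g ⊗[ℂ] RavK) {C : Op M} (hC : IsSm C) :
    R.opL x (R.opR y C) = R.opR y (R.opL x C) := by
  induction y using TensorProduct.induction_on with
  | zero => simp
  | add y y' hy hy' => simp only [map_add, LinearMap.add_apply, hy, hy']
  | tmul A ξ =>
    rw [opR_tmul]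
    refine LinearMap.ext fun β => LinearMap.ext fun v => ?_
    have hz : EvZero₂ fun l k => ((-1 : ℂ) ^ k) • R.ρ (dp (affineD g) k x)
        (C (mul (twist (dp RavK.deriv l ξ)) (mul (xp k) β)) (R.cur A (xp l) v)) := by
      refine EvZero₂.of_iter ?_ fun l => ?_
      · obtain ⟨N, hN⟩ := (R.cur_isSm A).evZero_xp v
        exact ⟨N, fun l hl k => by
          simp only [show R.cur A (xp l) v = 0 from hN l hl, map_zero, smul_zero]⟩
      · simp_rw [mul_left_comm' (twist _)]
        exact opL_evZero x hC _ _
    rw [opL_apply, opRPure_apply]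
    refine Eq.trans ?_ ((evsum_comm hz).symm.trans ?_)
    · congr 1; ext k
      rw [opRPure_apply, map_evsum _ (opR_evZero A ξ C _ v), ← evsum_smul]
    · congr 1; ext l
      rw [opL_apply]
      congr 1; ext k
      rw [mul_left_comm']

/-- The sign `(-1)^{p |β|}`. -/
def sgn (p : ZMod 2) : RavK →ₗ[ℂ] RavK := LinearMap.prodMap LinearMap.id (koszul p 1 • LinearMap.id)

theorem sgn_apply (p : ZMod 2) {s : ZMod 2} {β : RavK} (hβ : IsPar s β) :
    sgn p β = koszul p s • β := by
  have h : ∀ t : ZMod 2, t = 0 ∨ t = 1 := by decide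
  rcases h s with rfl | rfl
  · have := hβ.1 rfl
    ext1 <;> simp [sgn, koszul, this]
  · have := hβ.2 rfl
    ext1 <;> simp [sgn, this]

theorem mul_sgn (p : ZMod 2) (f : PowerSeries ℂ) (β : RavK) :
    mul (ofSeries f) (sgn p β) = sgn p (mul (ofSeries f) β) := by
  ext1 <;> simp [sgn, mul, ofSeries]

variable (R) in
/-- The action on the right for homogeneous elements of bidegree `d`, with its signs. -/
def opS (d : Bideg) : (g ⊗[ℂ] RavK) →ₗ[ℂ] Op M →ₗ[ℂ] Op M :=
  koszul d.2 d.1 • R.opR.compr₂ (LinearMap.lcomp ℂ _ (sgn d.2))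

theorem opS_apply (d : Bideg) (x : g ⊗[ℂ] RavK) (C : Op M) (β : RavK) :
    R.opS d x C β = koszul d.2 d.1 • R.opR x C (sgn d.2 β) := rfl

theorem opS_eq (d : Bideg) (x : g ⊗[ℂ] RavK) (C : Op M) :
    R.opS d x C = koszul d.2 d.1 • (R.opR x C ∘ₗ sgn d.2) := rfl

theorem isSm_comp_sgn (p : ZMod 2) {C : Op M} (hC : IsSm C) : IsSm (C ∘ₗ sgn p) := by
  intro v
  obtain ⟨N, hN⟩ := hC v
  exact ⟨N, fun f => by
    rw [LinearMap.comp_apply, sgn_apply p (isPar_ofSeries _), map_smul, LinearMap.smul_apply, hN,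
      smul_zero]⟩

theorem isSm_opS (d : Bideg) (x : g ⊗[ℂ] RavK) {C : Op M} (hC : IsSm C) : IsSm (R.opS d x C) :=
  (isSm_comp_sgn _ (isSm_opR x hC)).smul _

theorem opL_opS (e : Bideg) (x : (g ⊗[ℂ] RavK) × ℂ) (y : g ⊗[ℂ] RavK) {C : Op M} (hC : IsSm C) :
    R.opL x (R.opS e y C) = R.opS e y (R.opL x C) := by
  rw [opS_eq, opS_eq, map_smul, ← opL_opR x y hC]
  congr 1
  refine LinearMap.ext fun β => LinearMap.ext fun v => ?_
  rw [LinearMap.comp_apply, opL_apply, opL_apply]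
  congr 1; ext k
  rw [LinearMap.comp_apply, xp, mul_sgn]

theorem op_ext_par {F G : Op M} (H : ∀ (s : ZMod 2) (β : RavK), IsPar s β → F β = G β) :
    F = G := by
  refine LinearMap.ext fun β => ?_
  have e : β = ofSeries β.1 + (0, β.2) := by ext1 <;> simp [ofSeries]
  rw [e, map_add, map_add, H 0 _ (isPar_ofSeries _), H 1 (0, β.2) ⟨by simp, fun _ => rfl⟩]

theorem exists_deg_of_isPar {r : ZMod 2} {α : RavK} (hα : IsPar r α) :
    ∃ n : ℤ, (n : ZMod 2) = r ∧ α ∈ RavK.deg n := by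
  have h : ∀ t : ZMod 2, t = 0 ∨ t = 1 := by decide
  rcases h r with rfl | rfl
  · exact ⟨0, by simp, mem_deg_zero (hα.1 rfl)⟩
  · exact ⟨1, by simp, mem_deg_one (hα.2 rfl)⟩

theorem toAffine_mem {p : ZMod 2} {A : g} (hA : A ∈ 𝔤.par p) {n : ℤ} {α : RavK}
    (hα : α ∈ RavK.deg n) : LieSuperalgebra.toAffine (A ⊗ₜ α) ∈ (𝔤.affine h).deg (n, p) :=
  ⟨Submodule.subset_span ⟨A, hA, α, hα, rfl⟩, zero_mem _⟩

theorem kappa_mem : LieSuperalgebra.kappa g ∈ (𝔤.affine h).deg (1, 0) :=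
  ⟨zero_mem _, by simp⟩

/-- The commutation relations of the currents. -/
theorem cur_mul_cur {p q r s : ZMod 2} {A B : g} (hA : A ∈ 𝔤.par p) (hB : B ∈ 𝔤.par q)
    {α β : RavK} (hα : IsPar r α) (hβ : IsPar s β) :
    R.cur A α * R.cur B β - koszul (p + r) (q + s) • (R.cur B β * R.cur A α)
      = koszul r q • (R.cur (𝔤.br A B) (mul α β)
        - (h.form A B * res (mul α (RavK.deriv β))) • R.ρ (LieSuperalgebra.kappa g)) := by
  obtain ⟨m, rfl, hm⟩ := exists_deg_of_isPar hα
  obtain ⟨n, rfl, hn⟩ := exists_deg_of_isPar hβ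
  have h1 := R.br (toAffine_mem (h := h) hA hm) (toAffine_mem (h := h) hB hn)
  simp only [tot] at h1
  rw [add_comm p, add_comm q]
  refine h1.symm.trans ?_
  have e : (𝔤.affine h).br (LieSuperalgebra.toAffine (A ⊗ₜ α)) (LieSuperalgebra.toAffine (B ⊗ₜ β))
      = koszul m q • (LieSuperalgebra.toAffine (𝔤.br A B ⊗ₜ mul α β)
        - (h.form A B * res (mul α (RavK.deriv β))) • LieSuperalgebra.kappa g) := by
    show 𝔤.affineBr h _ _ = _
    rw [LieSuperalgebra.affineBr_apply]
    simp only [LieSuperalgebra.toAffine, LinearMap.inl_apply]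
    rw [𝔤.currentBr_tmul A hm hB, 𝔤.currentCocycle_tmul h A hm hB]
    ext1 <;> simp [LieSuperalgebra.kappa]
  rw [e, map_smul, map_sub, map_smul]
  rfl

/-- The central term is absent because `uⁱ ∂uʲ` has no residue. Right multiplications involve only
these modes, so they see no `κ`. -/
theorem cur_xp_mul_cur_xp {p q : ZMod 2} {A B : g} (hA : A ∈ 𝔤.par p) (hB : B ∈ 𝔤.par q)
    (i j : ℕ) : R.cur (𝔤.br A B) (xp (i + j))
      = R.cur A (xp i) * R.cur B (xp j) - koszul p q • (R.cur B (xp j) * R.cur A (xp i)) := by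
  have := cur_mul_cur (R := R) hA hB (isPar_xp i) (isPar_xp j)
  rw [add_zero, add_zero, koszul_zero_left, one_smul, xp_mul_xp] at this
  rw [this]
  have : res (mul (xp i) (RavK.deriv (xp j))) = 0 := by
    rw [deriv_xp, map_smul, xp_mul_xp]; simp [res, xp, ofSeries]
  simp [this]

theorem opS_opS_apply {d e : Bideg} {A B : g} {α α' : RavK}
    (hα' : α' ∈ RavK.deg e.1) {C : Op M} {s : ZMod 2} {β : RavK} (hβ : IsPar s β) (v : M) :
    R.opS e (B ⊗ₜ α') (R.opS d (A ⊗ₜ α) C) β v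
      = (koszul e.2 e.1 * koszul e.2 s * koszul d.2 d.1 * koszul d.2 (e.1 + s)) •
        evsum fun n => ∑ ij ∈ antidiagonal n,
          C (mul (twist (dp RavK.deriv ij.1 α)) (mul (twist (dp RavK.deriv ij.2 α')) β))
            (R.cur A (xp ij.1) (R.cur B (xp ij.2) v)) := by
  have hz : EvZero₂ fun l k =>
      C (mul (twist (dp RavK.deriv k α)) (mul (twist (dp RavK.deriv l α')) β))
            (R.cur A (xp k) (R.cur B (xp l) v)) := by
    refine EvZero₂.of_iter ?_ fun l => ?_
    · obtain ⟨N, hN⟩ := (R.cur_isSm B).evZero_xp v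
      exact ⟨N, fun l hl k => by
        simp only [show R.cur B (xp l) v = 0 from hN l hl, map_zero]⟩
    · exact opR_evZero _ _ _ _ _
  have e1 := evsum_evsum hz.swap
  rw [evsum_comm hz.swap] at e1
  rw [← e1, opS_apply, sgn_apply _ hβ, map_smul, opR_tmul, LinearMap.smul_apply,
    LinearMap.smul_apply, opRPure_apply, smul_smul, mul_assoc (koszul e.2 e.1 * _),
    mul_smul (koszul e.2 e.1 * _)]
  congr 1
  rw [← evsum_smul]
  congr 1; ext l
  rw [opS_apply, sgn_apply _ (((IsPar.of_mem hα').dp l).twist.mul hβ), map_smul, opR_tmul,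
    LinearMap.smul_apply, LinearMap.smul_apply, opRPure_apply, smul_smul]

/-- The operator applied last acts closest to the vector, so the order is reversed. The products
`A(uⁱ) B(uʲ)` combine to `[A, B](uⁱ⁺ʲ)`, and the coefficients `∂⁽ⁱ⁾α · ∂⁽ʲ⁾α'` to `∂⁽ⁿ⁾(αα')`. If
`α` and `α'` are both in `𝒦¹` all terms vanish, so the signs need to agree only when one of them is
in `𝒦⁰`. -/
theorem opS_opS {d e : Bideg} {x y : g ⊗[ℂ] RavK} (hx : x ∈ 𝔤.currentDeg d)
    (hy : y ∈ 𝔤.currentDeg e) (C : Op M) :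
    R.opS e y (R.opS d x C) - koszul (tot d) (tot e) • R.opS d x (R.opS e y C)
      = R.opS (d + e) (𝔤.currentBr x y) C := by
  induction hx using Submodule.span_induction with
  | zero => simp
  | add x x' _ _ hx hx' =>
    simp only [map_add, LinearMap.add_apply, smul_add, ← hx, ← hx']; abel
  | smul c x _ hx =>
    simp only [map_smul, LinearMap.smul_apply, smul_sub, smul_comm _ c, ← hx]
  | mem x hx =>
    obtain ⟨A, hA, α, hα, rfl⟩ := hx
    induction hy using Submodule.span_induction with
    | zero => simp
    | add x x' _ _ hx hx' =>
      simp only [map_add, LinearMap.add_apply, smul_add, ← hx, ← hx']; abel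
    | smul c x _ hx =>
      simp only [map_smul, LinearMap.smul_apply, smul_sub, smul_comm _ c, ← hx]
    | mem y hy =>
      obtain ⟨B, hB, α', hα', rfl⟩ := hy
      refine op_ext_par fun s β hβ => LinearMap.ext fun v => ?_
      rw [𝔤.currentBr_tmul A hα hB, LinearMap.sub_apply, LinearMap.smul_apply,
        LinearMap.sub_apply, LinearMap.smul_apply, opS_opS_apply hα' hβ,
        opS_opS_apply hα hβ, map_smul, LinearMap.smul_apply, LinearMap.smul_apply,
        LinearMap.smul_apply, opS_apply, sgn_apply _ hβ, map_smul, LinearMap.smul_apply,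
        LinearMap.smul_apply, opR_tmul, opRPure_apply]
      simp only [← evsum_smul, ← evsum_sub]
      congr 1; ext n
      rw [← Finset.Nat.sum_antidiagonal_swap (f := fun ij : ℕ × ℕ =>
          C (mul (twist (dp RavK.deriv ij.1 α')) (mul (twist (dp RavK.deriv ij.2 α)) β))
            (R.cur B (xp ij.1) (R.cur A (xp ij.2) v))), dp_deriv_mul, map_sum, map_sum]
      simp only [LinearMap.sum_apply, map_sum, Finset.smul_sum, ← Finset.sum_sub_distrib]
      refine Finset.sum_congr rfl fun ij hij => ?_
      rw [mem_antidiagonal] at hij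
      rw [← hij, cur_xp_mul_cur_xp hA hB, twist_mul, mul_assoc',
        RavK.mul_left_comm' (twist (dp RavK.deriv ij.swap.1 α'))]
      simp only [Prod.fst_swap, Prod.snd_swap, LinearMap.sub_apply, LinearMap.smul_apply,
        Module.End.mul_apply, map_sub, map_smul, smul_sub, smul_smul]
      rcases koszul_eq_one_or hα hα' with h1 | ⟨h1, h2⟩
      · congr 2
        · simp only [Prod.fst_add, Prod.snd_add, Int.cast_add, koszul_add_left, koszul_add_right]
          rw [koszul_comm d.1 e.2]
          linear_combination (-(koszul e.2 e.1 * koszul e.2 s * koszul d.2 d.1 * koszul d.2 e.1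
            * koszul d.2 s)) * koszul_mul_self e.2 d.1
        · simp only [tot, Prod.fst_add, Prod.snd_add, Int.cast_add, koszul_add_left,
            koszul_add_right, h1]
          rw [koszul_comm d.1 e.2]
          ring
      · have : ∀ v, C (mul (twist (dp RavK.deriv ij.1 α))
            (mul (twist (dp RavK.deriv ij.2 α')) β)) v = 0 := by
          intro v
          rw [← mul_assoc', show mul (twist (dp RavK.deriv ij.1 α)) (twist (dp RavK.deriv ij.2 α')) = 0
            from RavK.mul_eq_zero ((IsPar.dp (r := 1) ⟨by simp, fun _ => h1⟩ _).twist.2 rfl)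
              ((IsPar.dp (r := 1) ⟨by simp, fun _ => h2⟩ _).twist.2 rfl)]
          simp
        simp [this]

variable (R) in
/-- The action of elements of bidegree `d` of `ĝ_h` on fields; `c` is the parity of the field, as a
map on `𝒦`. -/
def op (d : Bideg) (c : ZMod 2) : ((g ⊗[ℂ] RavK) × ℂ) →ₗ[ℂ] Op M →ₗ[ℂ] Op M :=
  LinearMap.mk₂ ℂ (fun x C => R.opL x C - koszul (tot d) c • R.opS d x.1 C)
    (fun _ _ _ => by simp only [map_add, Prod.fst_add, LinearMap.add_apply, smul_add]; abel)
    (fun c _ _ => by simp only [map_smul, Prod.smul_fst, LinearMap.smul_apply, smul_sub, smul_comm _ c])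
    (fun _ _ _ => by simp only [map_add, smul_add]; abel)
    (fun c _ _ => by simp only [map_smul, smul_sub, smul_comm _ c])

theorem op_apply (d : Bideg) (c : ZMod 2) (x : (g ⊗[ℂ] RavK) × ℂ) (C : Op M) :
    R.op d c x C = R.opL x C - koszul (tot d) c • R.opS d x.1 C := rfl

theorem isSm_op (d : Bideg) (c : ZMod 2) (x : (g ⊗[ℂ] RavK) × ℂ) {C : Op M} (hC : IsSm C) :
    IsSm (R.op d c x C) := by
  exact (Fld M).sub_mem (isSm_opL x hC) ((Fld M).smul_mem _ (isSm_opS d x.1 hC))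

theorem tot_add (d e : Bideg) : tot (d + e) = tot d + tot e := by
  simp [tot]; ring

/-- Writing the action as `L - (±)S`, the `LL` terms give the bracket by `opL_opL`, the `SS` terms
by `opS_opS`, and the mixed terms cancel since `L` and `S` commute. The signs match because the
first operator shifts the parity of the field from `c` to `tot e + c` or `tot d + c`. -/
theorem op_op {d e : Bideg} (c : ZMod 2) {x y : (g ⊗[ℂ] RavK) × ℂ} (hx : x ∈ (𝔤.affine h).deg d)
    (hy : y ∈ (𝔤.affine h).deg e) {C : Op M} (hC : IsSm C) :
    R.op d (tot e + c) x (R.op e c y C)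
        - koszul (tot d) (tot e) • R.op e (tot d + c) y (R.op d c x C)
      = R.op (d + e) c ((𝔤.affine h).br x y) C := by
  have h1 := opL_opL (R := R) hx hy hC
  have h2 := opS_opS (R := R) hx.1 hy.1 C
  have e1 : ((𝔤.affine h).br x y).1 = 𝔤.currentBr x.1 y.1 := by
    show (𝔤.affineBr h x y).1 = _
    rw [LieSuperalgebra.affineBr_apply]
  simp only [op_apply, map_sub, map_smul, e1, ← h1, ← h2,
    opL_opS _ _ _ hC, koszul_add_right, koszul_add_left, tot_add, koszul_comm (tot e) (tot d)]
  have k1 := koszul_mul_self (tot d) (tot e)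
  generalize koszul (tot d) (tot e) = a at *
  generalize koszul (tot d) c = b at *
  generalize koszul (tot e) c = b' at *
  rcases mul_self_eq_one_iff.1 k1 with rfl | rfl <;> module

end SmRep

end Rep

/-! ### Universal properties -/

/-- Maps prescribed degree by degree glue along the direct sum decomposition. This turns formulas
whose Koszul signs depend on the degree of the argument into a single linear map. -/
theorem exists_gradedLift {I : Type*} [DecidableEq I] {L : Type*} [AddCommGroup L] [Module ℂ L]
    {W : Type*} [AddCommMonoid W] [Module ℂ W] {deg : I → Submodule ℂ L} (hG : IsGrading deg)
    (op : I → L →ₗ[ℂ] W) : ∃ f : L →ₗ[ℂ] W, ∀ d, ∀ x ∈ deg d, f x = op d x := by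
  have hI : DirectSum.IsInternal deg :=
    (DirectSum.isInternal_submodule_iff_iSupIndep_and_iSup_eq_top deg).2 hG
  let e := LinearEquiv.ofBijective (DirectSum.coeLinearMap deg) hI
  refine ⟨DirectSum.toModule ℂ I W (fun d => op d ∘ₗ (deg d).subtype) ∘ₗ e.symm.toLinearMap,
    fun d x hx => ?_⟩
  have : e.symm x = DirectSum.lof ℂ I (fun d => deg d) d ⟨x, hx⟩ := by
    rw [LinearEquiv.symm_apply_eq]
    exact (DirectSum.coeLinearMap_lof deg d ⟨x, hx⟩).symm
  simp [this]

theorem IsGrading.induction {I : Type*} {L : Type*} [AddCommGroup L] [Module ℂ L]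
    {deg : I → Submodule ℂ L} (hG : IsGrading deg) {P : L → Prop} (h0 : P 0)
    (hadd : ∀ x y, P x → P y → P (x + y)) (h : ∀ d, ∀ x ∈ deg d, P x) (x : L) : P x :=
  Submodule.iSup_induction deg (motive := P) (by rw [hG.2]; trivial) h h0 hadd

namespace GradedLieSuperalgebra

variable {L : Type u} [AddCommGroup L] [Module ℂ L] (𝔏 : GradedLieSuperalgebra L)

theorem ι_br {d e : Bideg} {x y : L} (hx : x ∈ 𝔏.deg d) (hy : y ∈ 𝔏.deg e) :
    𝔏.ι (𝔏.br x y) = 𝔏.ι x * 𝔏.ι y - koszul (tot d) (tot e) • (𝔏.ι y * 𝔏.ι x) := by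
  have := RingQuot.mkAlgHom_rel ℂ (EnvRel.comm hx hy)
  rw [map_sub, map_smul, map_mul, map_mul] at this
  exact this.symm

theorem exists_envLift {A : Type*} [Ring A] [Algebra ℂ A] (ρ : L →ₗ[ℂ] A)
    (hρ : ∀ {d e : Bideg} {x y : L}, x ∈ 𝔏.deg d → y ∈ 𝔏.deg e →
      ρ (𝔏.br x y) = ρ x * ρ y - koszul (tot d) (tot e) • (ρ y * ρ x)) :
    ∃ f : 𝔏.Env →ₐ[ℂ] A, ∀ x, f (𝔏.ι x) = ρ x := by
  let f : RingQuot 𝔏.EnvRel →ₐ[ℂ] A := RingQuot.liftAlgHom ℂ ⟨TensorAlgebra.lift ℂ ρ, by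
    rintro _ _ ⟨hx, hy⟩
    simp [hρ hx hy]⟩
  refine ⟨f, fun x => ?_⟩
  show RingQuot.liftAlgHom ℂ _ (RingQuot.mkAlgHom ℂ 𝔏.EnvRel (TensorAlgebra.ι ℂ x)) = _
  rw [RingQuot.liftAlgHom_mkAlgHom_apply]
  simp

theorem env_induction {P : 𝔏.Env → Prop} (halg : ∀ c : ℂ, P (algebraMap ℂ _ c))
    (hι : ∀ x, P (𝔏.ι x)) (hmul : ∀ a b, P a → P b → P (a * b))
    (hadd : ∀ a b, P a → P b → P (a + b)) (a : 𝔏.Env) : P a := by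
  obtain ⟨t, rfl⟩ := RingQuot.mkAlgHom_surjective ℂ 𝔏.EnvRel a
  induction t using TensorAlgebra.induction with
  | algebraMap c =>
    have := halg c
    rwa [show algebraMap ℂ 𝔏.Env c = RingQuot.mkAlgHom ℂ 𝔏.EnvRel (algebraMap ℂ _ c) from
      ((RingQuot.mkAlgHom ℂ 𝔏.EnvRel).commutes c).symm] at this
  | ι x => exact hι x
  | mul a b ha hb => rw [map_mul]; exact hmul _ _ ha hb
  | add a b ha hb => rw [map_add]; exact hadd _ _ ha hb

end GradedLieSuperalgebra

section Vacuum

variable {g : Type u} [AddCommGroup g] [Module ℂ g] {𝔤 : LieSuperalgebra g} {h : InvariantForm 𝔤}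
  {E : Type} [AddCommGroup E] [Module ℂ E] {k : Module.End ℂ E}

/-- The action of `ĝ_h` on the induced module. -/
def indAct (𝔤 : LieSuperalgebra g) (h : InvariantForm 𝔤) (k : Module.End ℂ E) :
    ((g ⊗[ℂ] RavK) × ℂ) →ₗ[ℂ] Module.End ℂ (Induced 𝔤 h E k) :=
  (Algebra.lsmul ℂ ℂ (Induced 𝔤 h E k)).toLinearMap ∘ₗ (𝔤.affine h).ι

theorem indAct_apply (x : (g ⊗[ℂ] RavK) × ℂ) (v : Induced 𝔤 h E k) :
    indAct 𝔤 h k x v = (𝔤.affine h).ι x • v := rfl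

theorem indAct_br {d e : Bideg} {x y : (g ⊗[ℂ] RavK) × ℂ} (hx : x ∈ (𝔤.affine h).deg d)
    (hy : y ∈ (𝔤.affine h).deg e) : indAct 𝔤 h k ((𝔤.affine h).br x y)
      = indAct 𝔤 h k x * indAct 𝔤 h k y
        - koszul (tot d) (tot e) • (indAct 𝔤 h k y * indAct 𝔤 h k x) := by
  simp only [indAct, LinearMap.comp_apply, GradedLieSuperalgebra.ι_br _ hx hy, map_sub, map_smul]
  simp [AlgHom.toLinearMap_apply, map_mul]

theorem indAct_posIncl (b : (g ⊗[ℂ] PowerSeries ℂ) × ℂ) (e : E) :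
    indAct 𝔤 h k (posIncl g b) (inducedMk 𝔤 h E k e) = inducedMk 𝔤 h E k (b.2 • k e) := by
  rw [indAct_apply, inducedMk, inducedMk, ← Submodule.Quotient.mk_smul, Submodule.Quotient.eq]
  refine Submodule.subset_span ⟨1, b, e, ?_⟩
  rw [TensorProduct.smul_tmul', smul_eq_mul, mul_one, one_mul]

/-- The universal property of the induced module. -/
theorem exists_inducedLift {F : Type*} [AddCommGroup F] [Module ℂ F]
    (ρ : ((g ⊗[ℂ] RavK) × ℂ) →ₗ[ℂ] Module.End ℂ F)
    (hρ : ∀ {d e : Bideg} {x y : (g ⊗[ℂ] RavK) × ℂ}, x ∈ (𝔤.affine h).deg d →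
      y ∈ (𝔤.affine h).deg e →
      ρ ((𝔤.affine h).br x y) = ρ x * ρ y - koszul (tot d) (tot e) • (ρ y * ρ x))
    (l : E →ₗ[ℂ] F) (hl : ∀ b e, ρ (posIncl g b) (l e) = b.2 • l (k e)) :
    ∃ Φ : Induced 𝔤 h E k →ₗ[ℂ] F, (∀ e, Φ (inducedMk 𝔤 h E k e) = l e) ∧
      ∀ x v, Φ (indAct 𝔤 h k x v) = ρ x (Φ v) := by
  obtain ⟨f, hf⟩ := (𝔤.affine h).exists_envLift ρ hρ
  let Ψ : ((𝔤.affine h).Env ⊗[ℂ] E) →ₗ[ℂ] F :=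
    TensorProduct.lift ((LinearMap.lcomp ℂ F l).comp f.toLinearMap)
  have hΨ : ∀ a e, Ψ (a ⊗ₜ e) = f a (l e) := fun a e => rfl
  have hsmul : ∀ a t, Ψ (a • t) = f a (Ψ t) := by
    intro a t
    induction t using TensorProduct.induction_on with
    | zero => simp
    | add x y hx hy => rw [smul_add, map_add, map_add, map_add, hx, hy]
    | tmul b e => rw [TensorProduct.smul_tmul', hΨ, hΨ, smul_eq_mul, map_mul]; rfl
  have hker : ∀ t ∈ inducedRel 𝔤 h E k, Ψ t = 0 := by
    intro t ht
    induction ht using Submodule.span_induction with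
    | zero => simp
    | add x y _ _ hx hy => rw [map_add, hx, hy, add_zero]
    | smul a t _ ht => rw [hsmul, ht, map_zero]
    | mem t ht =>
      obtain ⟨x, b, e, rfl⟩ := ht
      rw [map_sub, hΨ, hΨ, map_mul, hf, Module.End.mul_apply, hl, ← map_smul l, sub_self]
  refine ⟨((inducedRel 𝔤 h E k).restrictScalars ℂ).liftQ Ψ hker ∘ₗ
    (Submodule.Quotient.restrictScalarsEquiv ℂ (inducedRel 𝔤 h E k)).symm.toLinearMap,
    fun e => ?_, fun x v => ?_⟩
  · show Ψ ((1 : (𝔤.affine h).Env) ⊗ₜ e) = _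
    rw [hΨ, map_one]; rfl
  · obtain ⟨t, rfl⟩ := Submodule.Quotient.mk_surjective _ v
    rw [indAct_apply, ← Submodule.Quotient.mk_smul]
    exact (hsmul _ _).trans (by rw [hf]; rfl)

end Vacuum

/-! ### The representation on fields -/

theorem RavK.dp_deriv_ofSeries (m : ℕ) (f : PowerSeries ℂ) : dp RavK.deriv m (ofSeries f)
    = ofSeries (PowerSeries.mk fun n => ((n + m).choose m : ℂ) * PowerSeries.coeff (n + m) f) := by
  induction m with
  | zero =>
    simp only [dp_zero, Module.End.one_apply]
    congr 1; ext n; simp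
  | succ m ih =>
    have h1 : ((m : ℂ) + 1) ≠ 0 := by exact_mod_cast Nat.succ_ne_zero m
    rw [dp_succ_apply, ih]
    ext1
    · ext n
      simp only [RavK.deriv, ofSeries, LinearMap.inl_apply, LinearMap.prodMap_apply, Prod.smul_fst,
        map_smul, PowerSeries.coeff_mk]
      refine (congrArg _ (PowerSeries.coeff_derivative (R := ℂ) _ n)).trans ?_
      rw [PowerSeries.coeff_mk, smul_eq_mul, show n + 1 + m = n + (m + 1) by omega]
      have := Nat.choose_succ_right_eq (n + (m + 1)) m
      have h2 : ((n + (m + 1)).choose (m + 1) : ℂ) * (m + 1)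
          = ((n + (m + 1)).choose m : ℂ) * (n + 1) := by
        rw [show n + (m + 1) - m = n + 1 by omega] at this
        exact_mod_cast this
      field_simp
      linear_combination (-(PowerSeries.coeff (n + (m + 1)) f)) * h2
    · simp [RavK.deriv, ofSeries]

theorem RavK.twist_ofSeries (f : PowerSeries ℂ) : twist (ofSeries f)
    = ofSeries (PowerSeries.mk fun n => (-1) ^ n * PowerSeries.coeff n f) := by
  ext1
  · ext n; simp [twist, ofSeries]
  · simp [twist, ofSeries]

theorem RavK.res_ofSeries_mul_omega (f : PowerSeries ℂ) (n : ℕ) :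
    res (mul (ofSeries f) (omega n)) = PowerSeries.coeff n f := by
  rw [ofSeries_mul_omega, map_sum, Finset.sum_eq_single n]
  · simp [res, omega]
  · intro b hb hbn
    rw [Finset.mem_range] at hb
    simp only [map_smul, res, omega, LinearMap.comp_apply, LinearMap.snd_apply,
      Finsupp.lapply_apply]
    rw [Finsupp.single_eq_of_ne (by omega), smul_zero]
  · intro h'; simp at h'

theorem RavK.res_omega (n : ℕ) : res (omega n) = if n = 0 then 1 else 0 := by
  simp [res, omega, Finsupp.single_apply]

theorem RavK.res_ofSeries (f : PowerSeries ℂ) : res (ofSeries f) = 0 := by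
  simp [res, ofSeries]

theorem RavK.res_xp (n : ℕ) : res (xp n) = 0 := res_ofSeries _

section FieldRep

variable {g : Type u} [AddCommGroup g] [Module ℂ g] {𝔤 : LieSuperalgebra g} {h : InvariantForm 𝔤}
  {M : Type w} [AddCommGroup M] [Module ℂ M] (R : SmRep 𝔤 h M)

/-- The field of the vacuum. -/
def idField (M : Type*) [AddCommGroup M] [Module ℂ M] : Op M := res.smulRight 1

theorem idField_apply (β : RavK) (v : M) : idField M β v = res β • v := rfl

theorem isSm_idField : IsSm (idField M) := fun v => ⟨0, fun f => by
  rw [idField_apply, res_ofSeries, zero_smul]⟩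

instance fldSumAddCommGroup : AddCommGroup (Bideg →₀ Fld M) :=
  @Finsupp.instAddCommGroup Bideg (Fld M) _

namespace SmRep

variable {R}

/-- For a power series the expansions of `f(u - w)` in the two regions coincide, and the identity
commutes with `A(u)`, so the left and right terms cancel. The parity `1` is that of the identity
field as a map on `𝒦`. -/
theorem op_idField_series {p : ZMod 2} (A : g) (f : PowerSeries ℂ) :
    R.op (0, p) 1 (LieSuperalgebra.toAffine (A ⊗ₜ ofSeries f)) (idField M) = 0 := by
  rw [op_apply, sub_eq_zero]
  refine op_ext_par fun s β hβ => LinearMap.ext fun v => ?_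
  have e2 : (koszul (tot ((0, p) : Bideg)) 1 • R.opS (0, p)
      (LieSuperalgebra.toAffine (A ⊗ₜ[ℂ] ofSeries f)).1 (idField M)) β v
      = (koszul p 1 * koszul p s) •
        evsum fun n => res (mul (twist (dp RavK.deriv n (ofSeries f))) β) • R.cur A (xp n) v := by
    show koszul _ 1 • (R.opS (0, p) (A ⊗ₜ[ℂ] ofSeries f) (idField M)) β v = _
    rw [opS_apply, sgn_apply _ hβ, map_smul, opR_tmul, LinearMap.smul_apply, LinearMap.smul_apply,
      opRPure_apply]
    simp only [tot, Int.cast_zero, zero_add, koszul_comm p 0, koszul_zero_left, one_mul, smul_smul,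
      idField_apply]
  rw [e2, opL_apply]
  simp only [idField_apply, map_smul, dp_affineD_tmul]
  have h01 : ∀ t : ZMod 2, t = 0 ∨ t = 1 := by decide
  rcases h01 s with rfl | rfl
  · rw [hβ.eq_ofSeries]
    simp only [xp_mul_ofSeries, dp_deriv_ofSeries, twist_ofSeries, mul_ofSeries, res_ofSeries,
      zero_smul, smul_zero, evsum_zero]
  · rw [koszul_mul_self, one_smul]
    -- Both sides are linear in `β ∈ 𝒦¹`, so they are compared at `β = Ωⁿ`. There the left sum has
    -- the single term `k = n`; expanding `∂⁽ⁿ⁾f` into monomials gives the right sum, by the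
    -- symmetry of the binomial coefficients.
    let G₁ : RavK →ₗ[ℂ] M := evsum.comp (LinearMap.pi fun n =>
      ((res ∘ₗ mul (xp n)).smulRight
        (((-1 : ℂ) ^ n) • R.ρ (LieSuperalgebra.toAffine (A ⊗ₜ dp RavK.deriv n (ofSeries f))) v)))
    let G₂ : RavK →ₗ[ℂ] M := evsum.comp (LinearMap.pi fun n =>
      ((res ∘ₗ mul (twist (dp RavK.deriv n (ofSeries f)))).smulRight (R.cur A (xp n) v)))
    have e1 : G₁ β = G₂ β := by
      refine omega_ext (fun n => ?_) hβ
      show (evsum fun k => res (mul (xp k) (omega n)) • ((-1 : ℂ) ^ k)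
          • R.cur A (dp RavK.deriv k (ofSeries f)) v)
        = evsum fun k => res (mul (twist (dp RavK.deriv k (ofSeries f))) (omega n))
          • R.cur A (xp k) v
      rw [evsum_eq_single n fun k hk => by
        rw [xp_mul_omega]
        split_ifs with hkn
        · rw [res_omega, if_neg (by omega), zero_smul]
        · simp]
      have := (R.cur_isSm A).apply_series (PowerSeries.mk fun j => ((j + n).choose n : ℂ)
        * PowerSeries.coeff (j + n) f) (xp 0) v
      rw [RavK.mul_comm', xp_zero_mul] at this
      rw [xp_mul_omega, if_pos le_rfl, res_omega, if_pos (by omega), one_smul, dp_deriv_ofSeries,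
        this, ← evsum_smul]
      congr 1; ext j
      rw [RavK.mul_comm' (xp j), xp_zero_mul, dp_deriv_ofSeries, twist_ofSeries,
        res_ofSeries_mul_omega, PowerSeries.coeff_mk, PowerSeries.coeff_mk, PowerSeries.coeff_mk,
        smul_smul, add_comm n j, ← Nat.choose_symm_add]
    refine Eq.trans ?_ (e1.trans rfl)
    show _ = evsum fun k => res (mul (xp k) β) • ((-1 : ℂ) ^ k)
          • R.cur A (dp RavK.deriv k (ofSeries f)) v
    congr 1; ext j
    rw [smul_comm]; rfl

/-- As `∂κ = 0`, only the term `k = 0` of the left multiplication survives; the right multiplication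
does not see `κ`. -/
theorem op_kappa (c : ZMod 2) (C : Op M) (β : RavK) :
    R.op (1, 0) c (LieSuperalgebra.kappa g) C β = R.ρ (LieSuperalgebra.kappa g) * C β := by
  refine LinearMap.ext fun v => ?_
  have : (LieSuperalgebra.kappa g).1 = 0 := rfl
  rw [op_apply, this, map_zero, LinearMap.zero_apply, smul_zero, sub_zero, opL_apply,
    evsum_eq_single 0 (fun n hn => by rw [dp_affineD_kappa, if_neg hn]; simp)]
  simp [xp_zero_mul]

/-- The action on fields, restricted to smooth fields. -/
def opFld (d : Bideg) (c : ZMod 2) : ((g ⊗[ℂ] RavK) × ℂ) →ₗ[ℂ] Fld M →ₗ[ℂ] Fld M :=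
  LinearMap.mk₂ ℂ (fun x C => ⟨R.op d c x C, isSm_op d c x C.2⟩)
    (fun _ _ _ => Subtype.ext (by simp)) (fun _ _ _ => Subtype.ext (by simp))
    (fun _ _ _ => Subtype.ext (by simp)) (fun _ _ _ => Subtype.ext (by simp))

variable (R) in
/-- The action of elements of bidegree `d` on finite sums of homogeneous fields. -/
def opF (d : Bideg) : ((g ⊗[ℂ] RavK) × ℂ) →ₗ[ℂ] Module.End ℂ (Bideg →₀ Fld M) where
  toFun x := Finsupp.lsum ℂ fun e => Finsupp.lsingle (d + e) ∘ₗ opFld (R := R) d (tot e + 1) x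
  map_add' _ _ := by refine Finsupp.lhom_ext fun e C => ?_; simp
  map_smul' _ _ := by refine Finsupp.lhom_ext fun e C => ?_; simp

theorem opF_single (d e : Bideg) (x : (g ⊗[ℂ] RavK) × ℂ) (C : Fld M) :
    R.opF d x (Finsupp.single e C) = Finsupp.single (d + e) (opFld (R := R) d (tot e + 1) x C) := by
  simp [opF]

variable (R) in
/-- The action of `ĝ_h` on finite sums of homogeneous fields. -/
def actF : ((g ⊗[ℂ] RavK) × ℂ) →ₗ[ℂ] Module.End ℂ (Bideg →₀ Fld M) :=
  (exists_gradedLift (𝔤.affine h).isGrading R.opF).choose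

theorem actF_of_mem {d : Bideg} {x : (g ⊗[ℂ] RavK) × ℂ} (hx : x ∈ (𝔤.affine h).deg d) :
    R.actF x = R.opF d x :=
  (exists_gradedLift (𝔤.affine h).isGrading R.opF).choose_spec d x hx

theorem actF_br {d e : Bideg} {x y : (g ⊗[ℂ] RavK) × ℂ} (hx : x ∈ (𝔤.affine h).deg d)
    (hy : y ∈ (𝔤.affine h).deg e) : R.actF ((𝔤.affine h).br x y)
      = R.actF x * R.actF y - koszul (tot d) (tot e) • (R.actF y * R.actF x) := by
  rw [actF_of_mem ((𝔤.affine h).br_mem hx hy), actF_of_mem hx, actF_of_mem hy]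
  refine Finsupp.lhom_ext fun f C => ?_
  simp only [LinearMap.sub_apply, LinearMap.smul_apply, Module.End.mul_apply, opF_single]
  rw [add_left_comm e d f, ← add_assoc d e f, Finsupp.smul_single]
  refine Eq.trans ?_ (@Finsupp.single_sub Bideg (Fld M) _ _ _ _)
  congr 1
  refine Subtype.ext ?_
  have := op_op (R := R) (tot f + 1) hx hy C.2
  rw [← add_assoc, ← add_assoc, ← tot_add, ← tot_add] at this
  exact this.symm

end SmRep

end FieldRep

/-! ### Highest weight modules -/

section

variable {g : Type u} [AddCommGroup g] [Module ℂ g] {𝔤 : LieSuperalgebra g} {h : InvariantForm 𝔤}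
  {V : Type u} [AddCommGroup V] [Module ℂ V]

variable (𝔤 h V) in
/-- A representation of `ĝ_h` with a vector annihilated by `g[[u]]`. -/
structure PreVac where
  ρ : ((g ⊗[ℂ] RavK) × ℂ) →ₗ[ℂ] Module.End ℂ V
  vac : V
  br : ∀ {d e : Bideg} {x y : (g ⊗[ℂ] RavK) × ℂ}, x ∈ (𝔤.affine h).deg d →
    y ∈ (𝔤.affine h).deg e →
    ρ ((𝔤.affine h).br x y) = ρ x * ρ y - koszul (tot d) (tot e) • (ρ y * ρ x)
  series_vac : ∀ (A : g) (f : PowerSeries ℂ), ρ (LieSuperalgebra.toAffine (A ⊗ₜ ofSeries f)) vac = 0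

theorem affine_br_kappa (x : (g ⊗[ℂ] RavK) × ℂ) :
    (𝔤.affine h).br x (LieSuperalgebra.kappa g) = 0 := by
  show 𝔤.affineBr h _ _ = _
  rw [LieSuperalgebra.affineBr_apply]
  simp [LieSuperalgebra.kappa]

theorem affine_kappa_br (x : (g ⊗[ℂ] RavK) × ℂ) :
    (𝔤.affine h).br (LieSuperalgebra.kappa g) x = 0 := by
  show 𝔤.affineBr h _ _ = _
  rw [LieSuperalgebra.affineBr_apply]
  simp [LieSuperalgebra.kappa]

variable (𝔤) in
/-- The generators of degree one. -/
inductive Gen : ZMod 2 → (g ⊗[ℂ] RavK) × ℂ → Prop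
  | mu {p : ZMod 2} {A : g} (hA : A ∈ 𝔤.par p) (l : ℕ) :
      Gen p (LieSuperalgebra.toAffine (A ⊗ₜ omega l))
  | kappa : Gen 0 (LieSuperalgebra.kappa g)

theorem Gen.mem {p : ZMod 2} {x : (g ⊗[ℂ] RavK) × ℂ} (hx : Gen 𝔤 p x) :
    x ∈ (𝔤.affine h).deg (1, p) := by
  cases hx with
  | mu hA l => exact SmRep.toAffine_mem hA (mem_deg_one rfl)
  | kappa => exact SmRep.kappa_mem

theorem mem_deg_one_induction {p : ZMod 2} {P : (g ⊗[ℂ] RavK) × ℂ → Prop} (h0 : P 0)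
    (hadd : ∀ x y, P x → P y → P (x + y)) (hsmul : ∀ (c : ℂ) x, P x → P (c • x))
    (hgen : ∀ x, Gen 𝔤 p x → P x) {x : (g ⊗[ℂ] RavK) × ℂ} (hx : x ∈ (𝔤.affine h).deg (1, p)) :
    P x := by
  obtain ⟨y, c⟩ := x
  obtain ⟨hy, hc⟩ := hx
  have e1 : ((y, c) : (g ⊗[ℂ] RavK) × ℂ) = LieSuperalgebra.toAffine y
      + c • LieSuperalgebra.kappa g := by
    simp [LieSuperalgebra.toAffine, LieSuperalgebra.kappa]
  rw [e1]
  refine hadd _ _ ?_ ?_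
  · clear e1 hc
    change y ∈ 𝔤.currentDeg (1, p) at hy
    induction hy using Submodule.span_induction with
    | zero => rw [map_zero]; exact h0
    | add x y _ _ hx hy =>
      rw [map_add]
      exact hadd _ _ hx hy
    | smul c x _ hx =>
      rw [map_smul]
      exact hsmul _ _ hx
    | mem y hy =>
      obtain ⟨A, hA, α, hα, rfl⟩ := hy
      obtain ⟨f, q⟩ := α
      obtain rfl : f = 0 := RavK.fst_eq_zero_of_mem one_ne_zero hα
      clear hα
      induction q using Finsupp.induction_linear with
      | zero =>
        rw [show ((0, 0) : RavK) = 0 from rfl, TensorProduct.tmul_zero, map_zero]; exact h0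
      | add a b ha hb =>
        rw [show ((0, a + b) : RavK) = (0, a) + (0, b) by simp, TensorProduct.tmul_add, map_add]
        exact hadd _ _ ha hb
      | single m c =>
        rw [show ((0, Finsupp.single m c) : RavK) = c • omega m by simp [omega],
          TensorProduct.tmul_smul, map_smul]
        exact hsmul _ _ (hgen _ (Gen.mu hA m))
  · by_cases hp : p = 0
    · subst hp; exact hsmul _ _ (hgen _ Gen.kappa)
    · rw [if_neg (by simpa using hp)] at hc
      rw [show c = 0 from hc, zero_smul]; exact h0

theorem exists_br_gen_eq_zero {q : ZMod 2} {A : g} {x : (g ⊗[ℂ] RavK) × ℂ}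
    (hx : Gen 𝔤 q x) : ∃ m, ∀ f : PowerSeries ℂ, (𝔤.affine h).br (LieSuperalgebra.toAffine
      (A ⊗ₜ ofSeries (PowerSeries.X ^ m * f))) x = 0 := by
  cases hx with
  | kappa => exact ⟨0, fun f => affine_br_kappa _⟩
  | @mu _ B hB l =>
    -- The bracket needs `uᵐ Ωˡ = 0`, but the cocycle involves `∂Ωˡ`, a multiple of `Ωˡ⁺¹`; hence `l
    -- + 2` and not `l + 1`.
    refine ⟨l + 2, fun f => ?_⟩
    show 𝔤.affineBr h _ _ = _
    rw [LieSuperalgebra.affineBr_apply]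
    simp only [LieSuperalgebra.toAffine, LinearMap.inl_apply]
    have hz : ∀ j < l + 2, mul (ofSeries (PowerSeries.X ^ (l + 2) * f)) (omega j) = 0 := by
      intro j hj
      rw [← mul_ofSeries, RavK.mul_comm' (ofSeries _) (ofSeries f), mul_assoc',
        show ofSeries (PowerSeries.X ^ (l + 2)) = xp (l + 2) from rfl, xp_mul_omega,
        if_neg (by omega), map_zero]
    rw [𝔤.currentBr_tmul A (mem_deg_zero rfl) hB,
      𝔤.currentCocycle_tmul h A (mem_deg_zero rfl) hB, deriv_omega, map_smul,
      hz l (by omega), hz (l + 1) (by omega)]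
    simp

namespace PreVac

variable {U : PreVac 𝔤 h V}

variable (U) in
theorem comm {d e : Bideg} {x y : (g ⊗[ℂ] RavK) × ℂ} (hx : x ∈ (𝔤.affine h).deg d)
    (hy : y ∈ (𝔤.affine h).deg e) (v : V) :
    U.ρ x (U.ρ y v) = U.ρ ((𝔤.affine h).br x y) v
      + koszul (tot d) (tot e) • U.ρ y (U.ρ x v) := by
  rw [U.br hx hy]; simp

/-- Monomials in the generators, applied to the vacuum. -/
inductive Mon (U : PreVac 𝔤 h V) : Bideg → V → Prop
  | vac : Mon U 0 U.vac
  | act {p : ZMod 2} {x : (g ⊗[ℂ] RavK) × ℂ} {e : Bideg} {b : V} (hx : Gen 𝔤 p x)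
      (hb : Mon U e b) : Mon U ((1, p) + e) (U.ρ x b)

variable (U) in
/-- The bigrading by monomials. -/
def deg (e : Bideg) : Submodule ℂ V := Submodule.span ℂ {b | Mon U e b}

theorem vac_mem : U.vac ∈ U.deg 0 := Submodule.subset_span Mon.vac

theorem gen_mem {p : ZMod 2} {x : (g ⊗[ℂ] RavK) × ℂ} {e : Bideg} {b : V}
    (hx : Gen 𝔤 p x) (hb : b ∈ U.deg e) :
    U.ρ x b ∈ U.deg ((1, p) + e) := by
  induction hb using Submodule.span_induction with
  | zero => rw [map_zero]; exact zero_mem _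
  | add x y _ _ hx hy => rw [map_add]; exact add_mem hx hy
  | smul c x _ hx => rw [map_smul]; exact Submodule.smul_mem _ _ hx
  | mem b hb => exact Submodule.subset_span (Mon.act hx hb)

theorem deg_induction {P : Bideg → V → Prop} (h0 : ∀ e, P e 0)
    (hadd : ∀ {e b c}, P e b → P e c → P e (b + c)) (hsmul : ∀ {e b} (c : ℂ), P e b → P e (c • b))
    (hvac : P 0 (U.vac))
    (hact : ∀ {p x e b}, Gen 𝔤 p x → b ∈ U.deg e → P e b →
      P ((1, p) + e) (U.ρ x b)) {e : Bideg} {b : V}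
    (hb : b ∈ U.deg e) : P e b := by
  induction hb using Submodule.span_induction with
  | zero => exact h0 e
  | add x y _ _ hx hy => exact hadd hx hy
  | smul c x _ hx => exact hsmul c hx
  | mem b hb =>
    induction hb with
    | vac => exact hvac
    | act hx hb ih => exact hact hx (Submodule.subset_span hb) ih

/-- Monomials contain only generators of degree one. An element of `g[[u]]` is moved to the right
through them until it annihilates the vacuum; each commutator on the way is again of degree one,
where `key1` applies. -/
theorem act_mem {d e : Bideg} {x : (g ⊗[ℂ] RavK) × ℂ} {b : V}
    (hx : x ∈ (𝔤.affine h).deg d) (hb : b ∈ U.deg e) :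
    U.ρ x b ∈ U.deg (d + e) := by
  have key1 : ∀ {p : ZMod 2} {x : (g ⊗[ℂ] RavK) × ℂ} {e : Bideg} {b : V},
      x ∈ (𝔤.affine h).deg (1, p) → b ∈ U.deg e →
      U.ρ x b ∈ U.deg ((1, p) + e) := by
    intro p x e b hx hb
    refine mem_deg_one_induction (P := fun x => U.ρ x b ∈ U.deg ((1, p) + e))
      ?_ ?_ ?_ ?_ hx
    · rw [map_zero]; exact zero_mem _
    · intro x y hx hy; rw [map_add]; exact add_mem hx hy
    · intro c x hx; rw [map_smul]; exact Submodule.smul_mem _ _ hx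
    · intro x hx; exact gen_mem hx hb
  have key0 : ∀ {p : ZMod 2} {A : g}, A ∈ 𝔤.par p → ∀ (f : PowerSeries ℂ) {e : Bideg}
      {b : V}, b ∈ U.deg e →
      U.ρ (LieSuperalgebra.toAffine (A ⊗ₜ ofSeries f)) b
        ∈ U.deg ((0, p) + e) := by
    intro p A hA f e b hb
    have hm := SmRep.toAffine_mem (h := h) hA (mem_deg_zero (α := ofSeries f) rfl)
    refine deg_induction (P := fun e b => U.ρ
      (LieSuperalgebra.toAffine (A ⊗ₜ ofSeries f)) b ∈ U.deg ((0, p) + e)) ?_ ?_ ?_ ?_ ?_ hb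
    · intro e; rw [map_zero]; exact zero_mem _
    · intro e b c hb hc; rw [map_add]; exact add_mem hb hc
    · intro e b c hb; rw [map_smul]; exact Submodule.smul_mem _ _ hb
    · rw [U.series_vac]; exact zero_mem _
    · intro q x e b hx hb ih
      rw [U.comm hm hx.mem]
      refine add_mem ?_ (Submodule.smul_mem _ _ ?_)
      · have h1 := (𝔤.affine h).br_mem hm hx.mem
        rw [show ((0, p) + (1, q) : Bideg) = (1, p + q) by simp] at h1
        have := key1 h1 hb
        rwa [show ((1, p + q) + e : Bideg) = (0, p) + ((1, q) + e) by
          rw [← add_assoc]; simp] at this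
      · rw [add_left_comm]; exact gen_mem hx ih
  obtain ⟨n, p⟩ := d
  by_cases hn1 : n = 1
  · subst hn1; exact key1 hx hb
  · obtain ⟨y, c⟩ := x
    obtain ⟨hy, hc⟩ := hx
    rw [if_neg (by simp [hn1])] at hc
    obtain rfl : c = 0 := hc
    change y ∈ 𝔤.currentDeg (n, p) at hy
    show U.ρ (LieSuperalgebra.toAffine y) b ∈ _
    induction hy using Submodule.span_induction with
    | zero => rw [map_zero, map_zero]; exact zero_mem _
    | add x y _ _ hx hy => rw [map_add, map_add]; exact add_mem hx hy
    | smul c x _ hx => rw [map_smul, map_smul]; exact Submodule.smul_mem _ _ hx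
    | mem y hy =>
      obtain ⟨A, hA, α, hα, rfl⟩ := hy
      have h2 : α.2 = 0 := RavK.snd_eq_zero_of_mem hn1 hα
      by_cases hn0 : n = 0
      · subst hn0
        have : α = ofSeries α.1 := by ext1 <;> simp [ofSeries, h2]
        rw [this]; exact key0 hA _ hb
      · have : α = 0 := Prod.ext (RavK.fst_eq_zero_of_mem hn0 hα) h2
        rw [this, TensorProduct.tmul_zero, map_zero, map_zero]; exact zero_mem _

end PreVac

variable (𝔤 h V) in
/-- A representation of `ĝ_h` generated by a vector annihilated by `g[[u]]`. -/
structure VacMod extends PreVac 𝔤 h V where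
  iSup_deg : ⨆ e, toPreVac.deg e = ⊤

namespace VacMod

variable (U : VacMod 𝔤 h V)

theorem induction {P : V → Prop} (h0 : P 0)
    (hadd : ∀ b c, P b → P c → P (b + c)) (hdeg : ∀ e, ∀ b ∈ U.deg e, P b) (b : V) : P b :=
  Submodule.iSup_induction U.deg (motive := P) (by rw [U.iSup_deg]; trivial) hdeg h0 hadd

/-- Each generator in a monomial commutes with `A ⊗ uᵐf` for large `m`, uniformly in `f`, and the
vacuum is annihilated; the bounds add up along the monomial. -/
theorem smooth_of_mem {p : ZMod 2} {A : g} (hA : A ∈ 𝔤.par p) {e : Bideg}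
    {b : V} (hb : b ∈ U.deg e) : ∃ n : ℕ, ∀ f : PowerSeries ℂ, U.ρ
      (LieSuperalgebra.toAffine (A ⊗ₜ ofSeries (PowerSeries.X ^ n * f))) b = 0 := by
  have mono : ∀ {n m : ℕ} {b : V}, n ≤ m → (∀ f : PowerSeries ℂ, U.ρ
      (LieSuperalgebra.toAffine (A ⊗ₜ ofSeries (PowerSeries.X ^ n * f))) b = 0) →
      ∀ f : PowerSeries ℂ, U.ρ
      (LieSuperalgebra.toAffine (A ⊗ₜ ofSeries (PowerSeries.X ^ m * f))) b = 0 := by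
    intro n m b hnm hn f
    obtain ⟨j, rfl⟩ := Nat.exists_eq_add_of_le hnm
    rw [pow_add, mul_assoc]; exact hn _
  refine PreVac.deg_induction (P := fun e b => ∃ n : ℕ, ∀ f : PowerSeries ℂ, U.ρ
      (LieSuperalgebra.toAffine (A ⊗ₜ ofSeries (PowerSeries.X ^ n * f))) b = 0)
    ?_ ?_ ?_ ?_ ?_ hb
  · intro e; exact ⟨0, fun f => map_zero _⟩
  · rintro e b c ⟨n, hn⟩ ⟨m, hm⟩
    exact ⟨max n m, fun f => by
      rw [map_add, mono (le_max_left _ _) hn, mono (le_max_right _ _) hm, add_zero]⟩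
  · rintro e b c ⟨n, hn⟩
    exact ⟨n, fun f => by rw [map_smul, hn, smul_zero]⟩
  · exact ⟨0, fun f => U.series_vac _ _⟩
  · rintro q x e b hx hb ⟨n, hn⟩
    have hbr := exists_br_gen_eq_zero (h := h) (A := A) hx
    obtain ⟨m, hm⟩ := hbr
    refine ⟨n + m, fun f => ?_⟩
    rw [U.comm (SmRep.toAffine_mem (h := h) hA (mem_deg_zero (α := ofSeries _) rfl))
      hx.mem, pow_add, mul_assoc, hn, mul_left_comm, hm]
    simp

theorem smooth (v : V) (A : g) :
    ∃ n : ℕ, ∀ f : PowerSeries ℂ, U.ρ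
      (LieSuperalgebra.toAffine (A ⊗ₜ ofSeries (PowerSeries.X ^ n * f))) v = 0 := by
  refine U.induction (P := fun v => ∃ n : ℕ, ∀ f : PowerSeries ℂ, U.ρ
        (LieSuperalgebra.toAffine (A ⊗ₜ ofSeries (PowerSeries.X ^ n * f))) v = 0) ?_ ?_ ?_ v
  · exact ⟨0, fun f => map_zero _⟩
  · rintro b c ⟨n, hn⟩ ⟨m, hm⟩
    refine ⟨n + m, fun f => ?_⟩
    rw [map_add, pow_add, mul_assoc, hn, mul_left_comm, hm, add_zero]
  · intro e b hb
    obtain ⟨B, hB, C, hC, rfl⟩ := 𝔤.exists_par_add A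
    obtain ⟨n, hn⟩ := U.smooth_of_mem hB hb
    obtain ⟨m, hm⟩ := U.smooth_of_mem hC hb
    refine ⟨n + m, fun f => ?_⟩
    rw [TensorProduct.add_tmul, map_add, map_add, LinearMap.add_apply, pow_add, mul_assoc, hn,
      mul_left_comm, hm, add_zero]

/-- Such a representation is smooth. -/
def rep : SmRep 𝔤 h V where
  ρ := U.ρ
  br := U.br
  smooth := U.smooth

end VacMod

variable {M : Type w} [AddCommGroup M] [Module ℂ M]

variable (M) in
/-- The vacuum field as an element of the module of finite sums of fields. -/
def fldVac : Bideg →₀ Fld M := Finsupp.single 0 ⟨idField M, isSm_idField⟩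

/-- A map from states to sums of fields that is compatible with the actions of `ĝ_h`. -/
structure FieldMap (U : VacMod 𝔤 h V) (R : SmRep 𝔤 h M) where
  lift : V →ₗ[ℂ] (Bideg →₀ Fld M)
  lift_vac : lift U.vac = fldVac M
  lift_act : ∀ x v, lift (U.ρ x v) = R.actF x (lift v)

namespace FieldMap

variable {U : VacMod 𝔤 h V} {R : SmRep 𝔤 h M} (X : FieldMap U R)

/-- The field of a state, as an element of the space of fields. -/
def fldL : V →ₗ[ℂ] Fld M := (Finsupp.lsum ℂ fun _ => LinearMap.id) ∘ₗ X.lift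

/-- The field of a state. -/
def fld : V →ₗ[ℂ] Op M := (Fld M).subtype ∘ₗ X.fldL

theorem isSm_fld (b : V) : IsSm (X.fld b) := (X.fldL b).2

end FieldMap

end

/-! ### Fields of states, creation and translation -/

theorem IsPar.sgn {r : ZMod 2} {α : RavK} (p : ZMod 2) (hα : IsPar r α) :
    IsPar r (SmRep.sgn p α) := by
  rw [SmRep.sgn_apply p hα]; exact hα.smul _

theorem sgn_deriv (p : ZMod 2) (β : RavK) : SmRep.sgn p (RavK.deriv β) = RavK.deriv (SmRep.sgn p β) := by
  ext1
  · simp [SmRep.sgn, RavK.deriv]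
  · simp [SmRep.sgn, RavK.deriv]

theorem twist_ofSeries_mem {r : ℤ} {α : RavK} (hα : α ∈ RavK.deg r) : twist α ∈ RavK.deg r := by
  by_cases h0 : r = 0
  · subst h0
    exact mem_deg_zero (by simp [twist, RavK.snd_eq_zero_of_mem (by decide) hα])
  · by_cases h1 : r = 1
    · subst h1
      exact mem_deg_one (by simp [twist, RavK.fst_eq_zero_of_mem h0 hα])
    · rw [show α = 0 from Prod.ext (RavK.fst_eq_zero_of_mem h0 hα) (RavK.snd_eq_zero_of_mem h1 hα),
        map_zero]
      exact zero_mem _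

theorem dp_deriv_mem {r : ℤ} {α : RavK} (hα : α ∈ RavK.deg r) (k : ℕ) :
    dp RavK.deriv k α ∈ RavK.deg r := by
  by_cases h0 : r = 0
  · subst h0
    have : IsPar 0 α := ⟨fun _ => RavK.snd_eq_zero_of_mem (by decide) hα, fun h => by simp at h⟩
    exact mem_deg_zero ((this.dp k).1 rfl)
  · by_cases h1 : r = 1
    · subst h1
      have : IsPar 1 α := ⟨fun h => by simp at h, fun _ => RavK.fst_eq_zero_of_mem h0 hα⟩
      exact mem_deg_one ((this.dp k).2 rfl)
    · rw [show α = 0 from Prod.ext (RavK.fst_eq_zero_of_mem h0 hα) (RavK.snd_eq_zero_of_mem h1 hα),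
        map_zero]
      exact zero_mem _

theorem sgn_mem {r : ℤ} {α : RavK} (p : ZMod 2) (hα : α ∈ RavK.deg r) :
    SmRep.sgn p α ∈ RavK.deg r := by
  rw [SmRep.sgn_apply p (IsPar.of_mem hα)]
  exact Submodule.smul_mem _ _ hα

theorem twist_deriv (α : RavK) : twist (RavK.deriv α) = -RavK.deriv (twist α) := by
  obtain ⟨f, q⟩ := α
  ext1
  · ext n
    simp only [twist, RavK.deriv, LinearMap.prodMap_apply, LinearMap.coe_mk, AddHom.coe_mk,
      PowerSeries.coeff_rescale, Prod.fst_neg, map_neg]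
    have h1 := PowerSeries.coeff_derivative (R := ℂ) f n
    have h2 := PowerSeries.coeff_derivative (R := ℂ) (PowerSeries.rescale (-1 : ℂ) f) n
    refine (congrArg _ h1).trans ?_
    refine Eq.trans ?_ (congrArg Neg.neg h2).symm
    rw [PowerSeries.coeff_rescale]; ring
  · induction q using Finsupp.induction_linear with
    | zero => simp [twist, RavK.deriv]
    | add a b ha hb =>
      simp only [twist, RavK.deriv, LinearMap.prodMap_apply, map_add, Prod.snd_neg] at ha hb ⊢
      rw [ha, hb]; abel
    | single m c =>
      simp only [twist, RavK.deriv, LinearMap.prodMap_apply, Finsupp.linearCombination_single,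
        Finsupp.smul_single, smul_eq_mul, Prod.snd_neg]
      rw [← Finsupp.single_neg]
      congr 1
      ring

theorem dp_deriv_deriv (n : ℕ) (α : RavK) : dp RavK.deriv n (RavK.deriv α) = RavK.deriv (dp RavK.deriv n α) := by
  rw [dp_self_apply, self_dp_apply]

section

variable {g : Type u} [AddCommGroup g] [Module ℂ g] {𝔤 : LieSuperalgebra g} {h : InvariantForm 𝔤}
  {V : Type u} [AddCommGroup V] [Module ℂ V] {M : Type w} [AddCommGroup M] [Module ℂ M]

namespace SmRep

variable (R : SmRep 𝔤 h M)

/-- Integration by parts under the sum: `uⁿ ∂β = ∂(uⁿβ) - n uⁿ⁻¹β`. After a shift of the index the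
factor `n` turns `∂⁽ⁿ⁾x` into `∂⁽ⁿ⁻¹⁾(∂x)`. -/
theorem opL_deriv (x : (g ⊗[ℂ] RavK) × ℂ) {C : Op M} (hC : IsSm C) (β : RavK) (v : M) :
    R.opL x C (deriv β) v = R.opL x (C ∘ₗ deriv) β v + R.opL (affineD g x) C β v := by
  have e : ∀ n, ((-1 : ℂ) ^ n) • R.ρ (dp (affineD g) n x) (C (mul (xp n) (deriv β)) v)
      = ((-1 : ℂ) ^ n) • R.ρ (dp (affineD g) n x) ((C ∘ₗ deriv) (mul (xp n) β) v)
        - ((-1 : ℂ) ^ n * n) • R.ρ (dp (affineD g) n x) (C (mul (xp (n - 1)) β) v) := by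
    intro n
    have : mul (xp n) (deriv β) = deriv (mul (xp n) β) - (n : ℂ) • mul (xp (n - 1)) β := by
      rw [deriv_mul, deriv_xp, map_smul, LinearMap.smul_apply]; abel
    rw [this, map_sub, LinearMap.sub_apply, map_sub, smul_sub, map_smul, LinearMap.smul_apply,
      map_smul, smul_smul]
    rfl
  rw [opL_apply, opL_apply, opL_apply]
  simp only [e, evsum_sub]
  rw [sub_eq_add_neg]
  congr 1
  have hz : EvZero fun n => ((-1 : ℂ) ^ n * n) • R.ρ (dp (affineD g) n x)
      (C (mul (xp (n - 1)) β) v) := by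
    obtain ⟨N, hN⟩ := hC.evZero β v
    refine ⟨N + 1, fun n hn => ?_⟩
    have : C (mul (xp (n - 1)) β) v = 0 := hN (n - 1) (by omega)
    show _ • R.ρ _ (C (mul (xp (n - 1)) β) v) = 0
    rw [this, map_zero, smul_zero]
  rw [evsum_succ hz]
  simp only [Nat.cast_zero, mul_zero, zero_smul, zero_add, Nat.add_sub_cancel]
  rw [← evsum_neg]
  congr 1; ext n
  rw [dp_self_apply, map_smul, LinearMap.smul_apply, smul_smul, ← neg_smul]
  congr 1
  push_cast; ring

theorem opR_deriv (y : g ⊗[ℂ] RavK) (C : Op M) (β : RavK) (v : M) :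
    R.opR y C (deriv β) v = R.opR y (C ∘ₗ deriv) β v
      + R.opR (TensorProduct.map LinearMap.id deriv y) C β v := by
  induction y using TensorProduct.induction_on with
  | zero => simp
  | add x y hx hy => simp only [map_add, LinearMap.add_apply, hx, hy]; abel
  | tmul A ξ =>
    rw [TensorProduct.map_tmul, LinearMap.id_apply, opR_tmul, opR_tmul, opRPure_apply,
      opRPure_apply, opRPure_apply, ← evsum_add]
    congr 1; ext n
    rw [LinearMap.comp_apply, deriv_mul, map_add, LinearMap.add_apply, dp_deriv_deriv, twist_deriv]
    simp

theorem op_comp_deriv (d : Bideg) (c : ZMod 2) (x : (g ⊗[ℂ] RavK) × ℂ) {C : Op M} (hC : IsSm C) :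
    R.op d c x C ∘ₗ deriv = R.op d c x (C ∘ₗ deriv) + R.op d c (affineD g x) C := by
  refine LinearMap.ext fun β => LinearMap.ext fun v => ?_
  simp only [op_apply, LinearMap.add_apply, LinearMap.comp_apply, LinearMap.sub_apply,
    LinearMap.smul_apply, opS_apply, sgn_deriv, R.opL_deriv x hC, opR_deriv, affineD,
    LinearMap.prodMap_apply]
  module

/-- Right multiplication begins by applying a mode `A ⊗ uⁿ` to the vector. On vacuum-like vectors
the action on fields thus reduces to its left term. -/
theorem opS_apply_eq_zero (d : Bideg) (y : g ⊗[ℂ] RavK) (C : Op M) (β : RavK) {v : M}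
    (hv : ∀ A n, R.cur A (xp n) v = 0) : R.opS d y C β v = 0 := by
  have key : R.opR y C (sgn d.2 β) v = 0 := by
    induction y using TensorProduct.induction_on with
    | zero => simp
    | add x y hx hy => simp only [map_add, LinearMap.add_apply, hx, hy, add_zero]
    | tmul A ξ =>
      rw [opR_tmul, opRPure_apply]
      simp [hv]
  rw [opS_apply, LinearMap.smul_apply, key, smul_zero]

theorem opL_omega_zero (x : (g ⊗[ℂ] RavK) × ℂ) (C : Op M) (v : M) :
    R.opL x C (omega 0) v = R.ρ x (C (omega 0) v) := by
  rw [opL_apply, evsum_eq_single 0 fun n hn => by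
    rw [xp_mul_omega, if_neg (by omega)]; simp, xp_zero_mul]
  simp

theorem opL_omega_one (x : (g ⊗[ℂ] RavK) × ℂ) (C : Op M) (v : M) :
    R.opL x C (omega 1) v = R.ρ x (C (omega 1) v) - R.ρ (affineD g x) (C (omega 0) v) := by
  rw [opL_apply, evsum_eq (N := 2) fun n hn => by
    rw [xp_mul_omega, if_neg (by omega)]; simp]
  simp [Finset.sum_range_succ, xp_mul_omega, sub_eq_add_neg]

end SmRep

namespace FieldMap

variable {U : VacMod 𝔤 h V} {R : SmRep 𝔤 h M} (X : FieldMap U R)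

/-- The vacuum field sits in component `0`, and a generator shifts the component by its own degree,
so a monomial of degree `e` lands in component `e` alone. -/
theorem lift_of_mem {e : Bideg} {b : V} (hb : b ∈ U.deg e) :
    X.lift b = Finsupp.single e (X.fldL b) := by
  have key : ∃ C, X.lift b = Finsupp.single e C := by
    refine PreVac.deg_induction (P := fun e b => ∃ C, X.lift b = Finsupp.single e C)
      (fun e => ⟨0, by simp⟩) ?_ ?_ ⟨_, X.lift_vac⟩ ?_ hb
    · rintro e b c ⟨C, hC⟩ ⟨D, hD⟩
      exact ⟨C + D, by rw [map_add, hC, hD, Finsupp.single_add]⟩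
    · rintro e b c ⟨C, hC⟩
      exact ⟨c • C, by rw [map_smul, hC, Finsupp.smul_single]⟩
    · rintro p x e b hx hb ⟨C, hC⟩
      exact ⟨_, by rw [X.lift_act, hC, SmRep.actF_of_mem hx.mem, SmRep.opF_single]⟩
  obtain ⟨C, hC⟩ := key
  rw [fldL, LinearMap.comp_apply, hC]
  simp

theorem fld_vac : X.fld (U.vac) = idField M := by
  rw [fld, LinearMap.comp_apply, fldL, LinearMap.comp_apply, X.lift_vac, fldVac]
  simp

theorem fld_act {d e : Bideg} {x : (g ⊗[ℂ] RavK) × ℂ} {b : V}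
    (hx : x ∈ (𝔤.affine h).deg d) (hb : b ∈ U.deg e) :
    X.fld (U.ρ x b) = R.op d (tot e + 1) x (X.fld b) := by
  have : X.fldL (U.ρ x b) = SmRep.opFld (R := R) d (tot e + 1) x (X.fldL b) := by
    conv_lhs => rw [fldL, LinearMap.comp_apply, X.lift_act, X.lift_of_mem hb,
      SmRep.actF_of_mem hx, SmRep.opF_single]
    simp
  exact congrArg Subtype.val this

theorem fld_kappa (b : V) (β : RavK) :
    X.fld (U.ρ (LieSuperalgebra.kappa g) b) β
      = R.ρ (LieSuperalgebra.kappa g) * X.fld b β := by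
  refine U.induction (P := fun b => X.fld (U.ρ (LieSuperalgebra.kappa g) b) β
      = R.ρ (LieSuperalgebra.kappa g) * X.fld b β) ?_ ?_ ?_ b
  · simp
  · intro b c hb hc; simp only [map_add, LinearMap.add_apply, hb, hc, mul_add]
  · intro e b hb
    rw [X.fld_act SmRep.kappa_mem hb, SmRep.op_kappa]

end FieldMap

namespace FieldMap

variable {U : VacMod 𝔤 h V} {R : SmRep 𝔤 h M} (X : FieldMap U R) {m : M}

theorem fld_series_apply (hm : ∀ A n, R.cur A (xp n) m = 0) (b : V)
    (f : PowerSeries ℂ) : X.fld b (ofSeries f) m = 0 := by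
  refine U.induction (P := fun b => X.fld b (ofSeries f) m = 0)
    (by simp) (fun b c hb hc => by rw [map_add, LinearMap.add_apply, LinearMap.add_apply, hb, hc,
      add_zero]) ?_ b
  intro e b hb
  refine PreVac.deg_induction (P := fun e b => ∀ f, X.fld b (ofSeries f) m = 0)
    (by simp) (fun hb hc f => by rw [map_add, LinearMap.add_apply, LinearMap.add_apply, hb, hc,
      add_zero])
    (fun c hb f => by rw [map_smul, LinearMap.smul_apply, LinearMap.smul_apply, hb, smul_zero])
    ?_ ?_ hb f
  · intro f
    rw [X.fld_vac, idField_apply, res_ofSeries, zero_smul]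
  · intro p x e b hx hb ih f
    rw [X.fld_act hx.mem hb, SmRep.op_apply, LinearMap.sub_apply, LinearMap.sub_apply,
      LinearMap.smul_apply, LinearMap.smul_apply, SmRep.opS_apply_eq_zero _ _ _ _ _ hm,
      SmRep.opL_apply]
    simp only [xp_mul_ofSeries, ih]
    simp

theorem fld_act_omega_zero (hm : ∀ A n, R.cur A (xp n) m = 0) {d e : Bideg}
    {x : (g ⊗[ℂ] RavK) × ℂ} {b : V} (hx : x ∈ (𝔤.affine h).deg d)
    (hb : b ∈ U.deg e) :
    X.fld (U.ρ x b) (omega 0) m = R.ρ x (X.fld b (omega 0) m) := by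
  rw [X.fld_act hx hb, SmRep.op_apply, LinearMap.sub_apply, LinearMap.sub_apply,
    LinearMap.smul_apply, LinearMap.smul_apply, SmRep.opS_apply_eq_zero _ _ _ _ _ hm,
    SmRep.opL_omega_zero, smul_zero, sub_zero]

theorem fld_act_omega_one (hm : ∀ A n, R.cur A (xp n) m = 0) {d e : Bideg}
    {x : (g ⊗[ℂ] RavK) × ℂ} {b : V} (hx : x ∈ (𝔤.affine h).deg d)
    (hb : b ∈ U.deg e) :
    X.fld (U.ρ x b) (omega 1) m
      = R.ρ x (X.fld b (omega 1) m) - R.ρ (affineD g x) (X.fld b (omega 0) m) := by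
  rw [X.fld_act hx hb, SmRep.op_apply, LinearMap.sub_apply, LinearMap.sub_apply,
    LinearMap.smul_apply, LinearMap.smul_apply, SmRep.opS_apply_eq_zero _ _ _ _ _ hm,
    SmRep.opL_omega_one, smul_zero, sub_zero]

end FieldMap

/-! ### Creation axiom, bigrading and translation operator of the vacuum module. -/

section Vacuum

variable {U : VacMod 𝔤 h V} (Y : FieldMap U U.rep)

theorem cur_xp_vac (A : g) (n : ℕ) :
    U.rep.cur A (xp n) (U.vac) = 0 := U.series_vac _ _

theorem vfld_series_vac (b : V) (f : PowerSeries ℂ) :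
    Y.fld b (ofSeries f) (U.vac) = 0 :=
  Y.fld_series_apply cur_xp_vac b f

/-- The map `b ↦ Y.fld b (Ω⁰)|0⟩` fixes the vacuum and commutes with `ĝ_h`: right terms die on the
vacuum, and `uⁿΩ⁰ = 0` leaves only the leading left term. -/
theorem vfld_omega_zero_vac (b : V) :
    Y.fld b (omega 0) (U.vac) = b := by
  let G : Module.End ℂ (V) := (LinearMap.applyₗ (U.vac)) ∘ₗ
    (LinearMap.applyₗ (omega 0)) ∘ₗ Y.fld
  have h1 : ∀ b, Y.fld b (omega 0) (U.vac) = G b := fun b => rfl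
  have h2 : ∀ {d e : Bideg} {x : (g ⊗[ℂ] RavK) × ℂ} {b : V},
      x ∈ (𝔤.affine h).deg d → b ∈ U.deg e → G (U.ρ x b) = U.ρ x (G b) :=
    fun hx hb => Y.fld_act_omega_zero cur_xp_vac hx hb
  have h3 : G (U.vac) = U.vac := by
    rw [← h1, Y.fld_vac, idField_apply, res_omega, if_pos rfl, one_smul]
  rw [h1]
  clear_value G
  refine U.induction (P := fun b => G b = b)
    (map_zero G) (fun b c hb hc => by rw [map_add, hb, hc]) ?_ b
  intro e b hb
  exact PreVac.deg_induction (P := fun e b => G b = b)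
    (fun _ => map_zero G) (fun hb hc => by rw [map_add, hb, hc])
    (fun c hb => by rw [map_smul, hb]) h3 (fun hx hb ih => by rw [h2 hx.mem hb, ih]) hb

/-- Independence replaces a PBW argument: `Y.lift` separates the degrees into different components,
and a component, evaluated at `Ω⁰` on the vacuum, returns the state. This gives projections onto the
pieces. -/
theorem VacMod.isGrading (Y : FieldMap U U.rep) : IsGrading (U.deg) := by
  refine ⟨iSupIndep_of_proj _ (fun e => (LinearMap.applyₗ (U.vac)) ∘ₗ
      (LinearMap.applyₗ (omega 0)) ∘ₗ (Fld _).subtype ∘ₗ (Finsupp.lapply e) ∘ₗ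
      Y.lift) ?_ ?_, U.iSup_deg⟩
  · intro e b hb
    simp only [LinearMap.comp_apply, Y.lift_of_mem hb, Finsupp.lapply_apply,
      Finsupp.single_eq_same]
    exact vfld_omega_zero_vac Y b
  · intro e e' hee b hb
    simp only [LinearMap.comp_apply, Y.lift_of_mem hb, Finsupp.lapply_apply]
    rw [Finsupp.single_eq_of_ne hee]
    simp

/-- The translation operator. -/
def vT (Y : FieldMap U U.rep) : Module.End ℂ (V) :=
  (LinearMap.applyₗ (U.vac)) ∘ₗ (LinearMap.applyₗ (omega 1)) ∘ₗ Y.fld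

theorem vT_apply (b : V) :
    vT Y b = Y.fld b (omega 1) (U.vac) := rfl

theorem vT_vac : vT Y (U.vac) = 0 := by
  rw [vT_apply, Y.fld_vac, idField_apply, res_omega, if_neg one_ne_zero, zero_smul]

/-- At `Ω¹` the left multiplication has one term more than at `Ω⁰`, because `u Ω¹ = Ω⁰`; this term
is `-∂x` applied to `b`. -/
theorem vT_act (x : (g ⊗[ℂ] RavK) × ℂ) (b : V) :
    vT Y (U.ρ x b) = U.ρ x (vT Y b) - U.ρ (affineD g x) b := by
  have h1 : ∀ {d e : Bideg} {x : (g ⊗[ℂ] RavK) × ℂ} {b : V},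
      x ∈ (𝔤.affine h).deg d → b ∈ U.deg e → vT Y (U.ρ x b)
        = U.ρ x (vT Y b) - U.ρ (affineD g x) b := by
    intro d e x b hx hb
    have := Y.fld_act_omega_one cur_xp_vac hx hb
    rwa [vfld_omega_zero_vac] at this
  generalize vT Y = G at *
  refine IsGrading.induction (𝔤.affine h).isGrading (P := fun x => G (U.ρ x b)
    = U.ρ x (G b) - U.ρ (affineD g x) b) ?_ ?_ ?_ x
  · rw [map_zero, map_zero, map_zero, LinearMap.zero_apply, LinearMap.zero_apply, map_zero, sub_zero]
  · intro x y hx hy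
    rw [map_add, map_add, map_add, LinearMap.add_apply, LinearMap.add_apply, LinearMap.add_apply,
      map_add, hx, hy]; abel
  intro d x hx
  refine U.induction (P := fun b => G (U.ρ x b)
    = U.ρ x (G b) - U.ρ (affineD g x) b) ?_ ?_ ?_ b
  · rw [map_zero, map_zero, map_zero, map_zero, sub_zero]
  · intro b c hb hc
    rw [map_add, map_add, map_add, map_add, map_add, hb, hc]; abel
  intro e b hb
  exact h1 hx hb

theorem vT_mem {e : Bideg} {b : V} (hb : b ∈ U.deg e) :
    vT Y b ∈ U.deg e := by
  refine PreVac.deg_induction (P := fun e b => vT Y b ∈ U.deg e)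
    (fun e => by rw [map_zero]; exact zero_mem _)
    (fun hb hc => by rw [map_add]; exact add_mem hb hc)
    (fun c hb => by rw [map_smul]; exact Submodule.smul_mem _ _ hb) ?_ ?_ hb
  · rw [vT_vac]; exact zero_mem _
  · intro p x e b hx hb ih
    rw [vT_act]
    exact sub_mem (PreVac.act_mem hx.mem ih) (PreVac.act_mem (affineD_mem hx.mem) hb)

/-- On residues, `∂_w` becomes minus precomposition with `∂`. The induction starts from `res ∘ ∂ =
0`, and its step is the integration by parts `SmRep.op_comp_deriv`. -/
theorem FieldMap.fld_vT {R : SmRep 𝔤 h M} (X : FieldMap U R) (b : V) :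
    X.fld (vT Y b) = -(X.fld b ∘ₗ deriv) := by
  refine U.induction (P := fun b => X.fld (vT Y b) = -(X.fld b ∘ₗ deriv))
    (by simp) (fun b c hb hc => by simp only [map_add, hb, hc, LinearMap.add_comp]; abel) ?_ b
  intro e b hb
  refine PreVac.deg_induction (P := fun e b => X.fld (vT Y b) = -(X.fld b ∘ₗ deriv))
    (by simp) (fun hb hc => by simp only [map_add, hb, hc, LinearMap.add_comp]; abel)
    (fun c hb => by simp only [map_smul, hb, LinearMap.smul_comp, smul_neg]) ?_ ?_ hb
  · rw [vT_vac, map_zero, X.fld_vac]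
    refine LinearMap.ext fun β => LinearMap.ext fun v => ?_
    simp [idField_apply, res_deriv]
  · intro p x e b hx hb ih
    rw [vT_act, map_sub, X.fld_act hx.mem (vT_mem Y hb), X.fld_act (affineD_mem hx.mem) hb, ih,
      X.fld_act hx.mem hb, SmRep.op_comp_deriv _ _ _ _ (X.isSm_fld b), map_neg]
    abel

end Vacuum

/-! ### Homogeneity of the modes -/

section Graded

variable {Γ : Type v} [AddCommGroup Γ] {π : Bideg →+ Γ} {D : Γ → Submodule ℂ M}

/-- The subspace of operators of a given degree. -/
def degEnd (D : Γ → Submodule ℂ M) (γ : Γ) : Submodule ℂ (Module.End ℂ M) where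
  carrier := {f | ∀ δ, ∀ v ∈ D δ, f v ∈ D (γ + δ)}
  add_mem' hf hf' δ v hv := add_mem (hf δ v hv) (hf' δ v hv)
  zero_mem' _ _ _ := zero_mem _
  smul_mem' c _ hf δ v hv := Submodule.smul_mem _ c (hf δ v hv)

theorem SmRep.opL_mem {R : SmRep 𝔤 h M}
    (hR : ∀ {d : Bideg} {x : (g ⊗[ℂ] RavK) × ℂ}, x ∈ (𝔤.affine h).deg d → R.ρ x ∈ degEnd D (π d))
    {d e : Bideg} {x : (g ⊗[ℂ] RavK) × ℂ} (hx : x ∈ (𝔤.affine h).deg d) {C : Op M} (hC : IsSm C)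
    (hCe : ∀ {r : ℤ} {β : RavK}, β ∈ RavK.deg r → C β ∈ degEnd D (π (e + (r, 0))))
    {r : ℤ} {β : RavK} (hβ : β ∈ RavK.deg r) :
    R.opL x C β ∈ degEnd D (π (d + e + (r, 0))) := by
  intro δ v hv
  rw [opL_apply]
  refine evsum_mem _ (opL_evZero x hC β v) fun n => Submodule.smul_mem _ _ ?_
  have h1 : mul (xp n) β ∈ RavK.deg r := by
    simpa using RavK.mul_mem (mem_deg_zero (α := xp n) rfl) hβ
  rw [add_assoc d, map_add π d, add_assoc]
  exact hR (dp_affineD_mem hx n) _ _ (hCe h1 _ _ hv)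

theorem SmRep.opS_mem {R : SmRep 𝔤 h M}
    (hR : ∀ {d : Bideg} {x : (g ⊗[ℂ] RavK) × ℂ}, x ∈ (𝔤.affine h).deg d → R.ρ x ∈ degEnd D (π d))
    {d e : Bideg} {x : g ⊗[ℂ] RavK} (hx : x ∈ 𝔤.currentDeg d) {C : Op M}
    (hCe : ∀ {r : ℤ} {β : RavK}, β ∈ RavK.deg r → C β ∈ degEnd D (π (e + (r, 0))))
    {r : ℤ} {β : RavK} (hβ : β ∈ RavK.deg r) :
    R.opS d x C β ∈ degEnd D (π (d + e + (r, 0))) := by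
  rw [opS_apply]
  refine Submodule.smul_mem _ _ ?_
  induction hx using Submodule.span_induction with
  | zero => simp
  | add x y _ _ hx hy => rw [map_add R.opR]; exact add_mem hx hy
  | smul c x _ hx => rw [map_smul]; exact Submodule.smul_mem _ _ hx
  | mem x hx =>
    obtain ⟨A, hA, ξ, hξ, rfl⟩ := hx
    intro δ v hv
    rw [opR_tmul, opRPure_apply]
    refine evsum_mem _ (opR_evZero A ξ C _ v) fun n => ?_
    have h1 := RavK.mul_mem (twist_ofSeries_mem (dp_deriv_mem hξ n)) (sgn_mem d.2 hβ)
    have h2 : R.cur A (xp n) v ∈ D (π (0, d.2) + δ) :=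
      hR (toAffine_mem (h := h) hA (mem_deg_zero (α := xp n) rfl)) _ _ hv
    have h3 := hCe h1 _ _ h2
    rw [← add_assoc, ← map_add] at h3
    have h4 : ((e + (d.1 + r, 0)) + (0, d.2) : Bideg) = d + e + (r, 0) := by
      ext <;> simp <;> ring
    rwa [h4] at h3

/-- The shift by `(1, 0)` is the degree of the residue; the degree of the test element `β` is added
back. -/
theorem FieldMap.fld_mem {U : VacMod 𝔤 h V} {R : SmRep 𝔤 h M} (X : FieldMap U R)
    (hR : ∀ {d : Bideg} {x : (g ⊗[ℂ] RavK) × ℂ}, x ∈ (𝔤.affine h).deg d → R.ρ x ∈ degEnd D (π d))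
    {e : Bideg} {b : V} (hb : b ∈ U.deg e) {r : ℤ} {β : RavK}
    (hβ : β ∈ RavK.deg r) : X.fld b β ∈ degEnd D (π ((e - (1, 0)) + (r, 0))) := by
  refine PreVac.deg_induction (P := fun e b => ∀ {r : ℤ} {β : RavK}, β ∈ RavK.deg r →
    X.fld b β ∈ degEnd D (π ((e - (1, 0)) + (r, 0)))) ?_ ?_ ?_ ?_ ?_ hb hβ
  · intro e r β _; simp
  · intro e b c hb hc r β hβ; rw [map_add (X.fld)]; exact add_mem (hb hβ) (hc hβ)
  · intro e b c hb r β hβ; rw [map_smul]; exact Submodule.smul_mem _ _ (hb hβ)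
  · intro r β hβ δ v hv
    rw [X.fld_vac, idField_apply]
    by_cases hr : r = 1
    · subst hr
      refine Submodule.smul_mem _ _ ?_
      have h4 : ((0 - (1, 0)) + (1, 0) : Bideg) = 0 := by simp
      rw [h4, map_zero, zero_add]
      exact hv
    · rw [res, LinearMap.comp_apply, LinearMap.snd_apply, RavK.snd_eq_zero_of_mem hr hβ]
      simp
  · intro p x e b hx hb ih r β hβ
    rw [X.fld_act hx.mem hb, SmRep.op_apply, LinearMap.sub_apply, LinearMap.smul_apply,
      add_sub_assoc]
    exact sub_mem (SmRep.opL_mem hR hx.mem (X.isSm_fld b) ih hβ)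
      (Submodule.smul_mem _ _ (SmRep.opS_mem hR (hx.mem (h := h)).1 ih hβ))

end Graded

/-! ### Commutation with `κ` -/

theorem SmRep.cur_kappa {R : SmRep 𝔤 h M} {p r : ZMod 2} {A : g} (hA : A ∈ 𝔤.par p) {α : RavK}
    (hα : IsPar r α) : R.cur A α * R.ρ (LieSuperalgebra.kappa g)
      = koszul 1 (p + r) • (R.ρ (LieSuperalgebra.kappa g) * R.cur A α) := by
  obtain ⟨n, rfl, hn⟩ := exists_deg_of_isPar hα
  have := R.br (toAffine_mem (h := h) hA hn) kappa_mem
  rw [affine_br_kappa, map_zero] at this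
  have e : tot ((1, 0) : Bideg) = 1 := by simp [tot]
  rw [e, koszul_comm] at this
  rw [add_comm p]
  exact sub_eq_zero.1 this.symm

/-- The total parity of `κ` is odd, so its supercommutator with itself is `2κ²`, and `κ` is central.
-/
theorem SmRep.kappa_kappa {R : SmRep 𝔤 h M} :
    R.ρ (LieSuperalgebra.kappa g) * R.ρ (LieSuperalgebra.kappa g) = 0 := by
  have := R.br (kappa_mem (h := h)) kappa_mem
  have e : koszul (tot ((1, 0) : Bideg)) (tot ((1, 0) : Bideg)) = -1 := by simp [tot, koszul]
  rw [affine_br_kappa, map_zero, e, neg_one_smul, sub_neg_eq_add, ← two_smul ℂ] at this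
  exact (smul_eq_zero.1 this.symm).resolve_left two_ne_zero

end

/-! ### Normal-ordered products -/

section Tri

variable {M : Type w} [AddCommGroup M] [Module ℂ M]

/-- The product `C(w)_+ D(w)`. -/
def tri (C D : Op M) : Op M := LinearMap.mk₂ ℂ
  (fun β v => evsum fun n => C (omega n) (D (mul (xp n) β) v))
  (fun _ _ _ => by simp [evsum_add])
  (fun c _ _ => by simp [evsum_smul])
  (fun _ _ _ => by simp [evsum_add])
  (fun c _ _ => by simp [evsum_smul])

theorem tri_apply (C D : Op M) (β : RavK) (v : M) :
    tri C D β v = evsum fun n => C (omega n) (D (mul (xp n) β) v) := rfl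

theorem tri_evZero (C : Op M) {D : Op M} (hD : IsSm D) (β : RavK) (v : M) :
    EvZero fun n => C (omega n) (D (mul (xp n) β) v) := (hD.evZero β v).map fun n => C (omega n)

theorem tri_congr_left {C C' : Op M} (h : ∀ n, C (omega n) = C' (omega n)) (D : Op M) :
    tri C D = tri C' D := by
  refine LinearMap.ext fun β => LinearMap.ext fun v => ?_
  simp only [tri_apply, h]

theorem tri_omega (C D : Op M) (n : ℕ) :
    tri C D (omega n) = ∑ ij ∈ antidiagonal n, C (omega ij.1) * D (omega ij.2) := by
  refine LinearMap.ext fun v => ?_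
  rw [tri_apply, evsum_eq (N := n + 1) fun k hk => by
    rw [xp_mul_omega, if_neg (by omega)]; simp, LinearMap.sum_apply]
  rw [Finset.Nat.sum_antidiagonal_eq_sum_range_succ_mk]
  refine Finset.sum_congr rfl fun k hk => ?_
  rw [Finset.mem_range] at hk
  rw [xp_mul_omega, if_pos (by omega)]
  rfl

/-- `tri` reads its left factor only at the `Ωⁿ`, and there `tri C D` is the Cauchy product of the
creation modes; so it is associative like multiplication by power series. -/
theorem tri_tri (C D : Op M) {F : Op M} (hF : IsSm F) :
    tri (tri C D) F = tri C (tri D F) := by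
  refine LinearMap.ext fun β => LinearMap.ext fun v => ?_
  have e1 : tri C (tri D F) β v = evsum fun i => evsum fun j =>
      C (omega i) (D (omega j) (F (mul (xp (i + j)) β) v)) := by
    rw [tri_apply]
    congr 1; ext i
    rw [tri_apply, map_evsum _ (tri_evZero D hF _ v)]
    simp only [xp_mul_mul, add_comm]
  rw [e1, evsum_evsum, tri_apply]
  · congr 1; ext n
    rw [tri_omega, LinearMap.sum_apply]
    refine Finset.sum_congr rfl fun ij hij => ?_
    rw [← mem_antidiagonal.1 hij]; rfl
  · obtain ⟨N, hN⟩ := hF.evZero β v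
    refine ⟨N, fun i j hij => ?_⟩
    show C _ (D _ (F (mul (xp (i + j)) β) v)) = 0
    rw [show F (mul (xp (i + j)) β) v = 0 from hN _ hij]; simp

/-- The factor `f` may be absorbed into the creation part of `C`: both sides collect the same double
sum, since `f Ωⁿ = ∑ fᵢ Ωⁿ⁻ⁱ`. -/
theorem tri_series_mul (C : Op M) {D : Op M} (hD : IsSm D) (f : PowerSeries ℂ) (β : RavK) (v : M) :
    tri C D (mul (ofSeries f) β) v
      = evsum fun n => C (mul (ofSeries f) (omega n)) (D (mul (xp n) β) v) := by
  have e1 : tri C D (mul (ofSeries f) β) v = evsum fun i => evsum fun j =>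
      PowerSeries.coeff j f • C (omega i) (D (mul (xp (i + j)) β) v) := by
    rw [tri_apply]
    congr 1; ext i
    have hz : EvZero fun j => PowerSeries.coeff j f • D (mul (xp j) (mul (xp i) β)) v :=
      (hD.evZero _ v).smul _
    rw [mul_left_comm', hD.apply_series, map_evsum _ hz]
    simp only [map_smul, xp_mul_mul, add_comm]
  rw [e1, evsum_evsum]
  · congr 1; ext n
    rw [ofSeries_mul_omega, map_sum, LinearMap.sum_apply, ← Finset.Nat.sum_antidiagonal_swap,
      Finset.Nat.sum_antidiagonal_eq_sum_range_succ_mk]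
    refine Finset.sum_congr rfl fun i hi => ?_
    rw [Finset.mem_range] at hi
    simp only [Prod.swap_prod_mk, map_smul, LinearMap.smul_apply]
    rw [show n - i + i = n by omega]
  · obtain ⟨N, hN⟩ := hD.evZero β v
    refine ⟨N, fun i j hij => ?_⟩
    show _ • C _ (D (mul (xp (i + j)) β) v) = 0
    rw [show D (mul (xp (i + j)) β) v = 0 from hN _ hij]; simp

theorem tri_smul_left (c : ℂ) (C D : Op M) : tri (c • C) D = c • tri C D := by
  refine LinearMap.ext fun β => LinearMap.ext fun v => ?_
  simp [tri_apply, evsum_smul]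

theorem tri_smul_right (c : ℂ) (C D : Op M) : tri C (c • D) = c • tri C D := by
  refine LinearMap.ext fun β => LinearMap.ext fun v => ?_
  simp [tri_apply, evsum_smul]

theorem tri_add_left (C C' D : Op M) : tri (C + C') D = tri C D + tri C' D := by
  refine LinearMap.ext fun β => LinearMap.ext fun v => ?_
  simp [tri_apply, evsum_add]

theorem tri_add_right (C D D' : Op M) : tri C (D + D') = tri C D + tri C D' := by
  refine LinearMap.ext fun β => LinearMap.ext fun v => ?_
  simp [tri_apply, evsum_add]

theorem proj0_omega (n : ℕ) : proj0 (omega n) = 0 := by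
  ext1 <;> simp [proj0, omega]

theorem proj0_ofSeries (f : PowerSeries ℂ) : proj0 (ofSeries f) = ofSeries f := by
  ext1 <;> simp [proj0, ofSeries]

theorem RavK.IsPar.proj0_eq_zero {α : RavK} (h : IsPar 1 α) : proj0 α = 0 := by
  ext1 <;> simp [proj0, h.2 rfl]

theorem xp_mul_proj0 (n : ℕ) (β : RavK) : mul (xp n) (proj0 β) = proj0 (mul (xp n) β) := by
  ext1 <;> simp [proj0, mul, xp, ofSeries]

theorem tri_comp_proj0 (C D : Op M) : tri C (D ∘ₗ proj0) = tri C D ∘ₗ proj0 := by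
  refine LinearMap.ext fun β => LinearMap.ext fun v => ?_
  simp [tri_apply, xp_mul_proj0]

/-- The normal-ordered product, `c` being the sign for exchanging `C` and `D`. -/
def nop (c : ℂ) (C D : Op M) : Op M := tri C D + c • (tri D C ∘ₗ proj0)

theorem nop_add_left (c : ℂ) (C C' D : Op M) : nop c (C + C') D = nop c C D + nop c C' D := by
  rw [nop, nop, nop, tri_add_left, tri_add_right, LinearMap.add_comp, smul_add]; abel

theorem nop_smul_left (c c' : ℂ) (C D : Op M) : nop c (c' • C) D = c' • nop c C D := by
  rw [nop, nop, tri_smul_left, tri_smul_right, LinearMap.smul_comp, smul_add, smul_comm c]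

theorem nop_zero_left (c : ℂ) (D : Op M) : nop c 0 D = 0 := by
  simpa using nop_smul_left c 0 0 D

theorem nop_omega (c : ℂ) (C D : Op M) (n : ℕ) : nop c C D (omega n) = tri C D (omega n) := by
  simp [nop, proj0_omega]

theorem nop_apply_of_isPar (c : ℂ) (C D : Op M) {β : RavK} (hβ : IsPar 1 β) :
    nop c C D β = tri C D β := by
  simp [nop, hβ.proj0_eq_zero]

theorem nop_series (c : ℂ) (C D : Op M) (f : PowerSeries ℂ) :
    nop c C D (ofSeries f) = tri C D (ofSeries f) + c • tri D C (ofSeries f) := by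
  simp [nop, proj0_ofSeries]

/-- The creation parts of `C` and `D` commute up to the sign `c`. -/
def CreationComm (c : ℂ) (C D : Op M) : Prop :=
  ∀ i j, C (omega i) * D (omega j) = c • (D (omega j) * C (omega i))

theorem CreationComm.tri_omega {c : ℂ} {C D : Op M} (hc : CreationComm c C D) (n : ℕ) :
    tri C D (omega n) = c • tri D C (omega n) := by
  rw [Raviolo.tri_omega, Raviolo.tri_omega, Finset.smul_sum, ← Finset.Nat.sum_antidiagonal_swap]
  exact Finset.sum_congr rfl fun ij _ => hc _ _

theorem CreationComm.tri_tri {c : ℂ} {C D : Op M} (hc : CreationComm c C D) (F : Op M) :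
    tri (tri C D) F = c • tri (tri D C) F := by
  rw [← tri_smul_left]
  exact tri_congr_left (fun n => hc.tri_omega n) F

/-- Associativity of the normal-ordered product. -/
theorem nop_nop {c₁ c₂ c₃ : ℂ} {C D F : Op M} (hC : IsSm C) (hD : IsSm D) (hF : IsSm F)
    (h2 : CreationComm c₂ C F) (h3 : CreationComm c₃ D F) :
    nop (c₁ * c₂) C (nop c₃ D F) = nop (c₂ * c₃) (nop c₁ C D) F := by
  -- Only creation modes are read in a left factor, so `C` and `F` may be exchanged there at the
  -- cost of `c₂`. The same device, with `D` and `F`, gives `e2`.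
  have e1 : tri C (nop c₃ D F) = tri (tri C D) F + (c₃ * c₂) • tri F (tri C D) ∘ₗ proj0 := by
    rw [nop, tri_add_right, tri_smul_right, tri_comp_proj0, ← tri_tri C D hF, ← tri_tri C F hD,
      h2.tri_tri, tri_tri F C hD, LinearMap.smul_comp, smul_smul]
  have e2 : tri (nop c₃ D F) C = c₃ • tri F (tri D C) := by
    rw [tri_congr_left (nop_omega c₃ D F), h3.tri_tri, tri_tri F D hC]
  have e3 : tri F (nop c₁ C D) = tri F (tri C D) + c₁ • tri F (tri D C) ∘ₗ proj0 := by
    rw [nop, tri_add_right, tri_smul_right, tri_comp_proj0]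
  have e4 : ∀ G : Op M, (G ∘ₗ proj0) ∘ₗ proj0 = G ∘ₗ proj0 := fun G => rfl
  rw [nop, nop.eq_1 (c₂ * c₃), e1, e2, tri_congr_left (nop_omega c₁ C D), e3]
  simp only [LinearMap.add_comp, LinearMap.smul_comp, e4, smul_add, smul_smul]
  module

end Tri

/-! ### Supercommuting creation modes and the fields of the generators. -/

section

variable {g : Type u} [AddCommGroup g] [Module ℂ g] {𝔤 : LieSuperalgebra g} {h : InvariantForm 𝔤}
  {V : Type u} [AddCommGroup V] [Module ℂ V] {M : Type w} [AddCommGroup M] [Module ℂ M]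

theorem currentBr_deg_one {p q : ZMod 2} {x y : g ⊗[ℂ] RavK} (hx : x ∈ 𝔤.currentDeg (1, p))
    (hy : y ∈ 𝔤.currentDeg (1, q)) : 𝔤.currentBr x y = 0 ∧ 𝔤.currentCocycle h x y = 0 := by
  constructor
  · refine 𝔤.current_ext₂ 𝔤.currentBr 0 (fun A hA α hα B hB β hβ => ?_) hx hy
    rw [𝔤.currentBr_tmul A hα hB, RavK.mul_eq_zero (RavK.fst_eq_zero_of_mem one_ne_zero hα)
      (RavK.fst_eq_zero_of_mem one_ne_zero hβ)]
    simp
  · exact 𝔤.currentCocycle_eq_zero h (by simp) hx hy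

/-- The part of `ĝ_h` in cohomological degree one is abelian: `𝒦¹ · 𝒦¹ = 0` kills the bracket, and
the cocycle lives in total degree `1`, not `2`. -/
theorem SmRep.creation_comm {R : SmRep 𝔤 h M} {p q : ZMod 2} {x y : (g ⊗[ℂ] RavK) × ℂ}
    (hx : x ∈ (𝔤.affine h).deg (1, p)) (hy : y ∈ (𝔤.affine h).deg (1, q)) :
    R.ρ x * R.ρ y = koszul (1 + p) (1 + q) • (R.ρ y * R.ρ x) := by
  have h1 := R.br hx hy
  have h2 : (𝔤.affine h).br x y = 0 := by
    show 𝔤.affineBr h _ _ = _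
    rw [LieSuperalgebra.affineBr_apply, (currentBr_deg_one (h := h) hx.1 hy.1).1,
      (currentBr_deg_one hx.1 hy.1).2]
    simp
  rw [h2, map_zero] at h1
  have e : ∀ p : ZMod 2, tot ((1, p) : Bideg) = 1 + p := fun p => by simp [tot]
  rw [e, e] at h1
  exact sub_eq_zero.1 h1.symm

theorem tot_one (p : ZMod 2) : tot ((1, p) : Bideg) = 1 + p := by simp [tot]

theorem SmRep.opR_omega_omega {R : SmRep 𝔤 h M} {p : ZMod 2} {y : g ⊗[ℂ] RavK}
    (hy : y ∈ 𝔤.currentDeg (1, p)) (C : Op M) {β : RavK} (hβ : IsPar 1 β) : R.opR y C β = 0 := by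
  induction hy using Submodule.span_induction with
  | zero => simp
  | add x y _ _ hx hy => rw [map_add, LinearMap.add_apply, LinearMap.add_apply, hx, hy, add_zero]
  | smul c x _ hx => rw [map_smul, LinearMap.smul_apply, LinearMap.smul_apply, hx, smul_zero]
  | mem y hy =>
    obtain ⟨A, hA, ξ, hξ, rfl⟩ := hy
    refine LinearMap.ext fun v => ?_
    rw [opR_tmul, opRPure_apply]
    have : ∀ n, mul (twist (dp RavK.deriv n ξ)) β = 0 := fun n =>
      RavK.mul_eq_zero (RavK.fst_eq_zero_of_mem one_ne_zero
        (twist_ofSeries_mem (dp_deriv_mem hξ n))) (hβ.2 rfl)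
    simp [this]

/-- On `𝒦¹` the right term of a degree-one element evaluates `C` at a product of two elements of
`𝒦¹`, hence vanishes. -/
theorem SmRep.op_deg_one {R : SmRep 𝔤 h M} {p c : ZMod 2} {x : (g ⊗[ℂ] RavK) × ℂ}
    (hx : x ∈ (𝔤.affine h).deg (1, p)) (C : Op M) {β : RavK} (hβ : IsPar 1 β) :
    R.op (1, p) c x C β = R.opL x C β := by
  rw [op_apply, LinearMap.sub_apply, LinearMap.smul_apply, opS_apply,
    opR_omega_omega hx.1 C (IsPar.sgn p hβ), smul_zero, smul_zero, sub_zero]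

namespace FieldMap

variable {U : VacMod 𝔤 h V} {R : SmRep 𝔤 h M} (X : FieldMap U R)

theorem gen_creation_comm {p : ZMod 2} {x : (g ⊗[ℂ] RavK) × ℂ}
    (hx : x ∈ (𝔤.affine h).deg (1, p)) {e : Bideg} {b : V} (hb : b ∈ U.deg e) (j : ℕ) :
    R.ρ x * X.fld b (omega j) = koszul (1 + p) (tot e) • (X.fld b (omega j) * R.ρ x) := by
  refine PreVac.deg_induction (P := fun e b => ∀ j, R.ρ x * X.fld b (omega j)
    = koszul (1 + p) (tot e) • (X.fld b (omega j) * R.ρ x)) ?_ ?_ ?_ ?_ ?_ hb j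
  · intro e j; simp
  · intro e b c hb hc j
    rw [map_add, LinearMap.add_apply, mul_add, add_mul, hb, hc, smul_add]
  · intro e b c hb j
    rw [map_smul, LinearMap.smul_apply, mul_smul_comm, smul_mul_assoc, hb, smul_comm]
  · intro j
    refine LinearMap.ext fun v => ?_
    simp [fld_vac, idField, tot, koszul]
  · intro q y e b hy hb ih j
    rw [X.fld_act hy.mem hb, SmRep.op_deg_one hy.mem _ (isPar_omega j)]
    refine LinearMap.ext fun v => ?_
    simp only [Module.End.mul_apply, LinearMap.smul_apply]
    rw [SmRep.opL_apply, SmRep.opL_apply, map_evsum _ (SmRep.opL_evZero y (X.isSm_fld b) _ v),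
      ← evsum_smul]
    congr 1; ext n
    have h1 := SmRep.creation_comm (R := R) hx (dp_affineD_mem (hy.mem (h := h)) n)
    have h2 : R.ρ x * X.fld b (mul (xp n) (omega j))
        = koszul (1 + p) (tot e) • (X.fld b (mul (xp n) (omega j)) * R.ρ x) := by
      rw [xp_mul_omega]
      split_ifs
      · exact ih _
      · simp
    rw [map_smul, SmRep.tot_add, tot_one, koszul_add_right]
    have h3 := LinearMap.congr_fun h1 (X.fld b (mul (xp n) (omega j)) v)
    have h4 := LinearMap.congr_fun h2 v
    simp only [Module.End.mul_apply, LinearMap.smul_apply] at h3 h4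
    rw [h3, h4]
    simp only [map_smul, smul_smul]
    congr 1; ring

/-- By `SmRep.op_deg_one`, creation modes of a composite state are sums of products of degree-one
elements with creation modes of a shorter state, so induction over the monomial `a` reduces the
claim to `gen_creation_comm`. This is the commutativity on which `nop_nop` rests. -/
theorem creationComm {d e : Bideg} {a b : V} (ha : a ∈ U.deg d) (hb : b ∈ U.deg e) :
    CreationComm (koszul (tot d) (tot e)) (X.fld a) (X.fld b) := by
  intro i j
  refine PreVac.deg_induction (P := fun d a => ∀ i, X.fld a (omega i) * X.fld b (omega j)
    = koszul (tot d) (tot e) • (X.fld b (omega j) * X.fld a (omega i))) ?_ ?_ ?_ ?_ ?_ ha i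
  · intro e j; simp
  · intro e b c hb hc j
    rw [map_add, LinearMap.add_apply, mul_add, add_mul, hb, hc, smul_add]
  · intro e b c hb j
    rw [map_smul, LinearMap.smul_apply, mul_smul_comm, smul_mul_assoc, hb, smul_comm]
  · intro j
    refine LinearMap.ext fun v => ?_
    simp [fld_vac, idField, tot, koszul]
  · intro q y d a hy ha ih i
    rw [X.fld_act hy.mem ha, SmRep.op_deg_one hy.mem _ (isPar_omega i)]
    refine LinearMap.ext fun v => ?_
    simp only [Module.End.mul_apply, LinearMap.smul_apply]
    rw [SmRep.opL_apply, SmRep.opL_apply, map_evsum _ (SmRep.opL_evZero y (X.isSm_fld a) _ v),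
      ← evsum_smul]
    congr 1; ext n
    have h1 := X.gen_creation_comm (dp_affineD_mem (hy.mem (h := h)) n) hb j
    have h2 : X.fld a (mul (xp n) (omega i)) * X.fld b (omega j)
        = koszul (tot d) (tot e) • (X.fld b (omega j) * X.fld a (mul (xp n) (omega i))) := by
      rw [xp_mul_omega]
      split_ifs
      · exact ih _
      · simp
    rw [map_smul, SmRep.tot_add, tot_one, koszul_add_left]
    have h3 := LinearMap.congr_fun h1 (X.fld a (mul (xp n) (omega i)) v)
    have h4 := LinearMap.congr_fun h2 v
    simp only [Module.End.mul_apply, LinearMap.smul_apply] at h3 h4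
    rw [h4]
    simp only [map_smul, h3, smul_smul]
    congr 1; ring

/-! ### The fields of the generators -/

theorem fld_kappa_vac (β : RavK) : X.fld (U.ρ (LieSuperalgebra.kappa g) U.vac) β
    = res β • R.ρ (LieSuperalgebra.kappa g) := by
  rw [fld_kappa, fld_vac]
  refine LinearMap.ext fun v => ?_
  simp [idField]

/-- Applied to the identity field, `A ⊗ Ω⁰` reproduces the current: the left term gives its values
on `𝒦¹`, the right term those on monomials `uⁿ`. As both sides are fields, agreement on monomials
suffices. -/
theorem fld_mu_zero_vac {p : ZMod 2} {A : g} (hA : A ∈ 𝔤.par p) :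
    X.fld (U.ρ (LieSuperalgebra.toAffine (A ⊗ₜ omega 0)) U.vac) = R.cur A := by
  suffices H : ∀ v : M, ∀ β, X.fld (U.ρ (LieSuperalgebra.toAffine (A ⊗ₜ omega 0)) U.vac) β v
      = R.cur A β v from LinearMap.ext fun β => LinearMap.ext fun v => H v β
  intro v
  have := monomial_ext (M := M)
    (F := (X.fld (U.ρ (LieSuperalgebra.toAffine (A ⊗ₜ omega 0)) U.vac)).flip v)
    (G := (R.cur A).flip v) ?_ ?_ (X.isSm_fld _ v) (R.cur_isSm A v)
  · exact fun β => LinearMap.congr_fun this β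
  · intro n
    simp only [LinearMap.flip_apply]
    rw [X.fld_act (Gen.mu hA 0).mem PreVac.vac_mem,
      SmRep.op_deg_one (Gen.mu hA 0).mem _ (isPar_omega n), X.fld_vac, SmRep.opL_apply,
      evsum_eq_single n fun k hk => by
        rw [xp_mul_omega]
        split_ifs with hkn
        · rw [idField_apply, res_omega, if_neg (by omega)]; simp
        · simp]
    rw [xp_mul_omega, if_pos le_rfl, idField_apply, res_omega, if_pos (by omega), one_smul,
      dp_affineD_tmul, dp_deriv_omega, zero_add, Nat.choose_self, TensorProduct.tmul_smul, map_smul,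
      map_smul, LinearMap.smul_apply, smul_smul, Nat.cast_one, mul_one, ← mul_pow]
    simp [SmRep.cur_apply]
  · intro n
    simp only [LinearMap.flip_apply]
    rw [X.fld_act (Gen.mu hA 0).mem PreVac.vac_mem, X.fld_vac, SmRep.op_apply,
      LinearMap.sub_apply, LinearMap.smul_apply, LinearMap.sub_apply, LinearMap.smul_apply,
      SmRep.opL_apply]
    simp only [xp_mul_xp, idField_apply, res_xp, zero_smul, map_zero, smul_zero, evsum_zero]
    rw [SmRep.opS_apply, SmRep.sgn_apply _ (isPar_xp n)]
    show _ - _ • (_ • R.opR (A ⊗ₜ omega 0) _ _) v = _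
    rw [SmRep.opR_tmul, map_smul, LinearMap.smul_apply, LinearMap.smul_apply, SmRep.opRPure_apply,
      evsum_eq_single n fun k hk => by
        rw [dp_deriv_omega, map_smul, twist_omega, map_smul, map_smul, LinearMap.smul_apply,
          LinearMap.smul_apply, RavK.mul_comm', xp_mul_omega, idField_apply]
        split_ifs with hkn
        · rw [map_smul, map_smul, res_omega, if_neg (by omega)]; simp
        · simp]
    rw [dp_deriv_omega, map_smul, twist_omega, map_smul, map_smul, LinearMap.smul_apply,
      LinearMap.smul_apply, RavK.mul_comm', xp_mul_omega, idField_apply, if_pos (by omega), map_smul,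
      map_smul, res_omega, if_pos (by omega), tot_one]
    -- The Koszul signs of `op` and `opS` multiply to `-1`, which cancels the minus sign in front of
    -- the right term.
    have h1 : koszul (1 + p) (tot 0 + 1) * koszul p 1 = -1 := by
      have := LieSuperalgebra.par_cases p
      rcases this with rfl | rfl
      · simp [koszul, tot]
      · simp [koszul, tot, show (1 : ZMod 2) + 1 = 0 from rfl]
    have h2 : ((-1 : ℂ) ^ n) * (-1) ^ n = 1 := by rw [← mul_pow]; simp
    simp only [koszul_comm p 0, koszul_zero_left, smul_eq_mul, mul_one, zero_add,
      Nat.choose_self, Nat.cast_one, smul_smul, zero_sub]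
    rw [Int.cast_one, ← mul_assoc (koszul _ _), h1]
    rw [neg_one_mul, h2]; simp

end FieldMap

end

/-! ### Fields of composite states as normal-ordered products. -/

section

variable {g : Type u} [AddCommGroup g] [Module ℂ g] {𝔤 : LieSuperalgebra g} {h : InvariantForm 𝔤}
  {V : Type u} [AddCommGroup V] [Module ℂ V] {M : Type w} [AddCommGroup M] [Module ℂ M]

theorem nop_idField_left (C : Op M) : nop 1 (idField M) C = C := by
  refine LinearMap.ext fun β => LinearMap.ext fun v => ?_
  have e1 : ∀ β, tri (idField M) C β v = C β v := fun β => by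
    rw [tri_apply, evsum_eq_single 0 fun k hk => by simp [idField_apply, res_omega, hk]]
    rw [idField_apply, res_omega, if_pos rfl, one_smul, xp_zero_mul]
  have e2 : ∀ f, tri C (idField M) (ofSeries f) v = 0 := fun f => by
    rw [tri_apply]
    simp [idField_apply, xp_mul_ofSeries, res_ofSeries]
  rw [nop, LinearMap.add_apply, LinearMap.add_apply, e1, LinearMap.smul_apply,
    LinearMap.comp_apply, LinearMap.smul_apply, show proj0 β = ofSeries β.1 from rfl, e2]
  simp

theorem SmRep.opL_eq_tri (R : SmRep 𝔤 h M) (x : (g ⊗[ℂ] RavK) × ℂ) {G : Op M}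
    (hG : ∀ n, G (omega n) = (-1 : ℂ) ^ n • R.ρ (dp (affineD g) n x)) (C : Op M) :
    R.opL x C = tri G C := by
  refine LinearMap.ext fun β => LinearMap.ext fun v => ?_
  rw [opL_apply, tri_apply]
  simp only [hG, LinearMap.smul_apply]

namespace FieldMap

variable {U : VacMod 𝔤 h V} {R : SmRep 𝔤 h M} (X : FieldMap U R)

theorem fld_gen_omega {p : ZMod 2} {x : (g ⊗[ℂ] RavK) × ℂ} (hx : x ∈ (𝔤.affine h).deg (1, p))
    (n : ℕ) : X.fld (U.ρ x U.vac) (omega n) = (-1 : ℂ) ^ n • R.ρ (dp (affineD g) n x) := by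
  refine LinearMap.ext fun v => ?_
  rw [X.fld_act hx PreVac.vac_mem, SmRep.op_deg_one hx _ (isPar_omega n), X.fld_vac,
    SmRep.opL_apply, evsum_eq_single n fun k hk => by
      rw [xp_mul_omega]
      split_ifs with hkn
      · rw [idField_apply, res_omega, if_neg (by omega)]; simp
      · simp]
  rw [xp_mul_omega, if_pos le_rfl, idField_apply, res_omega, if_pos (by omega), one_smul]
  rfl

theorem fld_mu_xp {p : ZMod 2} {A : g} (hA : A ∈ 𝔤.par p) (l n : ℕ) :
    X.fld (U.ρ (LieSuperalgebra.toAffine (A ⊗ₜ omega l)) U.vac) (xp n)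
      = if l ≤ n then ((-1) ^ l * n.choose l : ℂ) • R.cur A (xp (n - l)) else 0 := by
  refine LinearMap.ext fun v => ?_
  have hsgn : koszul (1 + p) (tot 0 + 1) * koszul p ((1 : ℤ) : ZMod 2) = -1 := by
    rcases LieSuperalgebra.par_cases p with rfl | rfl
    · simp [koszul, tot]
    · simp [koszul, tot, show (1 : ZMod 2) + 1 = 0 from rfl]
  have h0 : R.opL (LieSuperalgebra.toAffine (A ⊗ₜ omega l)) (idField M) (xp n) v = 0 := by
    rw [SmRep.opL_apply]
    simp only [xp_mul_xp, idField_apply, res_xp, zero_smul, map_zero, smul_zero, evsum_zero]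
  have h1 : R.opR (A ⊗ₜ omega l) (idField M) (xp n) v
      = if l ≤ n then ((-1) ^ l * n.choose l : ℂ) • R.cur A (xp (n - l)) v else 0 := by
    have hk : ∀ k, idField M (mul (twist (dp RavK.deriv k (omega l))) (xp n)) (R.cur A (xp k) v)
        = if l + k = n then ((-1) ^ l * n.choose l : ℂ) • R.cur A (xp k) v else 0 := fun k => by
      rw [dp_deriv_omega, map_smul, twist_omega, map_smul, map_smul, LinearMap.smul_apply,
        LinearMap.smul_apply, RavK.mul_comm', xp_mul_omega, idField_apply]
      have e : ((-1 : ℂ)) ^ k * (-1) ^ k = 1 := by rw [← mul_pow]; simp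
      split_ifs with hkn hkn' hkn'
      · subst hkn'
        rw [map_smul, map_smul, res_omega, if_pos (by omega), Nat.choose_symm_add, smul_eq_mul,
          smul_eq_mul, mul_one, pow_add]
        congr 1; linear_combination (-1 : ℂ) ^ l * ((l + k).choose k : ℂ) * e
      · rw [map_smul, map_smul, res_omega, if_neg (by omega)]; simp
      · omega
      · simp
    rw [SmRep.opR_tmul, SmRep.opRPure_apply]
    simp only [hk]
    split_ifs with hln
    · rw [evsum_eq_single (n - l) fun k hk => if_neg (by omega), if_pos (by omega)]
    · exact (congrArg evsum (funext fun k => if_neg (by omega))).trans evsum_zero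
  rw [X.fld_act (Gen.mu hA l).mem PreVac.vac_mem, X.fld_vac, SmRep.op_apply,
    LinearMap.sub_apply, LinearMap.smul_apply, LinearMap.sub_apply, LinearMap.smul_apply, h0,
    SmRep.opS_apply, SmRep.sgn_apply _ (isPar_xp n), koszul_comm p 0, koszul_zero_left, one_smul,
    LinearMap.smul_apply, smul_smul, tot_one]
  rw [show koszul ((1, p) : Bideg).2 (((1, p) : Bideg).1 : ZMod 2) = koszul p ((1 : ℤ) : ZMod 2) from rfl, hsgn]
  show 0 - (-1 : ℂ) • R.opR (A ⊗ₜ omega l) (idField M) (xp n) v = _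
  rw [h1]
  split_ifs <;> simp

/-- On power series, right multiplication by `A ⊗ Ωˡ` is the creation part of `C` times the
annihilation part of the `l`-th divided derivative of the current. The first `l` terms of the left
sum vanish, whence the index shift by `l`. -/
theorem tri_fld_mu {p : ZMod 2} {A : g} (hA : A ∈ 𝔤.par p) (l : ℕ) (C : Op M)
    (f : PowerSeries ℂ) (v : M) :
    tri C (X.fld (U.ρ (LieSuperalgebra.toAffine (A ⊗ₜ omega l)) U.vac)) (ofSeries f) v
      = R.opR (A ⊗ₜ omega l) C (ofSeries f) v := by
  have hf : ofSeries f = mul (ofSeries f) (xp 0) := by rw [RavK.mul_comm', xp_zero_mul]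
  rw [SmRep.opR_tmul, SmRep.opRPure_apply, hf, tri_series_mul C (X.isSm_fld _)]
  simp only [xp_mul_xp, add_zero, X.fld_mu_xp hA]
  rw [evsum_shift l]
  · congr 1; ext k
    rw [if_pos (by omega), dp_deriv_omega, map_smul, twist_omega, ← hf, RavK.mul_comm' (ofSeries f)]
    have e : ((-1 : ℂ)) ^ k * (-1) ^ k = 1 := by rw [← mul_pow]; simp
    simp only [map_smul, LinearMap.smul_apply, smul_smul, Nat.add_sub_cancel_left]
    rw [Nat.choose_symm_add, pow_add]
    congr 1; linear_combination (-(-1 : ℂ) ^ l * ((l + k).choose k : ℂ)) * e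
  · intro k hk; rw [if_neg (by omega)]; simp
  · obtain ⟨N, hN⟩ := R.cur_isSm A v
    refine ⟨N + l, fun k hk => ?_⟩
    have := hN (PowerSeries.X ^ (k - l - N))
    rw [← pow_add, show N + (k - l - N) = k - l by omega] at this
    dsimp only
    rw [if_pos (by omega), LinearMap.smul_apply, show R.cur A (xp (k - l)) v = 0 from this]
    simp

/-- The left and right terms of `op` are the two halves of the normal-ordered product. On `𝒦¹` the
right term and the `proj0` term both vanish; on `𝒦⁰` they agree by `tri_fld_mu`, and for `κ` both
are zero since its field has no annihilation part. -/
theorem fld_gen_act {p : ZMod 2} {x : (g ⊗[ℂ] RavK) × ℂ} (hx : Gen 𝔤 p x) {e : Bideg} {b : V}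
    (hb : b ∈ U.deg e) : X.fld (U.ρ x b)
      = nop (koszul (1 + p) (tot e)) (X.fld (U.ρ x U.vac)) (X.fld b) := by
  rw [X.fld_act hx.mem hb, SmRep.op_apply, R.opL_eq_tri x (X.fld_gen_omega hx.mem)]
  refine SmRep.op_ext_par fun s β hβ => ?_
  rcases LieSuperalgebra.par_cases s with rfl | rfl
  swap
  · rw [nop_apply_of_isPar _ _ _ hβ, LinearMap.sub_apply, LinearMap.smul_apply, SmRep.opS_apply,
      SmRep.opR_omega_omega (hx.mem (h := h)).1 _ (IsPar.sgn p hβ), smul_zero, smul_zero, sub_zero]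
  rw [hβ.eq_ofSeries, nop_series, LinearMap.sub_apply, LinearMap.smul_apply, SmRep.opS_apply,
    SmRep.sgn_apply _ (isPar_ofSeries _)]
  refine LinearMap.ext fun v => ?_
  cases hx with
  | mu hA l =>
    rw [LinearMap.sub_apply, LinearMap.add_apply, LinearMap.smul_apply, LinearMap.smul_apply,
      LinearMap.smul_apply, X.tri_fld_mu hA, koszul_comm p 0, koszul_zero_left, one_smul, smul_smul, tot_one,
      sub_eq_add_neg, ← neg_smul]
    congr 2
    show -(koszul (1 + p) (tot e + 1) * koszul p ((1 : ℤ) : ZMod 2)) = _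
    rw [koszul_add_right, Int.cast_one, mul_assoc]
    have : koszul (1 + p) 1 * koszul p 1 = -1 := by
      rcases LieSuperalgebra.par_cases p with rfl | rfl
      · simp [koszul]
      · simp [koszul, show (1 : ZMod 2) + 1 = 0 from rfl]
    rw [this]; ring
  | kappa =>
    have : tri (X.fld b) (X.fld (U.ρ (LieSuperalgebra.kappa g) U.vac)) (ofSeries β.1) v = 0 := by
      rw [tri_apply]
      simp [X.fld_kappa_vac, xp_mul_ofSeries, res_ofSeries]
    rw [LinearMap.sub_apply, LinearMap.add_apply, LinearMap.smul_apply, LinearMap.smul_apply,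
      LinearMap.smul_apply, this]
    simp [LieSuperalgebra.kappa]

end FieldMap

section

variable {U : VacMod 𝔤 h V} (Y : FieldMap U U.rep)

theorem vfld_mem {d e : Bideg} {a b : V} (ha : a ∈ U.deg d) (hb : b ∈ U.deg e) {r : ℤ} {β : RavK}
    (hβ : β ∈ RavK.deg r) : Y.fld a β b ∈ U.deg (d - (1, 0) + (r, 0) + e) :=
  Y.fld_mem (π := AddMonoidHom.id Bideg) (D := U.deg)
    (fun hx _ _ hv => PreVac.act_mem hx hv) ha hβ _ _ hb

theorem vfld_xp_mem {d e : Bideg} {a b : V} (ha : a ∈ U.deg d) (hb : b ∈ U.deg e) (n : ℕ) :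
    Y.fld a (xp n) b ∈ U.deg (d - (1, 0) + e) := by
  have := vfld_mem Y ha hb (RavK.mem_deg_zero (α := xp n) rfl)
  rwa [show ((0, 0) : Bideg) = 0 from rfl, add_zero] at this

theorem vfld_omega_mem {d e : Bideg} {a b : V} (ha : a ∈ U.deg d) (hb : b ∈ U.deg e) (n : ℕ) :
    Y.fld a (omega n) b ∈ U.deg (d + e) := by
  have := vfld_mem Y ha hb (RavK.mem_deg_one (α := omega n) rfl)
  rwa [sub_add_cancel] at this

theorem vfld_gen_omega_zero {p : ZMod 2} {x : (g ⊗[ℂ] RavK) × ℂ} (hx : Gen 𝔤 p x) {e : Bideg}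
    {a : V} (ha : a ∈ U.deg e) (b : V) :
    Y.fld (U.ρ x a) (omega 0) b = U.ρ x (Y.fld a (omega 0) b) := by
  rw [Y.fld_act hx.mem ha, SmRep.op_deg_one hx.mem _ (isPar_omega 0), SmRep.opL_omega_zero]
  rfl

/-- Induction over the monomial `a`: a leading generator is split off by `fld_gen_act` and
reattached by `nop_nop`. The product is formed in the vacuum module by `Y`, while the fields act on
an arbitrary `M`. -/
theorem FieldMap.fld_nop {R : SmRep 𝔤 h M} (X : FieldMap U R) {d e : Bideg} {a b : V}
    (ha : a ∈ U.deg d) (hb : b ∈ U.deg e) :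
    X.fld (Y.fld a (omega 0) b) = nop (koszul (tot d) (tot e)) (X.fld a) (X.fld b) := by
  refine PreVac.deg_induction (P := fun d a => X.fld (Y.fld a (omega 0) b)
    = nop (koszul (tot d) (tot e)) (X.fld a) (X.fld b)) ?_ ?_ ?_ ?_ ?_ ha
  · intro d; simp [nop_zero_left]
  · intro d a a' h1 h2
    rw [map_add, LinearMap.add_apply, LinearMap.add_apply, map_add, h1, h2, map_add, nop_add_left]
  · intro d a c h1
    rw [map_smul, LinearMap.smul_apply, LinearMap.smul_apply, map_smul, h1, map_smul, nop_smul_left]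
  · rw [Y.fld_vac, X.fld_vac, idField_apply, res_omega, if_pos rfl, one_smul,
      show tot 0 = 0 by simp [tot], koszul_zero_left, nop_idField_left]
  · intro p x d a hx ha ih
    have h2 := X.creationComm (PreVac.gen_mem hx PreVac.vac_mem) hb
    rw [add_zero, tot_one] at h2
    rw [vfld_gen_omega_zero Y hx ha, X.fld_gen_act hx (vfld_omega_mem Y ha hb 0), ih,
      X.fld_gen_act hx ha, SmRep.tot_add, koszul_add_right,
      nop_nop (X.isSm_fld _) (X.isSm_fld _) (X.isSm_fld _)
        (h2 := h2) (h3 := X.creationComm ha hb), SmRep.tot_add, tot_one, koszul_add_left _ (tot d)]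

theorem FieldMap.fld_dp_vT {R : SmRep 𝔤 h M} (X : FieldMap U R) (l : ℕ) (a : V) :
    X.fld (dp (vT Y) l a) = (-1 : ℂ) ^ l • (X.fld a ∘ₗ dp RavK.deriv l) := by
  induction l with
  | zero => simp [Module.End.one_eq_id]
  | succ l ih =>
    rw [dp_succ_apply, map_smul, Y.fld_vT X, ih]
    refine LinearMap.ext fun β => ?_
    simp only [LinearMap.smul_apply, LinearMap.comp_apply, dp_self_apply,
      map_smul, smul_neg, smul_smul, ← neg_smul]
    congr 1
    have : (l : ℂ) + 1 ≠ 0 := Nat.cast_add_one_ne_zero l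
    field_simp
    ring

theorem dp_vT_mem {e : Bideg} {b : V} (hb : b ∈ U.deg e) (l : ℕ) : dp (vT Y) l b ∈ U.deg e := by
  induction l with
  | zero => simpa using hb
  | succ l ih => rw [dp_succ_apply]; exact Submodule.smul_mem _ _ (vT_mem Y ih)

/-- Since `∂⁽ˡ⁾Ω⁰ = (-1)ˡ Ωˡ`, the higher products `a_(-l-1)` reduce to `a_(-1)` of a translate. -/
theorem vfld_dp_vT_omega_zero (l : ℕ) (a : V) : Y.fld (dp (vT Y) l a) (omega 0) = Y.fld a (omega l) := by
  have e : ((-1 : ℂ)) ^ l * (-1) ^ l = 1 := by rw [← mul_pow]; simp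
  rw [Y.fld_dp_vT Y, LinearMap.smul_apply, LinearMap.comp_apply, dp_deriv_omega, map_smul, smul_smul,
    zero_add, Nat.choose_self, Nat.cast_one, mul_one, e, one_smul]

theorem vfld_omega_vac (l : ℕ) (a : V) : Y.fld a (omega l) U.vac = dp (vT Y) l a := by
  rw [← vfld_dp_vT_omega_zero, vfld_omega_zero_vac]

theorem FieldMap.fld_nop_omega {R : SmRep 𝔤 h M} (X : FieldMap U R) {d e : Bideg} {a b : V}
    (ha : a ∈ U.deg d) (hb : b ∈ U.deg e) (l : ℕ) :
    X.fld (Y.fld a (omega l) b) = nop (koszul (tot d) (tot e))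
      ((-1 : ℂ) ^ l • (X.fld a ∘ₗ dp RavK.deriv l)) (X.fld b) := by
  rw [← vfld_dp_vT_omega_zero, Y.fld_nop X (dp_vT_mem Y ha l) hb, Y.fld_dp_vT X]

end

end

/-! ### Commutator formulas -/

section OpComm

variable {M : Type w} [AddCommGroup M] [Module ℂ M]

/-- The modes of `C` and `D`, of parities `s` and `t`, satisfy the commutator formula with
singular part `E`. -/
def OpComm (s t : ZMod 2) (C D : Op M) (E : ℕ → Op M) : Prop :=
  ∀ (r r' : ZMod 2) (α β : RavK), IsPar r α → IsPar r' β → ∀ v : M,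
    C α (D β v) - koszul (s + r) (t + r') • D β (C α v)
      = koszul r t • evsum fun i => E i (mul (dp RavK.deriv i α) β) v

theorem RavK.IsPar.proj0 {r : ZMod 2} {α : RavK} (hα : IsPar r α) : IsPar r (proj0 α) :=
  ⟨fun _ => rfl, fun h => hα.2 h⟩

theorem RavK.IsPar.mul_proj0 {α : RavK} (hα : IsPar 1 α) (β : RavK) :
    RavK.mul α (RavK.proj0 β) = RavK.mul α β := by
  ext1 <;> simp [RavK.mul, RavK.proj0, hα.2 rfl]

theorem RavK.IsPar.mul_proj0_series {α : RavK} (hα : IsPar 0 α) (β : RavK) :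
    RavK.mul α (RavK.proj0 β) = RavK.proj0 (RavK.mul α β) := by
  ext1 <;> simp [RavK.mul, RavK.proj0, hα.1 rfl]

variable {s t t' : ZMod 2} {C D F : Op M} {E G : ℕ → Op M}

theorem EvZero.evZero_apply {E : ℕ → Op M} (hE : EvZero E) (β : ℕ → RavK) (v : M) :
    EvZero fun i => E i (β i) v := by
  obtain ⟨N, hN⟩ := hE
  exact ⟨N, fun k hk => by simp [hN k hk]⟩

theorem tri_evsum (D : Op M) (hG : EvZero G) (hGs : ∀ i, IsSm (G i)) (α : ℕ → RavK) (β : RavK)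
    (v : M) :
    (evsum fun n => D (omega n) (evsum fun i => G i (mul (α i) (mul (xp n) β)) v))
      = evsum fun i => tri D (G i) (mul (α i) β) v := by
  have hz : EvZero₂ fun i n => D (omega n) (G i (mul (α i) (mul (xp n) β)) v) := by
    refine EvZero₂.of_iter ?_ fun i => ?_
    · obtain ⟨N, hN⟩ := hG
      exact ⟨N, fun k hk l => by simp [hN k hk]⟩
    · simp only [mul_left_comm' (α i)]
      exact tri_evZero D (hGs i) _ v
  have e1 : ∀ n, D (omega n) (evsum fun i => G i (mul (α i) (mul (xp n) β)) v)
      = evsum fun i => D (omega n) (G i (mul (α i) (mul (xp n) β)) v) := fun n =>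
    map_evsum _ (hG.evZero_apply _ v)
  simp only [e1]
  rw [← evsum_comm hz]
  simp only [tri_apply, mul_left_comm' (α _)]

/-- The Leibniz rule `[C, D₊F] = [C, D₊]F ± D₊[C, F]`, applied to each term of `tri`. The additional
`1` in the parity of `tri D F` comes from the `Ωⁿ` at which `D` is evaluated. -/
theorem OpComm.tri_aux (hD : OpComm s t C D E) (hF : OpComm s t' C F G) (hFs : IsSm F)
    (hG : EvZero G) (hGs : ∀ i, IsSm (G i)) {r r' : ZMod 2} {α β : RavK} (hα : IsPar r α)
    (hβ : IsPar r' β) (v : M) :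
    C α (tri D F β v) - koszul (s + r) (t + t' + 1 + r') • tri D F β (C α v)
      = koszul r t • (evsum fun n => evsum fun i =>
          E i (mul (dp RavK.deriv i α) (omega n)) (F (mul (xp n) β) v))
        + (koszul (s + r) (t + 1) * koszul r t') •
          evsum fun i => tri D (G i) (mul (dp RavK.deriv i α) β) v := by
  rw [← tri_evsum D hG hGs]
  have key : ∀ n, C α (D (omega n) (F (mul (xp n) β) v))
      - koszul (s + r) (t + t' + 1 + r') • D (omega n) (F (mul (xp n) β) (C α v))
      = koszul r t • (evsum fun i => E i (mul (dp RavK.deriv i α) (omega n)) (F (mul (xp n) β) v))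
      + (koszul (s + r) (t + 1) * koszul r t') • D (omega n)
        (evsum fun i => G i (mul (dp RavK.deriv i α) (mul (xp n) β)) v) := by
    intro n
    have h1 := hD r 1 α (omega n) hα (isPar_omega n) (F (mul (xp n) β) v)
    have hβ' : IsPar r' (mul (xp n) β) := by simpa using (isPar_xp n).mul hβ
    have h2 := congrArg (D (omega n)) (hF r r' α (mul (xp n) β) hα hβ' v)
    rw [map_sub, map_smul, map_smul] at h2
    rw [mul_smul, ← h2, ← h1]
    have hk : koszul (s + r) (t + t' + 1 + r')
        = koszul (s + r) (t + 1) * koszul (s + r) (t' + r') := by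
      rw [← koszul_add_right]; congr 1; ring
    rw [hk]
    module
  rw [tri_apply, map_evsum _ (tri_evZero D hFs β v), tri_apply, ← evsum_smul, ← evsum_sub]
  simp only [key]
  rw [evsum_add, evsum_smul, evsum_smul]

theorem OpComm.tri_series (hD : OpComm s t C D E) (hF : OpComm s t' C F G) (hFs : IsSm F)
    (hE : EvZero E) (hG : EvZero G) (hGs : ∀ i, IsSm (G i)) {r' : ZMod 2} {α β : RavK}
    (hα : IsPar 0 α) (hβ : IsPar r' β) (v : M) :
    C α (tri D F β v) - koszul s (t + t' + 1 + r') • tri D F β (C α v)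
      = evsum fun i => (tri (E i) F + koszul s (t + 1) • tri D (G i))
          (mul (dp RavK.deriv i α) β) v := by
  have h := hD.tri_aux hF hFs hG hGs hα hβ v
  simp only [add_zero, koszul_zero_left, one_smul, mul_one] at h
  rw [h]
  have hz : EvZero₂ fun i n =>
      E i (mul (dp RavK.deriv i α) (omega n)) (F (mul (xp n) β) v) := by
    refine EvZero₂.of_iter ?_ fun i => ?_
    · obtain ⟨N, hN⟩ := hE
      exact ⟨N, fun k hk l => by simp [hN k hk]⟩
    · exact (hFs.evZero β v).map fun n => E i (mul (dp RavK.deriv i α) (omega n))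
  have e1 : ∀ i, tri (E i) F (mul (dp RavK.deriv i α) β) v
      = evsum fun n => E i (mul (dp RavK.deriv i α) (omega n)) (F (mul (xp n) β) v) := fun i => by
    rw [(hα.dp i).eq_ofSeries, tri_series_mul _ hFs]
  rw [← evsum_comm hz]
  simp only [← e1, LinearMap.add_apply, LinearMap.smul_apply]
  rw [evsum_add, evsum_smul]

/-- For `α ∈ 𝒦¹` the commutator of `C(α)` with a creation mode vanishes, because `Ω · Ω = 0`; only
the commutator with `F` is left. -/
theorem OpComm.tri_omega (hD : OpComm s t C D E) (hF : OpComm s t' C F G) (hFs : IsSm F)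
    (hG : EvZero G) (hGs : ∀ i, IsSm (G i)) {r' : ZMod 2} {α β : RavK}
    (hα : IsPar 1 α) (hβ : IsPar r' β) (v : M) :
    C α (tri D F β v) - koszul (s + 1) (t + t' + 1 + r') • tri D F β (C α v)
      = (koszul (s + 1) (t + 1) * koszul 1 t') •
          evsum fun i => tri D (G i) (mul (dp RavK.deriv i α) β) v := by
  have h := hD.tri_aux hF hFs hG hGs hα hβ v
  rw [h]
  have : ∀ i n, mul (dp RavK.deriv i α) (omega n) = 0 := fun i n =>
    (hα.dp i).mul_eq_zero (isPar_omega n)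
  simp [this]

/-- A Wick formula without double contractions. For `α ∈ 𝒦⁰` the two orderings in the normal-ordered
product contribute their own halves. For `α ∈ 𝒦¹` the contraction of `C` with `D` appears only in
the ordering with `F` on the left; `hc` is what brings it into the form `nop (E i) F`. -/
theorem OpComm.nop (hD : OpComm s t C D E) (hF : OpComm s t' C F G) (hDs : IsSm D) (hFs : IsSm F)
    (hE : EvZero E) (hEs : ∀ i, IsSm (E i)) (hG : EvZero G) (hGs : ∀ i, IsSm (G i))
    (hc : ∀ i, CreationComm (koszul (s + t + 1) (t' + 1)) (E i) F) :
    OpComm s (t + t' + 1) C (nop (koszul (t + 1) (t' + 1)) D F) fun i =>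
      Raviolo.nop (koszul (s + t + 1) (t' + 1)) (E i) F
        + koszul s (t + 1) • Raviolo.nop (koszul (t + 1) (s + t' + 1)) D (G i) := by
  intro r r' α β hα hβ v
  have hk : koszul s (t + 1) * koszul (t + 1) (s + t' + 1) = koszul (t + 1) (t' + 1) := by
    rw [show s + t' + 1 = s + (t' + 1) by ring, koszul_add_right (t + 1) s, koszul_comm (t + 1) s,
      ← mul_assoc, koszul_mul_self, one_mul]
  have hk' : koszul (s + t + 1) (t' + 1) = koszul (t + 1) (t' + 1) * koszul s (t' + 1) := by
    rw [add_assoc, koszul_add_left s, mul_comm]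
  have ht : t' + t + 1 = t + t' + 1 := by ring
  rcases LieSuperalgebra.par_cases r with rfl | rfl
  · have h1 := hD.tri_series hF hFs hE hG hGs hα hβ v
    have h2 := hF.tri_series hD hDs hG hE hEs hα hβ.proj0 v
    rw [ht] at h2
    have e : ∀ i, (Raviolo.nop (koszul (s + t + 1) (t' + 1)) (E i) F
        + koszul s (t + 1) • Raviolo.nop (koszul (t + 1) (s + t' + 1)) D (G i))
          (mul (dp RavK.deriv i α) β) v
        = (tri (E i) F + koszul s (t + 1) • tri D (G i)) (mul (dp RavK.deriv i α) β) v
          + koszul (t + 1) (t' + 1) • (tri (G i) D + koszul s (t' + 1) • tri F (E i))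
            (mul (dp RavK.deriv i α) (RavK.proj0 β)) v := fun i => by
      rw [(hα.dp i).mul_proj0_series]
      simp only [Raviolo.nop, LinearMap.add_apply, LinearMap.smul_apply, LinearMap.comp_apply,
        smul_add, smul_smul]
      rw [hk, hk']
      abel
    simp only [e, add_zero, koszul_zero_left, one_smul]
    rw [evsum_add, evsum_smul, ← h1, ← h2]
    simp only [Raviolo.nop, LinearMap.add_apply, LinearMap.smul_apply, LinearMap.comp_apply,
      map_add, map_smul]
    module
  · have h1 := hD.tri_omega hF hFs hG hGs hα hβ v
    have h2 := hF.tri_omega hD hDs hE hEs hα hβ.proj0 v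
    rw [ht] at h2
    have e : ∀ i, (Raviolo.nop (koszul (s + t + 1) (t' + 1)) (E i) F
        + koszul s (t + 1) • Raviolo.nop (koszul (t + 1) (s + t' + 1)) D (G i))
          (mul (dp RavK.deriv i α) β) v
        = koszul s (t + 1) • tri D (G i) (mul (dp RavK.deriv i α) β) v
          + koszul (s + t + 1) (t' + 1) • tri F (E i)
            (mul (dp RavK.deriv i α) (RavK.proj0 β)) v := fun i => by
      have hη : IsPar 1 (mul (dp RavK.deriv i α) β) := by
        rw [← (hα.dp i).mul_proj0]
        exact ⟨fun h => absurd h (by decide), fun _ => by simp [fst_mul, (hα.dp i).2 rfl]⟩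
      rw [(hα.dp i).mul_proj0, LinearMap.add_apply, LinearMap.smul_apply,
        nop_apply_of_isPar _ _ _ hη, nop_apply_of_isPar _ _ _ hη, LinearMap.add_apply, add_comm,
        LinearMap.smul_apply]
      congr 1
      rw [← LinearMap.smul_apply, ← LinearMap.smul_apply]
      exact LinearMap.congr_fun (omega_ext (fun n => (hc i).tri_omega n) hη) v
    have k1 : koszul (s + 1) (t + 1) * koszul 1 t' = koszul 1 (t + t' + 1) * koszul s (t + 1) := by
      rw [koszul_add_left s, show t + t' + 1 = (t + 1) + t' by ring, koszul_add_right 1 (t + 1)]; ring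
    have k2 : koszul (t + 1) (t' + 1) * (koszul (s + 1) (t' + 1) * koszul 1 t)
        = koszul 1 (t + t' + 1) * koszul (s + t + 1) (t' + 1) := by
      rw [hk', koszul_add_left s, show t + t' + 1 = t + (t' + 1) by ring, koszul_add_right 1 t]; ring
    simp only [e]
    rw [evsum_add, evsum_smul, evsum_smul, smul_add, smul_smul, smul_smul, ← k1, ← k2, ← h1,
      mul_smul, ← h2]
    simp only [Raviolo.nop, LinearMap.add_apply, LinearMap.smul_apply, LinearMap.comp_apply,
      map_add, map_smul]
    module

theorem OpComm.add_right {D' : Op M} {E' : ℕ → Op M} (h : OpComm s t C D E)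
    (h' : OpComm s t C D' E') : OpComm s t C (D + D') fun i => E i + E' i := by
  intro r r' α β hα hβ v
  have h1 := h r r' α β hα hβ v
  have h2 := h' r r' α β hα hβ v
  simp only [LinearMap.add_apply, map_add]
  rw [evsum_add, smul_add (koszul r t), ← h1, ← h2]
  module

theorem OpComm.smul_left (h : OpComm s t C D E) (c : ℂ) : OpComm s t (c • C) D fun i => c • E i := by
  intro r r' α β hα hβ v
  have h1 := h r r' α β hα hβ v
  simp only [LinearMap.smul_apply, map_smul]
  rw [evsum_smul, smul_comm (koszul r t) c, ← h1]
  module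

theorem OpComm.smul_right (h : OpComm s t C D E) (c : ℂ) : OpComm s t C (c • D) fun i => c • E i := by
  intro r r' α β hα hβ v
  have h1 := h r r' α β hα hβ v
  simp only [LinearMap.smul_apply, map_smul]
  rw [evsum_smul, smul_comm (koszul r t) c, ← h1]
  module

/-- From `∂⁽ⁱ⁾∂ = (i + 1) ∂⁽ⁱ⁺¹⁾` the singular part moves up by one index; at `i = 0` the factor `i`
annihilates the truncated `E (i - 1)`. -/
theorem OpComm.comp_deriv (h : OpComm s t C D E) (hE : EvZero E) :
    OpComm s t (-(C ∘ₗ RavK.deriv)) D fun i => -((i : ℂ) • E (i - 1)) := by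
  intro r r' α β hα hβ v
  have h1 := h r r' _ β hα.deriv hβ v
  simp only [LinearMap.neg_apply, LinearMap.comp_apply, map_neg, LinearMap.smul_apply, smul_neg]
  rw [evsum_neg, smul_neg, evsum_succ, Nat.cast_zero, zero_smul, zero_add]
  · simp only [dp_self_apply, map_smul, LinearMap.smul_apply] at h1
    simp only [Nat.cast_add, Nat.cast_one, Nat.add_sub_cancel]
    rw [← h1]; module
  · obtain ⟨N, hN⟩ := hE
    exact ⟨N + 1, fun k hk => by simp [hN (k - 1) (by omega)]⟩

end OpComm

/-- Iterated integration by parts. The induction writes `α ∂(∂⁽ʲ⁾β)` as `∂(α ∂⁽ʲ⁾β) - (∂α) ∂⁽ʲ⁾β`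
and applies the hypothesis to `α` and to `∂α`. It is the identity behind `Comm.skew`. -/
theorem RavK.sum_dp_deriv_mul (j : ℕ) (α β : RavK) :
    ∑ ij ∈ antidiagonal j, (-1 : ℂ) ^ ij.1 • dp RavK.deriv ij.2 (mul (dp RavK.deriv ij.1 α) β)
      = mul α (dp RavK.deriv j β) := by
  induction j generalizing α with
  | zero => simp
  | succ j ih =>
    have hj : ((j : ℂ) + 1) ≠ 0 := Nat.cast_add_one_ne_zero j
    refine smul_right_injective _ hj ?_
    dsimp only
    rw [← map_smul, ← self_dp_apply]
    have h1 := congrArg RavK.deriv (ih α)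
    have h2 := ih (RavK.deriv α)
    rw [RavK.deriv_mul, ← h2, map_sum] at h1
    rw [← sub_eq_iff_eq_add'.2 h1, Finset.smul_sum]
    have e1 : ∀ ij ∈ antidiagonal (j + 1), ((j : ℂ) + 1) • ((-1 : ℂ) ^ ij.1 •
        dp RavK.deriv ij.2 (mul (dp RavK.deriv ij.1 α) β))
        = ((ij.2 : ℂ) * (-1 : ℂ) ^ ij.1) • dp RavK.deriv ij.2 (mul (dp RavK.deriv ij.1 α) β)
        + ((ij.1 : ℂ) * (-1 : ℂ) ^ ij.1) • dp RavK.deriv ij.2 (mul (dp RavK.deriv ij.1 α) β) := by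
      intro ij hij
      have : (ij.1 : ℂ) + ij.2 = j + 1 := by exact_mod_cast mem_antidiagonal.1 hij
      rw [← this]; module
    rw [Finset.sum_congr rfl e1, Finset.sum_add_distrib, sub_eq_add_neg]
    congr 1
    · rw [Finset.Nat.sum_antidiagonal_succ']
      simp only [Nat.cast_zero, zero_mul, zero_smul, map_smul, self_dp_apply, smul_smul,
        Nat.cast_add, Nat.cast_one, mul_comm, zero_add]
    · rw [Finset.Nat.sum_antidiagonal_succ, ← Finset.sum_neg_distrib]
      simp only [Nat.cast_zero, zero_mul, zero_smul, map_smul, dp_self_apply, smul_smul,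
        Nat.cast_add, Nat.cast_one, zero_add, LinearMap.smul_apply]
      refine Finset.sum_congr rfl fun ij _ => ?_
      rw [pow_succ]; module

theorem tot_sub_add (d e : Bideg) : tot (d - (1, 0) + e) = tot d + 1 + tot e := by
  rw [SmRep.tot_add, sub_eq_add_neg, SmRep.tot_add]
  congr 2

/-! ### The commutator formula for pairs of states. -/

section

variable {g : Type u} [AddCommGroup g] [Module ℂ g] {𝔤 : LieSuperalgebra g} {h : InvariantForm 𝔤}
  {V : Type u} [AddCommGroup V] [Module ℂ V] {M : Type w} [AddCommGroup M] [Module ℂ M]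
  {U : VacMod 𝔤 h V} {Y : FieldMap U U.rep} {R : SmRep 𝔤 h M} {X : FieldMap U R}

variable (Y X) in
/-- The commutator formula for the fields of the states `a` and `b` of bidegrees `d` and `e`. -/
def Comm (d e : Bideg) (a b : V) : Prop :=
  OpComm (tot d + 1) (tot e + 1) (X.fld a) (X.fld b) fun i => X.fld (Y.fld a (xp i) b)

theorem evZero_singular (a b : V) : EvZero fun i => X.fld (Y.fld a (xp i) b) :=
  ((Y.isSm_fld a).evZero_xp b).map fun _ => X.fld

namespace Comm

variable {d e f : Bideg} {a b c : V}

theorem zero_right : Comm Y X d e a 0 := fun r r' α β _ _ v => by simp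

theorem add_right (h1 : Comm Y X d e a b) (h2 : Comm Y X d e a c) : Comm Y X d e a (b + c) := by
  have := OpComm.add_right h1 h2
  simpa only [Comm, map_add, LinearMap.add_apply] using this

theorem smul_left (h1 : Comm Y X d e a b) (z : ℂ) : Comm Y X d e (z • a) b := by
  have := OpComm.smul_left h1 z
  simpa only [Comm, map_smul, LinearMap.smul_apply] using this

theorem smul_right (h1 : Comm Y X d e a b) (z : ℂ) : Comm Y X d e a (z • b) := by
  have := OpComm.smul_right h1 z
  simpa only [Comm, map_smul, LinearMap.smul_apply] using this

theorem vT_left (h1 : Comm Y X d e a b) : Comm Y X d e (vT Y a) b := by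
  have := OpComm.comp_deriv h1 (evZero_singular a b)
  rw [Comm, Y.fld_vT X, Y.fld_vT Y]
  simpa only [LinearMap.neg_apply, LinearMap.comp_apply, deriv_xp, map_smul, map_neg,
    LinearMap.smul_apply] using this

theorem vac_right : Comm Y X d 0 a U.vac := by
  intro r r' α β hα hβ v
  have h0 : ∀ i, Y.fld a (xp i) U.vac = 0 := fun i => vfld_series_vac Y a _
  simp only [h0, map_zero, LinearMap.zero_apply, evsum_zero, smul_zero, X.fld_vac, idField_apply,
    map_smul]
  rcases LieSuperalgebra.par_cases r' with rfl | rfl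
  · rw [hβ.eq_ofSeries, res_ofSeries]; simp
  · simp [tot, koszul, show (1 : ZMod 2) + 1 = 0 from rfl]

/-- The commutator of `b(Ω⁰)` and `a(uⁱ)` is evaluated on the vacuum: `a(uⁱ)` annihilates it and
`b(Ω⁰)` creates `b`, so one ordering vanishes and the other is `a(uⁱ)b`. On the singular side,
creation modes on the vacuum are divided powers of translation. -/
theorem vfld_skew (h1 : Comm Y Y e d b a) (i : ℕ) :
    Y.fld a (xp i) b = -(koszul (tot d + 1) (tot e + 1) • evsum fun n =>
      (-1 : ℂ) ^ (i + n) • dp (vT Y) n (Y.fld b (xp (i + n)) a)) := by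
  have h2 := h1 1 0 (omega 0) (xp i) (isPar_omega 0) (isPar_xp i) U.vac
  rw [show Y.fld a (xp i) U.vac = 0 from vfld_series_vac Y a _, vfld_omega_zero_vac, map_zero,
    zero_sub, add_zero, evsum_shift i] at h2
  · have e1 : ∀ n, Y.fld (Y.fld b (xp (i + n)) a) (mul (dp RavK.deriv (i + n) (omega 0)) (xp i)) U.vac
        = (-1 : ℂ) ^ (i + n) • dp (vT Y) n (Y.fld b (xp (i + n)) a) := fun n => by
      rw [dp_deriv_omega, RavK.mul_comm', map_smul, xp_mul_omega, if_pos (by omega), map_smul,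
        LinearMap.smul_apply, show 0 + (i + n) - i = n by omega, vfld_omega_vac, zero_add,
        Nat.choose_self, Nat.cast_one, mul_one]
    simp only [e1] at h2
    rw [koszul_add_left (tot e + 1) 1, koszul_comm (tot e + 1), mul_comm, mul_smul, ← smul_neg] at h2
    have h3 := congrArg (fun x => koszul 1 (tot d + 1) • x) h2
    simp only [smul_smul, koszul_mul_self, one_smul] at h3
    rw [← h3, smul_neg, neg_neg, smul_smul, koszul_mul_self, one_smul]
  · intro k hk
    rw [dp_deriv_omega, RavK.mul_comm', map_smul, xp_mul_omega, if_neg (by omega)]; simp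
  · exact EvZero.evZero_apply (evZero_singular b a) _ _

/-- The singular part for `(a, b)` is rewritten by `vfld_skew`; translation becomes differentiation,
and `sum_dp_deriv_mul` contracts the double sum to the singular part for `(b, a)` with `α` and `β`
exchanged. -/
theorem skew (hV : Comm Y Y e d b a) (hM : Comm Y X e d b a) : Comm Y X d e a b := by
  intro r r' α β hα hβ v
  have hM := hM r' r β α hβ hα v
  obtain ⟨N, hN⟩ := evZero_singular (X := X) (Y := Y) b a
  have hz : EvZero₂ fun i n => (-1 : ℂ) ^ i • X.fld (Y.fld b (xp (i + n)) a)
      (dp RavK.deriv n (mul (dp RavK.deriv i α) β)) v :=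
    ⟨N, fun i n hin => by
      show _ • X.fld (Y.fld b (xp (i + n)) a) _ v = 0
      rw [show X.fld (Y.fld b (xp (i + n)) a) = 0 from hN _ hin]; simp⟩
  have e1 : ∀ i η, X.fld (Y.fld a (xp i) b) η v = -(koszul (tot d + 1) (tot e + 1) • evsum fun n =>
      (-1 : ℂ) ^ i • X.fld (Y.fld b (xp (i + n)) a) (dp RavK.deriv n η) v) := by
    intro i η
    have hs : EvZero fun n => (-1 : ℂ) ^ (i + n) • dp (vT Y) n (Y.fld b (xp (i + n)) a) := by
      obtain ⟨N, hN⟩ := (Y.isSm_fld b).evZero_xp a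
      exact ⟨N, fun k hk => by simp [hN (i + k) (by omega)]⟩
    have := map_evsum (LinearMap.applyₗ v ∘ₗ LinearMap.applyₗ η ∘ₗ X.fld) hs
    rw [vfld_skew hV, map_neg, map_smul]
    simp only [LinearMap.comp_apply, LinearMap.applyₗ_apply_apply] at this
    simp only [LinearMap.neg_apply, LinearMap.smul_apply, this]
    congr 2
    refine congrArg evsum (funext fun n => ?_)
    rw [map_smul, Y.fld_dp_vT X]
    simp only [LinearMap.smul_apply, LinearMap.comp_apply, smul_smul]
    congr 1
    have e : ((-1 : ℂ)) ^ n * (-1) ^ n = 1 := by rw [← mul_pow]; simp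
    rw [pow_add, mul_assoc, e, mul_one]
  simp only [e1]
  rw [evsum_neg, evsum_smul, evsum_evsum hz]
  have e2 : ∀ n, ∑ ij ∈ antidiagonal n, (-1 : ℂ) ^ ij.1 • X.fld (Y.fld b (xp (ij.1 + ij.2)) a)
      (dp RavK.deriv ij.2 (mul (dp RavK.deriv ij.1 α) β)) v
      = X.fld (Y.fld b (xp n) a) (mul (dp RavK.deriv n β) α) v := by
    intro n
    rw [RavK.mul_comm', ← sum_dp_deriv_mul, map_sum, LinearMap.sum_apply]
    refine Finset.sum_congr rfl fun ij hij => ?_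
    rw [mem_antidiagonal.1 hij]; simp
  simp only [e2]
  set S := evsum fun n => X.fld (Y.fld b (xp n) a) (mul (dp RavK.deriv n β) α) v with hS
  -- The sign for exchanging `α` and `β` may be inserted freely: it is nontrivial only if both are
  -- in `𝒦¹`, and then `S = 0`.
  have hS' : koszul r r' • S = S := by
    by_cases hr : r = 1 ∧ r' = 1
    · obtain ⟨rfl, rfl⟩ := hr
      have : S = 0 := by
        rw [hS]
        simp only [fun n => (hβ.dp n).mul_eq_zero hα]
        simp
      rw [this, smul_zero]
    · rw [koszul, if_neg hr, one_smul]
  have hkk := koszul_mul_self (tot d + 1 + r) (tot e + 1 + r')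
  rw [koszul_comm (tot e + 1 + r')] at hM
  have hk : koszul (tot d + 1 + r) (tot e + 1 + r') * koszul r' (tot d + 1)
      = koszul r (tot e + 1) * koszul (tot d + 1) (tot e + 1) * koszul r r' := by
    have := koszul_mul_self (tot d + 1) r'
    rw [koszul_add_left _ r, koszul_add_right _ _ r', koszul_add_right _ _ r', koszul_comm r' (tot d + 1)]
    linear_combination (koszul (tot d + 1) (tot e + 1) * koszul r (tot e + 1) * koszul r r') * this
  have h3 := congrArg (fun x => koszul (tot d + 1 + r) (tot e + 1 + r') • x) hM
  simp only [smul_sub, smul_smul, hkk, one_smul] at h3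
  rw [hk, mul_smul _ _ S, hS'] at h3
  rw [smul_neg, smul_smul, ← h3, neg_sub]

/-- The commutator formula at `α = uⁱ`, `β = Ω⁰`: all but the `i`-th singular term vanish, since
`∂⁽ʲ⁾uⁱ · Ω⁰ = 0` for `j ≠ i`. -/
theorem vfld_xp_nop (h1 : Comm Y Y d e a b) (i : ℕ) :
    Y.fld a (xp i) (Y.fld b (omega 0) c) = Y.fld (Y.fld a (xp i) b) (omega 0) c
      + koszul (tot d + 1) (tot e + 1 + 1) • Y.fld b (omega 0) (Y.fld a (xp i) c) := by
  have h2 := h1 0 1 (xp i) (omega 0) (isPar_xp i) (isPar_omega 0) c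
  rw [koszul_zero_left, one_smul, add_zero, evsum_eq_single i fun j hj => by
    rw [dp_deriv_xp, map_smul, LinearMap.smul_apply, xp_mul_omega]
    split_ifs with hij
    · rw [Nat.choose_eq_zero_of_lt (by omega)]; simp
    · simp, dp_deriv_xp, Nat.choose_self, Nat.cast_one, one_smul, Nat.sub_self, xp_zero_mul] at h2
  rw [← h2]; abel

/-- The commutator formula passes to normal-ordered products in the second argument. -/
theorem nop (hV : Comm Y Y d e a b) (hb : Comm Y X d e a b) (hc : Comm Y X d f a c)
    (ha' : a ∈ U.deg d) (hb' : b ∈ U.deg e) (hc' : c ∈ U.deg f) :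
    Comm Y X d (e + f) a (Y.fld b (omega 0) c) := by
  have two : (1 : ZMod 2) + 1 = 0 := rfl
  have h1 := OpComm.nop hb hc (X.isSm_fld _) (X.isSm_fld _) (evZero_singular a b)
    (fun _ => X.isSm_fld _) (evZero_singular a c) (fun _ => X.isSm_fld _) (fun i => by
      have := X.creationComm (vfld_xp_mem Y ha' hb' i) hc'
      rwa [tot_sub_add, show tot d + 1 + tot e = tot d + 1 + (tot e + 1) + 1 by
          linear_combination -two,
        show tot f = tot f + 1 + 1 by rw [add_assoc, two, add_zero]] at this)
  have e1 : tot e + 1 + 1 = tot e := by rw [add_assoc, two, add_zero]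
  have e2 : tot f + 1 + 1 = tot f := by rw [add_assoc, two, add_zero]
  have e3 : tot e + 1 + (tot f + 1) + 1 = tot e + tot f + 1 := by
    linear_combination two
  have e4 : tot d + 1 + (tot e + 1) + 1 = tot d + 1 + tot e := by linear_combination two
  have e5 : tot d + 1 + (tot f + 1) + 1 = tot d + 1 + tot f := by linear_combination two
  rw [Comm, Y.fld_nop X hb' hc', SmRep.tot_add]
  simp only [e1, e2, e3, e4, e5] at h1
  have e6 : ∀ i, X.fld (Y.fld a (xp i) (Y.fld b (omega 0) c))
      = Raviolo.nop (koszul (tot d + 1 + tot e) (tot f)) (X.fld (Y.fld a (xp i) b)) (X.fld c)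
        + koszul (tot d + 1) (tot e) • Raviolo.nop (koszul (tot e) (tot d + 1 + tot f)) (X.fld b)
          (X.fld (Y.fld a (xp i) c)) := fun i => by
    rw [vfld_xp_nop hV, e1, map_add, map_smul, Y.fld_nop X (vfld_xp_mem Y ha' hb' i) hc',
      Y.fld_nop X hb' (vfld_xp_mem Y ha' hc' i), tot_sub_add, tot_sub_add]
  simp only [e6]
  exact h1

/-- These are the defining relations of `ĝ_h`: the bracket is the product with index `0`, the
cocycle the product with index `1`, and no others occur. In the cocycle the derivative is moved from
`β` to `α`, as required by the form of the singular part. -/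
theorem mu_mu {p q : ZMod 2} {A B : g} (hA : A ∈ 𝔤.par p) (hB : B ∈ 𝔤.par q) :
    Comm Y X (1, p) (1, q) (U.ρ (LieSuperalgebra.toAffine (A ⊗ₜ omega 0)) U.vac)
      (U.ρ (LieSuperalgebra.toAffine (B ⊗ₜ omega 0)) U.vac) := by
  intro r r' α β hα hβ v
  have two : (1 : ZMod 2) + 1 = 0 := rfl
  have hp : ∀ p : ZMod 2, tot (1, p) + 1 = p := fun p => by rw [tot_one]; linear_combination two
  have h1 : ∀ i, Y.fld (U.ρ (LieSuperalgebra.toAffine (A ⊗ₜ omega 0)) U.vac) (xp i)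
      (U.ρ (LieSuperalgebra.toAffine (B ⊗ₜ omega 0)) U.vac)
      = U.rep.cur (𝔤.br A B) (mul (xp i) (omega 0)) U.vac
        - (h.form A B * res (mul (xp i) (RavK.deriv (omega 0)))) •
          U.ρ (LieSuperalgebra.kappa g) U.vac := fun i => by
    have := LinearMap.congr_fun (U.rep.cur_mul_cur hA hB (isPar_xp i) (isPar_omega 0)) U.vac
    simp only [LinearMap.sub_apply, LinearMap.smul_apply, Module.End.mul_apply, cur_xp_vac, map_zero,
      smul_zero, sub_zero, koszul_zero_left, one_smul] at this
    rw [Y.fld_mu_zero_vac hA]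
    exact this
  have h2 := LinearMap.congr_fun (R.cur_mul_cur hA hB hα hβ) v
  rw [evsum_eq (N := 2) fun k hk => by
    beta_reduce
    rw [h1, deriv_omega, map_smul, xp_mul_omega, xp_mul_omega, if_neg (by omega), if_neg (by omega)]
    simp, Finset.sum_range_succ, Finset.sum_range_one, hp, hp, X.fld_mu_zero_vac hA,
    X.fld_mu_zero_vac hB]
  beta_reduce
  rw [h1, h1]
  have h3 : X.fld (U.rep.cur (𝔤.br A B) (omega 0) U.vac) = R.cur (𝔤.br A B) :=
    X.fld_mu_zero_vac (𝔤.br_mem hA hB)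
  have h4 : res (mul (RavK.deriv α) β) = -res (mul α (RavK.deriv β)) := by
    rw [res_mul_deriv_skew, neg_neg, RavK.mul_comm']
  simp only [deriv_omega, map_smul, xp_mul_omega, res_omega, h3, X.fld_kappa_vac, map_sub,
    le_refl, if_true, LinearMap.sub_apply, LinearMap.smul_apply, dp_zero, dp_one, h4,
    Module.End.one_apply]
  simp only [LinearMap.sub_apply, LinearMap.smul_apply, Module.End.mul_apply] at h2
  rw [h2]
  have h5 : res (omega 1) = 0 := by simp [res_omega]
  simp [h5, sub_eq_add_neg, mul_smul]

theorem mu_kappa {p : ZMod 2} {A : g} (hA : A ∈ 𝔤.par p) :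
    Comm Y X (1, p) (1, 0) (U.ρ (LieSuperalgebra.toAffine (A ⊗ₜ omega 0)) U.vac)
      (U.ρ (LieSuperalgebra.kappa g) U.vac) := by
  intro r r' α β hα hβ v
  have two : (1 : ZMod 2) + 1 = 0 := rfl
  have hp : ∀ p : ZMod 2, tot (1, p) + 1 = p := fun p => by rw [tot_one]; linear_combination two
  have h1 : ∀ i, Y.fld (U.ρ (LieSuperalgebra.toAffine (A ⊗ₜ omega 0)) U.vac) (xp i)
      (U.ρ (LieSuperalgebra.kappa g) U.vac) = 0 := fun i => by
    rw [Y.fld_mu_zero_vac hA]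
    have := LinearMap.congr_fun (SmRep.cur_kappa (R := U.rep) hA (isPar_xp i)) U.vac
    rw [Module.End.mul_apply, LinearMap.smul_apply, Module.End.mul_apply, cur_xp_vac, map_zero,
      smul_zero] at this
    exact this
  simp only [h1, map_zero, LinearMap.zero_apply, evsum_zero, smul_zero, hp, X.fld_mu_zero_vac hA,
    X.fld_kappa_vac]
  have h2 := LinearMap.congr_fun (SmRep.cur_kappa (R := R) hA hα) v
  simp only [LinearMap.smul_apply, Module.End.mul_apply, map_smul] at h2 ⊢
  rcases LieSuperalgebra.par_cases r' with rfl | rfl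
  · rw [hβ.eq_ofSeries, res_ofSeries]; simp
  · rw [h2, smul_comm, zero_add, koszul_comm 1, sub_self]

theorem kappa_kappa : Comm Y X (1, 0) (1, 0) (U.ρ (LieSuperalgebra.kappa g) U.vac)
      (U.ρ (LieSuperalgebra.kappa g) U.vac) := by
  intro r r' α β hα hβ v
  have h1 : ∀ i, Y.fld (U.ρ (LieSuperalgebra.kappa g) U.vac) (xp i)
      (U.ρ (LieSuperalgebra.kappa g) U.vac) = 0 := fun i => by
    rw [Y.fld_kappa_vac, res_xp]; simp
  have h2 := LinearMap.congr_fun (SmRep.kappa_kappa (R := R)) v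
  simp only [h1, map_zero, LinearMap.zero_apply, evsum_zero, smul_zero, X.fld_kappa_vac]
  simp only [LinearMap.smul_apply, Module.End.mul_apply, map_smul, LinearMap.zero_apply] at h2 ⊢
  simp [h2]

end Comm

/-! ### From the generators to all states. -/

variable (𝔤) in
/-- The generators `A ⊗ Ω⁰` and `κ`. -/
inductive BaseGen : ZMod 2 → (g ⊗[ℂ] RavK) × ℂ → Prop
  | mu {p : ZMod 2} {A : g} (hA : A ∈ 𝔤.par p) :
      BaseGen p (LieSuperalgebra.toAffine (A ⊗ₜ omega 0))
  | kappa : BaseGen 0 (LieSuperalgebra.kappa g)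

theorem BaseGen.gen {p : ZMod 2} {x : (g ⊗[ℂ] RavK) × ℂ} (hx : BaseGen 𝔤 p x) : Gen 𝔤 p x := by
  cases hx with
  | mu hA => exact .mu hA 0
  | kappa => exact .kappa

theorem gen_vac_mem {p : ZMod 2} {x : (g ⊗[ℂ] RavK) × ℂ} (hx : Gen 𝔤 p x) :
    U.ρ x U.vac ∈ U.deg (1, p) := by
  simpa using PreVac.gen_mem hx (U := U.toPreVac) PreVac.vac_mem

theorem vT_mu (A : g) (l : ℕ) : vT Y (U.ρ (LieSuperalgebra.toAffine (A ⊗ₜ omega l)) U.vac)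
    = ((l : ℂ) + 1) • U.ρ (LieSuperalgebra.toAffine (A ⊗ₜ omega (l + 1))) U.vac := by
  rw [vT_act, vT_vac, map_zero, zero_sub, ← dp_one (affineD g), dp_affineD_tmul, dp_one, deriv_omega,
    TensorProduct.tmul_smul, map_smul, map_smul, LinearMap.smul_apply, neg_smul, neg_neg]

/-- By `vT_mu` the states `μ_{A,l}|0⟩` are scalar multiples of iterated translates of `μ_{A,0}|0⟩`.
-/
theorem mu_induction {p : ZMod 2} {x : (g ⊗[ℂ] RavK) × ℂ} {P : V → Prop}
    (hT : ∀ a, P a → P (vT Y a)) (hsmul : ∀ (c : ℂ) a, P a → P (c • a))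
    (hbase : ∀ y, BaseGen 𝔤 p y → P (U.ρ y U.vac)) (hx : Gen 𝔤 p x) : P (U.ρ x U.vac) := by
  cases hx with
  | kappa => exact hbase _ .kappa
  | mu hA l =>
    induction l with
    | zero => exact hbase _ (.mu hA)
    | succ l ih =>
      have := hsmul ((l : ℂ) + 1)⁻¹ _ (hT _ ih)
      rwa [vT_mu, smul_smul, inv_mul_cancel₀ (Nat.cast_add_one_ne_zero l), one_smul] at this

theorem comm_base_base {p q : ZMod 2} {x y : (g ⊗[ℂ] RavK) × ℂ} (hx : BaseGen 𝔤 p x)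
    (hy : BaseGen 𝔤 q y) : Comm Y X (1, p) (1, q) (U.ρ x U.vac) (U.ρ y U.vac) := by
  cases hx with
  | mu hA =>
    cases hy with
    | mu hB => exact Comm.mu_mu hA hB
    | kappa => exact Comm.mu_kappa hA
  | kappa =>
    cases hy with
    | mu hB => exact Comm.skew (Comm.mu_kappa hB) (Comm.mu_kappa hB)
    | kappa => exact Comm.kappa_kappa

theorem comm_gen_base {p q : ZMod 2} {x y : (g ⊗[ℂ] RavK) × ℂ} (hx : Gen 𝔤 p x)
    (hy : BaseGen 𝔤 q y) : Comm Y X (1, p) (1, q) (U.ρ x U.vac) (U.ρ y U.vac) :=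
  mu_induction (Y := Y) (P := fun a => Comm Y X (1, p) (1, q) a (U.ρ y U.vac))
    (fun _ h1 => h1.vT_left) (fun c _ h1 => h1.smul_left c) (fun _ hz => comm_base_base hz hy) hx

/-- The Wick formula extends the right argument from generators to monomials. Together with
translation on the left and `Comm.skew` this climbs a ladder: base against base, generator against
base, base against everything, generator against everything, and finally everything against
everything. -/
theorem comm_of_gen {d : Bideg} {a : V} (ha : a ∈ U.deg d)
    (hV : ∀ {q y}, Gen 𝔤 q y → Comm Y Y d (1, q) a (U.ρ y U.vac))
    (hM : ∀ {q y}, Gen 𝔤 q y → Comm Y X d (1, q) a (U.ρ y U.vac)) {e : Bideg} {b : V}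
    (hb : b ∈ U.deg e) : Comm Y X d e a b := by
  refine PreVac.deg_induction (P := fun e b => Comm Y X d e a b) (fun _ => Comm.zero_right)
    (fun h1 h2 => h1.add_right h2) (fun c h1 => h1.smul_right c) Comm.vac_right ?_ hb
  intro q y e b hy hb ih
  have : U.ρ y b = Y.fld (U.ρ y U.vac) (omega 0) b := by
    rw [vfld_gen_omega_zero Y hy PreVac.vac_mem, Y.fld_vac, idField_apply, res_omega, if_pos rfl,
      one_smul]
  rw [this]
  exact Comm.nop (hV hy) (hM hy) ih ha (gen_vac_mem hy) hb

theorem comm_base {q : ZMod 2} {y : (g ⊗[ℂ] RavK) × ℂ} (hy : BaseGen 𝔤 q y) {e : Bideg} {b : V}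
    (hb : b ∈ U.deg e) : Comm Y X (1, q) e (U.ρ y U.vac) b :=
  comm_of_gen (gen_vac_mem hy.gen)
    (fun hx => Comm.skew (comm_gen_base hx hy) (comm_gen_base hx hy))
    (fun hx => Comm.skew (comm_gen_base hx hy) (comm_gen_base hx hy)) hb

theorem comm_gen {q : ZMod 2} {y : (g ⊗[ℂ] RavK) × ℂ} (hy : Gen 𝔤 q y) {e : Bideg} {b : V}
    (hb : b ∈ U.deg e) : Comm Y X (1, q) e (U.ρ y U.vac) b :=
  mu_induction (Y := Y) (P := fun a => Comm Y X (1, q) e a b)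
    (fun _ h1 => h1.vT_left) (fun c _ h1 => h1.smul_left c) (fun _ hz => comm_base hz hb) hy

/-- The commutator formula for arbitrary states. -/
theorem comm {d e : Bideg} {a b : V} (ha : a ∈ U.deg d) (hb : b ∈ U.deg e) : Comm Y X d e a b :=
  comm_of_gen ha (fun hy => Comm.skew (comm_gen hy ha) (comm_gen hy ha))
    (fun hy => Comm.skew (comm_gen hy ha) (comm_gen hy ha)) hb

end

/-! ### Modes -/

namespace RavK

/-- The element of `𝒦` dual to the basis element of index `n`. -/
def elt : ℤ → RavK
  | .ofNat n => xp n
  | .negSucc i => omega i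

theorem elt_natCast (n : ℕ) : elt n = xp n := rfl

theorem elt_negSucc (i : ℕ) : elt (.negSucc i) = omega i := rfl

theorem ix_natCast (n : ℕ) : ix (n : ℤ) = 1 := if_pos (by positivity)

theorem ix_negSucc (i : ℕ) : ix (.negSucc i) = 0 := if_neg (by omega)

theorem isPar_elt (n : ℤ) : IsPar (1 + ix n) (elt n) := by
  cases n with
  | ofNat n => exact isPar_xp n
  | negSucc i => exact isPar_omega i

theorem elt_mem (n : ℤ) : elt n ∈ RavK.deg (1 - (ixDeg n).1) := by
  cases n with
  | ofNat n => exact mem_deg_zero rfl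
  | negSucc i => exact mem_deg_one rfl

theorem xp_one_mul_elt (p : ℤ) : mul (xp 1) (elt p) = if p = -1 then 0 else elt (p + 1) := by
  cases p with
  | ofNat n =>
    rw [if_neg (by simp), show Int.ofNat n + 1 = ((n + 1 : ℕ) : ℤ) by simp, elt_natCast]
    show mul (xp 1) (xp n) = _
    rw [xp_mul_xp, add_comm]
  | negSucc i =>
    rw [elt_negSucc, xp_mul_omega]
    cases i with
    | zero => simp
    | succ i => rw [if_pos (by omega), if_neg (by omega)]; rfl

theorem omega_mul_elt (m : ℕ) (p : ℤ) :
    mul (omega m) (elt p) = if 0 ≤ p ∧ p ≤ m then elt (p - m - 1) else 0 := by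
  cases p with
  | ofNat n =>
    rw [RavK.mul_comm']
    show mul (xp n) (omega m) = _
    rw [xp_mul_omega]
    by_cases h : n ≤ m
    · rw [if_pos h, if_pos ⟨by simp, by simpa using h⟩,
        show Int.ofNat n - m - 1 = Int.negSucc (m - n) by simp only [Int.ofNat_eq_natCast]; omega]
      rfl
    · rw [if_neg h, if_neg fun h' => h (by simpa using h'.2)]
  | negSucc i => rw [elt_negSucc, mul_omega_omega, if_neg (by omega)]

end RavK

/-! ### Bilinear singular parts and locality -/

section Cof

variable {W : Type*} [AddCommGroup W] [Module ℂ W]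

/-- The family of coefficients of a bilinear map. -/
def cof (σ : ZMod 2 → ZMod 2 → ℂ) (B : RavK →ₗ[ℂ] RavK →ₗ[ℂ] W) : ℤ → ℤ → W := fun p q =>
  σ (ix p) (ix q) • B (elt p) (elt q)

/-- The operator dual to multiplication by `z - w`. -/
def delta : Module.End ℂ (RavK →ₗ[ℂ] RavK →ₗ[ℂ] W) where
  toFun B := B ∘ₗ mul (xp 1) - B.compl₂ (mul (xp 1))
  map_add' B C := LinearMap.ext fun α => LinearMap.ext fun β => by
    simp only [LinearMap.sub_apply, LinearMap.add_apply, LinearMap.comp_apply,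
      LinearMap.compl₂_apply]
    abel
  map_smul' c B := LinearMap.ext fun α => LinearMap.ext fun β => by
    simp only [LinearMap.sub_apply, LinearMap.smul_apply, LinearMap.comp_apply,
      LinearMap.compl₂_apply, RingHom.id_apply, smul_sub]

theorem delta_apply (B : RavK →ₗ[ℂ] RavK →ₗ[ℂ] W) (α β : RavK) :
    delta B α β = B (mul (xp 1) α) β - B α (mul (xp 1) β) := rfl

/-- Multiplication of a distribution by `z` is dual to multiplication of the test element by `u`.
The exceptional index `-1` reflects `u Ω⁰ = 0`; elsewhere `p` and `p + 1` have the same parity `ix`,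
so the sign `σ` is unaffected. -/
theorem mulZ_sub_mulW_cof (σ : ZMod 2 → ZMod 2 → ℂ) (B : RavK →ₗ[ℂ] RavK →ₗ[ℂ] W) :
    (mulZ - mulW : Module.End ℂ (ℤ → ℤ → W)) (cof σ B) = cof σ (delta B) := by
  ext p q
  have hix : ∀ p : ℤ, p ≠ -1 → ix (p + 1) = ix p := fun p hp => by
    unfold ix; split_ifs <;> first | rfl | omega
  show (if p = -1 then 0 else cof σ B (p + 1) q) - (if q = -1 then 0 else cof σ B p (q + 1)) = _
  rw [show cof σ (delta B) p q = σ (ix p) (ix q) • delta B (elt p) (elt q) from rfl, delta_apply,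
    xp_one_mul_elt, xp_one_mul_elt, smul_sub]
  congr 1
  · split_ifs with hp
    · simp
    · rw [cof, hix p hp]
  · split_ifs with hq
    · simp
    · rw [cof, hix q hq]

theorem mulZ_sub_mulW_pow_cof (σ : ZMod 2 → ZMod 2 → ℂ) (B : RavK →ₗ[ℂ] RavK →ₗ[ℂ] W) (n : ℕ) :
    ((mulZ - mulW : Module.End ℂ (ℤ → ℤ → W)) ^ n) (cof σ B) = cof σ ((delta ^ n) B) := by
  induction n with
  | zero => rfl
  | succ n ih =>
    rw [pow_succ', Module.End.mul_apply, ih, mulZ_sub_mulW_cof, pow_succ', Module.End.mul_apply]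

theorem delta_pow_compl₂ (B : RavK →ₗ[ℂ] RavK →ₗ[ℂ] W) (γ : RavK) (n : ℕ) :
    (delta ^ n) (B.compl₂ (mul γ)) = ((delta ^ n) B).compl₂ (mul γ) := by
  induction n with
  | zero => rfl
  | succ n ih =>
    rw [pow_succ', Module.End.mul_apply, ih, Module.End.mul_apply]
    refine LinearMap.ext fun α => LinearMap.ext fun β => ?_
    rw [delta_apply]
    simp only [LinearMap.compl₂_apply, delta_apply, mul_left_comm' γ]

/-- The bilinear map `(α, β) ↦ φ (∂^(i) α · β)`. -/
def diagBil (φ : RavK →ₗ[ℂ] W) (i : ℕ) : RavK →ₗ[ℂ] RavK →ₗ[ℂ] W :=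
  (mul.compr₂ φ) ∘ₗ dp RavK.deriv i

theorem diagBil_apply (φ : RavK →ₗ[ℂ] W) (i : ℕ) (α β : RavK) :
    diagBil φ i α β = φ (mul (dp RavK.deriv i α) β) := rfl

theorem RavK.dp_deriv_xp_one_mul (i : ℕ) (α : RavK) :
    dp RavK.deriv (i + 1) (mul (xp 1) α)
      = mul (xp 1) (dp RavK.deriv (i + 1) α) + dp RavK.deriv i α := by
  rw [dp_deriv_mul, Finset.Nat.sum_antidiagonal_succ, dp_zero, Module.End.one_apply]
  congr 1
  rw [Finset.sum_eq_single (0, i)]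
  · rw [dp_deriv_xp]; simp [xp_zero_mul]
  · rintro ⟨a, b⟩ hab hne
    rw [mem_antidiagonal] at hab
    have : a ≠ 0 := by rintro rfl; exact hne (by simp at hab; simp [hab])
    rw [dp_deriv_xp, Nat.choose_eq_zero_of_lt (by simp; omega)]; simp
  · intro h; simp at h

/-- The commutator of `∂⁽ⁱ⁾` with multiplication by `u` is `∂⁽ⁱ⁻¹⁾`, so each factor `z - w` lowers
the order of the singularity by one. -/
theorem delta_diagBil (φ : RavK →ₗ[ℂ] W) (i : ℕ) :
    delta (diagBil φ i) = if i = 0 then 0 else diagBil φ (i - 1) := by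
  refine LinearMap.ext fun α => LinearMap.ext fun β => ?_
  rw [delta_apply, diagBil_apply, diagBil_apply]
  cases i with
  | zero => simp [mul_assoc', mul_left_comm' (xp 1)]
  | succ i =>
    rw [RavK.dp_deriv_xp_one_mul, map_add, LinearMap.add_apply, map_add, mul_assoc',
      mul_left_comm' (xp 1), add_sub_cancel_left]
    simp [diagBil_apply]

theorem delta_pow_diagBil (φ : RavK →ₗ[ℂ] W) (i n : ℕ) :
    (delta ^ n) (diagBil φ i) = if n ≤ i then diagBil φ (i - n) else 0 := by
  induction n with
  | zero => simp
  | succ n ih =>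
    rw [pow_succ', Module.End.mul_apply, ih]
    split_ifs with h1 h2 h2
    · rw [delta_diagBil, if_neg (by omega)]; rfl
    · rw [delta_diagBil, if_pos (by omega)]
    · omega
    · simp

/-- The Leibniz rule for `∂⁽ⁱ⁾(Ωᵐα)`, in which `∂⁽ʲ⁾Ωᵐ` supplies sign and binomial coefficient.
Terms with `j > i` vanish, so the range may be enlarged to a common bound `n`. -/
theorem diagBil_omega_mul (φ : RavK →ₗ[ℂ] W) (i m n : ℕ) (hn : i ≤ n) (α β : RavK) :
    diagBil φ i (mul (omega m) α) β = ∑ j ∈ Finset.range (n + 1),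
      ((-1) ^ j * ((m + j).choose j : ℂ)) • (delta ^ j) (diagBil φ i) α (mul (omega (m + j)) β) := by
  rw [diagBil_apply, dp_deriv_mul, Finset.Nat.sum_antidiagonal_eq_sum_range_succ_mk, map_sum,
    LinearMap.sum_apply, map_sum, ← Finset.sum_subset (Finset.range_mono (by omega : i + 1 ≤ n + 1))]
  · refine Finset.sum_congr rfl fun j hj => ?_
    rw [Finset.mem_range] at hj
    rw [delta_pow_diagBil, if_pos (by omega), diagBil_apply, dp_deriv_omega]
    simp only [map_smul, LinearMap.smul_apply]
    rw [← mul_assoc', RavK.mul_comm' (omega _)]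
  · intro j _ hj
    rw [Finset.mem_range] at hj
    rw [delta_pow_diagBil, if_neg (by omega)]; simp

/-- Multiplication by `Ω_z^m` reads only coefficients whose first index is negative, and `hB`
removes those whose second index is negative too. Hence the single sign `σ 0 1` remains. -/
theorem mulOmegaZ_cof (σ : ZMod 2 → ZMod 2 → ℂ) (B : RavK →ₗ[ℂ] RavK →ₗ[ℂ] W) (τ : ℂ)
    (hσ : σ 0 1 = τ) (hB : ∀ α β, IsPar 1 α → IsPar 1 β → B α β = 0) (m : ℕ) :
    mulOmegaZ m (cof σ B) = cof (fun _ _ => τ) (B ∘ₗ mul (omega m)) := by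
  ext p q
  rw [mulOmegaZ, show cof (fun _ _ => τ) (B ∘ₗ mul (omega m)) p q
    = τ • B (mul (omega m) (elt p)) (elt q) from rfl, omega_mul_elt]
  split_ifs with hp
  · rw [cof, show ix (p - m - 1) = 0 from if_neg (by omega)]
    cases q with
    | ofNat n => rw [show ix (Int.ofNat n) = 1 from ix_natCast n, hσ]
    | negSucc i =>
      rw [elt_negSucc, hB _ _ ?_ (isPar_omega i), smul_zero, smul_zero]
      have := isPar_elt (p - m - 1)
      rwa [show ix (p - m - 1) = 0 from if_neg (by omega)] at this
  · simp

theorem mulOmegaW_cof (σ : ZMod 2 → ZMod 2 → ℂ) (B : RavK →ₗ[ℂ] RavK →ₗ[ℂ] W) (τ : ℂ)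
    (hσ : σ 1 0 = -τ) (hB : ∀ α β, IsPar 1 α → IsPar 1 β → B α β = 0) (m : ℕ) :
    mulOmegaW m (cof σ B) = cof (fun _ _ => τ) (B.compl₂ (mul (omega m))) := by
  ext p q
  rw [mulOmegaW, show cof (fun _ _ => τ) (B.compl₂ (mul (omega m))) p q
    = τ • B (elt p) (mul (omega m) (elt q)) from rfl, omega_mul_elt]
  split_ifs with hq
  · rw [cof, show ix (q - m - 1) = 0 from if_neg (by omega)]
    cases p with
    | ofNat n => rw [show ix (Int.ofNat n) = 1 from ix_natCast n, hσ, smul_smul]; simp [koszul]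
    | negSucc i =>
      rw [elt_negSucc, hB _ _ (isPar_omega i), smul_zero, smul_zero, smul_zero]
      have := isPar_elt (q - m - 1)
      rwa [show ix (q - m - 1) = 0 from if_neg (by omega)] at this
  · simp

/-- A finite sum of singular terms of order at most `n + 1` is killed by `(z - w)ⁿ⁺¹`, and the
condition on `Ω_z^m` is its Taylor expansion `diagBil_omega_mul`. The hypothesis `hσ` compensates
the sign for moving `Ω_w` past `Ω_z`. -/
theorem mutuallyLocal_of_eq_cof {N : Type w} [AddCommGroup N] [Module ℂ N] {a b : ZMod 2}
    {A B : ℤ → Module.End ℂ N} (σ : ZMod 2 → ZMod 2 → ℂ) (hσ : σ 1 0 = -σ 0 1) (n : ℕ)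
    (φ : ℕ → RavK →ₗ[ℂ] Module.End ℂ N)
    (h : prodZW a A B - prodWZ a b A B = cof σ (∑ i ∈ Finset.range (n + 1), diagBil (φ i) i)) :
    MutuallyLocal a b A B := by
  have hB : ∀ α β, IsPar 1 α → IsPar 1 β →
      (∑ i ∈ Finset.range (n + 1), diagBil (φ i) i) α β = 0 := by
    intro α β hα hβ
    rw [LinearMap.sum_apply, LinearMap.sum_apply]
    refine Finset.sum_eq_zero fun i _ => ?_
    rw [diagBil_apply, (hα.dp i).mul_eq_zero hβ, map_zero]
  refine ⟨n, ?_, fun m => ?_⟩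
  · rw [h, mulZ_sub_mulW_pow_cof, map_sum, Finset.sum_eq_zero fun i hi => ?_]
    · ext p q; simp [cof]
    · rw [Finset.mem_range] at hi
      rw [delta_pow_diagBil, if_neg (by omega)]
  · have e1 : ∀ j, ((mulW - mulZ : Module.End ℂ (ℤ → ℤ → Module.End ℂ N)) ^ j)
        (mulOmegaW (m + j) (prodZW a A B - prodWZ a b A B))
        = (-1 : ℂ) ^ j • cof (fun _ _ => σ 0 1) (∑ i ∈ Finset.range (n + 1),
          ((delta ^ j) (diagBil (φ i) i)).compl₂ (mul (omega (m + j)))) := by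
      intro j
      rw [h, mulOmegaW_cof σ _ _ hσ hB, ← neg_sub mulZ mulW, ← neg_one_smul ℂ, smul_pow,
        LinearMap.smul_apply, mulZ_sub_mulW_pow_cof]
      rw [delta_pow_compl₂, map_sum]
      congr 2
      refine LinearMap.ext fun α => LinearMap.ext fun β => ?_
      simp only [LinearMap.compl₂_apply, LinearMap.sum_apply]
    simp only [e1]
    rw [h, mulOmegaZ_cof σ _ _ rfl hB]
    ext p q : 2
    simp only [Pi.sub_apply, Finset.sum_apply, Pi.smul_apply, cof, LinearMap.comp_apply,
      LinearMap.sum_apply, LinearMap.compl₂_apply, Pi.zero_apply]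
    rw [sub_eq_zero]
    simp only [smul_comm _ (σ 0 1)]
    rw [← Finset.smul_sum]
    congr 1
    simp only [Finset.smul_sum]
    rw [Finset.sum_comm]
    refine Finset.sum_congr rfl fun i hi => ?_
    rw [Finset.mem_range] at hi
    rw [diagBil_omega_mul _ i m n (by omega)]
    refine Finset.sum_congr rfl fun j _ => ?_
    rw [smul_smul, mul_comm]

end Cof

/-! ### Modes of states: homogeneity, translation, products and locality. -/

section

variable {g : Type u} [AddCommGroup g] [Module ℂ g] {𝔤 : LieSuperalgebra g} {h : InvariantForm 𝔤}
  {V : Type u} [AddCommGroup V] [Module ℂ V] {M : Type w} [AddCommGroup M] [Module ℂ M]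
  {U : VacMod 𝔤 h V}

theorem exists_parOp (Y : FieldMap U U.rep) : ∃ f : V →ₗ[ℂ] V, ∀ d, ∀ a ∈ U.deg d, f a = koszul (tot d + 1) 1 • a := by
  obtain ⟨f, hf⟩ := exists_gradedLift (VacMod.isGrading Y)
    (fun d => koszul (tot d + 1) 1 • (LinearMap.id : V →ₗ[ℂ] V))
  exact ⟨f, hf⟩

variable (Y : FieldMap U U.rep) {R : SmRep 𝔤 h M} (X : FieldMap U R)

/-- The sign `(-1)^{|a| + 1}`. -/
def parOp : V →ₗ[ℂ] V := (exists_parOp Y).choose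

theorem parOp_apply {d : Bideg} {a : V} (ha : a ∈ U.deg d) :
    parOp Y a = koszul (tot d + 1) 1 • a := (exists_parOp Y).choose_spec d a ha

/-- The mode of index `n` of the field of a state. -/
def mode : ℤ → V →ₗ[ℂ] Module.End ℂ M
  | .ofNat n => LinearMap.applyₗ (xp n) ∘ₗ X.fld ∘ₗ parOp Y
  | .negSucc i => LinearMap.applyₗ (omega i) ∘ₗ X.fld

/-- The modes of the field of a state. -/
def modes : V →ₗ[ℂ] (ℤ → Module.End ℂ M) := LinearMap.pi fun n => mode Y X n

theorem modes_natCast (a : V) (n : ℕ) : modes Y X a n = X.fld (parOp Y a) (xp n) := rfl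

theorem modes_negSucc (a : V) (i : ℕ) : modes Y X a (.negSucc i) = X.fld a (omega i) := rfl

theorem modes_apply {d : Bideg} {a : V} (ha : a ∈ U.deg d) (n : ℤ) :
    modes Y X a n = koszul (tot d + 1) (ix n) • X.fld a (elt n) := by
  cases n with
  | ofNat n =>
    show X.fld (parOp Y a) (xp n) = _
    rw [parOp_apply Y ha, map_smul]
    rfl
  | negSucc i =>
    rw [modes_negSucc, ix_negSucc, koszul_comm, koszul_zero_left, one_smul]; rfl

theorem isField_modes (a : V) : IsField (modes Y X a) := by
  intro v
  obtain ⟨N, hN⟩ := (X.isSm_fld (parOp Y a)).evZero_xp v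
  refine ⟨N, fun n hn => ?_⟩
  lift n to ℕ using by omega
  exact hN n (by omega)

theorem modes_vac (n : ℤ) : modes Y X U.vac n = if n = -1 then 1 else 0 := by
  rw [modes_apply Y X PreVac.vac_mem, X.fld_vac]
  refine LinearMap.ext fun v => ?_
  rw [LinearMap.smul_apply, idField_apply]
  cases n with
  | ofNat n => rw [show elt (Int.ofNat n) = xp n from rfl, res_xp, if_neg (by simp)]; simp
  | negSucc i =>
    rw [elt_negSucc, res_omega, ix_negSucc, koszul_comm, koszul_zero_left]
    cases i with
    | zero => simp
    | succ i => rw [if_neg (by omega), if_neg (by omega)]; simp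

theorem modes_mem {Γ : Type v} [AddCommGroup Γ] {π : Bideg →+ Γ} {D : Γ → Submodule ℂ M}
    (hR : ∀ {d : Bideg} {x : (g ⊗[ℂ] RavK) × ℂ}, x ∈ (𝔤.affine h).deg d →
      R.ρ x ∈ degEnd D (π d)) {d : Bideg} {γ : Γ} {a : V} {v : M} (ha : a ∈ U.deg d)
    (hv : v ∈ D γ) (n : ℤ) : modes Y X a n v ∈ D (π (d - ixDeg n) + γ) := by
  rw [modes_apply Y X ha]
  have := X.fld_mem hR ha (elt_mem n) γ v hv
  rw [show d - (1, 0) + ((1 - (ixDeg n).1, 0) : Bideg) = d - ixDeg n by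
    have h2 : (ixDeg n).2 = 0 := by unfold ixDeg; split_ifs <;> rfl
    ext
    · simp
    · simp [h2]] at this
  exact Submodule.smul_mem _ _ this

/-! ### Translation -/

/-- The translation operator acts on the field `C` by the derivative. -/
def TransField (T : Module.End ℂ V) (C : Op V) : Prop :=
  ∀ β v, T (C β v) - C β (T v) = -C (RavK.deriv β) v

/-- Differentiating `C(Ωⁿ) D(uⁿβ)` termwise produces `(n + 1) C(Ωⁿ⁺¹) D(uⁿβ)` and `-n C(Ωⁿ)
D(uⁿ⁻¹β)`, which telescope; what remains is the term with `∂β`. -/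
theorem TransField.nop {T : Module.End ℂ V} {C D : Op V} (hC : TransField T C)
    (hD : TransField T D) (hCs : IsSm C) (hDs : IsSm D) (c : ℂ) : TransField T (nop c C D) := by
  have key : ∀ {C D : Op V}, TransField T C → TransField T D → IsSm C → IsSm D →
      TransField T (tri C D) := by
    intro C D hC hD hCs hDs β v
    have h1 : ∀ n, T (C (omega n) (D (mul (xp n) β) v)) - C (omega n) (D (mul (xp n) β) (T v))
        = (((n + 1 : ℕ) : ℂ) • C (omega (n + 1)) (D (mul (xp n) β) v)
          - (n : ℂ) • C (omega n) (D (mul (xp (n - 1)) β) v))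
          - C (omega n) (D (mul (xp n) (RavK.deriv β)) v) := by
      intro n
      have e1 := hC (omega n) (D (mul (xp n) β) v)
      have e2 := congrArg (C (omega n)) (hD (mul (xp n) β) v)
      rw [deriv_omega, map_smul, LinearMap.smul_apply] at e1
      rw [RavK.deriv_mul, deriv_xp] at e2
      simp only [map_add, map_sub, map_neg, map_smul, LinearMap.add_apply, LinearMap.smul_apply,
        neg_smul, neg_neg] at e1 e2
      rw [← sub_add_sub_cancel, e1, e2]
      push_cast
      abel
    have hz := tri_evZero C hDs β v
    have ha : EvZero fun n => ((n + 1 : ℕ) : ℂ) • C (omega (n + 1)) (D (mul (xp n) β) v) := by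
      obtain ⟨N, hN⟩ := hDs.evZero β v
      refine ⟨N, fun k hk => ?_⟩
      show _ • C _ (D (mul (xp k) β) v) = 0
      rw [show D (mul (xp k) β) v = 0 from hN k hk]; simp
    have hb : EvZero fun n => (n : ℂ) • C (omega n) (D (mul (xp (n - 1)) β) v) := by
      obtain ⟨N, hN⟩ := hDs.evZero β v
      refine ⟨N + 1, fun k hk => ?_⟩
      show _ • C _ (D (mul (xp (k - 1)) β) v) = 0
      rw [show D (mul (xp (k - 1)) β) v = 0 from hN (k - 1) (by omega)]; simp
    rw [tri_apply, map_evsum _ hz, tri_apply, ← evsum_sub]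
    simp only [h1]
    rw [evsum_sub, evsum_sub, evsum_succ hb, tri_apply]
    simp
  intro β v
  have h1 := key hC hD hCs hDs β v
  have h2 := key hD hC hDs hCs (proj0 β) v
  have h3 : proj0 (RavK.deriv β) = RavK.deriv (proj0 β) := by ext1 <;> simp [proj0, RavK.deriv]
  simp only [Raviolo.nop, LinearMap.add_apply, LinearMap.smul_apply, LinearMap.comp_apply, map_add,
    map_smul, h3]
  rw [neg_add, ← h1, ← smul_neg, ← h2]
  module

theorem TransField.smul {T : Module.End ℂ V} {C : Op V} (hC : TransField T C) (c : ℂ) :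
    TransField T (c • C) := by
  intro β v
  simp only [LinearMap.smul_apply, map_smul]
  rw [← smul_sub, hC, smul_neg]

theorem transField_gen {p : ZMod 2} {x : (g ⊗[ℂ] RavK) × ℂ} (hx : Gen 𝔤 p x) :
    TransField (vT Y) (Y.fld (U.ρ x U.vac)) := by
  refine mu_induction (Y := Y) (P := fun a => TransField (vT Y) (Y.fld a)) ?_ ?_ ?_ hx
  · intro a ha β v
    rw [Y.fld_vT Y]
    simp only [LinearMap.neg_apply, LinearMap.comp_apply, map_neg]
    rw [← ha (RavK.deriv β) v]; abel
  · intro c a ha; rw [map_smul]; exact ha.smul c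
  · intro y hy β v
    cases hy with
    | mu hA =>
      rw [Y.fld_mu_zero_vac hA]
      show vT Y (U.ρ (LieSuperalgebra.toAffine (_ ⊗ₜ β)) v) - U.ρ (LieSuperalgebra.toAffine (_ ⊗ₜ β))
        (vT Y v) = -U.ρ (LieSuperalgebra.toAffine (_ ⊗ₜ RavK.deriv β)) v
      rw [vT_act, ← dp_one (affineD g), dp_affineD_tmul, dp_one]
      abel
    | kappa =>
      rw [Y.fld_kappa_vac, Y.fld_kappa_vac, res_deriv]
      show vT Y (res β • U.ρ _ v) - res β • U.ρ _ (vT Y v) = _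
      rw [map_smul, vT_act, show affineD g (LieSuperalgebra.kappa g) = 0 by
        rw [← dp_one (affineD g), dp_affineD_kappa]; simp]
      simp

theorem transField (a : V) : TransField (vT Y) (Y.fld a) := by
  refine U.induction (P := fun a => TransField (vT Y) (Y.fld a)) ?_ ?_ ?_ a
  · intro β v; simp
  · intro b c hb hc β v
    simp only [map_add, LinearMap.add_apply, neg_add]
    rw [← hb, ← hc]; abel
  · intro e b hb
    refine PreVac.deg_induction (P := fun e b => TransField (vT Y) (Y.fld b)) ?_ ?_ ?_ ?_ ?_ hb
    · intro e β v; simp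
    · intro e b c hb hc β v
      simp only [map_add, LinearMap.add_apply, neg_add]
      rw [← hb, ← hc]; abel
    · intro e b c hb; rw [map_smul]; exact hb.smul c
    · intro β v
      rw [Y.fld_vac, idField_apply, idField_apply, idField_apply, res_deriv]; simp
    · intro p x e b hx hb ih
      rw [Y.fld_gen_act hx hb]
      exact (transField_gen Y hx).nop ih (Y.isSm_fld _) (Y.isSm_fld _) _

theorem vT_modes (a v : V) (n : ℤ) :
    vT Y (modes Y Y a n v) - modes Y Y a n (vT Y v) = -(n : ℂ) • modes Y Y a (n - 1) v := by
  cases n with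
  | ofNat n =>
    show vT Y (Y.fld (parOp Y a) (xp n) v) - Y.fld (parOp Y a) (xp n) (vT Y v) = _
    rw [transField Y, deriv_xp]
    cases n with
    | zero => simp
    | succ n =>
      rw [show Int.ofNat (n + 1) - 1 = (n : ℤ) by simp, modes_natCast]
      simp only [map_smul, LinearMap.smul_apply, Nat.add_sub_cancel, ← neg_smul]
      congr 1
  | negSucc i =>
    rw [modes_negSucc, transField Y, deriv_omega,
      show Int.negSucc i - 1 = Int.negSucc (i + 1) by omega, modes_negSucc]
    simp only [map_smul, LinearMap.smul_apply, ← neg_smul]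
    congr 1
    push_cast; ring

/-! ### Products of modes -/

/-- The sign that relates products of modes to products of fields. -/
def prodSign (a b : ZMod 2) (x y : ZMod 2) : ℂ := koszul (a + x) y * koszul (a + 1) x * koszul (b + 1) y

variable {d e : Bideg} {a b : V}

theorem prodZW_modes (ha : a ∈ U.deg d) (hb : b ∈ U.deg e) (p q : ℤ) (v : M) :
    prodZW (tot d) (modes Y X a) (modes Y X b) p q v
      = prodSign (tot d) (tot e) (ix p) (ix q) • X.fld a (elt p) (X.fld b (elt q) v) := by
  rw [prodZW, modes_apply Y X ha, modes_apply Y X hb]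
  simp only [LinearMap.smul_apply, Module.End.mul_apply, map_smul, smul_smul, prodSign]
  congr 1; ring

theorem prodWZ_modes (ha : a ∈ U.deg d) (hb : b ∈ U.deg e) (p q : ℤ) (v : M) :
    prodWZ (tot d) (tot e) (modes Y X a) (modes Y X b) p q v
      = prodSign (tot d) (tot e) (ix p) (ix q) • koszul (tot d + ix p) (tot e + ix q) •
        X.fld b (elt q) (X.fld a (elt p) v) := by
  rw [prodWZ, modes_apply Y X ha, modes_apply Y X hb]
  simp only [LinearMap.smul_apply, Module.End.mul_apply, map_smul, smul_smul, prodSign]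
  congr 1
  have h1 := koszul_mul_self (ix q) (ix p)
  have h2 := koszul_mul_self (tot d + ix p) (ix q)
  rw [koszul_add_left (tot e), koszul_add_right _ (tot e), koszul_add_left (tot d) (ix p) (tot e),
    koszul_comm (ix p) (tot e), koszul_comm (ix p) (ix q)]
  linear_combination (koszul (tot d) (tot e) * koszul (tot e) (ix p) * koszul (tot d + 1) (ix p)
    * koszul (tot e + 1) (ix q)) * (h1 - h2)

theorem modes_modes (ha : a ∈ U.deg d) (hb : b ∈ U.deg e) (p q : ℤ) (v : M) :
    modes Y X (modes Y Y a p b) q v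
      = prodSign (tot d) (tot e) (ix p) (ix q) • X.fld (Y.fld a (elt p) b) (elt q) v := by
  have hm := modes_mem Y Y (π := AddMonoidHom.id Bideg) (D := U.deg)
    (fun hx _ _ hv => PreVac.act_mem hx hv) ha hb p
  rw [modes_apply Y X hm, modes_apply Y Y ha]
  have ht : tot (AddMonoidHom.id Bideg (d - ixDeg p) + e) + 1 = tot d + ix p + (tot e + 1) := by
    rw [AddMonoidHom.id_apply, SmRep.tot_add, sub_eq_add_neg, SmRep.tot_add,
      show tot (-ixDeg p) = ix p by
        unfold ixDeg ix; split_ifs <;> simp [tot]]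
    ring
  rw [ht, koszul_add_left]
  simp only [LinearMap.smul_apply, map_smul, smul_smul, prodSign]
  congr 1; ring

theorem prodZW_sub_prodWZ (ha : a ∈ U.deg d) (hb : b ∈ U.deg e) (p q : ℤ) (v : M) :
    prodZW (tot d) (modes Y X a) (modes Y X b) p q v
        - prodWZ (tot d) (tot e) (modes Y X a) (modes Y X b) p q v
      = (prodSign (tot d) (tot e) (ix p) (ix q) * koszul (1 + ix p) (tot e + 1)) •
        evsum fun i => X.fld (Y.fld a (xp i) b) (mul (dp RavK.deriv i (elt p)) (elt q)) v := by
  have h1 := comm (Y := Y) (X := X) ha hb _ _ _ _ (isPar_elt p) (isPar_elt q) v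
  have two : (1 : ZMod 2) + 1 = 0 := rfl
  rw [show tot d + 1 + (1 + ix p) = tot d + ix p by linear_combination two,
    show tot e + 1 + (1 + ix q) = tot e + ix q by linear_combination two] at h1
  rw [prodZW_modes Y X ha hb, prodWZ_modes Y X ha hb, ← smul_sub, h1, smul_smul]

/-- By the commutator formula the commutator of modes is a sum of singular terms `diagBil`, up to a
sign that depends only on the index parities; only finitely many products `a_(i) b` contribute. -/
theorem mutuallyLocal_modes (ha : a ∈ U.deg d) (hb : b ∈ U.deg e) :
    MutuallyLocal (tot d) (tot e) (modes Y X a) (modes Y X b) := by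
  obtain ⟨N, hN⟩ := evZero_singular (Y := Y) (X := X) a b
  refine mutuallyLocal_of_eq_cof (fun x y => prodSign (tot d) (tot e) x y *
    koszul (1 + x) (tot e + 1)) ?_ N (fun i => X.fld (Y.fld a (xp i) b)) ?_
  · have two : (1 : ZMod 2) + 1 = 0 := rfl
    have h11 : koszul 1 1 = -1 := by simp [koszul]
    simp only [prodSign, add_zero, two, koszul_zero_left, koszul_comm _ 0, mul_one]
    rw [koszul_add_left (tot d) 1, h11, koszul_comm 1 (tot e + 1)]
    linear_combination (koszul (tot d) 1) * koszul_mul_self (tot e + 1) 1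
  · ext p q v
    rw [Pi.sub_apply, Pi.sub_apply, LinearMap.sub_apply, prodZW_sub_prodWZ Y X ha hb,
      evsum_eq (N := N + 1) fun k hk => by
        rw [show X.fld (Y.fld a (xp k) b) = 0 from hN k (by omega)]; rfl]
    simp only [cof, LinearMap.smul_apply, LinearMap.sum_apply, diagBil_apply]

end

/-! ### Eventually zero families as finitely supported functions. -/

section EvFinsupp

variable {M : Type*} [AddCommGroup M] [Module ℂ M] {W : Type*} [AddCommGroup W]

theorem exists_evFinsupp {f : ℕ → W} (hf : ∃ N, ∀ k ≥ N, f k = 0) : ∃ F : ℕ →₀ W, ∀ k, F k = f k := by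
  obtain ⟨N, hN⟩ := hf
  refine ⟨Finsupp.onFinset (Finset.range N) f fun k hk => ?_, fun k => rfl⟩
  rw [Finset.mem_range]
  by_contra h
  exact hk (hN k (by omega))

theorem Finsupp.sum_eq_evsum (F : ℕ →₀ W) (φ : ℕ → W → M) (hφ : ∀ m, φ m 0 = 0) :
    F.sum φ = evsum fun m => φ m (F m) := by
  obtain ⟨N, hN⟩ : ∃ N, ∀ k ≥ N, F k = 0 := by
    refine ⟨F.support.sup id + 1, fun k hk => ?_⟩
    by_contra h
    have := Finset.le_sup (f := id) (Finsupp.mem_support_iff.2 h)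
    simp at this; omega
  rw [evsum_eq (N := N) fun k hk => by rw [hN k hk, hφ], Finsupp.sum]
  refine Finset.sum_subset (fun k hk => ?_) fun k _ hk => ?_
  · rw [Finset.mem_range]
    by_contra h
    exact Finsupp.mem_support_iff.1 hk (hN k (by omega))
  · rw [Finsupp.notMem_support_iff.1 hk, hφ]

end EvFinsupp

/-! ### Normal-ordered modes and the associativity of fields. -/

section

variable {g : Type u} [AddCommGroup g] [Module ℂ g] {𝔤 : LieSuperalgebra g} {h : InvariantForm 𝔤}
  {V : Type u} [AddCommGroup V] [Module ℂ V] {M : Type w} [AddCommGroup M] [Module ℂ M]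
  {U : VacMod 𝔤 h V} (Y : FieldMap U U.rep) {R : SmRep 𝔤 h M} (X : FieldMap U R)
  {d e : Bideg} {a b : V}

theorem fld_omega_omega (ha : a ∈ U.deg d) (hb : b ∈ U.deg e) (l k : ℕ) (v : M) :
    X.fld (Y.fld a (omega l) b) (omega k) v = ∑ i ∈ Finset.Icc l (k + l),
      (i.choose l : ℂ) • X.fld a (omega i) (X.fld b (omega (k + l - i)) v) := by
  have e1 : ((-1 : ℂ)) ^ l * (-1) ^ l = 1 := by rw [← mul_pow]; simp
  rw [Y.fld_nop_omega X ha hb, nop_omega, tri_omega, LinearMap.sum_apply,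
    Finset.Nat.sum_antidiagonal_eq_sum_range_succ_mk]
  refine (Finset.sum_bij (fun i _ => i + l) ?_ ?_ ?_ ?_)
  · intro i hi; rw [Finset.mem_range] at hi; rw [Finset.mem_Icc]; omega
  · intro i _ j _ hij; omega
  · intro j hj; rw [Finset.mem_Icc] at hj
    exact ⟨j - l, Finset.mem_range.2 (by omega), by omega⟩
  · intro i hi
    simp only [LinearMap.smul_apply, LinearMap.comp_apply, Module.End.mul_apply, dp_deriv_omega,
      map_smul, smul_smul, ← mul_assoc, e1, one_mul]
    rw [show k + l - (i + l) = k - i by omega]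

theorem fld_omega_xp (ha : a ∈ U.deg d) (hb : b ∈ U.deg e) (l k : ℕ) (v : M) :
    X.fld (Y.fld a (omega l) b) (xp k) v
      = (evsum fun n => ((n + l).choose l : ℂ) • X.fld a (omega (n + l)) (X.fld b (xp (n + k)) v))
        + ((-1) ^ l * koszul (tot d) (tot e)) • evsum fun n => ((n + k).choose l : ℂ) •
          X.fld b (omega n) (X.fld a (xp (n + k - l)) v) := by
  have e1 : ((-1 : ℂ)) ^ l * (-1) ^ l = 1 := by rw [← mul_pow]; simp
  rw [Y.fld_nop_omega X ha hb, show xp k = ofSeries (PowerSeries.X ^ k) from rfl, nop_series,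
    show ofSeries (PowerSeries.X ^ k) = xp k from rfl, LinearMap.add_apply, LinearMap.smul_apply,
    tri_apply, tri_apply]
  simp only [LinearMap.smul_apply, LinearMap.comp_apply, dp_deriv_omega, dp_deriv_xp, xp_mul_xp,
    map_smul, smul_smul, ← mul_assoc, e1, one_mul]
  congr 1
  rw [mul_comm, mul_smul]
  congr 1
  rw [← evsum_smul]
  simp only [smul_smul]

/-- The field of a composite state is a normal-ordered product. -/
theorem modes_normalOrdered (ha : a ∈ U.deg d) (hb : b ∈ U.deg e) (l : ℕ) (m : ℤ) (v : M) :
    modes Y X (Y.fld a (omega l) b) m v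
      = normalOrderedMode (tot d) (tot e) l (modes Y X a) (modes Y X b) m v := by
  have hd : Y.fld a (omega l) b ∈ U.deg (d + e) := vfld_omega_mem Y ha hb l
  have h11 : koszul 1 1 = -1 := by simp [koszul]
  cases m with
  | negSucc k =>
    rw [modes_negSucc, fld_omega_omega Y X ha hb]
    rfl
  | ofNat k =>
    rw [modes_apply Y X hd, show elt (Int.ofNat k) = xp k from rfl, LinearMap.smul_apply,
      fld_omega_xp Y X ha hb, show ix (Int.ofNat k) = 1 from ix_natCast k, smul_add, smul_smul,
      normalOrderedMode]
    congr 1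
    · have e1 : (∑ᶠ i : ℕ, (i.choose l : ℂ) • modes Y X a (.negSucc i) (modes Y X b (k + i - l) v))
          = koszul (tot e + 1) 1 • evsum fun n => ((n + l).choose l : ℂ) •
            X.fld a (omega (n + l)) (X.fld b (xp (n + k)) v) := by
        have hz : EvZero fun i : ℕ => (i.choose l : ℂ) •
            modes Y X a (.negSucc i) (modes Y X b (k + i - l) v) := by
          obtain ⟨N, hN⟩ := isField_modes Y X b v
          refine ⟨N.toNat + l, fun i hi => ?_⟩
          dsimp only
          rw [hN _ (by omega)]; simp
        rw [← evsum_eq_finsum hz, evsum_shift l _ hz, ← evsum_smul]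
        · congr 1; ext n
          rw [show ((k : ℤ) + (l + n : ℕ) - l) = ((n + k : ℕ) : ℤ) by push_cast; ring,
            modes_apply Y X hb, elt_natCast, ix_natCast, modes_negSucc, LinearMap.smul_apply,
            map_smul, smul_comm, add_comm l n]
        · intro i hi; rw [Nat.choose_eq_zero_of_lt hi]; simp
      rw [e1, smul_smul]
      congr 1
      rw [SmRep.tot_add, add_assoc, koszul_add_left]
    · have e1 : (∑ᶠ j : ℕ, ((k + j).choose l : ℂ) •
            modes Y X b (.negSucc j) (modes Y X a (k + j - l) v))
          = koszul (tot d + 1) 1 • evsum fun n => ((n + k).choose l : ℂ) •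
            X.fld b (omega n) (X.fld a (xp (n + k - l)) v) := by
        have hz : EvZero fun j : ℕ => ((k + j).choose l : ℂ) •
            modes Y X b (.negSucc j) (modes Y X a (k + j - l) v) := by
          obtain ⟨N, hN⟩ := isField_modes Y X a v
          refine ⟨N.toNat + l, fun i hi => ?_⟩
          dsimp only
          rw [hN _ (by omega)]; simp
        rw [← evsum_eq_finsum hz, ← evsum_smul]
        congr 1; ext n
        by_cases hl : l ≤ k + n
        · rw [show ((k : ℤ) + n - l) = ((n + k - l : ℕ) : ℤ) by omega,
            modes_apply Y X ha, elt_natCast, ix_natCast, modes_negSucc, LinearMap.smul_apply,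
            map_smul, smul_comm, add_comm k n]
        · rw [Nat.choose_eq_zero_of_lt (by omega), Nat.choose_eq_zero_of_lt (by omega)]; simp
      rw [e1, smul_smul]
      congr 1
      rw [SmRep.tot_add, koszul_add_left _ 1 1, koszul_add_left, koszul_add_left _ 1 1,
        koszul_add_left _ 1 (tot e), h11, koszul_comm 1 (tot e)]
      ring

theorem comm_elt (ha : a ∈ U.deg d) (hb : b ∈ U.deg e) (p q : ℤ) (v : M) :
    X.fld a (elt p) (X.fld b (elt q) v)
      = koszul (tot d + ix p) (tot e + ix q) • X.fld b (elt q) (X.fld a (elt p) v)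
        + koszul (1 + ix p) (tot e + 1) •
          evsum fun i => X.fld (Y.fld a (xp i) b) (mul (dp RavK.deriv i (elt p)) (elt q)) v := by
  have h1 := comm (Y := Y) (X := X) ha hb _ _ _ _ (isPar_elt p) (isPar_elt q) v
  have two : (1 : ZMod 2) + 1 = 0 := rfl
  rw [show tot d + 1 + (1 + ix p) = tot d + ix p by linear_combination two,
    show tot e + 1 + (1 + ix q) = tot e + ix q by linear_combination two] at h1
  rw [← h1]; abel

/-- The associativity of the fields of two states. -/
theorem exists_threePoint (ha : a ∈ U.deg d) (hb : b ∈ U.deg e) (v : M) : ∃ F : ThreePoint M,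
    (∀ p q, F.expandZW p q = prodZW (tot d) (modes Y X a) (modes Y X b) p q v) ∧
    (∀ p q, F.expandWZ p q = prodWZ (tot d) (tot e) (modes Y X a) (modes Y X b) p q v) ∧
    (∀ p q, F.expandDiag p q = modes Y X (modes Y Y a p b) q v) := by
  simp only [prodZW_modes Y X ha hb, prodWZ_modes Y X ha hb, modes_modes Y X ha hb]
  have h11 : koszul 1 1 = -1 := by simp [koszul]
  set S := prodSign (tot d) (tot e) with hS
  have two : (1 : ZMod 2) + 1 = 0 := rfl
  have S00 : S 0 0 = 1 := by simp [hS, prodSign, koszul_zero_left, koszul_comm _ 0]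
  have S10 : S 1 0 = -koszul (tot d) 1 := by
    simp [hS, prodSign, koszul_zero_left, koszul_comm _ 0, koszul_add_left (tot d), h11]
  have S01 : S 0 1 = -(koszul (tot d) 1 * koszul (tot e) 1) := by
    simp [hS, prodSign, koszul_zero_left, koszul_comm _ 0, koszul_add_left (tot e), h11]
  obtain ⟨Na, hNa⟩ := (X.isSm_fld a).evZero_xp v
  replace hNa : ∀ k ≥ Na, X.fld a (xp k) v = 0 := hNa
  obtain ⟨Nb, hNb⟩ := (X.isSm_fld b).evZero_xp v
  replace hNb : ∀ k ≥ Nb, X.fld b (xp k) v = 0 := hNb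
  obtain ⟨N, hN⟩ := (Y.isSm_fld a).evZero_xp b
  replace hN : ∀ k ≥ N, Y.fld a (xp k) b = 0 := hN
  -- Each coefficient is read off from an expansion in which it stands alone: `r` and `t` from
  -- `expandZW`, `s` and `x` from `expandWZ`, `D` and `y` from `expandDiag`. The remaining entries
  -- become identities: the commutator formula where `Ω_{z-w}` is expanded, and the normal-ordering
  -- formula for negative first index in `expandDiag`.
  obtain ⟨s, hs⟩ := exists_evFinsupp (f := fun (m : ℕ) (j : ℕ) => S 1 0 •
    koszul (tot d + 1) (tot e) • X.fld b (omega j) (X.fld a (xp m) v))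
    ⟨Na, fun k hk => by ext j; rw [hNa k hk]; simp⟩
  obtain ⟨t, ht⟩ := exists_evFinsupp (f := fun (m : ℕ) (i : ℕ) => S 0 1 •
    X.fld a (omega i) (X.fld b (xp m) v)) ⟨Nb, fun k hk => by ext j; rw [hNb k hk]; simp⟩
  obtain ⟨D, hD⟩ := exists_evFinsupp (f := fun (m : ℕ) (j : ℕ) => S 1 0 •
    X.fld (Y.fld a (xp m) b) (omega j) v) ⟨N, fun k hk => by ext j; rw [hN k hk]; simp⟩
  have hx' : ∀ m, ∃ F : ℕ →₀ M, ∀ k, F k = S 1 1 • koszul (tot d + 1) (tot e + 1) •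
      X.fld b (xp k) (X.fld a (xp m) v) := fun m => exists_evFinsupp (by
    obtain ⟨N, hN⟩ := (X.isSm_fld b).evZero_xp (X.fld a (xp m) v)
    beta_reduce at hN
    exact ⟨N, fun k hk => by rw [hN k hk]; simp⟩)
  choose x' hx' using hx'
  obtain ⟨x, hx⟩ := exists_evFinsupp (f := x')
    ⟨Na, fun k hk => by ext j; rw [hx', hNa k hk]; simp⟩
  have hy' : ∀ m, ∃ F : ℕ →₀ M, ∀ k, F k = S 1 1 • X.fld (Y.fld a (xp m) b) (xp k) v :=
    fun m => exists_evFinsupp (by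
      obtain ⟨N, hN⟩ := (X.isSm_fld (Y.fld a (xp m) b)).evZero_xp v
      beta_reduce at hN
      exact ⟨N, fun k hk => by rw [hN k hk]; simp⟩)
  choose y' hy' using hy'
  obtain ⟨y, hy⟩ := exists_evFinsupp (f := y')
    ⟨N, fun k hk => by ext j; rw [hy', hN k hk]; simp⟩
  refine ⟨⟨fun i j => X.fld a (omega i) (X.fld b (omega j) v), s, t, D, x, y⟩, ?_, ?_, ?_⟩
  · intro p q
    cases p with
    | negSucc i =>
      cases q with
      | negSucc j => rw [ix_negSucc, ix_negSucc, S00, one_smul]; rfl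
      | ofNat m =>
        show t m i = _
        rw [ht, ix_negSucc, show ix (Int.ofNat m) = 1 from ix_natCast m]; rfl
    | ofNat m =>
      cases q with
      | negSucc j =>
        show s m j + ∑ n ∈ Finset.range (min m j + 1), (m.choose n : ℂ) • D (m - n) (j - n) = _
        rw [comm_elt Y X ha hb, ix_negSucc, show ix (Int.ofNat m) = 1 from ix_natCast m, hs, add_zero,
          two, koszul_zero_left, one_smul, smul_add]
        congr 1
        -- As `∂⁽ⁿ⁾uᵐ = 0` for `n > m`, the singular part is a finite sum; the substitution `n ↦ m -
        -- n` matches it with the expansion of `Ω_{z-w}`.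
        conv_rhs =>
          rw [evsum_eq (N := m + 1) fun k hk => by
            rw [show elt (Int.ofNat m) = xp m from rfl, dp_deriv_xp,
              Nat.choose_eq_zero_of_lt (by omega)]; simp,
            ← Finset.sum_flip, Finset.smul_sum]
        refine Eq.trans (Finset.sum_congr rfl fun n hn => ?_)
          (Finset.sum_subset (Finset.range_mono (by omega : min m j + 1 ≤ m + 1))
            fun n hn hn' => ?_)
        · rw [Finset.mem_range] at hn
          rw [hD, show elt (Int.ofNat m) = xp m from rfl, dp_deriv_xp, Nat.choose_symm (by omega),
            map_smul, LinearMap.smul_apply, show m - (m - n) = n by omega, elt_negSucc, xp_mul_omega,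
            if_pos (by omega), map_smul, LinearMap.smul_apply, smul_comm]
        · rw [Finset.mem_range] at hn hn'
          rw [show elt (Int.ofNat m) = xp m from rfl, dp_deriv_xp, show m - (m - n) = n by omega,
            map_smul, LinearMap.smul_apply, elt_negSucc, xp_mul_omega, if_neg (by omega)]
          simp
      | ofNat k =>
        show x m k + ∑ n ∈ Finset.range (m + 1), (m.choose n : ℂ) • y (m - n) (k + n) = _
        rw [comm_elt Y X ha hb, show ix (Int.ofNat k) = 1 from ix_natCast k,
          show ix (Int.ofNat m) = 1 from ix_natCast m, hx, hx', 
          two, koszul_zero_left, one_smul, smul_add]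
        congr 1
        rw [evsum_eq (N := m + 1) fun k hk => by
            rw [show elt (Int.ofNat m) = xp m from rfl, dp_deriv_xp,
              Nat.choose_eq_zero_of_lt (by omega)]; simp,
          ← Finset.sum_flip, Finset.smul_sum]
        refine Finset.sum_congr rfl fun n hn => ?_
        rw [Finset.mem_range] at hn
        rw [hy, hy', show elt (Int.ofNat m) = xp m from rfl, dp_deriv_xp, Nat.choose_symm (by omega),
          map_smul, LinearMap.smul_apply, show m - (m - n) = n by omega,
          show elt (Int.ofNat k) = xp k from rfl, xp_mul_xp,
          map_smul, LinearMap.smul_apply, smul_comm, add_comm k (m - n)]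
  · intro p q
    cases p with
    | negSucc i =>
      cases q with
      | negSucc j =>
        show X.fld a (omega i) (X.fld b (omega j) v) = _
        have := comm_elt Y X ha hb (.negSucc i) (.negSucc j) v
        rw [elt_negSucc, elt_negSucc] at this
        rw [this, ix_negSucc, ix_negSucc, S00, one_smul, add_zero]
        simp only [fun n => ((isPar_omega i).dp n).mul_eq_zero (isPar_omega j)]
        simp [elt_negSucc]
      | ofNat k =>
        show t k i + (D.sum fun m c =>
          if k ≤ m + i then ((-1) ^ m * ((m + i).choose i : ℂ)) • c (m + i - k) else 0) = _
        have := comm_elt Y X ha hb (.negSucc i) (Int.ofNat k) v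
        rw [ix_negSucc, show ix (Int.ofNat k) = 1 from ix_natCast k] at *
        rw [← sub_eq_iff_eq_add] at this
        rw [← this, Finsupp.sum_eq_evsum _ _ (fun m => by simp), ht, smul_sub, sub_eq_add_neg]
        congr 1
        rw [smul_smul, ← neg_smul, ← evsum_smul]
        congr 1; ext m
        rw [elt_negSucc, dp_deriv_omega, map_smul, LinearMap.smul_apply, RavK.mul_comm',
          show elt (Int.ofNat k) = xp k from rfl, xp_mul_omega, hD, add_comm i m, Nat.choose_symm_add]
        split_ifs with hk
        · rw [map_smul, LinearMap.smul_apply, smul_comm, add_zero]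
          congr 1
          rw [S10, S01, koszul_add_right, h11, koszul_comm 1 (tot e)]
          linear_combination koszul (tot d) 1 * koszul_mul_self (tot e) 1
        · simp
    | ofNat m =>
      cases q with
      | negSucc j =>
        show s m j = _
        rw [hs, ix_negSucc, show ix (Int.ofNat m) = 1 from ix_natCast m, add_zero]; rfl
      | ofNat k =>
        show x m k = _
        rw [hx, hx', show ix (Int.ofNat k) = 1 from ix_natCast k,
          show ix (Int.ofNat m) = 1 from ix_natCast m]; rfl
  · intro p q
    cases p with
    | negSucc l =>
      cases q with
      | negSucc j =>
        show ∑ i ∈ Finset.Icc l (j + l), (i.choose l : ℂ) •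
          X.fld a (omega i) (X.fld b (omega (j + l - i)) v) = _
        rw [ix_negSucc, ix_negSucc, S00, one_smul, elt_negSucc, elt_negSucc,
          fld_omega_omega Y X ha hb]
      | ofNat k =>
        show (s.sum fun m c =>
            if k ≤ m + l then ((-1) ^ l * ((m + l).choose l : ℂ)) • c (m + l - k) else 0)
          + (t.sum fun m c => if k ≤ m then ((m - k + l).choose l : ℂ) • c (m - k + l) else 0) = _
        rw [Finsupp.sum_eq_evsum _ _ (fun m => by simp), Finsupp.sum_eq_evsum _ _ (fun m => by simp),
          elt_negSucc, show elt (Int.ofNat k) = xp k from rfl, fld_omega_xp Y X ha hb, add_comm,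
          smul_add, ix_negSucc, show ix (Int.ofNat k) = 1 from ix_natCast k]
        congr 1
        · rw [evsum_shift k, ← evsum_smul]
          · congr 1; ext n
            rw [if_pos (by omega), show k + n - k + l = n + l by omega, ht, smul_comm, add_comm k n]
          · intro m hm; rw [if_neg (by omega)]
          · refine ⟨Nb, fun m hm => ?_⟩
            dsimp only
            rw [ht, hNb m hm]; simp
        -- The sums over `n` and over `m` are both rewritten over the common index `j = n + k = m +
        -- l`; the conditions `l ≤ j` and `k ≤ j` guard the truncated subtractions.
        · have hz : EvZero fun j => if l ≤ j ∧ k ≤ j then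
              (j.choose l : ℂ) • X.fld b (omega (j - k)) (X.fld a (xp (j - l)) v) else 0 := by
            refine ⟨Na + l, fun j hj => ?_⟩
            dsimp only
            rw [hNa (j - l) (by omega)]; simp
          have e1 : (evsum fun n => ((n + k).choose l : ℂ) •
              X.fld b (omega n) (X.fld a (xp (n + k - l)) v))
              = evsum fun j => if l ≤ j ∧ k ≤ j then
                (j.choose l : ℂ) • X.fld b (omega (j - k)) (X.fld a (xp (j - l)) v) else 0 := by
            rw [evsum_shift k (fun j hj => if_neg (by omega)) hz]
            congr 1; ext n
            rw [add_comm k n]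
            split_ifs with hl
            · rw [Nat.add_sub_cancel]
            · rw [Nat.choose_eq_zero_of_lt (by omega)]; simp
          rw [e1, evsum_shift l (fun j hj => if_neg (by omega)) hz, smul_smul, ← evsum_smul]
          congr 1; ext m
          rw [add_comm l m]
          by_cases hk : k ≤ m + l
          · rw [if_pos hk, if_pos ⟨by omega, hk⟩, hs]
            simp only [smul_smul]
            rw [Nat.add_sub_cancel]
            congr 1
            rw [S10, S01, koszul_add_left, koszul_comm 1 (tot e)]
            ring
          · rw [if_neg hk, if_neg fun h => hk h.2, smul_zero]
    | ofNat m =>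
      cases q with
      | negSucc j =>
        show D m j = _
        rw [hD, ix_negSucc, show ix (Int.ofNat m) = 1 from ix_natCast m]; rfl
      | ofNat k =>
        show y m k = _
        rw [hy, hy', show ix (Int.ofNat k) = 1 from ix_natCast k,
          show ix (Int.ofNat m) = 1 from ix_natCast m]; rfl

end

/-! ### The raviolo vertex algebra of a vacuum module -/

section

variable {g : Type u} [AddCommGroup g] [Module ℂ g] {𝔤 : LieSuperalgebra g} {h : InvariantForm 𝔤}
  {V : Type u} [AddCommGroup V] [Module ℂ V]

/-- For `x ∈ 𝓑 i`, the part of `x` outside `𝓐 i` lies in `𝓑 i` and also in the sum of the other `𝓑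
j`, so it is zero by independence. -/
theorem IsGrading.eq_of_le {I : Type*} {N : Type*} [AddCommGroup N] [Module ℂ N]
    {𝓐 𝓑 : I → Submodule ℂ N} (hA : ⨆ i, 𝓐 i = ⊤) (hB : IsGrading 𝓑) (hle : ∀ i, 𝓐 i ≤ 𝓑 i) :
    𝓐 = 𝓑 := by
  funext i
  refine le_antisymm (hle i) fun x hx => ?_
  have h1 : (⊤ : Submodule ℂ N) ≤ 𝓐 i ⊔ ⨆ (j) (_ : j ≠ i), 𝓐 j := by
    rw [← hA]
    refine iSup_le fun j => ?_
    by_cases hj : j = i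
    · rw [hj]; exact le_sup_left
    · exact le_sup_of_le_right (le_iSup₂_of_le j hj le_rfl)
  obtain ⟨y, hy, z, hz, rfl⟩ := Submodule.mem_sup.1 (h1 (Submodule.mem_top (x := x)))
  have hz' : z ∈ ⨆ (j) (_ : j ≠ i), 𝓑 j := iSup₂_mono (fun j _ => hle j) hz
  have hz'' : z ∈ 𝓑 i := by
    have := sub_mem hx (hle i hy)
    rwa [add_sub_cancel_left] at this
  rw [Submodule.disjoint_def.1 (hB.1 i) z hz'' hz', add_zero]
  exact hy

theorem RavioloVertexAlgebra.eq_of_data_eq {Z Z' : RavioloVertexAlgebra V} (hdeg : Z.deg = Z'.deg)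
    (hvac : Z.vac = Z'.vac) (hT : Z.T = Z'.T) (hY : Z.Y = Z'.Y) : Z = Z' := by
  cases Z; cases Z'
  simp only at hdeg hvac hT hY
  subst hdeg hvac hT hY
  rfl

namespace VacMod

/-- `Z` is a raviolo vertex algebra structure on the representation `U` that is strongly generated
by the currents. -/
structure IsCurrent (U : VacMod 𝔤 h V) (Z : RavioloVertexAlgebra V) : Prop where
  vac_eq : Z.vac = U.vac
  act_mem : ∀ {d e : Bideg} {x : (g ⊗[ℂ] RavK) × ℂ} {v : V},
    x ∈ (𝔤.affine h).deg d → v ∈ Z.deg e → U.ρ x v ∈ Z.deg (d + e)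
  T_act : ∀ (x : (g ⊗[ℂ] RavK) × ℂ) (v : V),
    Z.T (U.ρ x v) = U.ρ x (Z.T v) - U.ρ (TensorProduct.map LinearMap.id RavK.deriv x.1, 0) v
  current_pos : ∀ {p : ZMod 2} {A : g}, A ∈ 𝔤.par p → ∀ (n : ℕ) (v : V),
    Z.Y (U.ρ (LieSuperalgebra.toAffine (A ⊗ₜ RavK.omega 0)) Z.vac) n v
      = koszul p 1 • U.ρ (LieSuperalgebra.toAffine (A ⊗ₜ RavK.ofSeries (PowerSeries.X ^ n))) v
  current_neg : ∀ {p : ZMod 2} {A : g}, A ∈ 𝔤.par p → ∀ (n : ℕ) (v : V),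
    Z.Y (U.ρ (LieSuperalgebra.toAffine (A ⊗ₜ RavK.omega 0)) Z.vac) (.negSucc n) v
      = U.ρ (LieSuperalgebra.toAffine (A ⊗ₜ RavK.omega n)) v
  composite : ∀ {p : ZMod 2} {A : g}, A ∈ 𝔤.par p → ∀ {e : Bideg} {b : V},
    b ∈ Z.deg e → ∀ (n : ℕ) (m : ℤ) (v : V),
    Z.Y (U.ρ (LieSuperalgebra.toAffine (A ⊗ₜ RavK.omega n)) b) m v
      = normalOrderedMode (1 + p) (tot e) n
          (Z.Y (U.ρ (LieSuperalgebra.toAffine (A ⊗ₜ RavK.omega 0)) Z.vac)) (Z.Y b) m v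
  Y_kappa : ∀ (b v : V) (m : ℤ),
    Z.Y (U.ρ (LieSuperalgebra.kappa g) b) m v
      = koszul 1 (ix m) • U.ρ (LieSuperalgebra.kappa g) (Z.Y b m v)
  mode_kappa : ∀ {e : Bideg} {b : V}, b ∈ Z.deg e → ∀ (m : ℤ) (v : V),
    Z.Y b m (U.ρ (LieSuperalgebra.kappa g) v)
      = koszul 1 (tot e + ix m) • U.ρ (LieSuperalgebra.kappa g) (Z.Y b m v)

variable {U : VacMod 𝔤 h V} (Y : FieldMap U U.rep)

/-- The raviolo vertex algebra structure of `U`. -/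
def rva : RavioloVertexAlgebra V where
  deg := U.deg
  isGrading := VacMod.isGrading Y
  vac := U.vac
  vac_mem := PreVac.vac_mem
  T := vT Y
  T_mem := vT_mem Y
  Y := modes Y Y
  Y_field := isField_modes Y Y
  Y_mem := fun ha hv n => modes_mem Y Y (π := AddMonoidHom.id Bideg)
    (fun hx _ _ hv => PreVac.act_mem hx hv) ha hv n
  translation := vT_modes Y
  T_vac := vT_vac Y
  Y_vac := modes_vac Y Y
  Y_apply_vac := by
    intro a n hn
    obtain ⟨m, rfl⟩ := Int.eq_ofNat_of_zero_le hn
    exact vfld_series_vac Y _ _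
  Y_creation := vfld_omega_zero_vac Y
  locality := mutuallyLocal_modes Y Y

theorem modes_mu_natCast {M : Type w} [AddCommGroup M] [Module ℂ M] {R : SmRep 𝔤 h M}
    (X : FieldMap U R) {p : ZMod 2} {A : g} (hA : A ∈ 𝔤.par p) (n : ℕ) :
    modes Y X (U.ρ (LieSuperalgebra.toAffine (A ⊗ₜ omega 0)) U.vac) n
      = koszul p 1 • R.cur A (xp n) := by
  have two : (1 : ZMod 2) + 1 = 0 := rfl
  rw [modes_apply Y X (gen_vac_mem (Gen.mu hA 0)), X.fld_mu_zero_vac hA, ix_natCast, tot_one,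
    elt_natCast, show 1 + p + 1 = p by linear_combination two]

theorem modes_mu_negSucc {M : Type w} [AddCommGroup M] [Module ℂ M] {R : SmRep 𝔤 h M}
    (X : FieldMap U R) {p : ZMod 2} {A : g} (hA : A ∈ 𝔤.par p) (n : ℕ) :
    modes Y X (U.ρ (LieSuperalgebra.toAffine (A ⊗ₜ omega 0)) U.vac) (.negSucc n)
      = R.cur A (omega n) := by
  rw [modes_negSucc, X.fld_mu_zero_vac hA]

theorem modes_kappa {M : Type w} [AddCommGroup M] [Module ℂ M] {R : SmRep 𝔤 h M}
    (X : FieldMap U R) (b : V) (m : ℤ) :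
    modes Y X (U.ρ (LieSuperalgebra.kappa g) b) m
      = koszul 1 (ix m) • (R.ρ (LieSuperalgebra.kappa g) * modes Y X b m) := by
  refine U.induction (P := fun b => modes Y X (U.ρ (LieSuperalgebra.kappa g) b) m
      = koszul 1 (ix m) • (R.ρ (LieSuperalgebra.kappa g) * modes Y X b m)) (by simp) ?_ ?_ b
  · intro b c hb hc
    simp only [map_add, Pi.add_apply, hb, hc, mul_add, smul_add]
  · intro e b hb
    have two : (1 : ZMod 2) + 1 = 0 := rfl
    have e1 : tot ((1, 0) : Bideg) = 1 := by simp [tot]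
    rw [modes_apply Y X (PreVac.gen_mem .kappa hb), modes_apply Y X hb, X.fld_kappa, mul_smul_comm,
      smul_smul, SmRep.tot_add, e1, add_assoc, koszul_add_left]

/-- The field of `κ|0⟩` is constant, so its singular part with any state is zero and `κ`
supercommutes with all modes. -/
theorem mode_kappa_apply {M : Type w} [AddCommGroup M] [Module ℂ M] {R : SmRep 𝔤 h M}
    (X : FieldMap U R) {e : Bideg} {b : V} (hb : b ∈ U.deg e) (m : ℤ) (v : M) :
    modes Y X b m (R.ρ (LieSuperalgebra.kappa g) v)
      = koszul 1 (tot e + ix m) • R.ρ (LieSuperalgebra.kappa g) (modes Y X b m v) := by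
  have e1 : tot ((1, 0) : Bideg) = 1 := by simp [tot]
  have := comm_elt Y X (gen_vac_mem Gen.kappa) hb (.negSucc 0) m v
  rw [elt_negSucc, X.fld_kappa_vac, res_omega, if_pos rfl, one_smul, ix_negSucc, add_zero, e1] at this
  simp only [Y.fld_kappa_vac, res_xp, zero_smul, LinearMap.zero_apply, map_zero, evsum_zero,
    smul_zero, add_zero] at this
  rw [modes_apply Y X hb, LinearMap.smul_apply, LinearMap.smul_apply, map_smul, this,
    smul_comm (koszul 1 _), smul_smul (koszul 1 _), koszul_mul_self, one_smul]

theorem isCurrent_rva : U.IsCurrent (rva Y) where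
  vac_eq := rfl
  act_mem := PreVac.act_mem
  T_act := vT_act Y
  current_pos := fun hA n v => LinearMap.congr_fun (modes_mu_natCast Y Y hA n) v
  current_neg := fun hA n v => LinearMap.congr_fun (modes_mu_negSucc Y Y hA n) v
  composite := by
    intro p A hA e b hb n m v
    have := modes_normalOrdered Y Y (gen_vac_mem (Gen.mu hA 0)) hb n m v
    rw [tot_one, Y.fld_mu_zero_vac hA] at this
    exact this
  Y_kappa := fun b v m => LinearMap.congr_fun (modes_kappa Y Y b m) v
  mode_kappa := fun hb m v => mode_kappa_apply Y Y hb m v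

theorem IsCurrent.deg_le {Z : RavioloVertexAlgebra V} (hZ : U.IsCurrent Z) (e : Bideg) :
    U.deg e ≤ Z.deg e := fun b hb => by
  refine PreVac.deg_induction (P := fun e b => b ∈ Z.deg e) (fun _ => zero_mem _) add_mem
    (fun c hb => Submodule.smul_mem _ c hb) ?_ (fun hx _ ih => hZ.act_mem hx.mem ih) hb
  rw [← hZ.vac_eq]
  exact Z.vac_mem

/-- The representation is generated from the vacuum by the `A ⊗ Ωˡ` and `κ`. `T_act` determines
translation on monomials, `composite` and `Y_kappa` determine the fields, and the grading is forced
because it contains the grading by monomials. -/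
theorem IsCurrent.eq {Z Z' : RavioloVertexAlgebra V} (hZ : U.IsCurrent Z) (hZ' : U.IsCurrent Z') :
    Z = Z' := by
  have hv : Z.vac = Z'.vac := hZ.vac_eq.trans hZ'.vac_eq.symm
  have hcur : ∀ {p : ZMod 2} {A : g}, A ∈ 𝔤.par p →
      Z.Y (U.ρ (LieSuperalgebra.toAffine (A ⊗ₜ omega 0)) Z.vac)
        = Z'.Y (U.ρ (LieSuperalgebra.toAffine (A ⊗ₜ omega 0)) Z'.vac) := by
    intro p A hA
    funext n
    refine LinearMap.ext fun v => ?_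
    cases n with
    | ofNat n => exact (hZ.current_pos hA n v).trans (hZ'.current_pos hA n v).symm
    | negSucc n => exact (hZ.current_neg hA n v).trans (hZ'.current_neg hA n v).symm
  refine RavioloVertexAlgebra.eq_of_data_eq ?_ hv ?_ ?_
  · exact (IsGrading.eq_of_le U.iSup_deg Z.isGrading hZ.deg_le).symm.trans
      (IsGrading.eq_of_le U.iSup_deg Z'.isGrading hZ'.deg_le)
  · refine LinearMap.ext fun b => U.induction (P := fun b => Z.T b = Z'.T b) (by simp)
      (fun b c hb hc => by rw [map_add, map_add, hb, hc]) (fun e b hb => ?_) b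
    refine PreVac.deg_induction (P := fun _ b => Z.T b = Z'.T b) (by simp)
      (fun hb hc => by rw [map_add, map_add, hb, hc]) (fun c hb => by rw [map_smul, map_smul, hb])
      ?_ (fun _ _ ih => by rw [hZ.T_act, hZ'.T_act, ih]) hb
    rw [← hZ.vac_eq, Z.T_vac, hv, Z'.T_vac]
  · refine LinearMap.ext fun b => U.induction (P := fun b => Z.Y b = Z'.Y b) (by simp)
      (fun b c hb hc => by rw [map_add, map_add, hb, hc]) (fun e b hb => ?_) b
    refine PreVac.deg_induction (P := fun _ b => Z.Y b = Z'.Y b) (by simp)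
      (fun hb hc => by rw [map_add, map_add, hb, hc]) (fun c hb => by rw [map_smul, map_smul, hb])
      ?_ ?_ hb
    · funext n
      rw [← hZ.vac_eq, Z.Y_vac, hv, Z'.Y_vac]
    · intro p x e b hx hb ih
      funext m
      refine LinearMap.ext fun v => ?_
      cases hx with
      | mu hA l => rw [hZ.composite hA (hZ.deg_le _ hb), hZ'.composite hA (hZ'.deg_le _ hb), hcur hA, ih]
      | kappa => rw [hZ.Y_kappa, hZ'.Y_kappa, ih]

end VacMod

end

/-! ### Induced modules as highest weight modules -/

/-- Data identifying `E` with `ℂ[κ]` or with `ℂ`. -/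
structure CoeffSys {E : Type} [AddCommGroup E] [Module ℂ E] (k : Module.End ℂ E) (e₀ : E) where
  ε₀ : E →ₗ[ℂ] ℂ
  ε₁ : E →ₗ[ℂ] ℂ
  eq : ∀ e, e = ε₀ e • e₀ + ε₁ e • k e₀
  ε₀_base : ε₀ e₀ = 1
  ε₁_base : ε₁ e₀ = 0
  ε₀_k : ∀ e, ε₀ (k e) = 0
  ε₁_k : k = 0 ∨ ∀ e, ε₁ (k e) = ε₀ e

section

variable {g : Type u} [AddCommGroup g] [Module ℂ g] {𝔤 : LieSuperalgebra g} {h : InvariantForm 𝔤}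
  {E : Type} [AddCommGroup E] [Module ℂ E] {k : Module.End ℂ E} {e₀ : E}
  {M : Type w} [AddCommGroup M] [Module ℂ M]

namespace SmRep

variable (R : SmRep 𝔤 h M)

theorem actF_series_fldVac (A : g) (f : PowerSeries ℂ) :
    R.actF (LieSuperalgebra.toAffine (A ⊗ₜ ofSeries f)) (fldVac M) = 0 := by
  have key : ∀ (p : ZMod 2), ∀ A ∈ 𝔤.par p,
      R.actF (LieSuperalgebra.toAffine (A ⊗ₜ ofSeries f)) (fldVac M) = 0 := by
    intro p A hA
    rw [SmRep.actF_of_mem (SmRep.toAffine_mem hA (mem_deg_zero (α := ofSeries f) rfl)), fldVac,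
      SmRep.opF_single]
    have : (SmRep.opFld (R := R) (0, p) (tot 0 + 1)
        (LieSuperalgebra.toAffine (A ⊗ₜ[ℂ] ofSeries f))) ⟨idField M, isSm_idField⟩ = 0 :=
      Subtype.ext (by
        have := SmRep.op_idField_series (R := R) (p := p) A f
        exact this)
    rw [this, Finsupp.single_zero]
  obtain ⟨B, hB, C, hC, rfl⟩ := 𝔤.exists_par_add A
  rw [TensorProduct.add_tmul, map_add, map_add, LinearMap.add_apply, key 0 B hB, key 1 C hC,
    add_zero]

/-- An odd central element squares to zero, here in the representation on fields. This matches `κ² =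
0` in `ℂ[κ]`. -/
theorem actF_kappa_actF_kappa (C : Bideg →₀ Fld M) :
    R.actF (LieSuperalgebra.kappa g) (R.actF (LieSuperalgebra.kappa g) C) = 0 := by
  have := congrArg (fun f => f C) (R.actF_br (SmRep.kappa_mem (h := h)) (SmRep.kappa_mem (h := h)))
  have k1 : koszul (tot ((1, 0) : Bideg)) (tot ((1, 0) : Bideg)) = -1 := by simp [tot, koszul]
  simp only [affine_br_kappa, map_zero, k1] at this
  have h2 : (2 : ℂ) • R.actF (LieSuperalgebra.kappa g) (R.actF (LieSuperalgebra.kappa g) C) = 0 := by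
    rw [two_smul]
    refine Eq.trans ?_ this.symm
    simp
  simpa using h2

theorem actF_kappa_eq_zero (hk : R.ρ (LieSuperalgebra.kappa g) = 0) :
    R.actF (LieSuperalgebra.kappa g) = 0 := by
  rw [SmRep.actF_of_mem (SmRep.kappa_mem (h := h))]
  refine Finsupp.lhom_ext fun e C => ?_
  rw [SmRep.opF_single]
  have : SmRep.opFld (R := R) (1, 0) (tot e + 1) (LieSuperalgebra.kappa g) C = 0 :=
    Subtype.ext (LinearMap.ext fun β => by
      show R.op _ _ _ _ β = 0
      rw [SmRep.op_kappa, hk, zero_mul])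
  rw [this, Finsupp.single_zero, LinearMap.zero_apply]

/-- The universal property of the induced module, applied to `e₀ ↦` identity field and `k e₀ ↦ κ ·`
identity field. The relations hold since `g[[u]]` kills both images, `κ` being central, and since
`κ² = 0`. If `k = 0`, then `κ` annihilates the vacuum vector, so it must act as zero on `M` as well.
-/
theorem exists_lift (S : CoeffSys k e₀) (hk : k = 0 → R.ρ (LieSuperalgebra.kappa g) = 0) :
    ∃ Φ : Induced 𝔤 h E k →ₗ[ℂ] (Bideg →₀ Fld M),
    Φ (inducedMk 𝔤 h E k e₀) = fldVac M ∧ ∀ x v, Φ (indAct 𝔤 h k x v) = R.actF x (Φ v) := by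
  let l : E →ₗ[ℂ] (Bideg →₀ Fld M) := S.ε₀.smulRight (fldVac M)
    + S.ε₁.smulRight (R.actF (LieSuperalgebra.kappa g) (fldVac M))
  have hl : ∀ e, l e = S.ε₀ e • fldVac M
    + S.ε₁ e • R.actF (LieSuperalgebra.kappa g) (fldVac M) := fun e => rfl
  obtain ⟨Φ, h1, h2⟩ := exists_inducedLift (k := k) R.actF R.actF_br l (by
    rintro ⟨y, c⟩ e
    have e1 : posIncl g (y, c) = LieSuperalgebra.toAffine (TensorProduct.map LinearMap.id ofSeries y)
        + c • LieSuperalgebra.kappa g := by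
      simp [posIncl, LieSuperalgebra.toAffine, LieSuperalgebra.kappa]
    have e2 : R.actF (LieSuperalgebra.toAffine (TensorProduct.map LinearMap.id ofSeries y)) (l e)
        = 0 := by
      induction y using TensorProduct.induction_on with
      | zero => simp
      | add x y hx hy => rw [map_add, map_add, map_add, LinearMap.add_apply, hx (by
          simp [posIncl, LieSuperalgebra.toAffine, LieSuperalgebra.kappa]), hy (by
          simp [posIncl, LieSuperalgebra.toAffine, LieSuperalgebra.kappa]), add_zero]
      | tmul A f =>
        rw [TensorProduct.map_tmul, LinearMap.id_apply, hl, map_add, map_smul, map_smul,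
          actF_series_fldVac, smul_zero, zero_add]
        have key : ∀ (p : ZMod 2), ∀ A ∈ 𝔤.par p,
            R.actF (LieSuperalgebra.toAffine (A ⊗ₜ ofSeries f))
              (R.actF (LieSuperalgebra.kappa g) (fldVac M)) = 0 := by
          intro p A hA
          have := congrArg (fun f => f (fldVac M)) (R.actF_br
            (SmRep.toAffine_mem (h := h) hA (mem_deg_zero (α := ofSeries f) rfl))
            (SmRep.kappa_mem (h := h)))
          simp only [affine_br_kappa, map_zero] at this
          refine Eq.trans ?_ this.symm
          simp [actF_series_fldVac]
        obtain ⟨B, hB, C, hC, rfl⟩ := 𝔤.exists_par_add A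
        rw [TensorProduct.add_tmul, map_add, map_add, LinearMap.add_apply, key 0 B hB, key 1 C hC,
          add_zero, smul_zero]
    rw [e1, map_add, map_smul, LinearMap.add_apply, e2, zero_add, LinearMap.smul_apply]
    congr 1
    rw [hl, hl, map_add, map_smul, map_smul, actF_kappa_actF_kappa, smul_zero, add_zero, S.ε₀_k,
      zero_smul, zero_add]
    rcases S.ε₁_k with h0 | h0
    · rw [R.actF_kappa_eq_zero (hk h0)]; simp
    · rw [h0])
  refine ⟨Φ, ?_, h2⟩
  rw [h1, hl, S.ε₀_base, S.ε₁_base]; simp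

end SmRep

theorem indAct_series_vac (A : g) (f : PowerSeries ℂ) :
    indAct 𝔤 h k (LieSuperalgebra.toAffine (A ⊗ₜ ofSeries f)) (inducedMk 𝔤 h E k e₀) = 0 := by
  have := indAct_posIncl (𝔤 := 𝔤) (h := h) (k := k) (A ⊗ₜ f, 0) e₀
  have e2 : inducedMk 𝔤 h E k (0 : E) = 0 := by
    rw [inducedMk, TensorProduct.tmul_zero, Submodule.Quotient.mk_zero]
  rw [zero_smul, e2] at this
  simpa [posIncl, LieSuperalgebra.toAffine] using this

theorem indAct_kappa_vac : indAct 𝔤 h k (LieSuperalgebra.kappa g) (inducedMk 𝔤 h E k e₀)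
    = inducedMk 𝔤 h E k (k e₀) := by
  have := indAct_posIncl (𝔤 := 𝔤) (h := h) (k := k) (0, 1) e₀
  rw [one_smul] at this
  simpa [posIncl, LieSuperalgebra.kappa] using this

variable (𝔤 h k e₀) in
/-- The induced module, with its vacuum vector. -/
def inducedPreVac : PreVac 𝔤 h (Induced 𝔤 h E k) where
  ρ := indAct 𝔤 h k
  vac := inducedMk 𝔤 h E k e₀
  br := indAct_br
  series_vac := indAct_series_vac

/-- The sum of the pieces is stable under the enveloping algebra and contains the vacuum, hence also
`κ` times the vacuum. These two vectors span `1 ⊗ E`, which generates the induced module. -/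
theorem iSup_inducedPreVac_deg (S : CoeffSys k e₀) : ⨆ e, (inducedPreVac 𝔤 h k e₀).deg e = ⊤ := by
  rw [eq_top_iff]
  have hx : ∀ (x : (g ⊗[ℂ] RavK) × ℂ) (v : Induced 𝔤 h E k), v ∈ ⨆ e, (inducedPreVac 𝔤 h k e₀).deg e →
      indAct 𝔤 h k x v ∈ ⨆ e, (inducedPreVac 𝔤 h k e₀).deg e := by
    intro x v hv
    refine IsGrading.induction (𝔤.affine h).isGrading
      (P := fun x => indAct 𝔤 h k x v ∈ ⨆ e, (inducedPreVac 𝔤 h k e₀).deg e) ?_ ?_ ?_ x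
    · rw [map_zero]; exact zero_mem _
    · intro x y hx hy; rw [map_add]; exact add_mem hx hy
    · intro d x hx
      refine Submodule.iSup_induction _
        (motive := fun v => indAct 𝔤 h k x v ∈ ⨆ e, (inducedPreVac 𝔤 h k e₀).deg e) hv ?_ ?_ ?_
      · intro e b hb; exact Submodule.mem_iSup_of_mem _ (PreVac.act_mem (U := inducedPreVac 𝔤 h k e₀) hx hb)
      · rw [map_zero]; exact zero_mem _
      · intro b c hb hc; rw [map_add]; exact add_mem hb hc
  have ha : ∀ (a : (𝔤.affine h).Env) (v : Induced 𝔤 h E k), v ∈ ⨆ e, (inducedPreVac 𝔤 h k e₀).deg e →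
      a • v ∈ ⨆ e, (inducedPreVac 𝔤 h k e₀).deg e := by
    intro a
    refine (𝔤.affine h).env_induction (P := fun a => ∀ v : Induced 𝔤 h E k,
      v ∈ ⨆ e, (inducedPreVac 𝔤 h k e₀).deg e → a • v ∈ ⨆ e, (inducedPreVac 𝔤 h k e₀).deg e) ?_ ?_ ?_ ?_ a
    · intro c v hv
      rw [algebraMap_smul]; exact Submodule.smul_mem _ _ hv
    · intro x v hv; exact hx x v hv
    · intro a b ha hb v hv; rw [mul_smul]; exact ha _ (hb _ hv)
    · intro a b ha hb v hv; rw [add_smul]; exact add_mem (ha _ hv) (hb _ hv)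
  intro v _
  obtain ⟨t, rfl⟩ := Submodule.Quotient.mk_surjective _ v
  induction t using TensorProduct.induction_on with
  | zero => exact zero_mem _
  | add x y hx hy =>
    rw [Submodule.Quotient.mk_add]; exact add_mem (hx trivial) (hy trivial)
  | tmul a e =>
    have e1 : (Submodule.Quotient.mk (a ⊗ₜ[ℂ] e) : Induced 𝔤 h E k)
        = a • (S.ε₀ e • inducedMk 𝔤 h E k e₀
          + S.ε₁ e • indAct 𝔤 h k (LieSuperalgebra.kappa g) (inducedMk 𝔤 h E k e₀)) := by
      rw [indAct_kappa_vac]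
      conv_lhs => rw [S.eq e, ← mul_one a, ← smul_eq_mul, ← TensorProduct.smul_tmul',
        Submodule.Quotient.mk_smul, TensorProduct.tmul_add, TensorProduct.tmul_smul,
        TensorProduct.tmul_smul]
      rfl
    rw [e1]
    have h0 : inducedMk 𝔤 h E k e₀ ∈ ⨆ e, (inducedPreVac 𝔤 h k e₀).deg e :=
      Submodule.mem_iSup_of_mem 0 (PreVac.vac_mem (U := inducedPreVac 𝔤 h k e₀))
    exact ha _ _ (add_mem (Submodule.smul_mem _ _ h0) (Submodule.smul_mem _ _ (hx _ _ h0)))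

/-- The induced module is generated by its vacuum vector. -/
def inducedVacMod (𝔤 : LieSuperalgebra g) (h : InvariantForm 𝔤) (S : CoeffSys k e₀) :
    VacMod 𝔤 h (Induced 𝔤 h E k) where
  toPreVac := inducedPreVac 𝔤 h k e₀
  iSup_deg := iSup_inducedPreVac_deg S

/-- The field map of a smooth representation. -/
def inducedFieldMap (S : CoeffSys k e₀) (R : SmRep 𝔤 h M)
    (hk : k = 0 → R.ρ (LieSuperalgebra.kappa g) = 0) : FieldMap (inducedVacMod 𝔤 h S) R where
  lift := (R.exists_lift S hk).choose
  lift_vac := (R.exists_lift S hk).choose_spec.1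
  lift_act := (R.exists_lift S hk).choose_spec.2

namespace VacMod

theorem kappa_eq_zero {V : Type u} [AddCommGroup V] [Module ℂ V] (U : VacMod 𝔤 h V)
    (hU : U.ρ (LieSuperalgebra.kappa g) U.vac = 0) : U.ρ (LieSuperalgebra.kappa g) = 0 := by
  refine LinearMap.ext fun v => ?_
  refine U.induction (P := fun v => U.ρ (LieSuperalgebra.kappa g) v = 0)
    (map_zero _) (fun b c hb hc => by rw [map_add, hb, hc, add_zero]) (fun e b hb => ?_) v
  refine PreVac.deg_induction (P := fun _ b => U.ρ (LieSuperalgebra.kappa g) b = 0)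
    (fun _ => map_zero _) (fun hb hc => by rw [map_add, hb, hc, add_zero])
    (fun c hb => by rw [map_smul, hb, smul_zero]) hU ?_ hb
  intro p x e b hx hb ih
  rw [U.comm (SmRep.kappa_mem (h := h)) hx.mem, affine_kappa_br, ih]
  simp

end VacMod

theorem inducedVacMod_kappa (S : CoeffSys k e₀) (hk : k = 0) :
    (inducedVacMod 𝔤 h S).ρ (LieSuperalgebra.kappa g) = 0 :=
  VacMod.kappa_eq_zero _ (by
    show indAct 𝔤 h k (LieSuperalgebra.kappa g) (inducedMk 𝔤 h E k e₀) = 0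
    rw [indAct_kappa_vac, hk, LinearMap.zero_apply, inducedMk, TensorProduct.tmul_zero,
      Submodule.Quotient.mk_zero])

/-- The state-field correspondence of the induced module. -/
def vacuumFieldMap (𝔤 : LieSuperalgebra g) (h : InvariantForm 𝔤) (S : CoeffSys k e₀) :
    FieldMap (inducedVacMod 𝔤 h S) (inducedVacMod 𝔤 h S).rep :=
  inducedFieldMap S _ (inducedVacMod_kappa S)

theorem isCurrentAlgebra_iff (S : CoeffSys k e₀) (X : RavioloVertexAlgebra (Induced 𝔤 h E k)) :
    IsCurrentAlgebra X e₀ ↔ (inducedVacMod 𝔤 h S).IsCurrent X :=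
  ⟨fun hX => ⟨hX.vac_eq, hX.act_mem, hX.T_act, hX.current_pos, hX.current_neg, hX.composite,
    hX.Y_kappa, hX.mode_kappa⟩,
  fun hX => ⟨hX.vac_eq, hX.act_mem, hX.T_act, hX.current_pos, hX.current_neg, hX.composite,
    hX.Y_kappa, hX.mode_kappa⟩⟩

theorem existsUnique_isCurrentAlgebra (S : CoeffSys k e₀) :
    ∃! X : RavioloVertexAlgebra (Induced 𝔤 h E k), IsCurrentAlgebra X e₀ :=
  ⟨VacMod.rva (vacuumFieldMap 𝔤 h S),
    (isCurrentAlgebra_iff S _).2 (VacMod.isCurrent_rva (vacuumFieldMap 𝔤 h S)),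
    fun _ hX => ((isCurrentAlgebra_iff S _).1 hX).eq (VacMod.isCurrent_rva (vacuumFieldMap 𝔤 h S))⟩

/-- The trivial module. -/
def coeffSysComplex : CoeffSys (0 : Module.End ℂ ℂ) (1 : ℂ) where
  ε₀ := LinearMap.id
  ε₁ := 0
  eq := by simp
  ε₀_base := rfl
  ε₁_base := rfl
  ε₀_k := by simp
  ε₁_k := Or.inl rfl

/-- The module `ℂ[κ]`. -/
def coeffSysDual : CoeffSys (LinearMap.mulLeft ℂ (DualNumber.eps : DualNumber ℂ))
    (1 : DualNumber ℂ) where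
  ε₀ := TrivSqZeroExt.fstHom ℂ ℂ ℂ |>.toLinearMap
  ε₁ := TrivSqZeroExt.sndHom ℂ ℂ
  eq := fun e => by
    ext <;> simp
  ε₀_base := by simp
  ε₁_base := by simp
  ε₀_k := by simp
  ε₁_k := Or.inr (by simp)

end

/-! ### The representation on a module -/

section

variable {g : Type u} [AddCommGroup g] [Module ℂ g] {𝔤 : LieSuperalgebra g} {h : InvariantForm 𝔤}
  {V : Type u} [AddCommGroup V] [Module ℂ V] {U : VacMod 𝔤 h V}

/-- The state `μ_{A,0}|0⟩` of a current. -/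
def curState (U : VacMod 𝔤 h V) : g →ₗ[ℂ] V :=
  (LinearMap.applyₗ U.vac) ∘ₗ U.ρ ∘ₗ LieSuperalgebra.toAffine ∘ₗ
    (TensorProduct.mk ℂ g RavK).flip (omega 0)

theorem curState_mem {p : ZMod 2} {A : g} (hA : A ∈ 𝔤.par p) : curState U A ∈ U.deg (1, p) :=
  gen_vac_mem (Gen.mu hA 0)

/-- The state `κ|0⟩`. -/
def kappaState (U : VacMod 𝔤 h V) : V := U.ρ (LieSuperalgebra.kappa g) U.vac

theorem kappaState_mem : kappaState U ∈ U.deg (1, 0) := gen_vac_mem Gen.kappa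

theorem cur_xp_curState {p q : ZMod 2} {A B : g} (hA : A ∈ 𝔤.par p) (hB : B ∈ 𝔤.par q) (i : ℕ) :
    U.rep.cur A (xp i) (curState U B) = (if i = 0 then curState U (𝔤.br A B) else 0)
      + if i = 1 then h.form A B • kappaState U else 0 := by
  have := LinearMap.congr_fun (U.rep.cur_mul_cur hA hB (isPar_xp i) (isPar_omega 0)) U.vac
  simp only [LinearMap.sub_apply, LinearMap.smul_apply, Module.End.mul_apply, cur_xp_vac, map_zero,
    smul_zero, sub_zero, koszul_zero_left, one_smul] at this
  refine this.trans ?_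
  rw [deriv_omega, map_smul, xp_mul_omega, xp_mul_omega]
  rcases i with _ | _ | i
  · simp [res_omega]; rfl
  · simp [res_omega]; rfl
  · simp

/-- The modes on a module, without its grading. -/
structure ModData (Y : FieldMap U U.rep) (M : Type w) [AddCommGroup M] [Module ℂ M] where
  B : V →ₗ[ℂ] (ℤ → Module.End ℂ M)
  field : ∀ a, IsField (B a)
  vac : ∀ n, B U.vac n = if n = -1 then 1 else 0
  assoc : ∀ {d e : Bideg} {a b : V}, a ∈ U.deg d → b ∈ U.deg e → ∀ v : M,
    ∃ F : ThreePoint M,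
      (∀ p q, F.expandZW p q = prodZW (tot d) (B a) (B b) p q v) ∧
      (∀ p q, F.expandWZ p q = prodWZ (tot d) (tot e) (B a) (B b) p q v) ∧
      (∀ p q, F.expandDiag p q = B (modes Y Y a p b) q v)

namespace ModData

variable {Y : FieldMap U U.rep} {M : Type w} [AddCommGroup M] [Module ℂ M] (N : ModData Y M)
  {d e : Bideg} {a b : V}

theorem exists_bound (a : V) (v : M) : ∃ n : ℕ, ∀ m : ℕ, n ≤ m → N.B a m v = 0 := by
  obtain ⟨n, hn⟩ := N.field a v
  exact ⟨n.toNat, fun m hm => hn _ (by omega)⟩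

/-- The coefficient of `(z - w)ˡ` in the third expansion involves only `r`, `s` and `t`. The first
expansion identifies `r` and `t`, the second identifies `s`, with products of modes; the outcome is
the normal-ordered product. -/
theorem normalOrdered (ha : a ∈ U.deg d) (hb : b ∈ U.deg e) (l : ℕ) (m : ℤ) (v : M) :
    N.B (Y.fld a (omega l) b) m v
      = normalOrderedMode (tot d) (tot e) l (N.B a) (N.B b) m v := by
  obtain ⟨F, h1, h2, h3⟩ := N.assoc ha hb v
  have hl := h3 (.negSucc l) m
  rw [modes_negSucc] at hl
  rw [← hl]
  cases m with
  | negSucc k =>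
    show ∑ i ∈ _, _ = ∑ i ∈ _, _
    refine Finset.sum_congr rfl fun i hi => ?_
    have := h1 (.negSucc i) (.negSucc (k + l - i))
    rw [show F.r i (k + l - i) = _ from this, prodZW, ix_negSucc, ix_negSucc, koszul_comm,
      koszul_zero_left, one_smul]
    rfl
  | ofNat k =>
    have hs : ∀ m j, F.s m j
        = (koszul (tot d + 1) (tot e)) • N.B b (.negSucc j) (N.B a m v) := fun m j => by
      have := h2 (Int.ofNat m) (.negSucc j)
      rw [show F.s m j = _ from this, prodWZ, ix_negSucc, show ix (Int.ofNat m) = 1 from ix_natCast m,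
        add_zero, koszul_comm 1 0, koszul_zero_left, mul_one, koszul_add_left, koszul_comm 1 (tot e)]
      rfl
    have ht : ∀ m i, F.t m i = koszul (tot d) 1 • N.B a (.negSucc i) (N.B b m v) := fun m i => by
      have := h1 (.negSucc i) (Int.ofNat m)
      rw [show F.t m i = _ from this, prodZW, ix_negSucc, show ix (Int.ofNat m) = 1 from ix_natCast m,
        add_zero]
      rfl
    show (F.s.sum fun m c =>
        if k ≤ m + l then ((-1) ^ l * ((m + l).choose l : ℂ)) • c (m + l - k) else 0)
      + (F.t.sum fun m c => if k ≤ m then ((m - k + l).choose l : ℂ) • c (m - k + l) else 0)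
      = koszul (tot d) 1 • (∑ᶠ i : ℕ, (i.choose l : ℂ) • N.B a (.negSucc i) (N.B b (k + i - l) v))
        + ((-1) ^ l * koszul (tot d + 1) (tot e)) • ∑ᶠ j : ℕ,
          ((k + j).choose l : ℂ) • N.B b (.negSucc j) (N.B a (k + j - l) v)
    obtain ⟨na, hna⟩ := N.exists_bound a v
    obtain ⟨nb, hnb⟩ := N.exists_bound b v
    have hza : EvZero fun j : ℕ => ((k + j).choose l : ℂ) •
        N.B b (.negSucc j) (N.B a (k + j - l) v) := by
      refine ⟨na + l, fun j hj => ?_⟩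
      beta_reduce
      rw [show ((k : ℤ) + j - l) = ((k + j - l : ℕ) : ℤ) by omega, hna _ (by omega)]; simp
    have hzb : EvZero fun i : ℕ => (i.choose l : ℂ) •
        N.B a (.negSucc i) (N.B b (k + i - l) v) := by
      refine ⟨nb + l, fun j hj => ?_⟩
      beta_reduce
      rw [show ((k : ℤ) + j - l) = ((k + j - l : ℕ) : ℤ) by omega, hnb _ (by omega)]; simp
    rw [Finsupp.sum_eq_evsum _ _ (fun m => by simp), Finsupp.sum_eq_evsum _ _ (fun m => by simp),
      ← evsum_eq_finsum hza, ← evsum_eq_finsum hzb, add_comm]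
    congr 1
    · rw [evsum_shift k (fun m hm => if_neg (by omega)), evsum_shift l (fun m hm => by
        rw [Nat.choose_eq_zero_of_lt hm]; simp) hzb, ← evsum_smul]
      · congr 1; ext n
        rw [if_pos (by omega), ht, smul_comm (koszul _ _)]
        rw [Nat.add_sub_cancel_left, add_comm n l,
          show ((k : ℤ) + ((l + n : ℕ) : ℤ) - l) = ((k + n : ℕ) : ℤ) by push_cast; ring]
      · refine ⟨nb, fun m hm => ?_⟩
        beta_reduce
        rw [ht, hnb m hm]; simp
    -- `G` is indexed by the common value `i = m + l = k + j` of the two summations, and both sums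
    -- are shifts of `evsum G`.
    · let G : ℕ → M := fun i => if l ≤ i ∧ k ≤ i then
        ((-1) ^ l * koszul (tot d + 1) (tot e)) • ((i.choose l : ℂ) •
          N.B b (.negSucc (i - k)) (N.B a (i - l : ℕ) v)) else 0
      have hG : EvZero G := by
        refine ⟨na + l, fun i hi => ?_⟩
        simp only [G]
        rw [hna _ (by omega)]; simp
      trans evsum G
      · rw [evsum_shift l (fun i hi => if_neg (by omega)) hG]
        congr 1; ext m
        by_cases hk : k ≤ m + l
        · rw [if_pos hk, if_pos ⟨by omega, by omega⟩, hs, smul_smul, smul_smul, add_comm l m,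
            Nat.add_sub_cancel]
          congr 1; ring
        · rw [if_neg hk, if_neg (by omega)]
      · rw [evsum_shift k (fun i hi => if_neg (by omega)) hG, ← evsum_smul]
        congr 1; ext j
        by_cases hl : l ≤ k + j
        · rw [if_pos ⟨hl, by omega⟩, Nat.add_sub_cancel_left,
            show ((k : ℤ) + j - l) = ((k + j - l : ℕ) : ℤ) by omega]
        · rw [if_neg (by omega), Nat.choose_eq_zero_of_lt (by omega)]; simp

/-- The translate of `κ|0⟩` is zero, so its field is constant. Concretely, `normalOrdered` with the
vacuum as second state and `l = 1` shows that a nonzero multiple of the mode vanishes. -/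
theorem kappa_eq_zero (n : ℤ) (hn : n ≠ -1) : N.B (kappaState U) n = 0 := by
  refine LinearMap.ext fun v => ?_
  have hT : Y.fld (kappaState U) (omega 1) U.vac = 0 := by
    rw [kappaState, Y.fld_kappa_vac, res_omega, if_neg one_ne_zero, zero_smul, LinearMap.zero_apply]
  cases n with
  | negSucc k =>
    obtain ⟨k, rfl⟩ : ∃ j, k = j + 1 := Nat.exists_eq_succ_of_ne_zero fun h0 => hn (by rw [h0]; rfl)
    have := N.normalOrdered kappaState_mem PreVac.vac_mem 1 (.negSucc k) v
    rw [hT, map_zero, normalOrderedMode, Finset.sum_eq_single (k + 1)] at this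
    · rw [N.vac, if_pos (by simp)] at this
      have h2 : ((k : ℂ) + 1) ≠ 0 := Nat.cast_add_one_ne_zero k
      have h3 : ((k : ℂ) + 1) • N.B (kappaState U) (.negSucc (k + 1)) v = 0 := by
        simpa using this.symm
      exact (smul_eq_zero.1 h3).resolve_left h2
    · intro i hi hi'
      rw [Finset.mem_Icc] at hi
      rw [N.vac, if_neg (by omega)]; simp
    · simp
  | ofNat k =>
    have := N.normalOrdered kappaState_mem PreVac.vac_mem 1 (Int.ofNat (k + 1)) v
    rw [hT, map_zero, normalOrderedMode, finsum_eq_single _ 0, finsum_eq_single _ 0] at this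
    · rw [N.vac, N.vac] at this
      have h2 : ((k : ℂ) + 1) ≠ 0 := Nat.cast_add_one_ne_zero k
      have h3 : ((k : ℂ) + 1) • N.B (kappaState U) k v = 0 := by
        have e0 : tot (0 : Bideg) = 0 := by simp [tot]
        rw [e0, koszul_comm _ 0, koszul_zero_left] at this
        simpa using this.symm
      exact (smul_eq_zero.1 h3).resolve_left h2
    · intro j hj
      rw [N.vac, if_neg (by omega)]; simp
    · intro j hj
      rw [N.vac, if_neg (by omega)]; simp

/-- The action of `κ`. -/
def kap : Module.End ℂ M := N.B (kappaState U) (-1)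

/-- The currents on a module. -/
def cur : g →ₗ[ℂ] Op M :=
  (LinearMap.mk₂ ℂ (fun A (α : RavK) => Finsupp.linearCombination ℂ
      (fun n : ℕ => N.B (curState U A) (.negSucc n)) α.2)
    (fun A A' α => by
      rw [Finsupp.linearCombination_apply, Finsupp.linearCombination_apply,
        Finsupp.linearCombination_apply]
      simp [Finsupp.sum_add])
    (fun c A α => by
      rw [Finsupp.linearCombination_apply, Finsupp.linearCombination_apply]
      simp [Finsupp.smul_sum, smul_comm c])
    (fun A α α' => by simp) (fun c A α => by simp))
  + LinearMap.mk₂ ℂ (fun A (α : RavK) =>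
      ({ toFun := fun v => evsum fun n : ℕ =>
          PowerSeries.coeff n α.1 • N.B (curState U (𝔤.parInv A)) n v
         map_add' := fun v v' => by simp [smul_add, evsum_add]
         map_smul' := fun c v => by simp [smul_comm _ c, evsum_smul] } : Module.End ℂ M))
    (fun A A' α => LinearMap.ext fun v => by simp [smul_add, evsum_add])
    (fun c A α => LinearMap.ext fun v => by simp [smul_comm _ c, evsum_smul])
    (fun A α α' => LinearMap.ext fun v => by simp [add_smul, evsum_add])
    (fun c A α => LinearMap.ext fun v => by simp [mul_smul, evsum_smul])

theorem cur_omega (A : g) (n : ℕ) : N.cur A (omega n) = N.B (curState U A) (.negSucc n) := by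
  refine LinearMap.ext fun v => ?_
  simp [cur, omega]

theorem cur_ofSeries_apply (A : g) (f : PowerSeries ℂ) (v : M) : N.cur A (ofSeries f) v
    = evsum fun n : ℕ => PowerSeries.coeff n f • N.B (curState U (𝔤.parInv A)) n v := by
  simp [cur, ofSeries]

theorem cur_xp {p : ZMod 2} {A : g} (hA : A ∈ 𝔤.par p) (n : ℕ) :
    N.cur A (xp n) = koszul p 1 • N.B (curState U A) n := by
  refine LinearMap.ext fun v => ?_
  rw [xp, cur_ofSeries_apply, evsum_eq_single n fun k hk => by
    rw [PowerSeries.coeff_X_pow, if_neg hk, zero_smul], PowerSeries.coeff_X_pow, if_pos rfl, one_smul,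
    𝔤.parInv_of_mem hA, koszul_comm, map_smul, map_smul]
  rfl

theorem cur_elt {p : ZMod 2} {A : g} (hA : A ∈ 𝔤.par p) (n : ℤ) :
    N.cur A (elt n) = koszul p (ix n) • N.B (curState U A) n := by
  cases n with
  | ofNat n => exact (N.cur_xp hA n).trans (by rw [← ix_natCast n]; rfl)
  | negSucc n => rw [elt_negSucc, cur_omega, ix_negSucc, koszul_comm, koszul_zero_left, one_smul]

theorem isSm_cur (A : g) : IsSm (N.cur A) := fun v => by
  obtain ⟨n, hn⟩ := N.exists_bound (curState U (𝔤.parInv A)) v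
  refine ⟨n, fun f => ?_⟩
  rw [cur_ofSeries_apply]
  refine Eq.trans (congrArg evsum (funext fun m => ?_)) evsum_zero
  rw [PowerSeries.coeff_X_pow_mul']
  split_ifs with hm
  · rw [hn m hm, smul_zero]
  · rw [zero_smul]

end ModData

end

/-! ### Commutation relations on a module -/

section

variable {g : Type u} [AddCommGroup g] [Module ℂ g] {𝔤 : LieSuperalgebra g} {h : InvariantForm 𝔤}
  {V : Type u} [AddCommGroup V] [Module ℂ V] {U : VacMod 𝔤 h V}

namespace ModData

variable {Y : FieldMap U U.rep} {M : Type w} [AddCommGroup M] [Module ℂ M] (N : ModData Y M)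
  {d e : Bideg} {a b : V}

/-- The annihilation modes of `κ|0⟩` vanish on the vertex algebra, so the coefficients `d` of the
three-point element are zero. For first index `-1`, the expansions in the two orders of `z` and `w`
then coincide. -/
theorem kap_mode (hb : b ∈ U.deg e) (j : ℤ) (v : M) :
    N.kap (N.B b j v) = koszul 1 (tot e + ix j) • N.B b j (N.kap v) := by
  obtain ⟨F, h1, h2, h3⟩ := N.assoc kappaState_mem hb v
  have e1 : tot ((1, 0) : Bideg) = 1 := by simp [tot]
  have e2 : (Int.negSucc 0) = -1 := rfl
  have e4 : ix (-1) = 0 := ix_negSucc 0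
  have hd : ∀ m j, F.d m j = 0 := fun m j => by
    refine (h3 (Int.ofNat m) (.negSucc j)).trans ?_
    rw [show modes Y Y (kappaState U) (Int.ofNat m) b = 0 by
      rw [modes_apply Y Y kappaState_mem, show elt (Int.ofNat m) = xp m from rfl, kappaState,
        Y.fld_kappa_vac, res_xp]; simp]
    simp
  cases j with
  | negSucc j =>
    have := (h1 (.negSucc 0) (.negSucc j)).symm.trans (h2 (.negSucc 0) (.negSucc j))
    simp only [prodZW, prodWZ, ix_negSucc, e1, koszul_comm _ 0, koszul_zero_left, one_smul, e2, e4, mul_one,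
      add_zero, LinearMap.smul_apply, Module.End.mul_apply] at this ⊢
    exact this
  | ofNat k =>
    have g1 : F.t k 0 = _ := h1 (.negSucc 0) (Int.ofNat k)
    have g2 : F.t k 0 + (F.d.sum fun m c =>
      if k ≤ m + 0 then ((-1) ^ m * ((m + 0).choose 0 : ℂ)) • c (m + 0 - k) else 0) = _ :=
      h2 (.negSucc 0) (Int.ofNat k)
    rw [Finsupp.sum_eq_evsum _ _ (fun m => by simp)] at g2
    simp only [hd, smul_zero, ite_self, evsum_zero, add_zero] at g2
    rw [g1] at g2
    have e3 : ix (Int.ofNat k) = 1 := ix_natCast k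
    simp only [prodZW, prodWZ, e1, koszul_comm _ 0, koszul_zero_left, e2, e4, mul_one,
      add_zero, LinearMap.smul_apply, Module.End.mul_apply, e3] at g2 ⊢
    rw [koszul_add_right]
    have h11 : koszul 1 1 = -1 := by simp [koszul]
    rw [h11, neg_one_smul] at g2
    rw [h11, mul_neg_one, neg_smul]
    exact neg_eq_iff_eq_neg.1 g2

theorem kap_kap (v : M) : N.kap (N.kap v) = 0 := by
  have := N.kap_mode kappaState_mem (-1) v
  have e1 : tot ((1, 0) : Bideg) = 1 := by simp [tot]
  rw [e1, show ix (-1) = 0 from ix_negSucc 0, add_zero, show koszul 1 1 = -1 by simp [koszul],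
    neg_one_smul] at this
  change N.kap (N.kap v) = -N.kap (N.kap v) at this
  have h2 := eq_neg_iff_add_eq_zero.1 this
  rw [← two_smul ℂ] at h2
  exact (smul_eq_zero.1 h2).resolve_left two_ne_zero

/-- The commutation relations of the currents, on monomials. -/
theorem cur_elt_cur_elt {p q : ZMod 2} {A B : g} (hA : A ∈ 𝔤.par p) (hB : B ∈ 𝔤.par q) (i j : ℤ)
    (v : M) : N.cur A (elt i) (N.cur B (elt j) v)
      = koszul (p + (1 + ix i)) (q + (1 + ix j)) • N.cur B (elt j) (N.cur A (elt i) v)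
        + koszul (1 + ix i) q • (N.cur (𝔤.br A B) (mul (elt i) (elt j)) v
          - (h.form A B * res (mul (elt i) (RavK.deriv (elt j)))) • N.kap v) := by
  obtain ⟨F, h1, h2, h3⟩ := N.assoc (curState_mem hA) (curState_mem hB) v
  have hAB := 𝔤.br_mem hA hB
  have hm : ∀ m : ℕ, modes Y Y (curState U A) m (curState U B) = koszul p 1 •
      ((if m = 0 then curState U (𝔤.br A B) else 0)
        + if m = 1 then h.form A B • kappaState U else 0) := fun m => by
    rw [← cur_xp_curState hA hB]
    exact LinearMap.congr_fun (VacMod.modes_mu_natCast Y Y hA m) (curState U B)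
  -- The singular part of two currents consists of the current of `[A, B]` at `Ω_{z-w}^0` and of `κ`
  -- at `Ω_{z-w}^1`, the latter with a constant field.
  have hD : ∀ m j, F.d m j = koszul p 1 • ((if m = 0 then N.cur (𝔤.br A B) (omega j) v else 0)
      + if m = 1 ∧ j = 0 then h.form A B • N.kap v else 0) := fun m j => by
    refine (h3 (Int.ofNat m) (.negSucc j)).trans ?_
    rw [show modes Y Y (curState U A) (Int.ofNat m) (curState U B) = _ from hm m]
    rcases m with _ | _ | m
    · simp [cur_omega]
    · rcases j with _ | j
      · simp [kap]
      · simp [N.kappa_eq_zero (.negSucc (j + 1)) (by omega)]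
    · simp
  have hy : ∀ m k, F.y m k = if m = 0 then (koszul q 1) • N.cur (𝔤.br A B) (xp k) v else 0 :=
    fun m k => by
    refine (h3 (Int.ofNat m) (Int.ofNat k)).trans ?_
    rw [show modes Y Y (curState U A) (Int.ofNat m) (curState U B) = _ from hm m]
    rcases m with _ | _ | m
    · simp only [N.cur_xp hAB, koszul_add_left, if_true, LinearMap.smul_apply, smul_smul]
      rw [mul_left_comm, koszul_mul_self]
      simp
    · simp [N.kappa_eq_zero k (by omega)]
    · simp
  have h11 : koszul 1 1 = -1 := by simp [koszul]
  have e11 : (1 : ZMod 2) + 1 = 0 := rfl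
  cases i with
  | negSucc i =>
    cases j with
    | negSucc j =>
      have g1 := (h1 (.negSucc i) (.negSucc j)).symm.trans (h2 (.negSucc i) (.negSucc j))
      rw [elt_negSucc, elt_negSucc, mul_omega_omega, deriv_omega, map_smul, mul_omega_omega, cur_omega,
        cur_omega]
      simp only [prodZW, prodWZ, ix_negSucc, koszul_comm _ 0, koszul_zero_left, mul_one,
        add_zero, one_smul, tot_one, LinearMap.smul_apply, Module.End.mul_apply] at g1
      rw [g1, ix_negSucc, ix_negSucc, add_comm p, add_comm q]
      simp
    | ofNat k =>
      have e3 : ix (Int.ofNat k) = 1 := ix_natCast k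
      have g1 : F.t k i = _ := h1 (.negSucc i) (Int.ofNat k)
      have g2 : F.t k i + (F.d.sum fun m c =>
        if k ≤ m + i then ((-1) ^ m * ((m + i).choose i : ℂ)) • c (m + i - k) else 0) = _ :=
        h2 (.negSucc i) (Int.ofNat k)
      rw [Finsupp.sum_eq_evsum _ _ (fun m => by simp), evsum_eq (N := 2) (fun m hm => by
        simp [hD, show m ≠ 0 by omega, show m ≠ 1 by omega]), Finset.sum_range_succ,
        Finset.sum_range_one, g1, hD, hD] at g2
      have g3 : N.cur (𝔤.br A B) (mul (omega i) (xp k)) v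
          = if k ≤ i then N.cur (𝔤.br A B) (omega (i - k)) v else 0 := by
        rw [RavK.mul_comm', xp_mul_omega]
        split_ifs <;> simp
      have g4 : res (mul (omega i) (RavK.deriv (xp k))) = if k = i + 1 then (i : ℂ) + 1 else 0 := by
        rw [deriv_xp, map_smul, RavK.mul_comm', xp_mul_omega, map_smul]
        rcases k with _ | k
        · simp
        · rw [Nat.add_sub_cancel]
          by_cases hki : k = i
          · subst hki; simp [res_omega]
          · rw [if_neg (show ¬k + 1 = i + 1 by omega)]
            split_ifs
            · rw [res_omega, if_neg (by omega)]; simp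
            · simp
      -- The `Ω_{z-w}^1` term carries the cocycle: it survives only for `k = i + 1`, and its
      -- binomial coefficient `i + 1` is the residue of `Ωⁱ ∂uⁱ⁺¹`.
      have g5 : (if k ≤ 1 + i then ((-1) ^ 1 * ((1 + i).choose i : ℂ)) • (koszul p 1 •
          ((if (1 : ℕ) = 0 then N.cur (𝔤.br A B) (omega (1 + i - k)) v else 0)
            + if 1 = 1 ∧ 1 + i - k = 0 then h.form A B • N.kap v else 0)) else 0)
          = if k = i + 1 then -(koszul p 1 * ((i : ℂ) + 1)) • (h.form A B • N.kap v) else 0 := by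
        rw [add_comm 1 i, Nat.choose_succ_self_right]
        by_cases hki : k = i + 1
        · subst hki
          simp only [le_refl, if_true, Nat.sub_self, and_self, one_ne_zero, if_false, zero_add, smul_smul]
          congr 1; push_cast; ring
        · rw [if_neg hki]
          by_cases hk : k ≤ i + 1
          · rw [if_pos hk, if_neg one_ne_zero, if_neg (by omega)]
            simp
          · rw [if_neg hk]
      rw [g5] at g2
      rw [elt_negSucc, show elt (Int.ofNat k) = xp k from rfl, g3, g4, cur_omega, N.cur_xp hB,
        ix_negSucc, e3]
      simp only [prodZW, prodWZ, ix_negSucc, koszul_comm _ 0, koszul_zero_left, mul_one, Nat.choose_self,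
        add_zero, zero_add, one_smul, tot_one, LinearMap.smul_apply, Module.End.mul_apply, map_smul,
        if_true, pow_zero, Nat.cast_one, zero_ne_one, false_and, if_false, Int.ofNat_eq_natCast] at g2 ⊢
      generalize N.B (curState U A) (Int.negSucc i) (N.B (curState U B) k v) = P at *
      generalize N.B (curState U B) k (N.B (curState U A) (Int.negSucc i) v) = Q at *
      -- With the two orderings abstracted as `P` and `Q`, each case is a linear relation, and its
      -- signs are verified for the four pairs of parities.
      split_ifs at g2 ⊢ <;>
        rcases LieSuperalgebra.par_cases p with rfl | rfl <;>
        rcases LieSuperalgebra.par_cases q with rfl | rfl <;>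
        simp [koszul, e11, ix_natCast] at g2 ⊢ <;>
        first
          | omega
          | linear_combination (norm := module) g2
          | linear_combination (norm := module) (-1 : ℂ) • g2
  | ofNat m =>
    have e3 : ix (Int.ofNat m) = 1 := ix_natCast m
    cases j with
    | negSucc j =>
      have g1 : F.s m j + ∑ n ∈ Finset.range (min m j + 1), (m.choose n : ℂ) • F.d (m - n) (j - n) = _ :=
        h1 (Int.ofNat m) (.negSucc j)
      have g2 : F.s m j = _ := h2 (Int.ofNat m) (.negSucc j)
      have g3 : N.cur (𝔤.br A B) (mul (xp m) (omega j)) v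
          = if m ≤ j then N.cur (𝔤.br A B) (omega (j - m)) v else 0 := by
        rw [xp_mul_omega]
        split_ifs <;> simp
      have g4 : res (mul (xp m) (RavK.deriv (omega j))) = if m = j + 1 then -((j : ℂ) + 1) else 0 := by
        rw [deriv_omega, map_smul, xp_mul_omega, map_smul]
        by_cases hki : m = j + 1
        · subst hki; simp [res_omega]
        · rw [if_neg hki]
          split_ifs
          · rw [res_omega, if_neg (by omega)]; simp
          · simp
      have g5 : ∑ n ∈ Finset.range (min m j + 1), (m.choose n : ℂ) • F.d (m - n) (j - n)
          = (if m ≤ j then koszul p 1 • N.cur (𝔤.br A B) (omega (j - m)) v else 0)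
            + if m = j + 1 then (koszul p 1 * ((j : ℂ) + 1)) • (h.form A B • N.kap v) else 0 := by
        simp only [hD, smul_add, Finset.sum_add_distrib]
        congr 1
        · by_cases hmj : m ≤ j
          · rw [if_pos hmj, Finset.sum_eq_single m]
            · simp
            · intro n hn hn'
              rw [Finset.mem_range] at hn
              rw [if_neg (by omega)]; simp
            · simp [hmj]
          · rw [if_neg hmj]
            refine Finset.sum_eq_zero fun n hn => ?_
            rw [Finset.mem_range] at hn
            rw [if_neg (by omega)]; simp
        · by_cases hmj : m = j + 1
          · subst hmj
            rw [if_pos rfl, Finset.sum_eq_single j]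
            · simp [smul_smul]; ring_nf
            · intro n hn hn'
              rw [Finset.mem_range] at hn
              rw [if_neg (by omega)]; simp
            · simp
          · rw [if_neg hmj]
            refine Finset.sum_eq_zero fun n hn => ?_
            rw [Finset.mem_range] at hn
            rw [if_neg (by omega)]; simp
      rw [g5, g2] at g1
      rw [elt_negSucc, show elt (Int.ofNat m) = xp m from rfl, g3, g4, N.cur_omega, N.cur_xp hA,
        ix_negSucc, e3]
      simp only [prodZW, prodWZ, ix_negSucc, koszul_comm _ 0, koszul_zero_left, mul_one,
        add_zero, one_smul, tot_one, LinearMap.smul_apply, Module.End.mul_apply, map_smul,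
        Int.ofNat_eq_natCast] at g1 ⊢
      generalize N.B (curState U A) m (N.B (curState U B) (Int.negSucc j) v) = P at *
      generalize N.B (curState U B) (Int.negSucc j) (N.B (curState U A) m v) = Q at *
      split_ifs at g1 ⊢ <;>
        rcases LieSuperalgebra.par_cases p with rfl | rfl <;>
        rcases LieSuperalgebra.par_cases q with rfl | rfl <;>
        simp [koszul, e11, ix_natCast] at g1 ⊢ <;>
        first
          | omega
          | linear_combination (norm := module) g1
          | linear_combination (norm := module) (-1 : ℂ) • g1
    | ofNat k =>
      have e4 : ix (Int.ofNat k) = 1 := ix_natCast k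
      have g1 : F.x m k + ∑ n ∈ Finset.range (m + 1), (m.choose n : ℂ) • F.y (m - n) (k + n) = _ :=
        h1 (Int.ofNat m) (Int.ofNat k)
      have g2 : F.x m k = _ := h2 (Int.ofNat m) (Int.ofNat k)
      rw [g2, Finset.sum_eq_single m (fun n hn hn' => by
        rw [Finset.mem_range] at hn
        rw [hy, if_neg (by omega), smul_zero]) (by simp), hy, Nat.sub_self, if_pos rfl,
        Nat.choose_self] at g1
      rw [show elt (Int.ofNat m) = xp m from rfl, show elt (Int.ofNat k) = xp k from rfl, deriv_xp,
        map_smul, xp_mul_xp, xp_mul_xp, map_smul, res_xp, N.cur_xp hA, N.cur_xp hB, e3, e4, add_comm m k]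
      simp only [prodZW, prodWZ, LinearMap.smul_apply, Module.End.mul_apply, map_smul, tot_one,
        Int.ofNat_eq_natCast, Nat.cast_one, one_smul] at g1 ⊢
      generalize N.B (curState U A) m (N.B (curState U B) k v) = P at *
      generalize N.B (curState U B) k (N.B (curState U A) m v) = Q at *
      rcases LieSuperalgebra.par_cases p with rfl | rfl <;>
        rcases LieSuperalgebra.par_cases q with rfl | rfl <;>
        simp [koszul, e11, ix_natCast] at g1 ⊢ <;>
        first
          | omega
          | linear_combination (norm := module) g1
          | linear_combination (norm := module) (-1 : ℂ) • g1

end ModData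

end

/-! ### From relations on monomials to all raviolo Laurent series. -/

section

variable {g : Type u} [AddCommGroup g] [Module ℂ g] {𝔤 : LieSuperalgebra g} {h : InvariantForm 𝔤}
  {V : Type u} [AddCommGroup V] [Module ℂ V] {U : VacMod 𝔤 h V}

theorem IsSm.exists_series_mul {M : Type*} [AddCommGroup M] [Module ℂ M] {C : Op M} (hC : IsSm C)
    (η : RavK) (v : M) :
    ∃ N, ∀ k ≥ N, ∀ f, C (mul (ofSeries (PowerSeries.X ^ k * f)) η) v = 0 := by
  obtain ⟨N, hN⟩ := hC.exists_bound η v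
  exact ⟨N, fun k hk f => by rw [← xp_mul_ofSeries, mul_assoc', hN k hk f]⟩

theorem IsSm.exists_series {M : Type*} [AddCommGroup M] [Module ℂ M] {C : Op M} (hC : IsSm C)
    (v : M) : ∃ N, ∀ k ≥ N, ∀ f, C (ofSeries (PowerSeries.X ^ k * f)) v = 0 := by
  obtain ⟨N, hN⟩ := hC.exists_series_mul (xp 0) v
  exact ⟨N, fun k hk f => by have := hN k hk f; rwa [RavK.mul_comm', xp_zero_mul] at this⟩

/-- The residue is itself a field, namely the identity field on `ℂ`, so the bounds for fields apply
to it. -/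
theorem exists_res_series_mul (η : RavK) :
    ∃ N, ∀ k ≥ N, ∀ f, res (mul (ofSeries (PowerSeries.X ^ k * f)) η) = 0 := by
  obtain ⟨N, hN⟩ := (isSm_idField (M := ℂ)).exists_series_mul η 1
  exact ⟨N, fun k hk f => by have := hN k hk f; rwa [idField_apply, smul_eq_mul, mul_one] at this⟩

theorem SmRep.sgn_ofSeries (p : ZMod 2) (f : PowerSeries ℂ) : sgn p (ofSeries f) = ofSeries f := by
  rw [sgn_apply p (isPar_ofSeries f), koszul_comm, koszul_zero_left, one_smul]

namespace ModData

variable {Y : FieldMap U U.rep} {M : Type w} [AddCommGroup M] [Module ℂ M] (N : ModData Y M)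
  {p q r s : ZMod 2} {A B : g}

theorem cur_kap (hA : A ∈ 𝔤.par p) {α : RavK} (hα : IsPar r α) (v : M) :
    N.cur A α (N.kap v) = koszul 1 (p + r) • N.kap (N.cur A α v) := by
  have key : LinearMap.applyₗ (N.kap v) ∘ₗ N.cur A
      = koszul 1 p • (N.kap ∘ₗ LinearMap.applyₗ v ∘ₗ N.cur A ∘ₗ SmRep.sgn 1) := by
    have hm : ∀ n : ℤ, N.cur A (elt n) (N.kap v)
        = koszul 1 p • N.kap (N.cur A (SmRep.sgn 1 (elt n)) v) := fun n => by
      rw [SmRep.sgn_apply 1 (isPar_elt n), N.cur_elt hA, map_smul, N.cur_elt hA]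
      simp only [LinearMap.smul_apply, map_smul]
      rw [N.kap_mode (curState_mem hA), tot_one, add_assoc]
      simp only [koszul_add_right]
      simp only [smul_smul, mul_assoc]
      generalize koszul p (ix n) = x
      generalize N.B (curState U A) n (N.kap v) = P
      have h1 := koszul_mul_self 1 p
      have h2 := koszul_mul_self 1 (ix n)
      have h3 := koszul_mul_self 1 1
      congr 1
      linear_combination (-x) * (h1 * koszul 1 1 ^ 2 * koszul 1 (ix n) ^ 2
        + h2 * koszul 1 1 ^ 2 + h3)
    refine monomial_ext (fun n => hm (.negSucc n)) (fun n => hm n) ?_ ?_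
    · exact N.isSm_cur A _
    · obtain ⟨K, hK⟩ := N.isSm_cur A v
      exact ⟨K, fun f => by
        simp only [LinearMap.smul_apply, LinearMap.comp_apply, SmRep.sgn_ofSeries,
          LinearMap.applyₗ_apply_apply, hK, map_zero, smul_zero]⟩
  have := LinearMap.congr_fun key α
  simp only [LinearMap.smul_apply, LinearMap.comp_apply, LinearMap.applyₗ_apply_apply,
    SmRep.sgn_apply 1 hα, map_smul] at this
  rw [this, smul_smul, koszul_add_right]

/-- For a fixed monomial in the second argument, both sides are linear in `α` and annihilate high
powers of `u`, so `monomial_ext` applies. The maps `sgn` make the sign depending on the parity of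
`α` linear in `α`. The second argument is freed afterwards in the same way. -/
theorem cur_cur_elt (hA : A ∈ 𝔤.par p) (hB : B ∈ 𝔤.par q) {α : RavK} (hα : IsPar r α) (j : ℤ)
    (v : M) : N.cur A α (N.cur B (elt j) v)
      = koszul (p + r) (q + (1 + ix j)) • N.cur B (elt j) (N.cur A α v)
        + koszul r q • (N.cur (𝔤.br A B) (mul α (elt j)) v
          - (h.form A B * res (mul α (RavK.deriv (elt j)))) • N.kap v) := by
  obtain ⟨c, hc⟩ : ∃ c, c = q + (1 + ix j) := ⟨_, rfl⟩
  rw [← hc]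
  have key : LinearMap.applyₗ (N.cur B (elt j) v) ∘ₗ N.cur A
      = koszul p c • (N.cur B (elt j) ∘ₗ LinearMap.applyₗ v ∘ₗ N.cur A ∘ₗ SmRep.sgn c)
        + (LinearMap.applyₗ v ∘ₗ N.cur (𝔤.br A B) ∘ₗ mul.flip (elt j) ∘ₗ SmRep.sgn q
          - (h.form A B • (res ∘ₗ mul.flip (RavK.deriv (elt j)) ∘ₗ SmRep.sgn q)).smulRight
              (N.kap v)) := by
    have hm : ∀ n : ℤ, N.cur A (elt n) (N.cur B (elt j) v)
        = koszul p c • N.cur B (elt j) (N.cur A (SmRep.sgn c (elt n)) v)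
        + (N.cur (𝔤.br A B) (mul (SmRep.sgn q (elt n)) (elt j)) v
          - (h.form A B • res (mul (SmRep.sgn q (elt n)) (RavK.deriv (elt j)))) • N.kap v) :=
        fun n => by
      rw [SmRep.sgn_apply _ (isPar_elt n), SmRep.sgn_apply _ (isPar_elt n),
        N.cur_elt_cur_elt hA hB n j v, ← hc, koszul_add_left, koszul_comm c, koszul_comm q (1 + ix n)]
      simp only [map_smul, LinearMap.smul_apply, smul_smul, smul_sub, smul_eq_mul]
      rw [mul_left_comm (h.form A B)]
    refine monomial_ext (fun n => hm (.negSucc n)) (fun n => hm n) ?_ ?_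
    · exact N.isSm_cur A _
    · obtain ⟨k1, h1⟩ := (N.isSm_cur A).exists_series v
      obtain ⟨k2, h2⟩ := (N.isSm_cur (𝔤.br A B)).exists_series_mul (elt j) v
      obtain ⟨k3, h3⟩ := exists_res_series_mul (RavK.deriv (elt j))
      refine ⟨k1 + k2 + k3, fun f => ?_⟩
      simp only [LinearMap.smul_apply, LinearMap.add_apply, LinearMap.sub_apply,
        LinearMap.comp_apply, SmRep.sgn_ofSeries, LinearMap.smulRight_apply, LinearMap.flip_apply,
        LinearMap.applyₗ_apply_apply]
      rw [h1 _ (by omega), h2 _ (by omega), h3 _ (by omega)]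
      simp
  have := LinearMap.congr_fun key α
  simp only [LinearMap.smul_apply, LinearMap.add_apply, LinearMap.sub_apply,
    LinearMap.comp_apply, LinearMap.smulRight_apply, LinearMap.flip_apply,
    LinearMap.applyₗ_apply_apply, SmRep.sgn_apply _ hα, map_smul, smul_eq_mul] at this
  rw [this, koszul_add_left, koszul_comm c r, koszul_comm q r, smul_sub]
  simp only [smul_smul]
  rw [mul_left_comm (h.form A B)]

/-- The commutation relations of the currents. -/
theorem cur_cur (hA : A ∈ 𝔤.par p) (hB : B ∈ 𝔤.par q) {α β : RavK} (hα : IsPar r α)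
    (hβ : IsPar s β) (v : M) : N.cur A α (N.cur B β v)
      = koszul (p + r) (q + s) • N.cur B β (N.cur A α v)
        + koszul r q • (N.cur (𝔤.br A B) (mul α β) v
          - (h.form A B * res (mul α (RavK.deriv β))) • N.kap v) := by
  set c := p + r
  have key : N.cur A α ∘ₗ LinearMap.applyₗ v ∘ₗ N.cur B
      = koszul c q • (LinearMap.applyₗ (N.cur A α v) ∘ₗ N.cur B ∘ₗ SmRep.sgn c)
        + koszul r q • (LinearMap.applyₗ v ∘ₗ N.cur (𝔤.br A B) ∘ₗ mul α
          - (h.form A B • (res ∘ₗ mul α ∘ₗ RavK.deriv)).smulRight (N.kap v)) := by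
    have hm : ∀ n : ℤ, N.cur A α (N.cur B (elt n) v)
        = koszul c q • N.cur B (SmRep.sgn c (elt n)) (N.cur A α v)
        + koszul r q • (N.cur (𝔤.br A B) (mul α (elt n)) v
          - (h.form A B • res (mul α (RavK.deriv (elt n)))) • N.kap v) :=
        fun n => by
      rw [SmRep.sgn_apply _ (isPar_elt n), N.cur_cur_elt hA hB hα n v, koszul_add_right]
      simp only [map_smul, LinearMap.smul_apply, smul_smul, smul_sub, smul_eq_mul]
      rfl
    refine monomial_ext (fun n => hm (.negSucc n)) (fun n => hm n) ?_ ?_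
    · obtain ⟨k, hk⟩ := N.isSm_cur B v
      exact ⟨k, fun f => by
        simp only [LinearMap.comp_apply, LinearMap.applyₗ_apply_apply, hk, map_zero]⟩
    · obtain ⟨k1, h1⟩ := (N.isSm_cur B).exists_series (N.cur A α v)
      obtain ⟨k2, h2⟩ := (N.isSm_cur (𝔤.br A B)).exists_series_mul α v
      obtain ⟨k3, h3⟩ := exists_res_series_mul (RavK.deriv α)
      refine ⟨k1 + k2 + k3, fun f => ?_⟩
      simp only [LinearMap.smul_apply, LinearMap.add_apply, LinearMap.sub_apply,
        LinearMap.comp_apply, SmRep.sgn_ofSeries, LinearMap.smulRight_apply,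
        LinearMap.applyₗ_apply_apply]
      -- The derivative is moved from `β` to `α`, so that the high power of `u` in `β` multiplies
      -- `∂α` and annihilates the residue.
      rw [h1 _ (by omega), res_mul_deriv_skew, RavK.mul_comm' α, h2 _ (by omega), h3 _ (by omega)]
      simp
  have := LinearMap.congr_fun key β
  simp only [LinearMap.smul_apply, LinearMap.add_apply, LinearMap.sub_apply,
    LinearMap.comp_apply, LinearMap.smulRight_apply, 
    LinearMap.applyₗ_apply_apply, SmRep.sgn_apply _ hβ, map_smul, smul_eq_mul] at this
  rw [this, koszul_add_right, smul_smul]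

/-- The action of the current algebra. -/
def curL : (g ⊗[ℂ] RavK) →ₗ[ℂ] Module.End ℂ M := TensorProduct.lift N.cur

theorem curL_kap {d : Bideg} {x : g ⊗[ℂ] RavK} (hx : x ∈ 𝔤.currentDeg d) :
    N.curL x * N.kap = koszul 1 (tot d) • (N.kap * N.curL x) := by
  induction hx using Submodule.span_induction with
  | zero => simp
  | add x y _ _ hx hy => rw [map_add, add_mul, hx, hy, mul_add, smul_add]
  | smul c x _ hx => rw [map_smul, smul_mul_assoc, hx, mul_smul_comm, smul_comm]
  | mem x hx =>
    obtain ⟨A, hA, α, hα, rfl⟩ := hx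
    refine LinearMap.ext fun v => ?_
    have := N.cur_kap hA (IsPar.of_mem hα) v
    rw [add_comm] at this
    exact this

theorem curL_br {d e : Bideg} {x y : g ⊗[ℂ] RavK} (hx : x ∈ 𝔤.currentDeg d)
    (hy : y ∈ 𝔤.currentDeg e) : N.curL (𝔤.currentBr x y) - 𝔤.currentCocycle h x y • N.kap
      = N.curL x * N.curL y - koszul (tot d) (tot e) • (N.curL y * N.curL x) := by
  have := 𝔤.current_ext₂
    (𝔤.currentBr.compr₂ N.curL - (𝔤.currentCocycle h).compr₂ (LinearMap.toSpanSingleton ℂ _ N.kap))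
    ((LinearMap.mul ℂ (Module.End ℂ M)).compl₁₂ N.curL N.curL
      - koszul (tot d) (tot e) • ((LinearMap.mul ℂ (Module.End ℂ M)).compl₁₂ N.curL N.curL).flip)
    (fun A hA α hα B hB β hβ => ?_) hx hy
  · simpa using this
  · refine LinearMap.ext fun v => ?_
    have := N.cur_cur hA hB (IsPar.of_mem hα) (IsPar.of_mem hβ) v
    rw [add_comm d.2, add_comm e.2] at this
    simp only [LinearMap.sub_apply, LinearMap.compr₂_apply, LinearMap.smul_apply,
      LinearMap.flip_apply, LinearMap.compl₁₂_apply, LinearMap.toSpanSingleton_apply]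
    rw [𝔤.currentBr_tmul A hα hB, 𝔤.currentCocycle_tmul h A hα hB, map_smul]
    simp only [curL, TensorProduct.lift.tmul, LinearMap.mul_apply', Module.End.mul_apply,
      LinearMap.smul_apply, tot]
    rw [this, add_sub_cancel_left, smul_sub, smul_smul]

/-- The representation of the central extension on a module. -/
def rep : SmRep 𝔤 h M where
  ρ := N.curL ∘ₗ LinearMap.fst ℂ _ _ + (LinearMap.snd ℂ _ _).smulRight N.kap
  br := by
    intro d e x y hx hy
    have h0 : N.kap * N.kap = 0 := LinearMap.ext N.kap_kap
    have h1 := N.curL_br hx.1 hy.1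
    -- A homogeneous element has a nonzero `κ`-component only in bidegree `(1, 0)`. In that case the
    -- sign is the one with which `κ` commutes with currents; otherwise the coefficient is zero.
    have h2 : y.2 • (N.curL x.1 * N.kap - koszul (tot d) (tot e) • (N.kap * N.curL x.1)) = 0 := by
      by_cases he : e = (1, 0)
      · rw [N.curL_kap hx.1, he, koszul_comm (tot d)]
        simp [tot]
      · have := hy.2
        rw [if_neg he] at this
        rw [show y.2 = 0 from this, zero_smul]
    have h3 : x.2 • (N.kap * N.curL y.1 - koszul (tot d) (tot e) • (N.curL y.1 * N.kap)) = 0 := by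
      by_cases he : d = (1, 0)
      · rw [N.curL_kap hy.1, he]
        simp [tot, smul_smul, koszul_mul_self]
      · have := hx.2
        rw [if_neg he] at this
        rw [show x.2 = 0 from this, zero_smul]
    rw [show (𝔤.affine h).br x y = 𝔤.affineBr h x y from rfl, LieSuperalgebra.affineBr_apply]
    simp only [LinearMap.add_apply, LinearMap.comp_apply, LinearMap.fst_apply,
      LinearMap.smulRight_apply, LinearMap.snd_apply, add_mul, mul_add, smul_mul_assoc,
      mul_smul_comm, h0, neg_smul, ← sub_eq_add_neg, h1]
    linear_combination (norm := module) -h2 - h3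
  smooth := fun v A => by
    obtain ⟨n, hn⟩ := N.isSm_cur A v
    exact ⟨n, fun f => by simpa [LieSuperalgebra.toAffine, curL] using hn f⟩

theorem rep_cur : N.rep.cur = N.cur := by
  refine LinearMap.ext fun A => LinearMap.ext fun α => ?_
  simp [SmRep.cur_apply, rep, LieSuperalgebra.toAffine, curL]

theorem rep_kappa : N.rep.ρ (LieSuperalgebra.kappa g) = N.kap := by
  simp [rep, LieSuperalgebra.kappa]

end ModData

end

/-! ### Morphisms -/

section

variable {g : Type u} [AddCommGroup g] [Module ℂ g] {𝔤 : LieSuperalgebra g} {h : InvariantForm 𝔤}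
  {V : Type u} [AddCommGroup V] [Module ℂ V] {U : VacMod 𝔤 h V}
  {M : Type w} [AddCommGroup M] [Module ℂ M] {M' : Type w} [AddCommGroup M'] [Module ℂ M']

theorem map_finsum_of_evZero (f : M →ₗ[ℂ] M') {X : ℕ → M} (hX : EvZero X) :
    f (∑ᶠ k, X k) = ∑ᶠ k, f (X k) := by
  rw [← evsum_eq_finsum hX, map_evsum f hX, evsum_eq_finsum (hX.map fun _ => f)]

/-- Maps that intertwine two pairs of fields intertwine their normal-ordered products. -/
theorem map_normalOrderedMode (f : M →ₗ[ℂ] M') {A B : ℤ → Module.End ℂ M}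
    {A' B' : ℤ → Module.End ℂ M'} (hA : IsField A) (hB : IsField B)
    (hfA : ∀ n v, f (A n v) = A' n (f v)) (hfB : ∀ n v, f (B n v) = B' n (f v)) (a b : ZMod 2)
    (l : ℕ) (m : ℤ) (v : M) :
    f (normalOrderedMode a b l A B m v) = normalOrderedMode a b l A' B' m (f v) := by
  have hz : ∀ {A B : ℤ → Module.End ℂ M}, IsField B → ∀ (c : ℕ → ℂ) (k : ℕ),
      EvZero fun i : ℕ => c i • A (.negSucc i) (B (k + i - l) v) := fun {A B} hB c k => by
    obtain ⟨n, hn⟩ := hB v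
    refine ⟨n.toNat + l, fun i hi => ?_⟩
    beta_reduce
    rw [hn _ (by omega), map_zero, smul_zero]
  cases m with
  | negSucc k => simp only [normalOrderedMode, map_sum, map_smul, hfA, hfB]
  | ofNat k =>
    simp only [normalOrderedMode, map_add, map_smul]
    rw [map_finsum_of_evZero f (hz hB _ k), map_finsum_of_evZero f (hz hA _ k)]
    simp only [map_smul, hfA, hfB]

namespace ModData

variable {Y : FieldMap U U.rep} (N : ModData Y M) (N' : ModData Y M')

theorem B_mu {p : ZMod 2} {A : g} (hA : A ∈ 𝔤.par p) {e : Bideg} {b : V} (hb : b ∈ U.deg e) (l : ℕ)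
    (m : ℤ) (v : M) : N.B (U.ρ (LieSuperalgebra.toAffine (A ⊗ₜ omega l)) b) m v
      = normalOrderedMode (1 + p) (tot e) l (N.B (curState U A)) (N.B b) m v := by
  rw [← tot_one, ← N.normalOrdered (curState_mem hA) hb]
  exact congrArg (fun C : Op V => N.B (C (omega l) b) m v) (Y.fld_mu_zero_vac hA).symm

theorem B_kappa {e : Bideg} {b : V} (hb : b ∈ U.deg e) (m : ℤ) (v : M) :
    N.B (U.ρ (LieSuperalgebra.kappa g) b) m v = koszul 1 (ix m) • N.kap (N.B b m v) := by
  have e1 : tot ((1, 0) : Bideg) = 1 := by simp [tot]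
  have := N.normalOrdered kappaState_mem hb 0 m v
  rw [kappaState, Y.fld_kappa_vac, res_omega, if_pos rfl, one_smul] at this
  refine this.trans ?_
  cases m with
  | negSucc k =>
    rw [normalOrderedMode, Finset.sum_eq_single 0, ix_negSucc, koszul_comm, koszul_zero_left]
    · simp; rfl
    · intro i _ hi
      rw [show N.B (U.ρ (LieSuperalgebra.kappa g) U.vac) (.negSucc i) = 0 from
        N.kappa_eq_zero _ (by omega)]
      simp
    · simp
  | ofNat k =>
    rw [normalOrderedMode, finsum_eq_single _ 0, finsum_eq_single _ 0, e1,
      show ix (Int.ofNat k) = 1 from ix_natCast k]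
    · rw [show N.B (U.ρ (LieSuperalgebra.kappa g) U.vac) ((k : ℤ) + (0 : ℕ) - (0 : ℕ)) = 0 from
        N.kappa_eq_zero _ (by omega)]
      simp; rfl
    · intro i hi
      rw [show N.B (U.ρ (LieSuperalgebra.kappa g) U.vac) ((k : ℤ) + i - (0 : ℕ)) = 0 from
        N.kappa_eq_zero _ (by omega)]
      simp
    · intro i hi
      rw [show N.B (U.ρ (LieSuperalgebra.kappa g) U.vac) (.negSucc i) = 0 from
        N.kappa_eq_zero _ (by omega)]
      simp

/-- Linear maps that commute with the action of the central extension are morphisms of modules. -/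
theorem map_B (f : M →ₗ[ℂ] M') (hcur : ∀ A α v, f (N.cur A α v) = N'.cur A α (f v))
    (hkap : ∀ v, f (N.kap v) = N'.kap (f v)) (a : V) (n : ℤ) (v : M) :
    f (N.B a n v) = N'.B a n (f v) := by
  have hA : ∀ {p : ZMod 2} {A : g}, A ∈ 𝔤.par p → ∀ n v,
      f (N.B (curState U A) n v) = N'.B (curState U A) n (f v) := by
    intro p A hA n v
    -- The modes of the current states are recovered from `cur` up to a sign; those of the other
    -- states follow by induction over monomials, since `B_mu` and `B_kappa` express them through
    -- modes already treated.
    have h1 := hcur A (elt n) v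
    rw [N.cur_elt hA, N'.cur_elt hA, LinearMap.smul_apply, LinearMap.smul_apply, map_smul] at h1
    have h2 := congrArg (koszul p (ix n) • ·) h1
    simpa only [smul_smul, koszul_mul_self, one_smul] using h2
  suffices H : ∀ n v, f (N.B a n v) = N'.B a n (f v) from H n v
  refine U.induction (P := fun a => ∀ n v, f (N.B a n v) = N'.B a n (f v)) (by simp)
    (fun b c hb hc n v => by simp [hb n v, hc n v]) (fun e b hb => ?_) a
  refine PreVac.deg_induction (P := fun _ b => ∀ n v, f (N.B b n v) = N'.B b n (f v)) (by simp)
    (fun hb hc n v => by simp [hb n v, hc n v]) (fun c hb n v => by simp [hb n v]) ?_ ?_ hb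
  · intro n v
    rw [N.vac, N'.vac]
    split_ifs <;> simp
  · intro p x e b hx hb ih n v
    cases hx with
    | mu hA' l =>
      rw [N.B_mu hA' hb, N'.B_mu hA' hb,
        map_normalOrderedMode f (N.field _) (N.field _) (hA hA') ih]
    | kappa => rw [N.B_kappa hb, N'.B_kappa hb, map_smul, hkap, ih]

/-- The module that is attached to a smooth representation. -/
def ofFieldMap (Y : FieldMap U U.rep) {R : SmRep 𝔤 h M} (X : FieldMap U R) : ModData Y M where
  B := modes Y X
  field := isField_modes Y X
  vac := modes_vac Y X
  assoc := fun ha hb v => exists_threePoint Y X ha hb v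

variable {R : SmRep 𝔤 h M} (X : FieldMap U R)

theorem ofFieldMap_kap : (ofFieldMap Y X).kap = R.ρ (LieSuperalgebra.kappa g) := by
  have := VacMod.modes_kappa Y X U.vac (-1)
  rw [show ix (-1) = 0 from ix_negSucc 0, koszul_comm, koszul_zero_left, one_smul, modes_vac,
    if_pos rfl, mul_one] at this
  exact this

theorem ofFieldMap_cur : (ofFieldMap Y X).cur = R.cur := by
  refine LinearMap.ext fun A => ?_
  obtain ⟨B, hB, C, hC, rfl⟩ := Submodule.mem_sup.1
    (𝔤.isCompl.sup_eq_top ▸ Submodule.mem_top : A ∈ 𝔤.par 0 ⊔ 𝔤.par 1)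
  have key : ∀ {p : ZMod 2} {A : g}, A ∈ 𝔤.par p → (ofFieldMap Y X).cur A = R.cur A := by
    intro p A hA
    refine LinearMap.ext fun α => LinearMap.ext fun v => ?_
    refine LinearMap.congr_fun (monomial_ext (F := LinearMap.applyₗ v ∘ₗ (ofFieldMap Y X).cur A)
      (G := LinearMap.applyₗ v ∘ₗ R.cur A) (fun n => ?_) (fun n => ?_)
      ((ofFieldMap Y X).isSm_cur A v) (R.cur_isSm A v)) α
    · simp only [LinearMap.comp_apply, cur_omega]
      exact LinearMap.congr_fun (VacMod.modes_mu_negSucc Y X hA n) v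
    · simp only [LinearMap.comp_apply, cur_xp _ hA]
      have := LinearMap.congr_fun (VacMod.modes_mu_natCast Y X hA n) v
      change koszul p 1 • modes Y X (U.ρ (LieSuperalgebra.toAffine (A ⊗ₜ omega 0)) U.vac) n v = _
      rw [this, LinearMap.smul_apply, smul_smul, koszul_mul_self, one_smul]
      rfl
  rw [map_add, map_add, key hB, key hC]

/-- The field of `μ_{A,0}|0⟩` is the current of `A` and that of `κ|0⟩` is the constant `κ`. Since
`rep` is built from just these two, the representation is recovered. -/
theorem rep_ofFieldMap : (ofFieldMap Y X).rep.ρ = R.ρ := by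
  refine LinearMap.prod_ext (TensorProduct.ext' fun A α => ?_) (LinearMap.ext_ring ?_)
  · have := congrArg (fun c => c A α) (rep_cur (ofFieldMap Y X))
    rw [ofFieldMap_cur] at this
    exact this
  · exact (rep_kappa _).trans (ofFieldMap_kap X)

end ModData

end

/-! ### The equivalence of categories -/

section

variable {g : Type u} [AddCommGroup g] [Module ℂ g] {𝔤 : LieSuperalgebra g} {h : InvariantForm 𝔤}
  {V : Type u} [AddCommGroup V] [Module ℂ V] {U : VacMod 𝔤 h V}

theorem ModData.rep_mem {Y : FieldMap U U.rep} {M : Type w} [AddCommGroup M] [Module ℂ M]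
    (N : ModData Y M) {Γ : Type v} [AddCommGroup Γ] {π : Bideg →+ Γ} {D : Γ → Submodule ℂ M}
    (hN : ∀ {d : Bideg} {γ : Γ} {a : V} {v : M}, a ∈ U.deg d → v ∈ D γ →
      ∀ n, N.B a n v ∈ D (π (d - ixDeg n) + γ))
    {d : Bideg} {γ : Γ} {x : (g ⊗[ℂ] RavK) × ℂ} {v : M} (hx : x ∈ (𝔤.affine h).deg d)
    (hv : v ∈ D γ) : N.rep.ρ x v ∈ D (π d + γ) := by
  obtain ⟨x, c⟩ := x
  refine add_mem (?_ : N.curL x v ∈ _) (?_ : c • N.kap v ∈ _)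
  · replace hx : x ∈ 𝔤.currentDeg d := hx.1
    induction hx using Submodule.span_induction with
    | zero => simp
    | add x y hx hy ihx ihy =>
      rw [map_add]
      exact add_mem ihx ihy
    | smul c x hx ih => rw [map_smul]; exact Submodule.smul_mem _ _ ih
    | mem x hx =>
      obtain ⟨A, hA, α, hα, rfl⟩ := hx
      show N.cur A α v ∈ _
      obtain ⟨d1, p⟩ := d
      by_cases h0 : d1 = 0
      · subst h0
        rw [(IsPar.of_mem hα : IsPar ((0 : ℤ) : ZMod 2) α).eq_ofSeries, N.cur_ofSeries_apply]
        obtain ⟨n, hn⟩ := N.exists_bound (curState U (𝔤.parInv A)) v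
        refine evsum_mem _ ⟨n, fun k hk => by beta_reduce; rw [hn k hk, smul_zero]⟩
          fun k => Submodule.smul_mem _ _ ?_
        have := hN (curState_mem (U := U) hA) hv k
        rw [𝔤.parInv_of_mem hA, map_smul, map_smul, Pi.smul_apply, LinearMap.smul_apply]
        simpa [ixDeg] using Submodule.smul_mem _ (koszul 1 p) this
      · by_cases h1 : d1 = 1
        · subst h1
          have := omega_ext (F := (D (π (1, p) + γ)).mkQ ∘ₗ LinearMap.applyₗ v ∘ₗ N.cur A) (G := 0)
            (fun n => ?_) (IsPar.of_mem hα : IsPar ((1 : ℤ) : ZMod 2) α)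
          · exact (Submodule.Quotient.mk_eq_zero _).1 this
          · refine (Submodule.Quotient.mk_eq_zero _).2 ?_
            simp only [LinearMap.comp_apply, LinearMap.applyₗ_apply_apply, N.cur_omega]
            simpa [ixDeg] using hN (curState_mem (U := U) hA) hv (.negSucc n)
        · rw [show α = 0 from Prod.ext (fst_eq_zero_of_mem h0 hα) (snd_eq_zero_of_mem h1 hα)]
          simp
  · by_cases hd : d = (1, 0)
    · subst hd
      refine Submodule.smul_mem _ _ ?_
      simpa [ixDeg, ModData.kap] using hN (kappaState_mem (U := U)) hv (-1)
    · have := hx.2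
      rw [if_neg hd] at this
      rw [show c = 0 from this, zero_smul]
      exact zero_mem _

/-- On each vector, the representation is a finite combination of modes of current states and of
`κ|0⟩`, even at a power series; a map that commutes with the modes passes through these sums. -/
theorem ModData.map_rep {Y : FieldMap U U.rep} {M M' : Type w} [AddCommGroup M] [Module ℂ M]
    [AddCommGroup M'] [Module ℂ M'] (N : ModData Y M) (N' : ModData Y M') {f : M →ₗ[ℂ] M'}
    (hf : ∀ a n v, f (N.B a n v) = N'.B a n (f v)) (x : (g ⊗[ℂ] RavK) × ℂ) (v : M) :
    f (N.rep.ρ x v) = N'.rep.ρ x (f v) := by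
  have key : ∀ A : g, f ∘ₗ LinearMap.applyₗ v ∘ₗ N.cur A = LinearMap.applyₗ (f v) ∘ₗ N'.cur A := by
    intro A
    refine LinearMap.prod_ext (LinearMap.ext fun s => ?_) (Finsupp.lhom_ext' fun n =>
      LinearMap.ext_ring ?_)
    · show f (N.cur A (ofSeries s) v) = N'.cur A (ofSeries s) (f v)
      obtain ⟨n, hn⟩ := N.exists_bound (curState U (𝔤.parInv A)) v
      rw [N.cur_ofSeries_apply, N'.cur_ofSeries_apply,
        map_evsum f ⟨n, fun k hk => by rw [hn k hk, smul_zero]⟩]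
      simp only [map_smul, hf]
    · show f (N.cur A (omega n) v) = N'.cur A (omega n) (f v)
      rw [N.cur_omega, N'.cur_omega, hf]
  have := congrArg (fun F => F x) (LinearMap.prod_ext
    (f := f ∘ₗ LinearMap.applyₗ v ∘ₗ N.rep.ρ) (g := LinearMap.applyₗ (f v) ∘ₗ N'.rep.ρ)
    (TensorProduct.ext' fun A α => ?_) (LinearMap.ext_ring ?_))
  · exact this
  · have h1 := LinearMap.congr_fun (key A) α
    rw [← N.rep_cur, ← N'.rep_cur] at h1
    exact h1
  · show f (N.rep.ρ (LieSuperalgebra.kappa g) v) = N'.rep.ρ (LieSuperalgebra.kappa g) (f v)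
    rw [N.rep_kappa, N'.rep_kappa]
    exact hf _ _ _

/-! ### One functor for the central extension and for the current algebra. -/

variable (h) in
/-- The graded Lie superalgebra `𝔏` is the central extension or, if `z` holds, its quotient by the
central element. -/
structure CentralQuotient {L : Type u} [AddCommGroup L] [Module ℂ L] (𝔏 : GradedLieSuperalgebra L)
    (j : (g ⊗[ℂ] RavK) →ₗ[ℂ] L) (z : Prop) where
  pr : ((g ⊗[ℂ] RavK) × ℂ) →ₗ[ℂ] L
  sec : L →ₗ[ℂ] (g ⊗[ℂ] RavK) × ℂ
  pr_sec : ∀ x, pr (sec x) = x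
  pr_toAffine : ∀ t, pr (LieSuperalgebra.toAffine t) = j t
  sec_j : ∀ t, sec (j t) = LieSuperalgebra.toAffine t
  pr_mem : ∀ {d : Bideg} {x}, x ∈ (𝔤.affine h).deg d → pr x ∈ 𝔏.deg d
  sec_mem : ∀ {d : Bideg} {x}, x ∈ 𝔏.deg d → sec x ∈ (𝔤.affine h).deg d
  pr_br : ∀ x y, pr ((𝔤.affine h).br x y) = 𝔏.br (pr x) (pr y)
  sec_br : ∀ x y, ∃ c : ℂ, (𝔤.affine h).br (sec x) (sec y)
    = sec (𝔏.br x y) + c • LieSuperalgebra.kappa g ∧ (z ∨ c = 0)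
  pr_kappa : z → pr (LieSuperalgebra.kappa g) = 0
  kappa_mem : z ∨ sec (pr (LieSuperalgebra.kappa g)) = LieSuperalgebra.kappa g

variable {L : Type u} [AddCommGroup L] [Module ℂ L] {𝔏 : GradedLieSuperalgebra L}
  {j : (g ⊗[ℂ] RavK) →ₗ[ℂ] L} {z : Prop} (Q : CentralQuotient h 𝔏 j z)
  {Γ : Type v} [AddCommGroup Γ] {π : Bideg →+ Γ}

/-- The modes on a module. -/
def RavioloModule.modData {Y : FieldMap U U.rep}
    (M : RavioloModule.{u, v, w} (VacMod.rva Y) π) : ModData Y M.carrier where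
  B := M.Y
  field := M.Y_field
  vac := M.Y_vac
  assoc := M.associativity

namespace CentralQuotient

theorem kap_eq_zero {Y : FieldMap U U.rep} {M : Type w} [AddCommGroup M] [Module ℂ M]
    (N : ModData Y M) (hU : U.ρ (LieSuperalgebra.kappa g) U.vac = 0) : N.kap = 0 := by
  rw [ModData.kap, kappaState, hU, map_zero]; rfl

variable (Y : FieldMap U U.rep) (hU : z → U.ρ (LieSuperalgebra.kappa g) U.vac = 0)

/-- The smooth module attached to a module. -/
def smoothModule (M : RavioloModule.{u, v, w} (VacMod.rva Y) π) : SmoothModule.{u, v, w} 𝔏 j π where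
  carrier := M.carrier
  deg := M.deg
  isGrading := M.isGrading
  act := M.modData.rep.ρ ∘ₗ Q.sec
  act_mem := fun hx hv => M.modData.rep_mem M.Y_mem (Q.sec_mem hx) hv
  act_br := by
    intro d e x y hx hy
    obtain ⟨c, hc, hz⟩ := Q.sec_br x y
    have h1 := M.modData.rep.br (Q.sec_mem hx) (Q.sec_mem hy)
    have h2 : c • M.modData.kap = 0 := by
      rcases hz with hz | rfl
      · rw [kap_eq_zero _ (hU hz), smul_zero]
      · rw [zero_smul]
    rw [hc, map_add, map_smul, ModData.rep_kappa, h2, add_zero] at h1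
    exact h1
  smooth := fun v A => by
    obtain ⟨n, hn⟩ := M.modData.rep.smooth v A
    exact ⟨n, fun f => by rw [LinearMap.comp_apply, Q.sec_j]; exact hn f⟩

theorem smoothModule_act_j (M : RavioloModule.{u, v, w} (VacMod.rva Y) π) (A : g) (α : RavK) :
    (Q.smoothModule Y hU M).act (j (A ⊗ₜ α)) = M.modData.cur A α := by
  show M.modData.rep.ρ (Q.sec (j (A ⊗ₜ α))) = _
  rw [Q.sec_j, ← ModData.rep_cur]; rfl

/-- The functor from modules to smooth modules. -/
def functor : CategoryTheory.Functor (RavioloModule.{u, v, w} (VacMod.rva Y) π)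
    (SmoothModule.{u, v, w} 𝔏 j π) where
  obj := Q.smoothModule Y hU
  map {M N} f :=
    { toLin := RavioloModule.Hom.toLin f
      map_act := fun x m => by
        have hB : ∀ a n v, RavioloModule.Hom.toLin f (M.modData.B a n v)
          = N.modData.B a n (RavioloModule.Hom.toLin f v) := RavioloModule.Hom.map_Y f
        exact ModData.map_rep _ _ hB _ _ }
  map_id _ := rfl
  map_comp _ _ := rfl

/-- A morphism of smooth modules commutes with the currents, and with `κ` either because `κ`
survives in `𝔏` or because it acts by zero on both modules. By `ModData.map_B` it then commutes with
all modes. -/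
theorem functor_full : (Q.functor (Γ := Γ) (π := π) Y hU : CategoryTheory.Functor
    (RavioloModule.{u, v, w} (VacMod.rva Y) π) _).Full where
  map_surjective := by
    intro M N f
    have hf : ∀ x v, SmoothModule.Hom.toLin f (M.modData.rep.ρ (Q.sec x) v)
        = N.modData.rep.ρ (Q.sec x) (SmoothModule.Hom.toLin f v) := SmoothModule.Hom.map_act f
    refine ⟨⟨SmoothModule.Hom.toLin f, M.modData.map_B N.modData _ (fun A α v => ?_) fun v => ?_⟩, rfl⟩
    · have := hf (j (A ⊗ₜ α)) v
      rw [Q.sec_j] at this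
      rw [← M.modData.rep_cur, ← N.modData.rep_cur]
      exact this
    · rcases Q.kappa_mem with hz | hk
      · rw [kap_eq_zero _ (hU hz), kap_eq_zero _ (hU hz)]
        exact map_zero (SmoothModule.Hom.toLin f)
      · have := hf (Q.pr (LieSuperalgebra.kappa g)) v
        rw [hk, M.modData.rep_kappa, N.modData.rep_kappa] at this
        exact this

theorem functor_faithful : (Q.functor (Γ := Γ) (π := π) Y hU : CategoryTheory.Functor
    (RavioloModule.{u, v, w} (VacMod.rva Y) π) _).Faithful where
  map_injective := fun {M N} f f' hff => by
    have := congrArg (fun F => SmoothModule.Hom.toLin F) hff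
    exact RavioloModule.Hom.ext this

/-- The representation of the central extension on a smooth module. -/
def smRep (S : SmoothModule.{u, v, w} 𝔏 j π) : SmRep 𝔤 h S.carrier where
  ρ := S.act ∘ₗ Q.pr
  br := fun {d e x y} hx hy => by
    rw [LinearMap.comp_apply, Q.pr_br, S.act_br (Q.pr_mem hx) (Q.pr_mem hy)]; rfl
  smooth := fun v A => by
    obtain ⟨n, hn⟩ := S.smooth v A
    exact ⟨n, fun f => by rw [LinearMap.comp_apply, Q.pr_toAffine]; exact hn f⟩

/-- The module attached to a smooth module. -/
def ravioloModule (S : SmoothModule.{u, v, w} 𝔏 j π) (X : FieldMap U (Q.smRep S)) :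
    RavioloModule.{u, v, w} (VacMod.rva Y) π where
  carrier := S.carrier
  deg := S.deg
  isGrading := S.isGrading
  Y := modes Y X
  Y_field := isField_modes Y X
  Y_mem := fun ha hv n => modes_mem Y X
    (fun hx _ _ hv => S.act_mem (Q.pr_mem hx) hv) ha hv n
  Y_vac := modes_vac Y X
  associativity := fun ha hb v => exists_threePoint Y X ha hb v

/-- A smooth module, pulled back to `ĝ_h` along `pr`, acquires a module structure from its field
map. By `ModData.rep_ofFieldMap` the functor returns the original action, so the identity map is the
required isomorphism. -/
theorem functor_essSurj (hX : ∀ {M : Type w} [AddCommGroup M] [Module ℂ M] (R : SmRep 𝔤 h M),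
    (z → R.ρ (LieSuperalgebra.kappa g) = 0) → Nonempty (FieldMap U R)) :
    (Q.functor (Γ := Γ) (π := π) Y hU : CategoryTheory.Functor
      (RavioloModule.{u, v, w} (VacMod.rva Y) π) _).EssSurj where
  mem_essImage := by
    intro S
    obtain ⟨X⟩ := hX (Q.smRep S) fun hz => by
      show S.act (Q.pr _) = 0
      rw [Q.pr_kappa hz, map_zero]
    refine ⟨Q.ravioloModule Y S X, ⟨?_⟩⟩
    have h1 : ∀ x, (Q.smoothModule Y hU (Q.ravioloModule Y S X)).act x = S.act x := fun x => by
      have := LinearMap.congr_fun (ModData.rep_ofFieldMap (Y := Y) X) (Q.sec x)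
      refine this.trans ?_
      show S.act (Q.pr (Q.sec x)) = _
      rw [Q.pr_sec]
    exact
      { hom := { toLin := LinearMap.id (M := S.carrier)
                 map_act := fun x m => congrArg (fun F => F m) (h1 x) }
        inv := { toLin := LinearMap.id (M := S.carrier)
                 map_act := fun x m => (congrArg (fun F => F m) (h1 x)).symm }
        hom_inv_id := rfl
        inv_hom_id := rfl }

theorem modulesAreSmoothModules (hU : z → U.ρ (LieSuperalgebra.kappa g) U.vac = 0)
    (hX : ∀ {M : Type w} [AddCommGroup M] [Module ℂ M] (R : SmRep 𝔤 h M),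
      (z → R.ρ (LieSuperalgebra.kappa g) = 0) → Nonempty (FieldMap U R)) {K : Set (V × L)}
    (hK : ∀ sx ∈ K, sx.1 = kappaState U ∧ Q.sec sx.2 = LieSuperalgebra.kappa g) :
    ModulesAreSmoothModules.{u, v, w} (VacMod.rva Y) 𝔏 j π 𝔤.par (fun A => curState U A) K := by
  have := Q.functor_full (Γ := Γ) (π := π) Y hU
  have := Q.functor_faithful (Γ := Γ) (π := π) Y hU
  have := Q.functor_essSurj (Γ := Γ) (π := π) Y hU hX
  have : (Q.functor (Γ := Γ) (π := π) Y hU).IsEquivalence := {}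
  refine ⟨(Q.functor Y hU).asEquivalence, fun M => LinearEquiv.refl ℂ M.carrier,
    ⟨fun M γ v => Iff.rfl, fun f v => rfl⟩, ⟨fun M p A hA n v => ?_, fun M p A hA n v => ?_⟩,
    fun sx hsx M v => ?_⟩
  · have h1 := Q.smoothModule_act_j Y hU M A (xp n)
    show M.modData.B (curState U A) n v
      = koszul p 1 • (Q.smoothModule Y hU M).act (j (A ⊗ₜ xp n)) v
    refine Eq.trans ?_ (congrArg (koszul p 1 • ·) (LinearMap.congr_fun h1 v)).symm
    show _ = koszul p 1 • (M.modData.cur A (xp n) v)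
    rw [M.modData.cur_xp hA, LinearMap.smul_apply, smul_smul, koszul_mul_self, one_smul]
  · have h1 := Q.smoothModule_act_j Y hU M A (omega n)
    show M.modData.B (curState U A) (.negSucc n) v
      = (Q.smoothModule Y hU M).act (j (A ⊗ₜ omega n)) v
    rw [h1, M.modData.cur_omega]
    rfl
  · obtain ⟨e1, e2⟩ := hK sx hsx
    show M.modData.B sx.1 (-1) v = M.modData.rep.ρ (Q.sec sx.2) v
    rw [e1, e2, ModData.rep_kappa]
    rfl

end CentralQuotient

variable (𝔤 h) in
/-- The central extension. -/
def centralQuotientAffine : CentralQuotient h (𝔤.affine h) LieSuperalgebra.toAffine False where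
  pr := LinearMap.id
  sec := LinearMap.id
  pr_sec := fun _ => rfl
  pr_toAffine := fun _ => rfl
  sec_j := fun _ => rfl
  pr_mem := id
  sec_mem := id
  pr_br := fun _ _ => rfl
  sec_br := fun _ _ => ⟨0, by simp, Or.inr rfl⟩
  pr_kappa := False.elim
  kappa_mem := Or.inr rfl

variable (𝔤 h) in
/-- The current algebra, as the quotient of the central extension. -/
def centralQuotientCurrent : CentralQuotient h 𝔤.current LinearMap.id True where
  pr := LinearMap.fst ℂ _ _
  sec := LieSuperalgebra.toAffine
  pr_sec := fun _ => rfl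
  pr_toAffine := fun _ => rfl
  sec_j := fun _ => rfl
  pr_mem := fun hx => hx.1
  sec_mem := fun hx => ⟨hx, zero_mem _⟩
  pr_br := fun x y => by
    show (𝔤.affineBr h x y).1 = 𝔤.currentBr x.1 y.1
    rw [LieSuperalgebra.affineBr_apply]
  sec_br := fun x y => ⟨-𝔤.currentCocycle h x y, by
    refine ⟨?_, Or.inl trivial⟩
    show 𝔤.affineBr h _ _ = LieSuperalgebra.toAffine (𝔤.currentBr x y) + _
    rw [LieSuperalgebra.affineBr_apply]
    simp [LieSuperalgebra.toAffine, LieSuperalgebra.kappa]⟩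
  pr_kappa := fun _ => rfl
  kappa_mem := Or.inl trivial

end

section

variable {g : Type u} [AddCommGroup g] [Module ℂ g] {𝔤 : LieSuperalgebra g} {h : InvariantForm 𝔤}
  {E : Type} [AddCommGroup E] [Module ℂ E] {k : Module.End ℂ E} {e₀ : E}
  {L : Type u} [AddCommGroup L] [Module ℂ L] {𝔏 : GradedLieSuperalgebra L}
  {j : (g ⊗[ℂ] RavK) →ₗ[ℂ] L} {Γ : Type v} [AddCommGroup Γ]

theorem IsCurrentAlgebra.modulesAreSmoothModules (S : CoeffSys k e₀)
    {z : Prop} (hz : z ↔ k = 0)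
    (Q : CentralQuotient h 𝔏 j z) (π : Bideg →+ Γ)
    {X : RavioloVertexAlgebra (Induced 𝔤 h E k)} (hX : IsCurrentAlgebra X e₀)
    {K : Set (Induced 𝔤 h E k × L)}
    (hK : ∀ sx ∈ K, sx.1 = (𝔤.affine h).ι (LieSuperalgebra.kappa g) • X.vac ∧
      Q.sec sx.2 = LieSuperalgebra.kappa g) :
    ModulesAreSmoothModules.{u, v, w} X 𝔏 j π 𝔤.par
      (fun A => (𝔤.affine h).ι (LieSuperalgebra.toAffine (A ⊗ₜ[ℂ] RavK.omega 0)) • X.vac) K := by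
  -- By uniqueness, any structure with the stated properties may be replaced by the constructed one.
  obtain rfl : X = VacMod.rva (vacuumFieldMap 𝔤 h S) := ((isCurrentAlgebra_iff S X).1 hX).eq
    (VacMod.isCurrent_rva (vacuumFieldMap 𝔤 h S))
  exact Q.modulesAreSmoothModules (vacuumFieldMap 𝔤 h S)
    (fun hk => by rw [inducedVacMod_kappa S (hz.1 hk), LinearMap.zero_apply])
    (fun R hR => ⟨inducedFieldMap S R fun hk => hR (hz.2 hk)⟩) hK

theorem mulLeft_eps_ne_zero : LinearMap.mulLeft ℂ (DualNumber.eps : DualNumber ℂ) ≠ 0 := fun hk => by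
  have := congrArg TrivSqZeroExt.snd (LinearMap.congr_fun hk 1)
  simp at this

end

end

end Raviolo

theorem mainTheorem10 {g : Type u} [AddCommGroup g] [Module ℂ g]
    (𝔤 : Raviolo.LieSuperalgebra g) (h : Raviolo.InvariantForm 𝔤) :
    ((∃! X : Raviolo.RavioloVertexAlgebra (Raviolo.VUniv 𝔤 h),
        Raviolo.IsCurrentAlgebra X (1 : DualNumber ℂ)) ∧
      ∀ X : Raviolo.RavioloVertexAlgebra (Raviolo.VUniv 𝔤 h),
        Raviolo.IsCurrentAlgebra X (1 : DualNumber ℂ) →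
        ∀ (Γ : Type v) [AddCommGroup Γ] (π : Raviolo.Bideg →+ Γ),
          Raviolo.ModulesAreSmoothModules.{u, v, w} X (𝔤.affine h)
            Raviolo.LieSuperalgebra.toAffine π 𝔤.par
            (fun A => (𝔤.affine h).ι (Raviolo.LieSuperalgebra.toAffine
              (TensorProduct.tmul ℂ A (Raviolo.RavK.omega 0))) • X.vac)
            {((𝔤.affine h).ι (Raviolo.LieSuperalgebra.kappa g) • X.vac,
              Raviolo.LieSuperalgebra.kappa g)}) ∧
    ((∃! X : Raviolo.RavioloVertexAlgebra (Raviolo.VZero 𝔤 h),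
        Raviolo.IsCurrentAlgebra X (1 : ℂ)) ∧
      ∀ X : Raviolo.RavioloVertexAlgebra (Raviolo.VZero 𝔤 h),
        Raviolo.IsCurrentAlgebra X (1 : ℂ) →
        ∀ (Γ : Type v) [AddCommGroup Γ] (π : Raviolo.Bideg →+ Γ),
          Raviolo.ModulesAreSmoothModules.{u, v, w} X 𝔤.current LinearMap.id π 𝔤.par
            (fun A => (𝔤.affine h).ι (Raviolo.LieSuperalgebra.toAffine
              (TensorProduct.tmul ℂ A (Raviolo.RavK.omega 0))) • X.vac)
            ∅) := by
  refine ⟨⟨Raviolo.existsUnique_isCurrentAlgebra Raviolo.coeffSysDual, fun X hX Γ _ π => ?_⟩,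
    Raviolo.existsUnique_isCurrentAlgebra Raviolo.coeffSysComplex, fun X hX Γ _ π => ?_⟩
  · refine hX.modulesAreSmoothModules Raviolo.coeffSysDual
      (iff_of_false id Raviolo.mulLeft_eps_ne_zero) (Raviolo.centralQuotientAffine 𝔤 h) π ?_
    rintro _ rfl
    exact ⟨rfl, rfl⟩
  · exact hX.modulesAreSmoothModules Raviolo.coeffSysComplex (iff_of_true trivial rfl)
      (Raviolo.centralQuotientCurrent 𝔤 h) π (fun _ hsx => hsx.elim)
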